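/- **Setting.** Let $d\ge 2$ and let $\Omega\subset\mathbb R^d$ be a bounded domain (open, connected, $\Omega=\operatorname{int}\overline\Omega$) with boundary $\Gamma$, equipped with its surface measure. Write $(\cdot,\cdot)$ and $\|\cdot\|$ for the inner product and norm of $L^2(\Omega)$ (scalar or vector valued), $\|\cdot\|_{0,\beta}$ for the norm of $L^\beta(\Omega)$, and $\langle\psi,r\rangle=\int_\Gamma \psi r\,d\sigma$. Let $g(s)=\sum_{i=0}^N a_i s^{\alpha_i}$, $s\ge 0$, with $N\ge1$, real exponents $0=\alpha_0<\alpha_1<\dots<\alpha_N$, $a_0,a_N>0$ and $a_1,\dots,a_{N-1}\ge0$. For $\xi\ge0$ let $K(\xi)=1/g(s(\xi))$, where $s(\xi)\ge 0$ is the unique non-negative solution of $s\,g(s)=\xi$. Put $$a=\frac{\alpha_N}{\alpha_N+1},\qquad \beta=2-a,\qquad \lambda=\frac{2-a}{1-a}=\frac{\beta}{\beta-1}.$$ Fix $0<T<\infty$, $k\ge0$ and constants $0<\phi_*$ and $\phi^*$. Let $\{\mathcal T_h\}_h$ be a quasiuniform family of (finite, conforming) simplicial triangulations of $\overline\Omega$: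 there is $\kappa>0$ such that every element of $\mathcal T_h$ contains a ball of radius $\kappa h$, $h$ being the maximal diameter of the elements of $\mathcal T_h$. Let $\mathcal M_h$ be the space of discontinuous vector fields on $\Omega$ whose components are polynomials of degree at most $k$ on each element of $\mathcal T_h$, and let $\mathcal R_h\subset H^1(\Omega)$ be the space of continuous functions on $\overline\Omega$ which are polynomials of degree at most $k$ on each element. **Data and solutions.** Let $\phi\in C^1(\Omega)$ with $\phi_*<\phi<\phi^*$, $f\in W^{1,2}(0,T;L^2(\Omega))$, $\psi\in W^{1,\infty}(0,T;L^\infty(\Gamma))$ (both identified with their continuous representatives on $[0,T]$), and $\rho^0\in C(\overline\Omega)\cap C^1(\Omega)$ with $\nabla\rho^0\in L^2(\Omega)^d$. A solution of the semidiscrete problem is a pair of functions of time $m_h$ and $\rho_h$ with values in $\mathcal M_h$ and $\mathcal R_h$, where $\rho_h$ is continuous on $[0,T]$ and differentiable on $(0,T]$ (one-sidedly at $T$), with time derivative $\rho_{h,t}$, such that for all $t\in(0,T]$ $$(m_h,z)+(K(|\nabla\rho_h|)\nabla\rho_h,z)=0\quad\forall z\in\mathcal M_h,$$ $$(\phi\rho_{h,t},r)-(m_h,\nabla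 r)=(f,r)-\langle\psi,r\rangle\quad\forall r\in\mathcal R_h,$$ and $\rho_h(0)$ is the $L^2(\Omega)$-orthogonal projection of $\rho^0$ onto $\mathcal R_h$. Put $$\mathcal A=1+\|\psi\|_{L^\infty(0,T;L^\infty(\Gamma))}^{\lambda}+\|f\|_{L^2(0,T;L^2(\Omega))}^2,$$ $$\mathcal B=\|\rho^0\|^2+\|\nabla\rho^0\|_{0,\beta}^\beta+\|\psi(0)\|_{L^2(\Gamma)}\|\rho^0\|_{L^2(\Gamma)}+\|\psi_t\|_{L^\infty(0,T;L^\infty(\Gamma))}^\lambda+\mathcal A.$$ **Theorem.** There is a constant $C>0$, depending only on $d$, $\Omega$, $g$, $\phi_*$, $\phi^*$, $T$, $k$ and the family of triangulations, and in particular not on the mesh $\mathcal T_h$ within the family nor on $t_*$, $\phi$, $f$, $\psi$, $\rho^0$, such that for every mesh of the family, all data as above, every solution $(m_h,\rho_h)$ of the semidiscrete problem, every $t_*$ with $0<t_*<T$ and every $t\in[t_*,T]$, $$\|\rho_{h,t}(t)\|^2\le C\,(1+t_*^{-1})\,\mathcal B+C\int_0^T\bigl(1+\|\psi_t(\tau)\|_{L^\infty(\Gamma)}\bigr)^{2\lambda}\bigl(1+\|f_t(\tau)\|\bigr)^2\,d\tau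 .$$ -/

import Mathlib

open MeasureTheory Set
open scoped ENNReal

noncomputable section

/-- Generalized (Forchheimer) polynomials `g(s) = a₀ s^{α₀} + ⋯ + a_N s^{α_N}`, `s ≥ 0`, with
`N ≥ 1`, real exponents `0 = α₀ < α₁ < ⋯ < α_N`, and coefficients `a₀, a_N > 0`,
`a₁, …, a_{N-1} ≥ 0`. -/
structure ForchheimerPolynomial where
  N : ℕ
  one_le_N : 1 ≤ N
  α : Fin (N + 1) → ℝ
  a : Fin (N + 1) → ℝ
  α_zero : α 0 = 0
  α_strictMono : StrictMono α
  a_nonneg : ∀ i, 0 ≤ a i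
  a_zero_pos : 0 < a 0
  a_last_pos : 0 < a (Fin.last N)

namespace ForchheimerPolynomial

variable (G : ForchheimerPolynomial)

/-- The function `g`. -/
def g (s : ℝ) : ℝ := ∑ i, G.a i * s ^ G.α i

theorem α_nonneg (i : Fin (G.N + 1)) : 0 ≤ G.α i := by
  rw [← G.α_zero]
  exact G.α_strictMono.monotone (Fin.zero_le i)

theorem a_zero_le_g {s : ℝ} (hs : 0 ≤ s) : G.a 0 ≤ G.g s := by
  have h : G.a 0 * s ^ G.α 0 ≤ G.g s :=
    Finset.single_le_sum (f := fun i => G.a i * s ^ G.α i)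
      (fun i _ => mul_nonneg (G.a_nonneg i) (Real.rpow_nonneg hs _)) (Finset.mem_univ 0)
  simpa [G.α_zero] using h

theorem g_mono {s t : ℝ} (hs : 0 ≤ s) (hst : s ≤ t) : G.g s ≤ G.g t :=
  Finset.sum_le_sum fun i _ =>
    mul_le_mul_of_nonneg_left (Real.rpow_le_rpow hs hst (G.α_nonneg i)) (G.a_nonneg i)

theorem continuous_g : Continuous G.g :=
  continuous_finsetSum _ fun i _ =>
    continuous_const.mul (continuous_id.rpow_const fun _ => Or.inr (G.α_nonneg i))

/-- For `ξ ≥ 0` the equation `s g(s) = ξ` has exactly one solution `s ≥ 0`. -/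
theorem existsUnique_mul_g_eq {ξ : ℝ} (hξ : 0 ≤ ξ) : ∃! s : ℝ, 0 ≤ s ∧ s * G.g s = ξ := by
  have ha := G.a_zero_pos
  have hlt : ∀ s t : ℝ, 0 ≤ s → s < t → s * G.g s < t * G.g t := by
    intro s t hs hst
    have h1 := G.g_mono hs hst.le
    have h2 := G.a_zero_le_g (hs.trans hst.le)
    have h3 : s * G.g s ≤ s * G.g t := mul_le_mul_of_nonneg_left h1 hs
    have h4 : s * G.g t < t * G.g t := mul_lt_mul_of_pos_right hst (ha.trans_le h2)
    linarith
  have hb : 0 ≤ ξ / G.a 0 := by positivity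
  have hcont : ContinuousOn (fun s : ℝ => s * G.g s) (Icc 0 (ξ / G.a 0)) :=
    (continuous_id.mul G.continuous_g).continuousOn
  have hmem : ξ ∈ Icc ((0 : ℝ) * G.g 0) (ξ / G.a 0 * G.g (ξ / G.a 0)) := by
    refine ⟨by simpa using hξ, ?_⟩
    calc ξ = ξ / G.a 0 * G.a 0 := by field_simp
      _ ≤ _ := mul_le_mul_of_nonneg_left (G.a_zero_le_g hb) hb
  obtain ⟨s, hs, hsξ⟩ := intermediate_value_Icc hb hcont hmem
  refine ⟨s, ⟨hs.1, hsξ⟩, ?_⟩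
  rintro t ⟨ht, htξ⟩
  have hsξ' : s * G.g s = ξ := hsξ
  rcases lt_trichotomy t s with h | h | h
  · have := hlt t s ht h
    linarith
  · exact h
  · have := hlt s t hs.1 h
    linarith

/-- `s(ξ)`: the unique non-negative solution of `s g(s) = ξ` (for `ξ ≥ 0`). -/
def sOf (ξ : ℝ) : ℝ := Function.invFunOn (fun s => s * G.g s) (Ici 0) ξ

theorem sOf_spec {ξ : ℝ} (hξ : 0 ≤ ξ) : 0 ≤ G.sOf ξ ∧ G.sOf ξ * G.g (G.sOf ξ) = ξ := by
  obtain ⟨s, ⟨h0, h1⟩, -⟩ := G.existsUnique_mul_g_eq hξ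
  have h : ∃ s ∈ Ici (0 : ℝ), (fun s => s * G.g s) s = ξ := ⟨s, h0, h1⟩
  exact ⟨Function.invFunOn_mem h, Function.invFunOn_eq h⟩

/-- The conductivity `K(ξ) = 1 / g(s(ξ))`. -/
def K (ξ : ℝ) : ℝ := 1 / G.g (G.sOf ξ)

/-- `deg g = α_N`. -/
def deg : ℝ := G.α (Fin.last G.N)

/-- `β = 2 - a` with `a = deg g / (deg g + 1)`. -/
def β : ℝ := 2 - G.deg / (G.deg + 1)

/-- `λ = (2 - a) / (1 - a) = β / (β - 1)`. -/
def lam : ℝ := G.β / (G.β - 1)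

end ForchheimerPolynomial

section FiniteElements

variable {d : ℕ}

/-- A (conforming) triangulation of the closure of `Ω ⊆ ℝᵈ`: a finite simplicial complex whose
maximal faces are `d`-simplices and whose underlying set is the closure of `Ω`. -/
structure Triangulation (Ω : Set (EuclideanSpace ℝ (Fin d))) where
  complex : Geometry.SimplicialComplex ℝ (EuclideanSpace ℝ (Fin d))
  finite_faces : complex.faces.Finite
  pure_dim : ∀ s ∈ complex.faces, ∃ t ∈ complex.faces, s ⊆ t ∧ t.card = d + 1
  space_eq : complex.space = closure Ω

namespace Triangulation

variable {Ω : Set (EuclideanSpace ℝ (Fin d))} (𝒯 : Triangulation Ω)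

/-- The mesh elements, as closed subsets of `ℝᵈ`: the closed `d`-simplices. -/
def elements : Set (Set (EuclideanSpace ℝ (Fin d))) :=
  {T | ∃ s ∈ 𝒯.complex.faces, s.card = d + 1 ∧
    T = convexHull ℝ (s : Set (EuclideanSpace ℝ (Fin d)))}

/-- The mesh size `h`: the maximum of the diameters of the (finitely many) elements. -/
def meshSize : ℝ := sSup (Metric.diam '' 𝒯.elements)

/-- Quasi-uniformity of a family of triangulations: every element of every member contains a ball
of radius comparable with the mesh size of that member, uniformly over the family. -/
def IsQuasiuniform {ι : Type*} (𝒯 : ι → Triangulation Ω) : Prop :=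
  ∃ κ : ℝ, 0 < κ ∧ ∀ i, ∀ T ∈ (𝒯 i).elements, ∃ x, Metric.closedBall x (κ * (𝒯 i).meshSize) ⊆ T

/-- The scalar space `R_h ⊆ H¹(Ω)`: continuous functions on the closure of `Ω` which on each
element coincide with a polynomial of degree at most `k` (values outside are irrelevant). -/
def scalarSpace (k : ℕ) : Set (EuclideanSpace ℝ (Fin d) → ℝ) :=
  {r | ContinuousOn r (closure Ω) ∧ ∀ T ∈ 𝒯.elements, ∃ p : MvPolynomial (Fin d) ℝ,
    p.totalDegree ≤ k ∧ ∀ x ∈ T, r x = MvPolynomial.eval (fun j => x j) p}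

/-- The vector space `M_h`: discontinuous vector fields each of whose components coincides, inside
each element, with a polynomial of degree at most `k` (values on element boundaries, a null set,
are irrelevant). -/
def vectorSpace (k : ℕ) : Set (EuclideanSpace ℝ (Fin d) → EuclideanSpace ℝ (Fin d)) :=
  {z | ∀ T ∈ 𝒯.elements, ∃ p : Fin d → MvPolynomial (Fin d) ℝ,
    ∀ j, (p j).totalDegree ≤ k ∧
      ∀ x ∈ interior T, z x j = MvPolynomial.eval (fun l => x l) (p j)}

end Triangulation

/-- The surface measure on the boundary `Γ = ∂Ω`. -/
def surfaceMeasure (Ω : Set (EuclideanSpace ℝ (Fin d))) : Measure (EuclideanSpace ℝ (Fin d)) :=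
  (Measure.euclideanHausdorffMeasure (d - 1)).restrict (frontier Ω)

end FiniteElements

/-- `u ∈ W^{1,p}(0,T; X)` with (weak) time derivative `ut`, where `u` denotes the (absolutely)
continuous representative on `[0,T]`. -/
def HasSobolevTimeDeriv {X : Type*} [NormedAddCommGroup X] [NormedSpace ℝ X] (p : ℝ≥0∞) (T : ℝ)
    (u ut : ℝ → X) : Prop :=
  MemLp ut p (volume.restrict (Ioo 0 T)) ∧ ∀ t ∈ Icc 0 T, u t = u 0 + ∫ s in (0 : ℝ)..t, ut s

/-- `(m, ρ)` is a solution on `(0,T]` of the semidiscrete problem on the mesh `𝒯` with elements of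
degree `k`, for the porosity `φ`, source `f`, boundary flux `ψ` and initial density `ρ0`;
`ρt` is the time derivative of `ρ` (one-sided at `t = T`). -/
structure IsSemidiscreteSolution {d : ℕ} {Ω : Set (EuclideanSpace ℝ (Fin d))}
    (G : ForchheimerPolynomial) (𝒯 : Triangulation Ω) (k : ℕ) (T : ℝ)
    (φ : EuclideanSpace ℝ (Fin d) → ℝ)
    (f : ℝ → Lp ℝ 2 (volume.restrict Ω)) (ψ : ℝ → Lp ℝ ∞ (surfaceMeasure Ω))
    (ρ0 : EuclideanSpace ℝ (Fin d) → ℝ)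
    (m : ℝ → EuclideanSpace ℝ (Fin d) → EuclideanSpace ℝ (Fin d))
    (ρ ρt : ℝ → EuclideanSpace ℝ (Fin d) → ℝ) : Prop where
  m_mem : ∀ t ∈ Ioc 0 T, m t ∈ 𝒯.vectorSpace k
  ρ_mem : ∀ t ∈ Icc 0 T, ρ t ∈ 𝒯.scalarSpace k
  continuousOn : ∀ x ∈ closure Ω, ContinuousOn (fun t => ρ t x) (Icc 0 T)
  hasDeriv : ∀ t ∈ Ioc 0 T, ∀ x ∈ closure Ω,
    HasDerivWithinAt (fun s => ρ s x) (ρt t x) (Icc 0 T) t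
  /-- The initial value is the `L²(Ω)`-projection of `ρ0` onto `R_h`. -/
  initial : ∀ r ∈ 𝒯.scalarSpace k, ∫ x in Ω, (ρ 0 x - ρ0 x) * r x = 0
  momentum_eq : ∀ t ∈ Ioc 0 T, ∀ z ∈ 𝒯.vectorSpace k,
    (∫ x in Ω, inner ℝ (m t x) (z x)) +
      (∫ x in Ω, inner ℝ (G.K ‖gradient (ρ t) x‖ • gradient (ρ t) x) (z x)) = 0
  continuity_eq : ∀ t ∈ Ioc 0 T, ∀ r ∈ 𝒯.scalarSpace k,
    (∫ x in Ω, φ x * ρt t x * r x) - (∫ x in Ω, inner ℝ (m t x) (gradient r x)) =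
      (∫ x in Ω, f t x * r x) - ∫ x, ψ t x * r x ∂(surfaceMeasure Ω)

section Data

variable {d : ℕ} {Ω : Set (EuclideanSpace ℝ (Fin d))}

/-- `𝒜 = 1 + ‖ψ‖_{L^∞(0,T;L^∞(Γ))}^λ + ‖f‖_{L²(0,T;L²(Ω))}²`. -/
def dataA (G : ForchheimerPolynomial) (T : ℝ) (f : ℝ → Lp ℝ 2 (volume.restrict Ω))
    (ψ : ℝ → Lp ℝ ∞ (surfaceMeasure Ω)) : ℝ :=
  1 + (eLpNorm ψ ∞ (volume.restrict (Ioo 0 T))).toReal ^ G.lam + ∫ t in (0 : ℝ)..T, ‖f t‖ ^ 2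

/-- `ℬ = ‖ρ⁰‖² + ‖∇ρ⁰‖_{0,β}^β + ‖ψ(0)‖_{L²(Γ)} ‖ρ⁰‖_{L²(Γ)} + ‖ψ_t‖_{L^∞(0,T;L^∞(Γ))}^λ + 𝒜`. -/
def dataB (G : ForchheimerPolynomial) (T : ℝ) (f : ℝ → Lp ℝ 2 (volume.restrict Ω))
    (ψ ψt : ℝ → Lp ℝ ∞ (surfaceMeasure Ω)) (ρ0 : EuclideanSpace ℝ (Fin d) → ℝ) : ℝ :=
  (∫ x in Ω, ρ0 x ^ 2) + (∫ x in Ω, ‖gradient ρ0 x‖ ^ G.β) +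
    (eLpNorm (ψ 0) 2 (surfaceMeasure Ω)).toReal * (eLpNorm ρ0 2 (surfaceMeasure Ω)).toReal +
    (eLpNorm ψt ∞ (volume.restrict (Ioo 0 T))).toReal ^ G.lam + dataA G T f ψ

end Data

end

noncomputable section

/-! In a basis of the discrete space the problem is a finite system of ordinary differential
equations. Its solution is differentiable, but the derivative is not known to be integrable, so the
equation is never differentiated in time. Three estimates for an abstract system, `GalerkinFlow`,
give the bound.

Energy (`exists_sq_le_data`): testing with the solution and Gronwall's inequality bound ρ_h in L² at
all times and ∇ρ_h in L^β over space and time. A good time (`exists_time_mass_le`): the flux K(|y|)y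
is a gradient of a convex potential, so the potential energy plus the boundary functional decreases
at a rate of at least half the φ-weighted square of ρ_{h,t}, up to data. Since the initial energy is
controlled, some t₀ ≤ t_* satisfies ‖ρ_{h,t}(t₀)‖² ≤ C t_*⁻¹ · data. Propagation
(`exists_mass_sub_le`): the increment ρ_h(τ+s) - ρ_h(τ) satisfies the difference of two equations.
The monotonicity of the flux degenerates like K, but it still absorbs the increment of the boundary
flux at the price s²(1 + |∇ρ_h(τ+s)|^β + |∇ρ_h(τ)|^β + P^λ), see `exists_mul_norm_sub_le`, and the
energy estimate makes this price integrable in time. Gronwall from t₀ to t, division by s² and s → 0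
give the claim, with ∫‖f_t‖² in the role of the last integral, which dominates it.

Two facts must hold uniformly over the meshes. One is a trace inequality in L¹ (`exists_trace_le`),
which together with Young's inequality for the pair (β, λ) controls the boundary flux. The other is
the stability of the L²-projection in W^{1,β} (`exists_gradient_projection_le`), which controls the
initial energy. For the latter, the projection is local up to exponentially small tails at scale h
(`exists_weighted_projection_le`); with an inverse inequality this bounds |∇w(x)|^β by h^{-(β+d)}
times a nonlocal difference functional of ρ⁰ whose kernel has width h. That functional is O(h^{β+d})
(`exists_nonlocalForm_le`). No Lipschitz condition on Γ is available, so Ω is cut into the cells of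
one fixed triangulation and each pair of cells is treated alone: a cell with itself by convexity,
cells with a common facet by an affine map of one to the other, and all other pairs by the smallness
of W^{1,β} functions near faces of codimension two, which is where β < 2 enters. -/

theorem mul_rpow_sub_rpow_le {a s t : ℝ} (ha : 0 ≤ a) (ht : 0 ≤ t) (hts : t ≤ s) :
    t * (s ^ a - t ^ a) ≤ a * s ^ a * (s - t) := by
  rcases ht.eq_or_lt with rfl | ht
  · have : 0 ≤ s ^ a := Real.rpow_nonneg hts _
    simp only [zero_mul, sub_zero]
    positivity
  have hs : 0 < s := ht.trans_le hts
  -- Bernoulli's inequality in both cases, at t/s - 1 for a ≥ 1 and at s/t - 1 for a ≤ 1. For a ≥ 1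
  -- it even gives the bound with the larger factor s in place of t on the left.
  rcases le_total 1 a with h1 | h1
  · have hB := one_add_mul_self_le_rpow_one_add (s := t / s - 1)
      (by have : 0 ≤ t / s := by positivity
          linarith) h1
    rw [add_sub_cancel, Real.div_rpow ht.le hs.le] at hB
    have hsa : 0 < s ^ a := Real.rpow_pos_of_pos hs _
    have h2 : s * (s ^ a - t ^ a) ≤ a * s ^ a * (s - t) := by
      have h3 := mul_le_mul_of_nonneg_left hB (mul_pos hs hsa).le
      have h4 : s * s ^ a * (1 + a * (t / s - 1)) = s * s ^ a - a * s ^ a * (s - t) := by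
        field_simp; ring
      have h5 : s * s ^ a * (t ^ a / s ^ a) = s * t ^ a := by field_simp
      rw [h4, h5] at h3
      linarith
    have h6 : t ^ a ≤ s ^ a := Real.rpow_le_rpow ht.le hts ha
    have := mul_le_mul_of_nonneg_right hts (sub_nonneg.2 h6)
    linarith
  · have hB := rpow_one_add_le_one_add_mul_self (s := s / t - 1)
      (by have : 0 ≤ s / t := by positivity
          linarith) ha h1
    rw [add_sub_cancel, Real.div_rpow hs.le ht.le] at hB
    have hta : 0 < t ^ a := Real.rpow_pos_of_pos ht _
    have h3 := mul_le_mul_of_nonneg_left hB (mul_pos ht hta).le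
    have h4 : t * t ^ a * (1 + a * (s / t - 1)) = t * t ^ a + a * t ^ a * (s - t) := by
      field_simp
    have h5 : t * t ^ a * (s ^ a / t ^ a) = t * s ^ a := by field_simp
    rw [h4, h5] at h3
    have h6 : t ^ a ≤ s ^ a := Real.rpow_le_rpow ht.le hts ha
    have h7 : a * t ^ a * (s - t) ≤ a * s ^ a * (s - t) := by
      have : 0 ≤ s - t := by linarith
      gcongr
    linarith

/-! ### The Forchheimer nonlinearity: monotonicity, growth, potential. -/

namespace ForchheimerPolynomial

variable (G : ForchheimerPolynomial)

theorem deg_pos : 0 < G.deg := by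
  rw [← G.α_zero]
  exact G.α_strictMono (Fin.lt_def.2 (by have := G.one_le_N; simp; omega))

theorem β_eq : G.β = 1 + 1 / (1 + G.deg) := by
  have := G.deg_pos
  unfold β; field_simp; ring

theorem one_lt_β : 1 < G.β := by
  rw [β_eq]; have := G.deg_pos
  have : 0 < 1 / (1 + G.deg) := by positivity
  linarith

theorem β_pos : 0 < G.β := one_pos.trans G.one_lt_β

theorem β_lt_two : G.β < 2 := by
  rw [β_eq]; have := G.deg_pos
  have : 1 / (1 + G.deg) < 1 := by rw [div_lt_one] <;> linarith
  linarith

theorem lam_eq : G.lam = G.deg + 2 := by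
  have := G.deg_pos
  unfold lam; rw [β_eq]; field_simp; ring

theorem two_lt_lam : 2 < G.lam := by rw [lam_eq]; linarith [G.deg_pos]

theorem lam_pos : 0 < G.lam := two_pos.trans G.two_lt_lam

theorem β_holderConjugate_lam : G.β.HolderConjugate G.lam :=
  Real.holderConjugate_iff.2 ⟨G.one_lt_β, by
    rw [lam]
    have := G.one_lt_β
    field_simp; ring⟩

theorem g_pos {s : ℝ} (hs : 0 ≤ s) : 0 < G.g s := G.a_zero_pos.trans_le (G.a_zero_le_g hs)

theorem sOf_nonneg {ξ : ℝ} (hξ : 0 ≤ ξ) : 0 ≤ G.sOf ξ := (G.sOf_spec hξ).1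

theorem sOf_mul_g {ξ : ℝ} (hξ : 0 ≤ ξ) : G.sOf ξ * G.g (G.sOf ξ) = ξ := (G.sOf_spec hξ).2

theorem K_pos {ξ : ℝ} (hξ : 0 ≤ ξ) : 0 < G.K ξ := one_div_pos.2 (G.g_pos (G.sOf_nonneg hξ))

theorem K_mul_self {ξ : ℝ} (hξ : 0 ≤ ξ) : G.K ξ * ξ = G.sOf ξ := by
  have h := G.g_pos (G.sOf_nonneg hξ)
  nth_rewrite 2 [← G.sOf_mul_g hξ]
  rw [K]; field_simp

theorem sOf_le_sOf {ξ η : ℝ} (hξ : 0 ≤ ξ) (h : ξ ≤ η) : G.sOf ξ ≤ G.sOf η := by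
  by_contra! hlt
  have h0 := G.sOf_nonneg (hξ.trans h)
  have h1 := G.g_mono h0 hlt.le
  have h2 := G.sOf_mul_g hξ
  have h3 := G.sOf_mul_g (hξ.trans h)
  have h4 := G.g_pos h0
  have : G.sOf η * G.g (G.sOf η) < G.sOf ξ * G.g (G.sOf ξ) :=
    (mul_lt_mul_of_pos_right hlt h4).trans_le
      (mul_le_mul_of_nonneg_left h1 (h0.trans hlt.le))
  linarith

theorem monotoneOn_sOf : MonotoneOn G.sOf (Ici 0) := fun _ hx _ _ h => G.sOf_le_sOf hx h

theorem K_le_K {ξ η : ℝ} (hξ : 0 ≤ ξ) (h : ξ ≤ η) : G.K η ≤ G.K ξ :=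
  one_div_le_one_div_of_le (G.g_pos (G.sOf_nonneg hξ))
    (G.g_mono (G.sOf_nonneg hξ) (G.sOf_le_sOf hξ h))

/-- `g` grows at most linearly relative to itself: `s g(s) - t g(t) ≤ (1 + deg g) g(s) (s - t)`. -/
theorem mul_g_sub_mul_g_le {s t : ℝ} (ht : 0 ≤ t) (hts : t ≤ s) :
    s * G.g s - t * G.g t ≤ (1 + G.deg) * G.g s * (s - t) := by
  have h : t * (G.g s - G.g t) ≤ G.deg * G.g s * (s - t) := by
    simp only [g, ← Finset.sum_sub_distrib, Finset.mul_sum, Finset.sum_mul]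
    refine Finset.sum_le_sum fun i _ => ?_
    have h1 := mul_rpow_sub_rpow_le (G.α_nonneg i) ht hts
    have h2 : G.α i ≤ G.deg := G.α_strictMono.monotone (Fin.le_last i)
    have h3 := G.a_nonneg i
    have h4 : 0 ≤ s ^ G.α i := Real.rpow_nonneg (ht.trans hts) _
    have h5 : 0 ≤ s - t := by linarith
    calc t * (G.a i * s ^ G.α i - G.a i * t ^ G.α i)
        = G.a i * (t * (s ^ G.α i - t ^ G.α i)) := by ring
      _ ≤ G.a i * (G.α i * s ^ G.α i * (s - t)) := by gcongr
      _ ≤ G.a i * (G.deg * s ^ G.α i * (s - t)) := by gcongr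
      _ = _ := by ring
  nlinarith

/-- Since s g(s) has slope at most (1 + deg) g(s), its inverse has slope at least K/(1 + deg), and K
is decreasing, so the value at the larger endpoint is the safe one. -/
theorem sub_le_of_le {ξ η : ℝ} (hη : 0 ≤ η) (h : η ≤ ξ) :
    G.K ξ * (ξ - η) ≤ (1 + G.deg) * (G.sOf ξ - G.sOf η) := by
  have h1 := G.mul_g_sub_mul_g_le (G.sOf_nonneg hη) (G.sOf_le_sOf hη h)
  rw [G.sOf_mul_g hη, G.sOf_mul_g (hη.trans h)] at h1
  have h2 := G.g_pos (G.sOf_nonneg (hη.trans h))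
  rw [K, one_div_mul_eq_div, div_le_iff₀ h2]
  linarith

section VectorField

variable {E : Type*} [NormedAddCommGroup E] [InnerProductSpace ℝ E]

/-- The nonlinear flux `y ↦ K(|y|) y`. -/
def flux (y : E) : E := G.K ‖y‖ • y

theorem norm_flux (y : E) : ‖G.flux y‖ = G.sOf ‖y‖ := by
  rw [flux, norm_smul, Real.norm_of_nonneg (G.K_pos (norm_nonneg y)).le,
    G.K_mul_self (norm_nonneg y)]

theorem inner_flux_self (y : E) : inner ℝ (G.flux y) y = G.sOf ‖y‖ * ‖y‖ := by
  rw [flux, real_inner_smul_left, real_inner_self_eq_norm_sq, ← G.K_mul_self (norm_nonneg y)]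
  ring

/-- Splits the monotonicity into a radial and an angular part, both nonnegative, the second by
Cauchy–Schwarz. -/
theorem inner_flux_sub (y z : E) : inner ℝ (G.flux y - G.flux z) (y - z) =
    (G.sOf ‖y‖ - G.sOf ‖z‖) * (‖y‖ - ‖z‖) +
      (G.K ‖y‖ + G.K ‖z‖) * (‖y‖ * ‖z‖ - inner ℝ y z) := by
  have h1 := G.K_mul_self (norm_nonneg y)
  have h2 := G.K_mul_self (norm_nonneg z)
  simp only [flux, inner_sub_left, inner_sub_right, real_inner_smul_left,
    real_inner_self_eq_norm_sq, real_inner_comm y z]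
  rw [← h1, ← h2]; ring

/-- Monotonicity is only degenerate: the weight is the conductivity at the larger of the two
gradients and tends to zero as that gradient grows. It has to be carried along until
`exists_sq_mul_g_le` pays for it. -/
theorem norm_sub_sq_le_inner_flux {y z : E} (h : ‖z‖ ≤ ‖y‖) :
    G.K ‖y‖ * ‖y - z‖ ^ 2 ≤ (1 + G.deg) * inner ℝ (G.flux y - G.flux z) (y - z) := by
  rw [inner_flux_sub, norm_sub_sq_real]
  have h1 := G.sub_le_of_le (norm_nonneg z) h
  have h2 := G.K_le_K (norm_nonneg z) h
  have h3 := G.K_pos (norm_nonneg y)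
  have h4 := real_inner_le_norm y z
  have h5 := G.deg_pos
  have h6 : 0 ≤ ‖y‖ - ‖z‖ := by linarith
  have h7 : 0 ≤ ‖y‖ * ‖z‖ - inner ℝ y z := by linarith
  have h8 := mul_le_mul_of_nonneg_right h1 h6
  have h9 : 2 * G.K ‖y‖ * (‖y‖ * ‖z‖ - inner ℝ y z) ≤
      (G.K ‖y‖ + G.K ‖z‖) * (‖y‖ * ‖z‖ - inner ℝ y z) := by gcongr; linarith
  have h10 : 0 ≤ G.deg * ((G.K ‖y‖ + G.K ‖z‖) * (‖y‖ * ‖z‖ - inner ℝ y z)) := by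
    have := G.K_pos (norm_nonneg z)
    positivity
  linarith [sq_nonneg (‖y‖ - ‖z‖)]

theorem K_le (ξ : ℝ) (hξ : 0 ≤ ξ) : G.K ξ ≤ (G.a 0)⁻¹ := by
  rw [K, one_div]
  exact inv_anti₀ G.a_zero_pos (G.a_zero_le_g (G.sOf_nonneg hξ))

theorem norm_flux_sub_le (y z : E) : ‖G.flux y - G.flux z‖ ≤ 2 * (G.a 0)⁻¹ * ‖y - z‖ := by
  wlog h : ‖z‖ ≤ ‖y‖ generalizing y z
  · have := this z y (le_of_not_ge h)
    rwa [norm_sub_rev, norm_sub_rev y z]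
  have ha := inv_pos.2 G.a_zero_pos
  have h1 := G.K_le_K (norm_nonneg z) h
  have h2 := G.K_le _ (norm_nonneg y)
  have h3 := G.K_pos (norm_nonneg y)
  have h4 : G.flux y - G.flux z = G.K ‖y‖ • (y - z) - (G.K ‖z‖ - G.K ‖y‖) • z := by
    simp only [flux]; module
  -- Because s is increasing, (K(|z|) - K(|y|))|z| = s(|z|) - K(|y|)|z| ≤ K(|y|)(|y| - |z|).
  have h5 : ‖(G.K ‖z‖ - G.K ‖y‖) • z‖ ≤ (G.a 0)⁻¹ * ‖y - z‖ := by
    rw [norm_smul, Real.norm_of_nonneg (by linarith), sub_mul, G.K_mul_self (norm_nonneg z)]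
    have h6 : G.sOf ‖z‖ ≤ G.sOf ‖y‖ := G.sOf_le_sOf (norm_nonneg z) h
    have h7 := G.K_mul_self (norm_nonneg y)
    have h8 : ‖y‖ - ‖z‖ ≤ ‖y - z‖ := norm_sub_norm_le y z
    have h9 : G.K ‖y‖ * (‖y‖ - ‖z‖) ≤ (G.a 0)⁻¹ * ‖y - z‖ := by
      have : 0 ≤ ‖y‖ - ‖z‖ := by linarith
      gcongr
    linarith
  rw [h4]
  refine (norm_sub_le _ _).trans ?_
  rw [norm_smul, Real.norm_of_nonneg h3.le]
  have : G.K ‖y‖ * ‖y - z‖ ≤ (G.a 0)⁻¹ * ‖y - z‖ := by gcongr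
  linarith

theorem continuous_flux : Continuous (G.flux : E → E) :=
  (LipschitzWith.of_dist_le_mul (K := (2 * (G.a 0)⁻¹).toNNReal) fun y z => by
    rw [dist_eq_norm, dist_eq_norm, Real.coe_toNNReal _
      (by have := inv_pos.2 G.a_zero_pos; positivity)]
    exact G.norm_flux_sub_le y z).continuous

end VectorField

/-! ### Growth -/

theorem rpow_le_one_add_rpow {s a b : ℝ} (hs : 0 ≤ s) (ha : 0 ≤ a) (hab : a ≤ b) :
    s ^ a ≤ 1 + s ^ b := by
  rcases le_total s 1 with h | h
  · have := Real.rpow_le_one hs h ha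
    have := Real.rpow_nonneg hs b
    linarith
  · have := Real.rpow_le_rpow_of_exponent_le h hab
    linarith

/-- The sum of the coefficients. -/
def coeffSum : ℝ := ∑ i, G.a i

theorem coeffSum_pos : 0 < G.coeffSum :=
  G.a_zero_pos.trans_le (Finset.single_le_sum (f := G.a) (fun i _ => G.a_nonneg i)
    (Finset.mem_univ 0))

theorem g_le {s : ℝ} (hs : 0 ≤ s) : G.g s ≤ G.coeffSum * (1 + s ^ G.deg) := by
  rw [g, coeffSum, Finset.sum_mul]
  exact Finset.sum_le_sum fun i _ => mul_le_mul_of_nonneg_left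
    (rpow_le_one_add_rpow hs (G.α_nonneg i) (G.α_strictMono.monotone (Fin.le_last i)))
    (G.a_nonneg i)

theorem le_g {s : ℝ} (hs : 0 ≤ s) : G.a (Fin.last G.N) * s ^ G.deg ≤ G.g s :=
  Finset.single_le_sum (f := fun i => G.a i * s ^ G.α i)
    (fun i _ => mul_nonneg (G.a_nonneg i) (Real.rpow_nonneg hs _)) (Finset.mem_univ _)

/-- The leading term alone gives a_N s^{1+deg} ≤ s g(s) = ξ, and β - 1 = 1/(1 + deg). -/
theorem exists_sOf_le : ∃ C, 0 < C ∧ ∀ ξ, 0 ≤ ξ → G.sOf ξ ≤ C * ξ ^ (G.β - 1) := by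
  have hd := G.deg_pos
  have ha := G.a_last_pos
  refine ⟨((G.a (Fin.last G.N))⁻¹) ^ (1 / (1 + G.deg)), by positivity, fun ξ hξ => ?_⟩
  have hs := G.sOf_nonneg hξ
  have h1 : G.sOf ξ ^ (1 + G.deg) ≤ (G.a (Fin.last G.N))⁻¹ * ξ := by
    rw [← div_eq_inv_mul, le_div_iff₀ ha]
    nth_rewrite 2 [← G.sOf_mul_g hξ]
    rw [Real.rpow_add_of_nonneg hs zero_le_one hd.le, Real.rpow_one]
    have := mul_le_mul_of_nonneg_left (G.le_g hs) hs
    linarith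
  have h2 := Real.rpow_le_rpow (by positivity) h1 (z := 1 / (1 + G.deg)) (by positivity)
  rw [← Real.rpow_mul hs, mul_one_div_cancel (by positivity), Real.rpow_one,
    Real.mul_rpow (by positivity) hξ] at h2
  rw [β_eq, add_sub_cancel_left]
  exact h2

theorem exists_sOf_mul_le : ∃ C, 0 < C ∧ ∀ ξ, 0 ≤ ξ → G.sOf ξ * ξ ≤ C * ξ ^ G.β := by
  obtain ⟨C, hC, h⟩ := G.exists_sOf_le
  refine ⟨C, hC, fun ξ hξ => ?_⟩
  have h1 := mul_le_mul_of_nonneg_right (h ξ hξ) hξ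
  have h2 : ξ ^ G.β = ξ ^ (G.β - 1) * ξ := by
    have := Real.rpow_add_of_nonneg hξ (y := G.β - 1) (z := 1)
      (by linarith [G.one_lt_β]) zero_le_one
    rwa [sub_add_cancel, Real.rpow_one] at this
  rw [h2]; linarith

/-- Coercivity: `ξ^β ≤ C (1 + K(ξ) ξ²)`. -/
theorem exists_rpow_le : ∃ C, 0 < C ∧ ∀ ξ, 0 ≤ ξ → ξ ^ G.β ≤ C * (1 + G.sOf ξ * ξ) := by
  have hd := G.deg_pos
  have hA := G.coeffSum_pos
  set A := G.coeffSum
  set C₀ := (2 * A) ^ (1 / (1 + G.deg))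
  have hC₀ : 0 < C₀ := by positivity
  refine ⟨C₀ * (2 + 2 * A), by positivity, fun ξ hξ => ?_⟩
  have hs := G.sOf_nonneg hξ
  have hsp : 0 ≤ G.sOf ξ ^ G.deg := Real.rpow_nonneg hs _
  set s := G.sOf ξ
  have e1 : s ^ (1 + G.deg) = s * s ^ G.deg := by
    rw [Real.rpow_add_of_nonneg hs zero_le_one hd.le, Real.rpow_one]
  have h1 : ξ ≤ A * (s + s * s ^ G.deg) := by
    rw [← G.sOf_mul_g hξ]
    have := mul_le_mul_of_nonneg_left (G.g_le hs) hs
    linarith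
  have h2 : ξ ≤ 2 * A * (1 + s) ^ (1 + G.deg) := by
    have h3 : s ^ (1 + G.deg) ≤ (1 + s) ^ (1 + G.deg) :=
      Real.rpow_le_rpow hs (by linarith) (by linarith)
    have h4 : s ≤ (1 + s) ^ (1 + G.deg) := by
      have := Real.rpow_le_rpow_of_exponent_le (x := 1 + s) (by linarith)
        (show 1 ≤ 1 + G.deg by linarith)
      rw [Real.rpow_one] at this
      linarith
    rw [e1] at h3
    nlinarith
  have h3 : ξ ^ (G.β - 1) ≤ C₀ * (1 + s) := by
    have := Real.rpow_le_rpow hξ h2 (z := 1 / (1 + G.deg)) (by positivity)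
    rw [Real.mul_rpow (by positivity) (by positivity), ← Real.rpow_mul (by positivity),
      mul_one_div_cancel (by positivity), Real.rpow_one] at this
    rwa [β_eq, add_sub_cancel_left]
  -- If s ≤ 1 then ξ = s g(s) ≤ 2A; if s ≥ 1 then ξ ≤ sξ.
  have h4 : ξ ≤ 2 * A + s * ξ := by
    rcases le_total s 1 with h | h
    · have h5 : s ^ G.deg ≤ 1 := Real.rpow_le_one hs h hd.le
      have h6 : s * s ^ G.deg ≤ 1 := mul_le_one₀ h hsp h5
      nlinarith [mul_nonneg hs hξ]
    · nlinarith
  have h5 : ξ ^ G.β = ξ ^ (G.β - 1) * ξ := by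
    have := Real.rpow_add_of_nonneg hξ (y := G.β - 1) (z := 1)
      (by linarith [G.one_lt_β]) zero_le_one
    rwa [sub_add_cancel, Real.rpow_one] at this
  rw [h5]
  have h6 := mul_le_mul_of_nonneg_right h3 hξ
  have h7 : (1 + s) * ξ ≤ (2 + 2 * A) * (1 + s * ξ) := by
    nlinarith [mul_nonneg hs hξ, mul_nonneg hA.le (mul_nonneg hs hξ)]
  nlinarith

/-- Young's inequality with a parameter. -/
theorem exists_young {ε : ℝ} (hε : 0 < ε) : ∃ C, 0 < C ∧ ∀ P ξ, 0 ≤ P → 0 ≤ ξ →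
    P * ξ ≤ ε * ξ ^ G.β + C * P ^ G.lam := by
  have hβ := G.β_pos
  have hl := G.lam_pos
  set δ := (ε * G.β) ^ (1 / G.β)
  have hδ : 0 < δ := by positivity
  refine ⟨(1 / δ) ^ G.lam / G.lam, by positivity, fun P ξ hP hξ => ?_⟩
  have h := Real.young_inequality_of_nonneg (a := δ * ξ) (b := 1 / δ * P) (by positivity)
    (by positivity) G.β_holderConjugate_lam
  rw [Real.mul_rpow hδ.le hξ, Real.mul_rpow (by positivity) hP, ← Real.rpow_mul (by positivity),
    one_div_mul_cancel hβ.ne', Real.rpow_one] at h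
  calc P * ξ = δ * ξ * (1 / δ * P) := by field_simp
    _ ≤ _ := h
    _ = _ := by field_simp

/-- The price P²/K of dividing by the degenerate weight. As 1/K = g(s) grows like s^deg and λ = deg
+ 2, the product P² s^deg is at most P^λ + s^λ, and a_N s^λ ≤ s² g(s) = sξ ≤ Cξ^β. -/
theorem exists_sq_mul_g_le : ∃ C, 0 < C ∧ ∀ P ξ, 0 ≤ P → 0 ≤ ξ →
    P ^ 2 * G.g (G.sOf ξ) ≤ C * (1 + ξ ^ G.β + P ^ G.lam) := by
  obtain ⟨C₁, hC₁, h₁⟩ := G.exists_sOf_mul_le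
  have hA := G.coeffSum_pos
  have hd := G.deg_pos
  have ha := G.a_last_pos
  set aN := G.a (Fin.last G.N)
  refine ⟨G.coeffSum * (2 + C₁ / aN), by positivity, fun P ξ hP hξ => ?_⟩
  have hs := G.sOf_nonneg hξ
  have h1 := h₁ ξ hξ
  have h2 := G.sOf_mul_g hξ
  have h3 := G.le_g hs
  have h4 := G.g_le hs
  set s := G.sOf ξ
  have hξβ : 0 ≤ ξ ^ G.β := by positivity
  have hPl : 0 ≤ P ^ G.lam := by positivity
  have es : ∀ x : ℝ, 0 ≤ x → x ^ G.lam = x ^ 2 * x ^ G.deg := fun x hx => by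
    rw [lam_eq, Real.rpow_add_of_nonneg hx hd.le zero_le_two, mul_comm, Real.rpow_two]
  have h5 : s ^ G.lam ≤ C₁ / aN * ξ ^ G.β := by
    rw [div_mul_eq_mul_div, le_div_iff₀ ha, es s hs]
    have : s ^ 2 * (aN * s ^ G.deg) ≤ s ^ 2 * G.g s := by gcongr
    nlinarith
  have h6 : P ^ 2 ≤ 1 + P ^ G.lam := by
    have := rpow_le_one_add_rpow hP zero_le_two G.two_lt_lam.le
    rwa [Real.rpow_two] at this
  have h7 : P ^ 2 * s ^ G.deg ≤ P ^ G.lam + s ^ G.lam := by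
    rcases le_total P s with h | h
    · have : P ^ 2 * s ^ G.deg ≤ s ^ 2 * s ^ G.deg := by gcongr
      rw [es s hs]; linarith
    · have : P ^ 2 * s ^ G.deg ≤ P ^ 2 * P ^ G.deg := by gcongr
      rw [es P hP]
      have : 0 ≤ s ^ G.lam := by positivity
      linarith
  have h8 : P ^ 2 * G.g s ≤ P ^ 2 * (G.coeffSum * (1 + s ^ G.deg)) := by gcongr
  have h9 : P ^ 2 * (1 + s ^ G.deg) ≤ (2 + C₁ / aN) * (1 + ξ ^ G.β + P ^ G.lam) := by
    have : 0 ≤ C₁ / aN := by positivity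
    nlinarith [mul_nonneg this hPl]
  nlinarith

/-- The absorption used for time increments, with s the time shift and P the size of the rate of the
boundary flux. Completing the square against the weight K at the larger vector leaves an error
carrying s², so it survives a later division by s². -/
theorem exists_mul_norm_sub_le : ∃ C, 0 < C ∧
    ∀ {E : Type} [NormedAddCommGroup E] [InnerProductSpace ℝ E] (y z : E) (s P : ℝ), 0 ≤ s →
      0 ≤ P → s * P * ‖y - z‖ ≤ inner ℝ (G.flux y - G.flux z) (y - z) +
        C * s ^ 2 * (1 + ‖y‖ ^ G.β + ‖z‖ ^ G.β + P ^ G.lam) := by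
  obtain ⟨C, hC, h⟩ := G.exists_sq_mul_g_le
  have hd := G.deg_pos
  refine ⟨C * (1 + G.deg) / 4, by positivity, fun y z s P hs hP => ?_⟩
  wlog hyz : ‖z‖ ≤ ‖y‖ generalizing y z
  · have h1 := this z y (le_of_not_ge hyz)
    rw [norm_sub_rev, ← neg_sub (G.flux y), ← neg_sub y, inner_neg_neg] at h1
    linarith
  have h1 := G.norm_sub_sq_le_inner_flux hyz
  have h2 := h P ‖y‖ hP (norm_nonneg y)
  have hγ := G.g_pos (G.sOf_nonneg (norm_nonneg y))
  rw [K] at h1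
  set γ := G.g (G.sOf ‖y‖)
  set I := inner ℝ (G.flux y - G.flux z) (y - z)
  have hz : 0 ≤ ‖z‖ ^ G.β := by positivity
  have h3 : s * P * ‖y - z‖ ≤ (1 / γ * ‖y - z‖ ^ 2) / (1 + G.deg) +
      (1 + G.deg) / 4 * s ^ 2 * (P ^ 2 * γ) := by
    have h0 := sq_nonneg (2 * ‖y - z‖ - (1 + G.deg) * γ * (s * P))
    have : 0 < 4 * γ * (1 + G.deg) := by positivity
    rw [← sub_nonneg]
    have e : (1 / γ * ‖y - z‖ ^ 2) / (1 + G.deg) + (1 + G.deg) / 4 * s ^ 2 * (P ^ 2 * γ) -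
      s * P * ‖y - z‖ = (2 * ‖y - z‖ - (1 + G.deg) * γ * (s * P)) ^ 2 / (4 * γ * (1 + G.deg)) := by
      field_simp; ring
    rw [e]; positivity
  have h4 : (1 / γ * ‖y - z‖ ^ 2) / (1 + G.deg) ≤ I := by
    rw [div_le_iff₀ (by positivity)]; linarith
  have h5 : (1 + G.deg) / 4 * s ^ 2 * (P ^ 2 * γ) ≤
      (1 + G.deg) / 4 * s ^ 2 * (C * (1 + ‖y‖ ^ G.β + ‖z‖ ^ G.β + P ^ G.lam)) := by
    refine mul_le_mul_of_nonneg_left (h2.trans ?_) (by positivity)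
    exact mul_le_mul_of_nonneg_left (by linarith) hC.le
  linarith

/-! ### The potential -/

/-- The potential `H(ξ) = ∫₀^ξ s(η) dη` of the flux. -/
def potential (ξ : ℝ) : ℝ := ∫ η in (0 : ℝ)..ξ, G.sOf η

theorem intervalIntegrable_sOf {a b : ℝ} (ha : 0 ≤ a) (hb : 0 ≤ b) :
    IntervalIntegrable G.sOf volume a b :=
  (G.monotoneOn_sOf.mono fun _ hx => (le_min ha hb).trans hx.1).intervalIntegrable

/-- Convexity: the monotone function s is a subgradient of its primitive, whether or not it is
continuous. -/
theorem mul_sub_le_potential_sub {ξ η : ℝ} (hξ : 0 ≤ ξ) (hη : 0 ≤ η) :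
    G.sOf ξ * (η - ξ) ≤ G.potential η - G.potential ξ := by
  rw [potential, potential, intervalIntegral.integral_interval_sub_left
    (G.intervalIntegrable_sOf le_rfl hη) (G.intervalIntegrable_sOf le_rfl hξ)]
  rcases le_total ξ η with h | h
  · have := intervalIntegral.integral_mono_on h (f := fun _ => G.sOf ξ) (g := G.sOf) (by simp)
      (G.intervalIntegrable_sOf hξ hη) (fun x hx => G.sOf_le_sOf hξ hx.1)
    rwa [intervalIntegral.integral_const, smul_eq_mul, mul_comm] at this
  · rw [intervalIntegral.integral_symm]
    have := intervalIntegral.integral_mono_on h (f := G.sOf) (g := fun _ => G.sOf ξ)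
      (G.intervalIntegrable_sOf hη hξ) (by simp) (fun x hx => G.sOf_le_sOf (hη.trans hx.1) hx.2)
    rw [intervalIntegral.integral_const, smul_eq_mul] at this
    linarith

theorem potential_zero : G.potential 0 = 0 := by simp [potential]

theorem potential_nonneg {ξ : ℝ} (hξ : 0 ≤ ξ) : 0 ≤ G.potential ξ := by
  have h := G.mul_sub_le_potential_sub le_rfl hξ
  have := mul_nonneg (G.sOf_nonneg le_rfl) hξ
  rw [potential_zero] at h
  linarith

theorem potential_le {ξ : ℝ} (hξ : 0 ≤ ξ) : G.potential ξ ≤ G.sOf ξ * ξ := by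
  have := G.mul_sub_le_potential_sub hξ le_rfl
  rw [potential_zero] at this
  linarith

theorem exists_potential_le : ∃ C, 0 < C ∧ ∀ ξ, 0 ≤ ξ → G.potential ξ ≤ C * ξ ^ G.β := by
  obtain ⟨C, hC, h⟩ := G.exists_sOf_mul_le
  exact ⟨C, hC, fun ξ hξ => (G.potential_le hξ).trans (h ξ hξ)⟩

/-- By convexity the potential at ξ is at least s(ξ/2)·ξ/2, so the coercivity at ξ/2 transfers to it
at the cost of a factor 2^β. -/
theorem exists_rpow_le_potential :
    ∃ C, 0 < C ∧ ∀ ξ, 0 ≤ ξ → ξ ^ G.β ≤ C * (1 + G.potential ξ) := by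
  obtain ⟨C, hC, h⟩ := G.exists_rpow_le
  refine ⟨2 ^ G.β * C, by positivity, fun ξ hξ => ?_⟩
  have h1 := h (ξ / 2) (by positivity)
  have h2 := G.mul_sub_le_potential_sub (ξ := ξ / 2) (by positivity) hξ
  have h3 := G.potential_nonneg (ξ := ξ / 2) (by positivity)
  calc ξ ^ G.β = 2 ^ G.β * (ξ / 2) ^ G.β := by
        rw [← Real.mul_rpow (by norm_num) (by positivity)]; congr 1; ring
    _ ≤ 2 ^ G.β * (C * (1 + G.potential ξ)) := by
        gcongr
        refine h1.trans ?_
        gcongr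
        linarith
    _ = _ := by ring

/-- The flux is a subgradient of y ↦ H(|y|). Energy increments can therefore be estimated without
differentiating the energy. -/
theorem inner_flux_le_potential_sub {E : Type*} [NormedAddCommGroup E] [InnerProductSpace ℝ E]
    (y z : E) : inner ℝ (G.flux y) (z - y) ≤ G.potential ‖z‖ - G.potential ‖y‖ := by
  refine le_trans ?_ (G.mul_sub_le_potential_sub (norm_nonneg y) (norm_nonneg z))
  rw [inner_sub_right, inner_flux_self]
  have := real_inner_le_norm (G.flux y) z
  rw [norm_flux] at this
  linarith

theorem continuousOn_potential : ContinuousOn G.potential (Ici 0) := by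
  have h : ∀ x ∈ Ici (0 : ℝ), ∀ y ∈ Ici (0 : ℝ), ∀ R, x ≤ R → y ≤ R →
      |G.potential x - G.potential y| ≤ G.sOf R * |x - y| := by
    intro x hx y hy R hxR hyR
    wlog hxy : x ≤ y generalizing x y
    · rw [abs_sub_comm, abs_sub_comm x y]; exact this y hy x hx hyR hxR (le_of_not_ge hxy)
    have h1 := G.mul_sub_le_potential_sub hx hy
    have h2 := G.mul_sub_le_potential_sub hy hx
    have h3 := G.sOf_le_sOf hy hyR
    have h4 := G.sOf_nonneg hx
    have h5 : 0 ≤ y - x := by linarith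
    rw [abs_sub_comm, abs_sub_comm x y, abs_of_nonneg h5, abs_of_nonneg (by nlinarith)]
    nlinarith
  intro x hx
  have h1 : Filter.Tendsto (fun y : ℝ => G.sOf (x + 1) * |y - x|) (nhdsWithin x (Ici 0))
      (nhds 0) := by
    have : Continuous fun y : ℝ => G.sOf (x + 1) * |y - x| := by fun_prop
    have h := this.continuousWithinAt (s := Ici 0) (x := x)
    simpa [ContinuousWithinAt] using h
  refine tendsto_iff_norm_sub_tendsto_zero.2 (squeeze_zero' (.of_forall fun _ => norm_nonneg _)
    ?_ h1)
  have : ∀ᶠ y in nhdsWithin x (Ici 0), y < x + 1 :=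
    nhdsWithin_le_nhds (gt_mem_nhds (by linarith))
  filter_upwards [this, self_mem_nhdsWithin] with y hy hy0
  exact h y hy0 x hx _ hy.le (by linarith)

end ForchheimerPolynomial


/-! ### Parameter integrals and Gronwall's inequality. -/

set_option linter.unusedSectionVars false

open Filter Topology in
/-- Dependence on a parameter of integrals of continuous functions of an essentially bounded
function. -/
theorem continuous_integral_comp_of_bounded {X P W : Type*} [MeasurableSpace X] {μ : Measure X}
    [IsFiniteMeasure μ] [TopologicalSpace P] [LocallyCompactSpace P] [FirstCountableTopology P]
    [NormedAddCommGroup W] [ProperSpace W] {Z : X → W} (hZ : AEStronglyMeasurable Z μ) {M : ℝ}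
    (hM : ∀ᵐ x ∂μ, ‖Z x‖ ≤ M) {Ψ : P → W → ℝ} (hΨ : Continuous fun q : P × W => Ψ q.1 q.2) :
    (∀ p, Integrable (fun x => Ψ p (Z x)) μ) ∧ Continuous fun p => ∫ x, Ψ p (Z x) ∂μ := by
  have hΨp : ∀ p, Continuous (Ψ p) := fun p =>
    hΨ.comp (continuous_const.prodMk continuous_id)
  have hm : ∀ p, AEStronglyMeasurable (fun x => Ψ p (Z x)) μ := fun p =>
    (hΨp p).comp_aestronglyMeasurable hZ
  have hb : ∀ p, ∃ U ∈ 𝓝 p, ∃ C, ∀ q ∈ U, ∀ᵐ x ∂μ, ‖Ψ q (Z x)‖ ≤ C := by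
    intro p
    obtain ⟨K, hK, hpK⟩ := exists_compact_mem_nhds p
    obtain ⟨C, hC⟩ := (hK.prod (isCompact_closedBall (0 : W) M)).exists_bound_of_continuousOn
      hΨ.continuousOn
    refine ⟨K, hpK, C, fun q hq => ?_⟩
    filter_upwards [hM] with x hx
    exact hC (q, Z x) ⟨hq, by simpa using hx⟩
  refine ⟨fun p => ?_, continuous_iff_continuousAt.2 fun p => ?_⟩
  · obtain ⟨U, hU, C, hC⟩ := hb p
    exact Integrable.of_bound (hm p) C (hC p (mem_of_mem_nhds hU))
  · obtain ⟨U, hU, C, hC⟩ := hb p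
    refine tendsto_integral_filter_of_dominated_convergence (fun _ => C)
      (.of_forall hm) (by filter_upwards [hU] with q hq using hC q hq) (integrable_const C)
      (.of_forall fun x => ?_)
    exact (hΨ.comp (continuous_id.prodMk continuous_const)).continuousAt

/-- Gronwall's inequality with a dissipation term. -/
theorem gronwall_add_integral_le {y y' k p : ℝ → ℝ} {a b C : ℝ} (hab : a ≤ b) (hC : 0 ≤ C)
    (hy : ContinuousOn y (Icc a b)) (hk : ContinuousOn k (Icc a b)) (hp : ContinuousOn p (Icc a b))
    (hk0 : ∀ t ∈ Icc a b, 0 ≤ k t) (hp0 : ∀ t ∈ Icc a b, 0 ≤ p t)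
    (hy' : ∀ t ∈ Ioo a b, HasDerivAt y (y' t) t) (h : ∀ t ∈ Ioo a b, y' t ≤ C * y t - k t + p t) :
    y b + ∫ τ in a..b, k τ ≤ Real.exp (C * (b - a)) * (y a + ∫ τ in a..b, p τ) := by
  -- Integrating factor. The differential inequality says that e·y plus the integral of e(k - p) is
  -- nonincreasing.
  set e : ℝ → ℝ := fun t => Real.exp (-(C * (t - a)))
  have he : Continuous e := by fun_prop
  have he0 : ∀ t, 0 < e t := fun t => Real.exp_pos _
  have hed : ∀ t, HasDerivAt e (-C * e t) t := fun t => by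
    have : HasDerivAt (fun t => -(C * (t - a))) (-(C * 1)) t :=
      (((hasDerivAt_id t).sub_const a).const_mul C).neg
    convert this.exp using 1
    simp only [e]; ring
  have hq : ContinuousOn (fun t => e t * (k t - p t)) (Icc a b) :=
    he.continuousOn.mul (hk.sub hp)
  have hqi : IntervalIntegrable (fun t => e t * (k t - p t)) volume a b :=
    hq.intervalIntegrable_of_Icc hab
  set Z : ℝ → ℝ := fun t => e t * y t + ∫ τ in a..t, e τ * (k τ - p τ)
  have hZc : ContinuousOn Z (Icc a b) := by
    refine (he.continuousOn.mul hy).add ?_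
    have := intervalIntegral.continuousOn_primitive_interval (a := a) (b := b) (μ := volume)
      (f := fun t => e t * (k t - p t)) (by rw [uIcc_of_le hab]; exact hq.integrableOn_Icc)
    rwa [uIcc_of_le hab] at this
  have hZd : ∀ t ∈ Ioo a b, HasDerivAt Z
      (-C * e t * y t + e t * y' t + e t * (k t - p t)) t := by
    intro t ht
    refine ((hed t).mul (hy' t ht)).add ?_
    refine intervalIntegral.integral_hasDerivAt_right
      ((hq.mono (Icc_subset_Icc_right ht.2.le)).intervalIntegrable_of_Icc ht.1.le)
      (hq.stronglyMeasurableAtFilter_nhdsWithin measurableSet_Icc t |>.filter_mono ?_)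
      (hq.continuousAt (Icc_mem_nhds ht.1 ht.2))
    rw [nhdsWithin_eq_nhds.2 (Icc_mem_nhds ht.1 ht.2)]
  have hZa : AntitoneOn Z (Icc a b) := by
    refine antitoneOn_of_deriv_nonpos (convex_Icc a b) hZc
      (fun t ht => ?_) (fun t ht => ?_)
    · rw [interior_Icc] at ht
      exact (hZd t ht).differentiableAt.differentiableWithinAt
    · rw [interior_Icc] at ht
      rw [(hZd t ht).deriv]
      have h1 := mul_le_mul_of_nonneg_left (h t ht) (he0 t).le
      linarith
  have hZab := hZa (left_mem_Icc.2 hab) (right_mem_Icc.2 hab) hab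
  have hea : e a = 1 := by simp [e]
  simp only [Z, hea, one_mul, intervalIntegral.integral_same, add_zero] at hZab
  -- On [a, b] the factor lies between e(b) and 1, so the dissipation keeps at least the weight e(b)
  -- and the source gets at most the weight 1.
  have hI : e b * (∫ τ in a..b, k τ) - ∫ τ in a..b, p τ ≤ ∫ τ in a..b, e τ * (k τ - p τ) := by
    have hki : IntervalIntegrable (fun t => e b * k t) volume a b :=
      (continuousOn_const.mul hk).intervalIntegrable_of_Icc hab
    rw [← intervalIntegral.integral_const_mul, ← intervalIntegral.integral_sub hki
      (hp.intervalIntegrable_of_Icc hab)]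
    refine intervalIntegral.integral_mono_on hab
      (hki.sub (hp.intervalIntegrable_of_Icc hab)) hqi fun t ht => ?_
    have h1 : e t ≤ 1 := by
      rw [← Real.exp_zero]
      exact Real.exp_le_exp.2 (neg_nonpos.2 (mul_nonneg hC (sub_nonneg.2 ht.1)))
    have h2 : e b ≤ e t := Real.exp_le_exp.2 (by nlinarith [ht.2])
    have h3 := hk0 t ht
    have h4 := hp0 t ht
    nlinarith
  have h5 : e b * (y b + ∫ τ in a..b, k τ) ≤ y a + ∫ τ in a..b, p τ := by linarith
  have h6 : Real.exp (C * (b - a)) * e b = 1 := by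
    simp only [e]; rw [← Real.exp_add]; simp
  calc _ = Real.exp (C * (b - a)) * (e b * (y b + ∫ τ in a..b, k τ)) := by
        rw [← mul_assoc, h6, one_mul]
    _ ≤ _ := by gcongr

/-! ### The abstract Galerkin flow. -/

/-- A Galerkin approximation of a degenerate parabolic problem: a finite-dimensional trial space,
spanned by essentially bounded functions `b i` with "gradients" `B i`, the coefficients `c` of the
solution and their derivatives `c'`, a source functional `Lf` and a boundary functional `Lψ`,
together with the bounds on the data that enter the energy estimates. -/
structure GalerkinFlow (G : ForchheimerPolynomial) (d : ℕ) {X : Type*} [MeasurableSpace X]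
    (μ : Measure X) (φlo φhi T : ℝ) where
  n : ℕ
  b : Fin n → X → ℝ
  B : Fin n → X → EuclideanSpace ℝ (Fin d)
  φ : X → ℝ
  c : ℝ → Fin n → ℝ
  c' : ℝ → Fin n → ℝ
  Lf : ℝ → Fin n → ℝ
  Lψ : ℝ → Fin n → ℝ
  -- In the application `Nf` is ‖f‖, `N` is the accumulated ∫₀ᵗ‖f_t‖², and `Ps`, `Pt` are the
  -- suprema of ψ and ψ_t multiplied by the trace constant. The bound `M` is qualitative: it secures
  -- integrability and enters no estimate.
  Nf : ℝ → ℝ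
  N : ℝ → ℝ
  Ps : ℝ
  Pt : ℝ
  M : ℝ
  aesm_b : ∀ i, AEStronglyMeasurable (b i) μ
  aesm_B : ∀ i, AEStronglyMeasurable (B i) μ
  aesm_φ : AEStronglyMeasurable φ μ
  bound_b : ∀ i, ∀ᵐ x ∂μ, ‖b i x‖ ≤ M
  bound_B : ∀ i, ∀ᵐ x ∂μ, ‖B i x‖ ≤ M
  le_φ : ∀ᵐ x ∂μ, φlo ≤ φ x
  φ_le : ∀ᵐ x ∂μ, φ x ≤ φhi
  continuousOn_c : ∀ i, ContinuousOn (fun t => c t i) (Icc 0 T)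
  hasDeriv_c : ∀ t ∈ Ioc 0 T, ∀ i, HasDerivWithinAt (fun s => c s i) (c' t i) (Icc 0 T) t
  eqn : ∀ t ∈ Ioc 0 T, ∀ e : Fin n → ℝ,
    (∫ x, φ x * (∑ i, c' t i * b i x) * (∑ i, e i * b i x) ∂μ) +
      (∫ x, inner ℝ (G.flux (∑ i, c t i • B i x)) (∑ i, e i • B i x) ∂μ) =
        (∑ i, e i * Lf t i) - ∑ i, e i * Lψ t i
  continuousOn_Nf : ContinuousOn Nf (Icc 0 T)
  Lf_le : ∀ t ∈ Icc 0 T, ∀ e : Fin n → ℝ,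
    |∑ i, e i * Lf t i| ≤ Nf t * √(∫ x, (∑ i, e i * b i x) ^ 2 ∂μ)
  continuousOn_N : ContinuousOn N (Icc 0 T)
  N_mono : MonotoneOn N (Icc 0 T)
  N_zero : 0 ≤ N 0
  Lf_sub_le : ∀ s ∈ Icc 0 T, ∀ t ∈ Icc 0 T, s ≤ t → ∀ e : Fin n → ℝ,
    |∑ i, e i * (Lf t i - Lf s i)| ≤
      √((t - s) * (N t - N s)) * √(∫ x, (∑ i, e i * b i x) ^ 2 ∂μ)
  Ps_nonneg : 0 ≤ Ps
  Pt_nonneg : 0 ≤ Pt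
  Lψ_le : ∀ t ∈ Icc 0 T, ∀ e : Fin n → ℝ, |∑ i, e i * Lψ t i| ≤
    Ps * ((∫ x, |∑ i, e i * b i x| ∂μ) + ∫ x, ‖∑ i, e i • B i x‖ ∂μ)
  Lψ_sub_le : ∀ s ∈ Icc 0 T, ∀ t ∈ Icc 0 T, s ≤ t → ∀ e : Fin n → ℝ,
    |∑ i, e i * (Lψ t i - Lψ s i)| ≤
      Pt * (t - s) * ((∫ x, |∑ i, e i * b i x| ∂μ) + ∫ x, ‖∑ i, e i • B i x‖ ∂μ)

namespace GalerkinFlow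

variable {G : ForchheimerPolynomial} {d : ℕ} {X : Type*} [MeasurableSpace X] {μ : Measure X}
  [IsFiniteMeasure μ] {φlo φhi T : ℝ} (D : GalerkinFlow G d μ φlo φhi T)

/-- The trial functions and the porosity, bundled. -/
def Z (x : X) : (Fin D.n → ℝ) × (Fin D.n → EuclideanSpace ℝ (Fin d)) × ℝ :=
  (fun i => D.b i x, fun i => D.B i x, D.φ x)

def u (e : Fin D.n → ℝ) (x : X) : ℝ := ∑ i, e i * D.b i x

def U (e : Fin D.n → ℝ) (x : X) : EuclideanSpace ℝ (Fin d) := ∑ i, e i • D.B i x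

/-- Bundling the trial functions, their gradients and the porosity into one essentially bounded map
makes integrability and continuity in the coefficients of every functional below an instance of a
single statement. -/
theorem param {P : Type*} [TopologicalSpace P] [LocallyCompactSpace P] [FirstCountableTopology P]
    {Ψ : P → (Fin D.n → ℝ) × (Fin D.n → EuclideanSpace ℝ (Fin d)) × ℝ → ℝ}
    (hΨ : Continuous fun q : P × ((Fin D.n → ℝ) × (Fin D.n → EuclideanSpace ℝ (Fin d)) × ℝ) =>
      Ψ q.1 q.2) :
    (∀ p, Integrable (fun x => Ψ p (D.Z x)) μ) ∧ Continuous fun p => ∫ x, Ψ p (D.Z x) ∂μ := by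
  have hZ : AEStronglyMeasurable D.Z μ :=
    ((aemeasurable_pi_lambda _ fun i => (D.aesm_b i).aemeasurable).prodMk
      ((aemeasurable_pi_lambda _ fun i => (D.aesm_B i).aemeasurable).prodMk
        D.aesm_φ.aemeasurable)).aestronglyMeasurable
  refine continuous_integral_comp_of_bounded hZ (M := max (max D.M 0) (max |φlo| |φhi|)) ?_ hΨ
  filter_upwards [ae_all_iff.2 D.bound_b, ae_all_iff.2 D.bound_B, D.le_φ, D.φ_le] with x h1 h2 h3 h4
  have h5 : ‖D.φ x‖ ≤ max |φlo| |φhi| := abs_le_max_abs_abs h3 h4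
  simp only [Z, Prod.norm_def, max_le_iff]
  refine ⟨?_, ?_, h5.trans (le_max_right _ _)⟩
  · exact (pi_norm_le_iff_of_nonneg (by positivity)).2 fun i => (h1 i).trans (by simp)
  · exact (pi_norm_le_iff_of_nonneg (by positivity)).2 fun i => (h2 i).trans (by simp)

def sq (e : Fin D.n → ℝ) : ℝ := ∫ x, D.u e x ^ 2 ∂μ
def mass (e e' : Fin D.n → ℝ) : ℝ := ∫ x, D.φ x * D.u e x * D.u e' x ∂μ
def grad (e : Fin D.n → ℝ) : ℝ := ∫ x, ‖D.U e x‖ ^ G.β ∂μ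
def energy (e : Fin D.n → ℝ) : ℝ := ∫ x, G.potential ‖D.U e x‖ ∂μ
def abs₀ (e : Fin D.n → ℝ) : ℝ := ∫ x, |D.u e x| ∂μ
def abs₁ (e : Fin D.n → ℝ) : ℝ := ∫ x, ‖D.U e x‖ ∂μ
def form (e e' : Fin D.n → ℝ) : ℝ := ∫ x, inner ℝ (G.flux (D.U e x)) (D.U e' x) ∂μ

theorem sq_param : (∀ e, Integrable (fun x => D.u e x ^ 2) μ) ∧ Continuous D.sq := by
  have h := D.param (P := Fin D.n → ℝ) (Ψ := fun e w => (∑ i, e i * w.1 i) ^ 2) (by fun_prop)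
  exact h

theorem mass_param :
    (∀ p : (Fin D.n → ℝ) × (Fin D.n → ℝ), Integrable (fun x => D.φ x * D.u p.1 x * D.u p.2 x) μ) ∧
      Continuous fun p : (Fin D.n → ℝ) × (Fin D.n → ℝ) => D.mass p.1 p.2 := by
  have h := D.param (P := (Fin D.n → ℝ) × (Fin D.n → ℝ))
    (Ψ := fun p w => w.2.2 * (∑ i, p.1 i * w.1 i) * (∑ i, p.2 i * w.1 i)) (by fun_prop)
  exact h

theorem grad_param : (∀ e, Integrable (fun x => ‖D.U e x‖ ^ G.β) μ) ∧ Continuous D.grad := by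
  have h := D.param (P := Fin D.n → ℝ) (Ψ := fun e w => ‖∑ i, e i • w.2.1 i‖ ^ G.β)
    (Continuous.rpow_const (by fun_prop) fun _ => Or.inr G.β_pos.le)
  exact h

theorem energy_param :
    (∀ e, Integrable (fun x => G.potential ‖D.U e x‖) μ) ∧ Continuous D.energy := by
  have h := D.param (P := Fin D.n → ℝ) (Ψ := fun e w => G.potential ‖∑ i, e i • w.2.1 i‖)
    (G.continuousOn_potential.comp_continuous (by fun_prop) fun _ => norm_nonneg _)
  exact h

theorem abs₀_param : (∀ e, Integrable (fun x => |D.u e x|) μ) ∧ Continuous D.abs₀ := by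
  have h := D.param (P := Fin D.n → ℝ) (Ψ := fun e w => |∑ i, e i * w.1 i|) (by fun_prop)
  exact h

theorem abs₁_param : (∀ e, Integrable (fun x => ‖D.U e x‖) μ) ∧ Continuous D.abs₁ := by
  have h := D.param (P := Fin D.n → ℝ) (Ψ := fun e w => ‖∑ i, e i • w.2.1 i‖) (by fun_prop)
  exact h

theorem form_param :
    (∀ p : (Fin D.n → ℝ) × (Fin D.n → ℝ),
      Integrable (fun x => inner ℝ (G.flux (D.U p.1 x)) (D.U p.2 x)) μ) ∧
      Continuous fun p : (Fin D.n → ℝ) × (Fin D.n → ℝ) => D.form p.1 p.2 := by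
  have h := D.param (P := (Fin D.n → ℝ) × (Fin D.n → ℝ))
    (Ψ := fun p w => inner ℝ (G.flux (∑ i, p.1 i • w.2.1 i)) (∑ i, p.2 i • w.2.1 i))
    ((G.continuous_flux.comp (by fun_prop)).inner (by fun_prop))
  exact h

theorem u_sub (e e' : Fin D.n → ℝ) (x : X) : D.u (e - e') x = D.u e x - D.u e' x := by
  simp [u, sub_mul]

theorem U_sub (e e' : Fin D.n → ℝ) (x : X) : D.U (e - e') x = D.U e x - D.U e' x := by
  simp [U, sub_smul]

theorem u_smul (r : ℝ) (e : Fin D.n → ℝ) (x : X) : D.u (r • e) x = r * D.u e x := by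
  simp [u, Finset.mul_sum, mul_assoc]

theorem U_smul (r : ℝ) (e : Fin D.n → ℝ) (x : X) : D.U (r • e) x = r • D.U e x := by
  simp [U, Finset.smul_sum, mul_smul]

theorem sq_nonneg' (e : Fin D.n → ℝ) : 0 ≤ D.sq e := integral_nonneg fun _ => sq_nonneg _

theorem grad_nonneg (e : Fin D.n → ℝ) : 0 ≤ D.grad e :=
  integral_nonneg fun _ => Real.rpow_nonneg (norm_nonneg _) _

theorem abs₀_nonneg (e : Fin D.n → ℝ) : 0 ≤ D.abs₀ e := integral_nonneg fun _ => abs_nonneg _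

theorem abs₁_nonneg (e : Fin D.n → ℝ) : 0 ≤ D.abs₁ e := integral_nonneg fun _ => norm_nonneg _

theorem mass_sub_left (e e' f : Fin D.n → ℝ) :
    D.mass (e - e') f = D.mass e f - D.mass e' f := by
  rw [mass, mass, mass, ← integral_sub (D.mass_param.1 (e, f)) (D.mass_param.1 (e', f))]
  refine integral_congr_ae (.of_forall fun x => ?_)
  simp only [u_sub]; ring

theorem mass_comm (e f : Fin D.n → ℝ) : D.mass e f = D.mass f e :=
  integral_congr_ae (.of_forall fun x => by ring)

theorem mass_smul_self (r : ℝ) (e : Fin D.n → ℝ) :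
    D.mass (r • e) (r • e) = r ^ 2 * D.mass e e := by
  rw [mass, mass, ← integral_const_mul]
  refine integral_congr_ae (.of_forall fun x => ?_)
  simp only [u_smul]; ring

theorem form_smul_right (r : ℝ) (e f : Fin D.n → ℝ) : D.form e (r • f) = r * D.form e f := by
  rw [form, form, ← integral_const_mul]
  refine integral_congr_ae (.of_forall fun x => ?_)
  simp only [U_smul, inner_smul_right]

theorem lo_mul_sq_le (e : Fin D.n → ℝ) : φlo * D.sq e ≤ D.mass e e := by
  rw [sq, mass, ← integral_const_mul]
  refine integral_mono_ae ((D.sq_param.1 e).const_mul _) (D.mass_param.1 (e, e)) ?_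
  filter_upwards [D.le_φ] with x hx
  have := mul_le_mul_of_nonneg_right hx (sq_nonneg (D.u e x))
  linarith

theorem mass_le (e : Fin D.n → ℝ) : D.mass e e ≤ φhi * D.sq e := by
  rw [sq, mass, ← integral_const_mul]
  refine integral_mono_ae (D.mass_param.1 (e, e)) ((D.sq_param.1 e).const_mul _) ?_
  filter_upwards [D.φ_le] with x hx
  have := mul_le_mul_of_nonneg_right hx (sq_nonneg (D.u e x))
  linarith

theorem mass_add_right (e f f' : Fin D.n → ℝ) :
    D.mass e (f + f') = D.mass e f + D.mass e f' := by
  rw [mass, mass, mass, ← integral_add (D.mass_param.1 (e, f)) (D.mass_param.1 (e, f'))]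
  refine integral_congr_ae (.of_forall fun x => ?_)
  simp only [u, Pi.add_apply, add_mul, Finset.sum_add_distrib]; ring

theorem mass_smul_left (r : ℝ) (e f : Fin D.n → ℝ) : D.mass (r • e) f = r * D.mass e f := by
  rw [mass, mass, ← integral_const_mul]
  refine integral_congr_ae (.of_forall fun x => ?_)
  simp only [u_smul]; ring

/-- By symmetry and bilinearity the difference quotient of mass(c, c) is the mass form of the slope
of c and c(s) + c(t); continuity of the form gives the limit. -/
theorem hasDerivAt_mass {c : ℝ → Fin D.n → ℝ} {c' : Fin D.n → ℝ} {t : ℝ}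
    (h : HasDerivAt c c' t) :
    HasDerivAt (fun s => D.mass (c s) (c s)) (2 * D.mass c' (c t)) t := by
  have h1 := hasDerivAt_iff_tendsto_slope.1 h
  rw [hasDerivAt_iff_tendsto_slope]
  have hm : Continuous fun p : (Fin D.n → ℝ) × (Fin D.n → ℝ) => D.mass p.1 p.2 := D.mass_param.2
  have hp : Filter.Tendsto (fun s => (slope c t s, c s + c t)) (nhdsWithin t {t}ᶜ)
      (nhds (c', c t + c t)) :=
    h1.prodMk_nhds ((h.continuousAt.tendsto.mono_left nhdsWithin_le_nhds).add_const _)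
  have h2 := (hm.tendsto (c', c t + c t)).comp hp
  simp only [Function.comp_def] at h2
  rw [mass_add_right, ← two_mul] at h2
  refine h2.congr fun s => ?_
  have h3 : D.mass (c s - c t) (c s + c t) = D.mass (c s) (c s) - D.mass (c t) (c t) := by
    rw [mass_sub_left, mass_add_right, mass_add_right, D.mass_comm (c s) (c t)]; ring
  rw [slope_def_module, slope_def_module, mass_smul_left, h3, smul_eq_mul]

end GalerkinFlow

/-! ### Integrated coercivity and the basic energy estimate. -/

set_option linter.unusedSectionVars false

namespace GalerkinFlow

variable {G : ForchheimerPolynomial} {d : ℕ} {X : Type*} [MeasurableSpace X] {μ : Measure X}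
  [IsFiniteMeasure μ] {φlo φhi T : ℝ} (D : GalerkinFlow G d μ φlo φhi T)

theorem sq_le_one_add_rpow {P : ℝ} (hP : 0 ≤ P) : P ^ 2 ≤ 1 + P ^ G.lam := by
  have := ForchheimerPolynomial.rpow_le_one_add_rpow hP zero_le_two G.two_lt_lam.le
  rwa [Real.rpow_two] at this

variable (G d μ φlo φhi T) in
theorem exists_grad_le_form : ∃ C, 0 < C ∧ ∀ (D : GalerkinFlow G d μ φlo φhi T) e,
    D.grad e ≤ C * (1 + D.form e e) := by
  obtain ⟨C, hC, h⟩ := G.exists_rpow_le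
  have hV : 0 ≤ μ.real univ := measureReal_nonneg
  refine ⟨C * (1 + μ.real univ), by positivity, fun D e => ?_⟩
  have hi := D.form_param.1 (e, e)
  have h0 : 0 ≤ D.form e e := integral_nonneg fun x => by
    simp only [G.inner_flux_self]
    exact mul_nonneg (G.sOf_nonneg (norm_nonneg _)) (norm_nonneg _)
  have h1 : D.grad e ≤ ∫ x, C * (1 + inner ℝ (G.flux (D.U e x)) (D.U e x)) ∂μ :=
    integral_mono (D.grad_param.1 e) (((integrable_const _).add hi).const_mul _) fun x => by
      simp only [G.inner_flux_self]
      exact h _ (norm_nonneg _)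
  rw [integral_const_mul, integral_add (integrable_const _) hi] at h1
  simp only [integral_const, smul_eq_mul, mul_one] at h1
  change D.grad e ≤ C * (μ.real univ + D.form e e) at h1
  nlinarith [mul_nonneg hC.le (mul_nonneg hV h0)]

variable (G d μ φlo φhi T) in
theorem exists_grad_le_energy : ∃ C, 0 < C ∧ ∀ (D : GalerkinFlow G d μ φlo φhi T) e,
    D.grad e ≤ C * (1 + D.energy e) := by
  obtain ⟨C, hC, h⟩ := G.exists_rpow_le_potential
  have hV : 0 ≤ μ.real univ := measureReal_nonneg
  refine ⟨C * (1 + μ.real univ), by positivity, fun D e => ?_⟩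
  have hi := D.energy_param.1 e
  have h0 : 0 ≤ D.energy e := integral_nonneg fun x => G.potential_nonneg (norm_nonneg _)
  have h1 : D.grad e ≤ ∫ x, C * (1 + G.potential ‖D.U e x‖) ∂μ :=
    integral_mono (D.grad_param.1 e) (((integrable_const _).add hi).const_mul _) fun x =>
      h _ (norm_nonneg _)
  rw [integral_const_mul, integral_add (integrable_const _) hi] at h1
  simp only [integral_const, smul_eq_mul, mul_one] at h1
  change D.grad e ≤ C * (μ.real univ + D.energy e) at h1
  nlinarith [mul_nonneg hC.le (mul_nonneg hV h0)]

variable (G d μ φlo φhi T) in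
theorem exists_energy_le_grad : ∃ C, 0 < C ∧ ∀ (D : GalerkinFlow G d μ φlo φhi T) e,
    D.energy e ≤ C * D.grad e := by
  obtain ⟨C, hC, h⟩ := G.exists_potential_le
  refine ⟨C, hC, fun D e => ?_⟩
  rw [grad, ← integral_const_mul]
  exact integral_mono (D.energy_param.1 e) ((D.grad_param.1 e).const_mul _) fun x =>
    h _ (norm_nonneg _)

variable (G d μ φlo φhi T) in
-- Absorbs the boundary functional, which the trace inequality bounds by P(abs₀ + abs₁): the
-- gradient part goes by Young's inequality for (β, λ), the other part by squares, with P² ≤ 1 + P^λ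
-- because λ > 2.
theorem exists_mul_abs_le {ε : ℝ} (hε : 0 < ε) :
    ∃ C, 0 < C ∧ ∀ (D : GalerkinFlow G d μ φlo φhi T) e P, 0 ≤ P →
      P * (D.abs₀ e + D.abs₁ e) ≤ ε * D.grad e + D.sq e + C * (1 + P ^ G.lam) := by
  obtain ⟨C, hC, h⟩ := G.exists_young hε
  have hV : 0 ≤ μ.real univ := measureReal_nonneg
  refine ⟨(1 + C) * (1 + μ.real univ), by positivity, fun D e P hP => ?_⟩
  have hPl : 0 ≤ P ^ G.lam := by positivity
  have h1 : P * D.abs₀ e ≤ ∫ x, (D.u e x ^ 2 + (1 + P ^ G.lam)) ∂μ := by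
    rw [abs₀, ← integral_const_mul]
    refine integral_mono ((D.abs₀_param.1 e).const_mul _)
      ((D.sq_param.1 e).add (integrable_const _)) fun x => ?_
    have := sq_le_one_add_rpow (G := G) hP
    have h2 : (P - |D.u e x|) ^ 2 ≥ 0 := sq_nonneg _
    simp only
    nlinarith [sq_abs (D.u e x), sq_nonneg P, sq_nonneg (D.u e x)]
  have h2 : P * D.abs₁ e ≤ ∫ x, (ε * ‖D.U e x‖ ^ G.β + C * P ^ G.lam) ∂μ := by
    rw [abs₁, ← integral_const_mul]
    exact integral_mono ((D.abs₁_param.1 e).const_mul _)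
      (((D.grad_param.1 e).const_mul _).add (integrable_const _)) fun x =>
        h P _ hP (norm_nonneg _)
  rw [integral_add (D.sq_param.1 e) (integrable_const _)] at h1
  rw [integral_add ((D.grad_param.1 e).const_mul _) (integrable_const _), integral_const_mul] at h2
  simp only [integral_const, smul_eq_mul] at h1 h2
  change _ ≤ D.sq e + _ at h1
  change _ ≤ ε * D.grad e + _ at h2
  nlinarith [mul_nonneg hC.le hPl, mul_nonneg hV hPl, mul_nonneg hV hC.le]

variable (G d μ φlo φhi T) in
-- Integrated form of `exists_mul_norm_sub_le`. It uses up exactly the form difference that the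
-- difference of two equations provides, with coefficient one.
theorem exists_mul_abs_sub_le :
    ∃ C, 0 < C ∧ ∀ (D : GalerkinFlow G d μ φlo φhi T) e f s P, 0 ≤ s → 0 ≤ P →
      s * P * (D.abs₀ (e - f) + D.abs₁ (e - f)) ≤ D.form e (e - f) - D.form f (e - f) +
        D.sq (e - f) + C * s ^ 2 * (1 + P ^ G.lam + D.grad e + D.grad f) := by
  obtain ⟨C, hC, h⟩ := G.exists_mul_norm_sub_le
  have hV : 0 ≤ μ.real univ := measureReal_nonneg
  refine ⟨(1 + C) * (1 + μ.real univ), by positivity, fun D e f s P hs hP => ?_⟩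
  have hPl : 0 ≤ P ^ G.lam := by positivity
  have h1 : s * P * D.abs₀ (e - f) ≤ ∫ x, (D.u (e - f) x ^ 2 + s ^ 2 * (1 + P ^ G.lam)) ∂μ := by
    rw [abs₀, ← integral_const_mul]
    refine integral_mono ((D.abs₀_param.1 _).const_mul _)
      ((D.sq_param.1 _).add (integrable_const _)) fun x => ?_
    have h1 := sq_le_one_add_rpow (G := G) hP
    have h2 : (s * P - |D.u (e - f) x|) ^ 2 ≥ 0 := sq_nonneg _
    have h3 : s ^ 2 * P ^ 2 ≤ s ^ 2 * (1 + P ^ G.lam) := by gcongr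
    simp only
    nlinarith [sq_abs (D.u (e - f) x), sq_nonneg (s * P), sq_nonneg (D.u (e - f) x)]
  have hi : Integrable (fun x => inner ℝ (G.flux (D.U e x)) (D.U (e - f) x) -
      inner ℝ (G.flux (D.U f x)) (D.U (e - f) x)) μ :=
    (D.form_param.1 (e, e - f)).sub (D.form_param.1 (f, e - f))
  have hj : Integrable (fun x => ‖D.U e x‖ ^ G.β + ‖D.U f x‖ ^ G.β) μ :=
    (D.grad_param.1 e).add (D.grad_param.1 f)
  have hk : Integrable (fun x => (1 + P ^ G.lam) + (‖D.U e x‖ ^ G.β + ‖D.U f x‖ ^ G.β)) μ :=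
    (integrable_const _).add hj
  have h2 : s * P * D.abs₁ (e - f) ≤ ∫ x, ((inner ℝ (G.flux (D.U e x)) (D.U (e - f) x) -
      inner ℝ (G.flux (D.U f x)) (D.U (e - f) x)) +
        C * s ^ 2 * ((1 + P ^ G.lam) + (‖D.U e x‖ ^ G.β + ‖D.U f x‖ ^ G.β))) ∂μ := by
    rw [abs₁, ← integral_const_mul]
    refine integral_mono ((D.abs₁_param.1 _).const_mul _) (hi.add (hk.const_mul _)) fun x => ?_
    have := h (D.U e x) (D.U f x) s P hs hP
    simp only [U_sub, ← inner_sub_left]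
    linarith
  rw [integral_add (D.sq_param.1 _) (integrable_const _)] at h1
  rw [integral_add hi (hk.const_mul _), integral_sub (D.form_param.1 (e, e - f))
    (D.form_param.1 (f, e - f)), integral_const_mul, integral_add (integrable_const _) hj,
    integral_add (D.grad_param.1 e) (D.grad_param.1 f)] at h2
  simp only [integral_const, smul_eq_mul] at h1 h2
  change _ ≤ D.sq (e - f) + _ at h1
  change _ ≤ D.form e (e - f) - D.form f (e - f) + C * s ^ 2 *
    (μ.real univ * (1 + P ^ G.lam) + (D.grad e + D.grad f)) at h2
  have h3 := D.grad_nonneg e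
  have h4 := D.grad_nonneg f
  have h5 : s ^ 2 * (μ.real univ * (1 + P ^ G.lam) +
      C * (μ.real univ * (1 + P ^ G.lam) + (D.grad e + D.grad f))) ≤
      s ^ 2 * ((1 + C) * (1 + μ.real univ) * (1 + P ^ G.lam + D.grad e + D.grad f)) := by
    refine mul_le_mul_of_nonneg_left ?_ (sq_nonneg s)
    nlinarith [mul_nonneg hC.le hPl, mul_nonneg hV hPl, mul_nonneg hV hC.le, mul_nonneg hV h3,
      mul_nonneg hV h4, mul_nonneg hC.le (mul_nonneg hV h3), mul_nonneg hC.le (mul_nonneg hV h4)]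
  linarith

theorem form_sub_le_energy_sub (e f : Fin D.n → ℝ) :
    D.form e (f - e) ≤ D.energy f - D.energy e := by
  rw [energy, energy, ← integral_sub (D.energy_param.1 f) (D.energy_param.1 e)]
  refine integral_mono (D.form_param.1 (e, f - e))
    ((D.energy_param.1 f).sub (D.energy_param.1 e)) fun x => ?_
  simp only [U_sub]
  exact G.inner_flux_le_potential_sub _ _

/-! ### Time evolution -/

/-- The quantity that controls the solution. -/
def data : ℝ := 1 + D.sq (D.c 0) + D.grad (D.c 0) + D.Ps ^ G.lam + D.Pt ^ G.lam +
  ∫ t in (0 : ℝ)..T, D.Nf t ^ 2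

theorem continuousOn_c' : ContinuousOn D.c (Icc 0 T) := continuousOn_pi.2 D.continuousOn_c

theorem hasDerivWithinAt_c {t : ℝ} (ht : t ∈ Ioc 0 T) :
    HasDerivWithinAt D.c (D.c' t) (Icc 0 T) t := hasDerivWithinAt_pi.2 (D.hasDeriv_c t ht)

theorem hasDerivAt_c {t : ℝ} (ht : t ∈ Ioo 0 T) : HasDerivAt D.c (D.c' t) t :=
  (D.hasDerivWithinAt_c ⟨ht.1, ht.2.le⟩).hasDerivAt (Icc_mem_nhds ht.1 ht.2)

theorem eqn' {t : ℝ} (ht : t ∈ Ioc 0 T) (e : Fin D.n → ℝ) :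
    D.mass (D.c' t) e + D.form (D.c t) e = (∑ i, e i * D.Lf t i) - ∑ i, e i * D.Lψ t i :=
  D.eqn t ht e

theorem Lf_le' {t : ℝ} (ht : t ∈ Icc 0 T) (e : Fin D.n → ℝ) {η : ℝ} (hη : 0 < η) :
    ∑ i, e i * D.Lf t i ≤ D.Nf t ^ 2 / (4 * η) + η * D.sq e := by
  have h := (le_abs_self _).trans (D.Lf_le t ht e)
  have h1 : √(∫ x, (∑ i, e i * D.b i x) ^ 2 ∂μ) = √(D.sq e) := rfl
  have h2 := Real.sq_sqrt (D.sq_nonneg' e)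
  rw [h1] at h
  have h3 : D.Nf t * √(D.sq e) ≤ D.Nf t ^ 2 / (4 * η) + η * √(D.sq e) ^ 2 := by
    have : D.Nf t ^ 2 / (4 * η) + η * √(D.sq e) ^ 2 - D.Nf t * √(D.sq e) =
      (D.Nf t - 2 * η * √(D.sq e)) ^ 2 / (4 * η) := by field_simp; ring
    have h4 : 0 ≤ (D.Nf t - 2 * η * √(D.sq e)) ^ 2 / (4 * η) := by positivity
    linarith
  rw [h2] at h3
  linarith

theorem neg_Lψ_le' {t : ℝ} (ht : t ∈ Icc 0 T) (e : Fin D.n → ℝ) :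
    |∑ i, e i * D.Lψ t i| ≤ D.Ps * (D.abs₀ e + D.abs₁ e) := D.Lψ_le t ht e

theorem integral_Nf_nonneg (hT : 0 ≤ T) : 0 ≤ ∫ t in (0 : ℝ)..T, D.Nf t ^ 2 :=
  intervalIntegral.integral_nonneg hT fun _ _ => sq_nonneg _

theorem one_le_data (hT : 0 ≤ T) : 1 ≤ D.data := by
  have h1 := D.sq_nonneg' (D.c 0)
  have h2 := D.grad_nonneg (D.c 0)
  have h3 := D.integral_Nf_nonneg hT
  have h4 := Real.rpow_nonneg D.Ps_nonneg G.lam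
  have h5 := Real.rpow_nonneg D.Pt_nonneg G.lam
  unfold data; linarith

variable (G d μ φlo φhi T) in
/-- The basic energy estimate. -/
theorem exists_sq_le_data (hφ : 0 < φlo) (hT : 0 ≤ T) :
    ∃ C, 0 < C ∧ ∀ D : GalerkinFlow G d μ φlo φhi T,
      (∀ t ∈ Icc 0 T, D.sq (D.c t) ≤ C * D.data) ∧
        ∫ t in (0 : ℝ)..T, D.grad (D.c t) ≤ C * D.data := by
  obtain ⟨A, hA, hgrad⟩ := exists_grad_le_form G d μ φlo φhi T
  -- The boundary term takes half of the coercivity A⁻¹ of the form; after the factor 2 from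
  -- differentiating mass(c, c) the dissipation A⁻¹·grad is left. The source and the boundary term
  -- each cost one square norm, which doubles to the rate 4/φlo.
  obtain ⟨A₂, hA₂, habs⟩ := exists_mul_abs_le G d μ φlo φhi T (ε := 1 / (2 * A)) (by positivity)
  set R := Real.exp (4 / φlo * T) * (|φhi| + 4 * (1 + A₂) * (1 + T))
  have hR : 0 < R := by positivity
  have key : ∀ D : GalerkinFlow G d μ φlo φhi T, ∀ t ∈ Icc 0 T,
      D.mass (D.c t) (D.c t) + ∫ τ in (0 : ℝ)..t, A⁻¹ * D.grad (D.c τ) ≤ R * D.data := by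
    intro D t ht
    have hsub : Icc 0 t ⊆ Icc 0 T := Icc_subset_Icc_right ht.2
    have hcc := D.continuousOn_c'.mono hsub
    have hmc : Continuous fun p : (Fin D.n → ℝ) × (Fin D.n → ℝ) => D.mass p.1 p.2 :=
      D.mass_param.2
    have hp : ContinuousOn (fun τ => 2 * (1 + D.Nf τ ^ 2 + A₂ * (1 + D.Ps ^ G.lam))) (Icc 0 t) := by
      have := D.continuousOn_Nf.mono hsub
      fun_prop
    have hPl := Real.rpow_nonneg D.Ps_nonneg G.lam
    have h := gronwall_add_integral_le (y := fun τ => D.mass (D.c τ) (D.c τ))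
      (y' := fun τ => 2 * D.mass (D.c' τ) (D.c τ)) (k := fun τ => A⁻¹ * D.grad (D.c τ))
      (p := fun τ => 2 * (1 + D.Nf τ ^ 2 + A₂ * (1 + D.Ps ^ G.lam))) (C := 4 / φlo) ht.1
      (by positivity) (hmc.comp_continuousOn (hcc.prodMk hcc))
      (continuousOn_const.mul (D.grad_param.2.comp_continuousOn hcc)) hp
      (fun τ _ => mul_nonneg (inv_pos.2 hA).le (D.grad_nonneg _))
      (fun τ _ => by positivity)
      (fun τ hτ => D.hasDerivAt_mass (D.hasDerivAt_c ⟨hτ.1, hτ.2.trans_le ht.2⟩)) ?_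
    · refine h.trans ?_
      have h1 : Real.exp (4 / φlo * (t - 0)) ≤ Real.exp (4 / φlo * T) :=
        Real.exp_le_exp.2 (by rw [sub_zero]; have := ht.2; gcongr)
      have h2 : ∫ τ in (0 : ℝ)..t, 2 * (1 + D.Nf τ ^ 2 + A₂ * (1 + D.Ps ^ G.lam)) ≤
          4 * (1 + A₂) * (1 + T) * D.data := by
        have hN : IntervalIntegrable (fun τ => D.Nf τ ^ 2) volume 0 T :=
          (D.continuousOn_Nf.pow 2).intervalIntegrable_of_Icc hT
        have h3 : ∫ τ in (0 : ℝ)..t, 2 * (1 + D.Nf τ ^ 2 + A₂ * (1 + D.Ps ^ G.lam)) ≤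
            ∫ τ in (0 : ℝ)..T, 2 * (1 + D.Nf τ ^ 2 + A₂ * (1 + D.Ps ^ G.lam)) := by
          refine intervalIntegral.integral_mono_interval le_rfl ht.1 ht.2
            (.of_forall fun τ => ?_) ?_
          · simp only [Pi.zero_apply]; positivity
          · exact (((intervalIntegrable_const).add hN).add intervalIntegrable_const).const_mul 2
        have e3 : ∫ τ in (0 : ℝ)..T, 2 * (1 + D.Nf τ ^ 2 + A₂ * (1 + D.Ps ^ G.lam)) =
            2 * (T + (∫ τ in (0 : ℝ)..T, D.Nf τ ^ 2) + T * (A₂ * (1 + D.Ps ^ G.lam))) := by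
          rw [intervalIntegral.integral_const_mul, intervalIntegral.integral_add
            ((intervalIntegrable_const).add hN) intervalIntegrable_const,
            intervalIntegral.integral_add intervalIntegrable_const hN]
          simp only [intervalIntegral.integral_const, smul_eq_mul, sub_zero, mul_one]
        rw [e3] at h3
        refine h3.trans ?_
        have h4 := D.sq_nonneg' (D.c 0)
        have h5 := D.grad_nonneg (D.c 0)
        have h6 := D.integral_Nf_nonneg hT
        have h7 := Real.rpow_nonneg D.Pt_nonneg G.lam
        have h8 : (∫ τ in (0 : ℝ)..T, D.Nf τ ^ 2) ≤ D.data := by unfold data; linarith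
        have h9 : 1 + D.Ps ^ G.lam ≤ D.data := by unfold data; linarith
        have h10 := D.one_le_data hT
        have h11 : T * (A₂ * (1 + D.Ps ^ G.lam)) ≤ T * (A₂ * D.data) := by gcongr
        have h12 : T * 1 ≤ T * D.data := by gcongr
        nlinarith [mul_nonneg hT hA₂.le, mul_nonneg hA₂.le (zero_le_one.trans h10)]
      have h3 : D.mass (D.c 0) (D.c 0) ≤ |φhi| * D.data := by
        refine (D.mass_le _).trans ?_
        have h4 := D.sq_nonneg' (D.c 0)
        have h5 := D.grad_nonneg (D.c 0)
        have h6 := D.integral_Nf_nonneg hT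
        have h7 := Real.rpow_nonneg D.Pt_nonneg G.lam
        refine mul_le_mul (le_abs_self _) (by unfold data; linarith) h4 (abs_nonneg _)
      have h4 := D.one_le_data hT
      calc _ ≤ Real.exp (4 / φlo * (t - 0)) * (|φhi| * D.data +
            4 * (1 + A₂) * (1 + T) * D.data) := by gcongr
        _ ≤ Real.exp (4 / φlo * T) * (|φhi| * D.data + 4 * (1 + A₂) * (1 + T) * D.data) := by
          gcongr
        _ = _ := by simp only [R]; ring
    · intro τ hτ
      have hτ' : τ ∈ Ioc 0 T := ⟨hτ.1, hτ.2.le.trans ht.2⟩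
      have hτ'' : τ ∈ Icc 0 T := ⟨hτ.1.le, hτ'.2⟩
      have h1 := D.eqn' hτ' (D.c τ)
      have h2 := D.Lf_le' hτ'' (D.c τ) (η := 1) one_pos
      have h3 := (neg_le_abs _).trans (D.neg_Lψ_le' hτ'' (D.c τ))
      have h4 := habs D (D.c τ) D.Ps D.Ps_nonneg
      have h5 := hgrad D (D.c τ)
      have h6 := D.lo_mul_sq_le (D.c τ)
      have h7 : A⁻¹ * D.grad (D.c τ) ≤ 1 + D.form (D.c τ) (D.c τ) := by
        rw [inv_mul_le_iff₀ hA]; exact h5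
      have h8 : D.sq (D.c τ) ≤ D.mass (D.c τ) (D.c τ) / φlo := by
        rw [le_div_iff₀ hφ]; linarith
      have h9 : 1 / (2 * A) * D.grad (D.c τ) = A⁻¹ * D.grad (D.c τ) / 2 := by field_simp
      have h10 : 4 / φlo * D.mass (D.c τ) (D.c τ) = 4 * (D.mass (D.c τ) (D.c τ) / φlo) := by ring
      have h11 : D.Nf τ ^ 2 / (4 * 1) ≤ D.Nf τ ^ 2 := by
        have := sq_nonneg (D.Nf τ); linarith
      rw [h9] at h4
      simp only [h10]
      linarith
  refine ⟨R * (φlo⁻¹ + A), by positivity, fun D => ⟨fun t ht => ?_, ?_⟩⟩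
  · have h1 := key D t ht
    have h2 : 0 ≤ ∫ τ in (0 : ℝ)..t, A⁻¹ * D.grad (D.c τ) :=
      intervalIntegral.integral_nonneg ht.1 fun τ _ =>
        mul_nonneg (inv_pos.2 hA).le (D.grad_nonneg _)
    have h3 := D.lo_mul_sq_le (D.c t)
    have h4 := D.one_le_data hT
    have h5 : D.sq (D.c t) ≤ φlo⁻¹ * (R * D.data) := by
      rw [← div_eq_inv_mul, le_div_iff₀ hφ]; linarith
    have : 0 ≤ R * A * D.data := by positivity
    linarith
  · have h1 := key D T ⟨hT, le_rfl⟩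
    have h3 := D.lo_mul_sq_le (D.c T)
    have h6 := mul_nonneg hφ.le (D.sq_nonneg' (D.c T))
    have h4 := D.one_le_data hT
    rw [intervalIntegral.integral_const_mul] at h1
    have h5 : ∫ t in (0 : ℝ)..T, D.grad (D.c t) ≤ A * (R * D.data) := by
      rw [← inv_mul_le_iff₀ hA]; linarith
    have : 0 ≤ R * φlo⁻¹ * D.data := by positivity
    linarith

end GalerkinFlow

/-! ### Decrease of the energy and the choice of a good time. -/

set_option linter.unusedSectionVars false

namespace GalerkinFlow

variable {G : ForchheimerPolynomial} {d : ℕ} {X : Type*} [MeasurableSpace X] {μ : Measure X}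
  [IsFiniteMeasure μ] {φlo φhi T : ℝ} (D : GalerkinFlow G d μ φlo φhi T)

theorem sum_sub_mul (e f : Fin D.n → ℝ) (L : Fin D.n → ℝ) :
    ∑ i, (e - f) i * L i = (∑ i, e i * L i) - ∑ i, f i * L i := by
  simp [sub_mul]

theorem Lψ_lipschitz (i : Fin D.n) {s t : ℝ} (hs : s ∈ Icc 0 T) (ht : t ∈ Icc 0 T) :
    |D.Lψ t i - D.Lψ s i| ≤ D.Pt * (D.abs₀ (Pi.single i 1) + D.abs₁ (Pi.single i 1)) * |t - s| := by
  wlog hst : s ≤ t generalizing s t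
  · rw [abs_sub_comm, abs_sub_comm t]; exact this ht hs (le_of_not_ge hst)
  have h : |∑ j, (Pi.single i 1 : Fin D.n → ℝ) j * (D.Lψ t j - D.Lψ s j)| ≤ D.Pt * (t - s) *
    (D.abs₀ (Pi.single i 1) + D.abs₁ (Pi.single i 1)) := D.Lψ_sub_le s hs t ht hst _
  rw [abs_of_nonneg (sub_nonneg.2 hst)]
  simp only [Pi.single_apply, ite_mul, one_mul, zero_mul, Finset.sum_ite_eq', Finset.mem_univ,
    if_true] at h
  linarith

theorem continuousOn_Lψ (i : Fin D.n) : ContinuousOn (fun t => D.Lψ t i) (Icc 0 T) := by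
  have hK : 0 ≤ D.Pt * (D.abs₀ (Pi.single i 1) + D.abs₁ (Pi.single i 1)) :=
    mul_nonneg D.Pt_nonneg (add_nonneg (D.abs₀_nonneg _) (D.abs₁_nonneg _))
  refine (LipschitzOnWith.of_dist_le_mul
    (K := (D.Pt * (D.abs₀ (Pi.single i 1) + D.abs₁ (Pi.single i 1))).toNNReal)
    fun t ht s hs => ?_).continuousOn
  rw [Real.coe_toNNReal _ hK]
  exact D.Lψ_lipschitz i hs ht

theorem continuous_abs : Continuous fun e => D.abs₀ e + D.abs₁ e :=
  D.abs₀_param.2.add D.abs₁_param.2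

open Filter Topology in
/-- The energy inequality for the time derivative, in a form that does not need the derivative to
be integrable: if the mass of `c'` is at least `Λ` throughout, the energy has to decrease. -/
theorem energy_decrease (hφ : 0 < φlo) {a b Λ : ℝ} (ha : 0 < a) (hab : a ≤ b) (hbT : b ≤ T)
    (hΛ : ∀ t ∈ Icc a b, Λ ≤ D.mass (D.c' t) (D.c' t)) :
    D.energy (D.c b) + (∑ i, D.c b i * D.Lψ b i) + Λ / 2 * (b - a) ≤
      D.energy (D.c a) + (∑ i, D.c a i * D.Lψ a i) +
        ∫ τ in a..b, (D.Nf τ ^ 2 / (2 * φlo) + D.Pt * (D.abs₀ (D.c τ) + D.abs₁ (D.c τ))) := by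
  set f : ℝ → ℝ := fun t => D.energy (D.c t) + ∑ i, D.c t i * D.Lψ t i with hf
  set κ : ℝ → ℝ := fun τ => D.Nf τ ^ 2 / (2 * φlo) + D.Pt * (D.abs₀ (D.c τ) + D.abs₁ (D.c τ))
  have hsub : Icc a b ⊆ Icc 0 T := Icc_subset_Icc ha.le hbT
  have hcc : ContinuousOn D.c (Icc a b) := D.continuousOn_c'.mono hsub
  have hfc : ContinuousOn f (Icc a b) :=
    (D.energy_param.2.comp_continuousOn hcc).add (continuousOn_finsetSum _ fun i _ =>
      ((continuous_apply i).comp_continuousOn hcc).mul ((D.continuousOn_Lψ i).mono hsub))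
  have hκ0 : ContinuousOn κ (Icc 0 T) :=
    ((D.continuousOn_Nf.pow 2).div_const _).add
      (continuousOn_const.mul (D.continuous_abs.comp_continuousOn D.continuousOn_c'))
  have hκ : ContinuousOn κ (Icc a b) := hκ0.mono hsub
  set B : ℝ → ℝ := fun t => f a + ((∫ τ in a..t, κ τ) - Λ / 2 * (t - a))
  have hprim : ContinuousOn (fun t => ∫ τ in a..t, κ τ) (Icc a b) := by
    have := intervalIntegral.continuousOn_primitive_interval (a := a) (b := b) (μ := volume)
      (f := κ) (by rw [uIcc_of_le hab]; exact hκ.integrableOn_Icc)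
    rwa [uIcc_of_le hab] at this
  have hB : ContinuousOn B (Icc a b) :=
    continuousOn_const.add (hprim.sub (by fun_prop))
  have hB' : ∀ x ∈ Ico a b, HasDerivWithinAt B (κ x - Λ / 2) (Ici x) x := by
    intro x hx
    refine HasDerivWithinAt.const_add _ (HasDerivWithinAt.sub ?_ ?_)
    · have hm : Icc a b ∈ 𝓝[>] x :=
        mem_of_superset (Ioc_mem_nhdsGT hx.2) (fun y hy => ⟨hx.1.trans hy.1.le, hy.2⟩)
      refine intervalIntegral.integral_hasDerivWithinAt_right
        ((hκ.mono (Icc_subset_Icc_right hx.2.le)).intervalIntegrable_of_Icc hx.1) ?_ ?_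
        (s := Ici x) (t := Ioi x)
      · exact ⟨Icc a b, hm, hκ.aestronglyMeasurable measurableSet_Icc⟩
      · exact (hκ x ⟨hx.1, hx.2.le⟩).mono_of_mem_nhdsWithin hm
    · have := (((hasDerivAt_id x).sub_const a).const_mul (Λ / 2)).hasDerivWithinAt (s := Ici x)
      simpa using this
  -- Comparison principle for lower right difference quotients: f is not known to be differentiable,
  -- and only quotients arbitrarily close to t from the right are needed.
  have hfin := image_le_of_liminf_slope_right_le_deriv_boundary hfc (B := B)
    (B' := fun x => κ x - Λ / 2) (by simp [B]) hB hB' ?_ (right_mem_Icc.2 hab)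
  · simp only [B, f] at hfin
    linarith
  · intro t ht r hr
    have ht0 : t ∈ Ioo 0 T := ⟨ha.trans_le ht.1, ht.2.trans_le hbT⟩
    have htI : t ∈ Icc 0 T := ⟨ht0.1.le, ht0.2.le⟩
    have hcd := D.hasDerivAt_c ht0
    have hct : Tendsto D.c (𝓝[>] t) (𝓝 (D.c t)) :=
      hcd.continuousAt.tendsto.mono_left nhdsWithin_le_nhds
    have hsl : Tendsto (slope D.c t) (𝓝[>] t) (𝓝 (D.c' t)) :=
      (hasDerivAt_iff_tendsto_slope.1 hcd).mono_left
        (nhdsWithin_mono _ fun y hy => ne_of_gt hy)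
    have hform : Continuous fun p : (Fin D.n → ℝ) × (Fin D.n → ℝ) => D.form p.1 p.2 :=
      D.form_param.2
    have hlim : Tendsto (fun z => D.form (D.c z) (slope D.c t z) +
        (∑ i, slope D.c t z i * D.Lψ t i) + D.Pt * (D.abs₀ (D.c z) + D.abs₁ (D.c z))) (𝓝[>] t)
        (𝓝 (D.form (D.c t) (D.c' t) + (∑ i, D.c' t i * D.Lψ t i) +
          D.Pt * (D.abs₀ (D.c t) + D.abs₁ (D.c t)))) := by
      refine Tendsto.add (Tendsto.add ?_ ?_) ?_
      · have := (hform.tendsto (D.c t, D.c' t)).comp (hct.prodMk_nhds hsl)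
        simpa only [Function.comp_def] using this
      · exact tendsto_finsetSum _ fun i _ => (((continuous_apply i).tendsto _).comp hsl).mul_const _
      · exact ((D.continuous_abs.tendsto _).comp hct).const_mul _
    -- The equation tested with c'(t). Young's inequality with η = φlo/2 spends half of the mass of
    -- c' on the source, and the other half is at least Λ/2.
    have hval : D.form (D.c t) (D.c' t) + (∑ i, D.c' t i * D.Lψ t i) +
          D.Pt * (D.abs₀ (D.c t) + D.abs₁ (D.c t)) < r := by
      refine lt_of_le_of_lt ?_ hr
      have h1 := D.eqn' ⟨ht0.1, ht0.2.le⟩ (D.c' t)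
      have h2 := D.Lf_le' htI (D.c' t) (η := φlo / 2) (by positivity)
      have h3 := D.lo_mul_sq_le (D.c' t)
      have h4 := hΛ t ⟨ht.1, ht.2.le⟩
      have h5 : D.Nf t ^ 2 / (4 * (φlo / 2)) = D.Nf t ^ 2 / (2 * φlo) := by ring
      rw [h5] at h2
      simp only [κ]
      linarith
    refine Eventually.frequently ?_
    filter_upwards [hlim.eventually (gt_mem_nhds hval), Ioo_mem_nhdsGT (ht.2.trans_le hbT),
      self_mem_nhdsWithin] with z hz hzT hzt
    refine lt_of_le_of_lt ?_ hz
    have hzt' : 0 < z - t := sub_pos.2 hzt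
    have hzI : z ∈ Icc 0 T := ⟨ht0.1.le.trans hzT.1.le, hzT.2.le⟩
    have e1 : D.c z - D.c t = (z - t) • slope D.c t z := by
      rw [sub_smul_slope, vsub_eq_sub]
    -- Convexity at the later point z bounds the increment E(c z) - E(c t) from above by form(c z, c
    -- z - c t).
    have h1 := D.form_sub_le_energy_sub (D.c z) (D.c t)
    rw [← neg_sub, e1, ← neg_smul, form_smul_right] at h1
    have h2 : (∑ i, D.c z i * D.Lψ t i) - ∑ i, D.c t i * D.Lψ t i =
        (z - t) * ∑ i, slope D.c t z i * D.Lψ t i := by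
      rw [← D.sum_sub_mul, e1, Finset.mul_sum]
      simp [mul_assoc]
    have h3 : (∑ i, D.c z i * D.Lψ z i) - ∑ i, D.c z i * D.Lψ t i ≤
        D.Pt * (z - t) * (D.abs₀ (D.c z) + D.abs₁ (D.c z)) := by
      rw [← Finset.sum_sub_distrib]
      simp only [← mul_sub]
      exact (le_abs_self _).trans (D.Lψ_sub_le t htI z hzI hzt.le _)
    rw [slope_def_field, div_le_iff₀ hzt']
    simp only [f]
    nlinarith

variable (G d μ φlo φhi T) in
/-- In any initial time interval there is a time at which the time derivative is controlled. -/
theorem exists_time_mass_le (hφ : 0 < φlo) (hT : 0 < T) :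
    ∃ C, 0 < C ∧ ∀ D : GalerkinFlow G d μ φlo φhi T, ∀ tstar, 0 < tstar → tstar < T →
      ∃ t₀ ∈ Ioc 0 tstar, D.mass (D.c' t₀) (D.c' t₀) ≤ C * tstar⁻¹ * D.data := by
  obtain ⟨C₁, hC₁, hbasic⟩ := exists_sq_le_data G d μ φlo φhi T hφ hT.le
  obtain ⟨C₂, hC₂, hge⟩ := exists_grad_le_energy G d μ φlo φhi T
  obtain ⟨C₃, hC₃, heg⟩ := exists_energy_le_grad G d μ φlo φhi T
  -- With ε = C₂⁻¹ the boundary term at the final time is dominated by the energy there, so only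
  -- lower-order terms remain.
  obtain ⟨C₄, hC₄, habs⟩ := exists_mul_abs_le G d μ φlo φhi T (ε := C₂⁻¹) (inv_pos.2 hC₂)
  obtain ⟨C₅, hC₅, habs1⟩ := exists_mul_abs_le G d μ φlo φhi T (ε := 1) one_pos
  set R := C₃ + 3 + C₅ + 1 + C₁ + C₄ + (1 / (2 * φlo) + C₁ + T * C₁ + T * C₅)
  have hR : 0 < R := by positivity
  refine ⟨4 * R, by positivity, fun D ts hts htsT => ?_⟩
  -- If the mass of c' exceeded 4R·data/t_* on all of (0, t_*], the energy would have to fall by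
  -- 2R·data, while at most R·data is available.
  by_contra! hcon
  have hd1 := D.one_le_data hT.le
  set Λ := 4 * R * ts⁻¹ * D.data
  have hsq0 := D.sq_nonneg' (D.c 0)
  have hgr0 := D.grad_nonneg (D.c 0)
  have hN0 := D.integral_Nf_nonneg hT.le
  have hPs := Real.rpow_nonneg D.Ps_nonneg G.lam
  have hPt := Real.rpow_nonneg D.Pt_nonneg G.lam
  set κ : ℝ → ℝ := fun τ => D.Nf τ ^ 2 / (2 * φlo) + D.Pt * (D.abs₀ (D.c τ) + D.abs₁ (D.c τ))
  have hκc : ContinuousOn κ (Icc 0 T) :=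
    ((D.continuousOn_Nf.pow 2).div_const _).add
      (continuousOn_const.mul (D.continuous_abs.comp_continuousOn D.continuousOn_c'))
  have hκ0 : ∀ τ, 0 ≤ κ τ := fun τ => by
    have h1 := D.abs₀_nonneg (D.c τ)
    have h2 := D.abs₁_nonneg (D.c τ)
    have h3 := D.Pt_nonneg
    positivity
  have hκint : ∫ τ in (0 : ℝ)..T, κ τ ≤ (1 / (2 * φlo) + C₁ + T * C₁ + T * C₅) * D.data := by
    have hNi : IntervalIntegrable (fun τ => D.Nf τ ^ 2) volume 0 T :=
      (D.continuousOn_Nf.pow 2).intervalIntegrable_of_Icc hT.le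
    have hgi : IntervalIntegrable (fun τ => D.grad (D.c τ)) volume 0 T :=
      (D.grad_param.2.comp_continuousOn D.continuousOn_c').intervalIntegrable_of_Icc hT.le
    have h1 : ∫ τ in (0 : ℝ)..T, κ τ ≤ ∫ τ in (0 : ℝ)..T, (1 / (2 * φlo) * D.Nf τ ^ 2 +
        D.grad (D.c τ) + (C₁ * D.data + C₅ * (1 + D.Pt ^ G.lam))) := by
      refine intervalIntegral.integral_mono_on hT.le (hκc.intervalIntegrable_of_Icc hT.le)
        (((hNi.const_mul _).add hgi).add intervalIntegrable_const) fun τ hτ => ?_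
      have h2 := habs1 D (D.c τ) D.Pt D.Pt_nonneg
      have h3 := (hbasic D).1 τ hτ
      simp only [κ]
      rw [div_eq_mul_one_div, mul_comm (D.Nf τ ^ 2)]
      linarith
    rw [intervalIntegral.integral_add ((hNi.const_mul _).add hgi) intervalIntegrable_const,
      intervalIntegral.integral_add (hNi.const_mul _) hgi, intervalIntegral.integral_const_mul,
      intervalIntegral.integral_const, smul_eq_mul, sub_zero] at h1
    have h2 := (hbasic D).2
    have h3 : (∫ τ in (0 : ℝ)..T, D.Nf τ ^ 2) ≤ D.data := by unfold data; linarith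
    have h4 : 1 + D.Pt ^ G.lam ≤ D.data := by unfold data; linarith
    have h5 : 1 / (2 * φlo) * (∫ τ in (0 : ℝ)..T, D.Nf τ ^ 2) ≤ 1 / (2 * φlo) * D.data := by gcongr
    have h6 : T * (C₅ * (1 + D.Pt ^ G.lam)) ≤ T * (C₅ * D.data) := by gcongr
    linarith
  have hstep : ∀ a ∈ Ioo 0 ts, Λ / 2 * (ts - a) ≤
      D.energy (D.c a) + (∑ i, D.c a i * D.Lψ a i) + (C₄ * D.data + 1 * D.data + C₁ * D.data +
        (1 / (2 * φlo) + C₁ + T * C₁ + T * C₅) * D.data) := by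
    intro a ha
    have h1 := D.energy_decrease hφ ha.1 ha.2.le htsT.le (Λ := Λ)
      fun t ht => (hcon t ⟨ha.1.trans_le ht.1, ht.2⟩).le
    have h2 : ∫ τ in a..ts, κ τ ≤ ∫ τ in (0 : ℝ)..T, κ τ :=
      intervalIntegral.integral_mono_interval ha.1.le ha.2.le htsT.le (.of_forall hκ0)
        (hκc.intervalIntegrable_of_Icc hT.le)
    have htsI : ts ∈ Icc 0 T := ⟨hts.le, htsT.le⟩
    have h3 := (neg_le_abs _).trans (D.neg_Lψ_le' htsI (D.c ts))
    have h4 := habs D (D.c ts) D.Ps D.Ps_nonneg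
    have h5 := (hbasic D).1 ts htsI
    have h6 := hge D (D.c ts)
    rw [← inv_mul_le_iff₀ hC₂] at h6
    have h8 : 1 + D.Ps ^ G.lam ≤ D.data := by unfold data; linarith
    have h9 : C₄ * (1 + D.Ps ^ G.lam) ≤ C₄ * D.data := by gcongr
    linarith
  -- The equation holds for positive times only. The inequality on [a, t_*] is carried to a = 0 by
  -- continuity of the coefficients.
  have hlim : Λ / 2 * (ts - 0) ≤
      D.energy (D.c 0) + (∑ i, D.c 0 i * D.Lψ 0 i) + (C₄ * D.data + 1 * D.data + C₁ * D.data +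
        (1 / (2 * φlo) + C₁ + T * C₁ + T * C₅) * D.data) := by
    have h0 : (0 : ℝ) ∈ Icc 0 T := ⟨le_rfl, hT.le⟩
    have hcc := D.continuousOn_c'
    have hc2 : ContinuousOn (fun a => D.energy (D.c a) + (∑ i, D.c a i * D.Lψ a i) +
        (C₄ * D.data + 1 * D.data + C₁ * D.data +
        (1 / (2 * φlo) + C₁ + T * C₁ + T * C₅) * D.data)) (Icc 0 T) :=
      ((D.energy_param.2.comp_continuousOn hcc).add (continuousOn_finsetSum _ fun i _ =>
        ((continuous_apply i).comp_continuousOn hcc).mul (D.continuousOn_Lψ i))).add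
          continuousOn_const
    have hc1 : ContinuousWithinAt (fun a => Λ / 2 * (ts - a)) (Ioo 0 ts) 0 := by fun_prop
    have hne : (nhdsWithin (0 : ℝ) (Ioo 0 ts)).NeBot := by
      rw [← mem_closure_iff_nhdsWithin_neBot, closure_Ioo hts.ne]; exact ⟨le_rfl, hts.le⟩
    exact le_of_tendsto_of_tendsto hc1.tendsto
      ((hc2 0 h0).mono fun a ha => ⟨ha.1.le, ha.2.le.trans htsT.le⟩).tendsto
      (Filter.eventually_of_mem self_mem_nhdsWithin hstep)
  have h0 : (0 : ℝ) ∈ Icc 0 T := ⟨le_rfl, hT.le⟩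
  have h1 := (le_abs_self _).trans (D.neg_Lψ_le' h0 (D.c 0))
  have h2 := habs1 D (D.c 0) D.Ps D.Ps_nonneg
  have h3 := heg D (D.c 0)
  have h4 : D.grad (D.c 0) ≤ D.data := by unfold data; linarith
  have h5 : D.sq (D.c 0) ≤ D.data := by unfold data; linarith
  have h6 : 1 + D.Ps ^ G.lam ≤ D.data := by unfold data; linarith
  have h7 : Λ / 2 * (ts - 0) = 2 * R * D.data := by
    simp only [Λ]; field_simp; ring
  have h8 : C₃ * D.grad (D.c 0) ≤ C₃ * D.data := by gcongr
  have h9 : C₅ * (1 + D.Ps ^ G.lam) ≤ C₅ * D.data := by gcongr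
  have h10 : 0 < R * D.data := by positivity
  have h11 : R * D.data = C₃ * D.data + 3 * D.data + C₅ * D.data + 1 * D.data + C₁ * D.data +
    C₄ * D.data + (1 / (2 * φlo) + C₁ + T * C₁ + T * C₅) * D.data := by simp only [R]; ring
  rw [h7] at hlim
  linarith

end GalerkinFlow

/-! ### Propagation of time increments and the bound for the derivative. -/

set_option linter.unusedSectionVars false

namespace GalerkinFlow

variable {G : ForchheimerPolynomial} {d : ℕ} {X : Type*} [MeasurableSpace X] {μ : Measure X}
  [IsFiniteMeasure μ] {φlo φhi T : ℝ} (D : GalerkinFlow G d μ φlo φhi T)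

theorem N_nonneg {t : ℝ} (ht : t ∈ Icc 0 T) : 0 ≤ D.N t :=
  D.N_zero.trans (D.N_mono ⟨le_rfl, ht.1.trans ht.2⟩ ht ht.1)

set_option maxHeartbeats 1000000 in
variable (G d μ φlo φhi T) in
-- The equations at τ + s and τ are subtracted and tested with the increment. The monotone flux
-- cancels the boundary increment up to s² times quantities integrable by the basic energy estimate,
-- so the mass of the increment is transported from t₀ to t up to O(s²). This replaces the
-- differentiated equation.
theorem exists_mass_sub_le (hφ : 0 < φlo) (hT : 0 < T) :
    ∃ C, 0 < C ∧ ∀ D : GalerkinFlow G d μ φlo φhi T, ∀ t₀ t s, 0 < t₀ → 0 < s → t₀ + s ≤ t →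
      t ≤ T → D.mass (D.c t - D.c (t - s)) (D.c t - D.c (t - s)) ≤
        C * (D.mass (D.c (t₀ + s) - D.c t₀) (D.c (t₀ + s) - D.c t₀) +
          s ^ 2 * (D.data + D.N T)) := by
  obtain ⟨C₁, hC₁, hbasic⟩ := exists_sq_le_data G d μ φlo φhi T hφ hT.le
  obtain ⟨C₂, hC₂, habs⟩ := exists_mul_abs_sub_le G d μ φlo φhi T
  set R := 2 * C₂ * (T + 2 * C₁) + 2
  have hR : 0 < R := by positivity
  refine ⟨Real.exp (4 / φlo * T) * (1 + R), by positivity, fun D t₀ t s ht₀ hs hts htT => ?_⟩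
  have hd1 := D.one_le_data hT.le
  have hab : t₀ ≤ t - s := by linarith
  have hsub : Icc t₀ (t - s) ⊆ Icc 0 T := Icc_subset_Icc ht₀.le (by linarith)
  have hmaps : MapsTo (fun τ => τ + s) (Icc t₀ (t - s)) (Icc 0 T) := fun τ hτ =>
    ⟨by linarith [hτ.1], by linarith [hτ.2]⟩
  have hadd : ContinuousOn (fun τ : ℝ => τ + s) (Icc t₀ (t - s)) := by fun_prop
  have hc0 : ContinuousOn D.c (Icc t₀ (t - s)) := D.continuousOn_c'.mono hsub
  have hc1 : ContinuousOn (fun τ => D.c (τ + s)) (Icc t₀ (t - s)) :=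
    D.continuousOn_c'.comp hadd hmaps
  have hg0 : ContinuousOn (fun τ => D.grad (D.c τ)) (Icc t₀ (t - s)) :=
    D.grad_param.2.comp_continuousOn hc0
  have hg1 : ContinuousOn (fun τ => D.grad (D.c (τ + s))) (Icc t₀ (t - s)) :=
    D.grad_param.2.comp_continuousOn hc1
  have hN0 : ContinuousOn D.N (Icc t₀ (t - s)) := D.continuousOn_N.mono hsub
  have hN1 : ContinuousOn (fun τ => D.N (τ + s)) (Icc t₀ (t - s)) :=
    D.continuousOn_N.comp hadd hmaps
  have hPt := Real.rpow_nonneg D.Pt_nonneg G.lam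
  set p : ℝ → ℝ := fun τ => 2 * C₂ * s ^ 2 * (1 + D.Pt ^ G.lam) +
    2 * C₂ * s ^ 2 * (D.grad (D.c (τ + s)) + D.grad (D.c τ)) + 2 * s * (D.N (τ + s) - D.N τ)
  have hp : ContinuousOn p (Icc t₀ (t - s)) :=
    (continuousOn_const.add (continuousOn_const.mul (hg1.add hg0))).add
      (continuousOn_const.mul (hN1.sub hN0))
  have hmc : Continuous fun p : (Fin D.n → ℝ) × (Fin D.n → ℝ) => D.mass p.1 p.2 :=
    D.mass_param.2
  have h := gronwall_add_integral_le (a := t₀) (b := t - s) (C := 4 / φlo)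
    (y := fun τ => D.mass (D.c (τ + s) - D.c τ) (D.c (τ + s) - D.c τ))
    (y' := fun τ => 2 * D.mass (D.c' (τ + s) - D.c' τ) (D.c (τ + s) - D.c τ))
    (k := fun _ => 0) (p := p) hab (by positivity)
    (hmc.comp_continuousOn ((hc1.sub hc0).prodMk (hc1.sub hc0))) continuousOn_const hp
    (fun _ _ => le_rfl) (fun τ hτ => ?_) (fun τ hτ => ?_) (fun τ hτ => ?_)
  · rw [intervalIntegral.integral_zero, add_zero] at h
    simp only [sub_add_cancel] at h
    refine h.trans ?_
    have h1 : Real.exp (4 / φlo * (t - s - t₀)) ≤ Real.exp (4 / φlo * T) :=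
      Real.exp_le_exp.2 (by gcongr; linarith)
    have hint : ∫ τ in t₀..(t - s), p τ ≤ R * (s ^ 2 * (D.data + D.N T)) := by
      have hgi0 := hg0.intervalIntegrable_of_Icc hab (μ := volume)
      have hgi1 := hg1.intervalIntegrable_of_Icc hab (μ := volume)
      have hNi0 := hN0.intervalIntegrable_of_Icc hab (μ := volume)
      have hNi1 := hN1.intervalIntegrable_of_Icc hab (μ := volume)
      have e : ∫ τ in t₀..(t - s), p τ = 2 * C₂ * s ^ 2 * ((t - s - t₀) * (1 + D.Pt ^ G.lam)) +
          2 * C₂ * s ^ 2 * ((∫ τ in t₀..(t - s), D.grad (D.c (τ + s))) +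
            ∫ τ in t₀..(t - s), D.grad (D.c τ)) +
          2 * s * ((∫ τ in t₀..(t - s), D.N (τ + s)) - ∫ τ in t₀..(t - s), D.N τ) := by
        simp only [p]
        rw [intervalIntegral.integral_add (intervalIntegrable_const.add
          ((hgi1.add hgi0).const_mul _)) ((hNi1.sub hNi0).const_mul _),
          intervalIntegral.integral_add intervalIntegrable_const ((hgi1.add hgi0).const_mul _),
          intervalIntegral.integral_const, intervalIntegral.integral_const_mul,
          intervalIntegral.integral_const_mul, intervalIntegral.integral_add hgi1 hgi0,
          intervalIntegral.integral_sub hNi1 hNi0, smul_eq_mul]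
        ring
      have hgT : IntervalIntegrable (fun τ => D.grad (D.c τ)) volume 0 T :=
        (D.grad_param.2.comp_continuousOn D.continuousOn_c').intervalIntegrable_of_Icc hT.le
      have hg0' : ∀ a b, 0 ≤ a → a ≤ b → b ≤ T →
          ∫ τ in a..b, D.grad (D.c τ) ≤ C₁ * D.data := fun a b ha hab hb =>
        (intervalIntegral.integral_mono_interval ha hab hb
          (.of_forall fun τ => D.grad_nonneg _) hgT).trans (hbasic D).2
      have i1 : ∫ τ in t₀..(t - s), D.grad (D.c (τ + s)) ≤ C₁ * D.data := by
        rw [intervalIntegral.integral_comp_add_right (fun τ => D.grad (D.c τ)), sub_add_cancel]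
        exact hg0' _ _ (by linarith) hts htT
      have i2 : ∫ τ in t₀..(t - s), D.grad (D.c τ) ≤ C₁ * D.data :=
        hg0' _ _ ht₀.le hab (by linarith)
      -- The two integrals differ only over end intervals of length s, and N is nonnegative and
      -- monotone. This yields the second factor s of the source contribution.
      have i3 : (∫ τ in t₀..(t - s), D.N (τ + s)) - (∫ τ in t₀..(t - s), D.N τ) ≤ s * D.N T := by
        have hNT : ∀ a b, a ∈ Icc 0 T → b ∈ Icc 0 T → IntervalIntegrable D.N volume a b := by
          intro a b ha hb
          refine ((D.continuousOn_N.mono ?_).intervalIntegrable)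
          exact uIcc_subset_Icc ha hb
        have m0 : t₀ ∈ Icc 0 T := ⟨ht₀.le, by linarith⟩
        have m1 : t₀ + s ∈ Icc 0 T := ⟨by linarith, by linarith⟩
        have m2 : t - s ∈ Icc 0 T := ⟨by linarith, by linarith⟩
        have m3 : t ∈ Icc 0 T := ⟨by linarith, htT⟩
        rw [intervalIntegral.integral_comp_add_right D.N, sub_add_cancel,
          intervalIntegral.integral_interval_sub_interval_comm (hNT _ _ m1 m3) (hNT _ _ m0 m2)
          (hNT _ _ m1 m0)]
        have j1 : 0 ≤ ∫ τ in t₀..(t₀ + s), D.N τ :=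
          intervalIntegral.integral_nonneg (by linarith) fun τ hτ =>
            D.N_nonneg ⟨by linarith [hτ.1], by linarith [hτ.2]⟩
        have j2 : ∫ τ in (t - s)..t, D.N τ ≤ ∫ _ in (t - s)..t, D.N T :=
          intervalIntegral.integral_mono_on (by linarith) (hNT _ _ m2 m3)
            intervalIntegrable_const fun τ hτ =>
              D.N_mono ⟨by linarith [hτ.1, m2.1], by linarith [hτ.2]⟩ ⟨hT.le, le_rfl⟩
                (by linarith [hτ.2])
        rw [intervalIntegral.integral_const, smul_eq_mul, sub_sub_cancel] at j2
        rw [intervalIntegral.integral_symm (t₀)]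
        rw [intervalIntegral.integral_symm (t - s)]
        linarith
      have h4 : 1 + D.Pt ^ G.lam ≤ D.data := by
        have h2 := D.sq_nonneg' (D.c 0)
        have h3 := D.grad_nonneg (D.c 0)
        have h5 := D.integral_Nf_nonneg hT.le
        have h6 := Real.rpow_nonneg D.Ps_nonneg G.lam
        unfold data; linarith
      have h5 : (t - s - t₀) * (1 + D.Pt ^ G.lam) ≤ T * D.data := by
        have : t - s - t₀ ≤ T := by linarith
        gcongr
      have hNT := D.N_nonneg (t := T) ⟨hT.le, le_rfl⟩
      rw [e]
      calc _ ≤ 2 * C₂ * s ^ 2 * (T * D.data) + 2 * C₂ * s ^ 2 * (C₁ * D.data + C₁ * D.data) +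
            2 * s * (s * D.N T) := by gcongr
        _ = s ^ 2 * (2 * C₂ * (T + 2 * C₁) * D.data + 2 * D.N T) := by ring
        _ ≤ s ^ 2 * (R * D.data + R * D.N T) := by
          have : 2 * C₂ * (T + 2 * C₁) ≤ R := by simp only [R]; linarith
          have : 2 ≤ R := by simp only [R]; linarith [show 0 ≤ 2 * C₂ * (T + 2 * C₁) by positivity]
          gcongr
        _ = _ := by ring
    have hm0 : 0 ≤ D.mass (D.c (t₀ + s) - D.c t₀) (D.c (t₀ + s) - D.c t₀) :=
      (mul_nonneg hφ.le (D.sq_nonneg' _)).trans (D.lo_mul_sq_le _)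
    have hNT := D.N_nonneg (t := T) ⟨hT.le, le_rfl⟩
    have hq : 0 ≤ s ^ 2 * (D.data + D.N T) := by positivity
    calc _ ≤ Real.exp (4 / φlo * (t - s - t₀)) * (D.mass (D.c (t₀ + s) - D.c t₀)
            (D.c (t₀ + s) - D.c t₀) + R * (s ^ 2 * (D.data + D.N T))) := by gcongr
      _ ≤ Real.exp (4 / φlo * T) * (D.mass (D.c (t₀ + s) - D.c t₀)
            (D.c (t₀ + s) - D.c t₀) + R * (s ^ 2 * (D.data + D.N T))) := by gcongr
      _ ≤ Real.exp (4 / φlo * T) * ((1 + R) * (D.mass (D.c (t₀ + s) - D.c t₀)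
            (D.c (t₀ + s) - D.c t₀) + s ^ 2 * (D.data + D.N T))) := by
          gcongr
          nlinarith [mul_nonneg hR.le hm0]
      _ = _ := by ring
  · have h1 := D.grad_nonneg (D.c (τ + s))
    have h2 := D.grad_nonneg (D.c τ)
    have h3 : D.N τ ≤ D.N (τ + s) := D.N_mono (hsub hτ) (hmaps hτ) (by linarith)
    have h4 : 0 ≤ D.N (τ + s) - D.N τ := by linarith
    positivity
  · have m1 : τ ∈ Ioo 0 T := ⟨by linarith [hτ.1], by linarith [hτ.2]⟩
    have m2 : τ + s ∈ Ioo 0 T := ⟨by linarith [hτ.1], by linarith [hτ.2]⟩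
    have h1 : HasDerivAt (fun τ => D.c (τ + s)) (D.c' (τ + s)) τ :=
      (D.hasDerivAt_c m2).comp_add_const τ s
    exact D.hasDerivAt_mass (h1.sub (D.hasDerivAt_c m1))
  · have m1 : τ ∈ Ioc 0 T := ⟨by linarith [hτ.1], by linarith [hτ.2]⟩
    have m2 : τ + s ∈ Ioc 0 T := ⟨by linarith [hτ.1], by linarith [hτ.2]⟩
    have m1' : τ ∈ Icc 0 T := ⟨m1.1.le, m1.2⟩
    have m2' : τ + s ∈ Icc 0 T := ⟨m2.1.le, m2.2⟩
    set δ := D.c (τ + s) - D.c τ with hδ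
    have h1 := D.eqn' m1 δ
    have h2 := D.eqn' m2 δ
    have h3 := habs D (D.c (τ + s)) (D.c τ) s D.Pt hs.le D.Pt_nonneg
    have h4 := (le_abs_self _).trans (D.Lf_sub_le τ m1' (τ + s) m2' (by linarith) δ)
    have h5 := (neg_le_abs _).trans (D.Lψ_sub_le τ m1' (τ + s) m2' (by linarith) δ)
    simp only [mul_sub, Finset.sum_sub_distrib, add_sub_cancel_left] at h4 h5
    -- Young's inequality for the source increment; the term s(N(τ+s) - N(τ)) is of order s² only
    -- after integration in τ.
    have h6 : √(s * (D.N (τ + s)) - s * D.N τ) * √(∫ x, (∑ i, δ i * D.b i x) ^ 2 ∂μ) ≤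
        s * (D.N (τ + s) - D.N τ) + D.sq δ := by
      have hN : D.N τ ≤ D.N (τ + s) := D.N_mono m1' m2' (by linarith)
      have e1 := Real.sq_sqrt (x := s * (D.N (τ + s)) - s * D.N τ) (by nlinarith)
      have e2 := Real.sq_sqrt (D.sq_nonneg' δ)
      change √(s * (D.N (τ + s)) - s * D.N τ) * √(D.sq δ) ≤ _
      have q1 := Real.sqrt_nonneg (s * (D.N (τ + s)) - s * D.N τ)
      have q2 := Real.sqrt_nonneg (D.sq δ)
      nlinarith [sq_nonneg (√(s * (D.N (τ + s)) - s * D.N τ) - √(D.sq δ))]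
    change -_ ≤ D.Pt * s * (D.abs₀ δ + D.abs₁ δ) at h5
    have h7 := D.lo_mul_sq_le δ
    have h8 : D.sq δ ≤ D.mass δ δ / φlo := by
      rw [le_div_iff₀ hφ]; linarith
    have h10 : 4 / φlo * D.mass δ δ = 4 * (D.mass δ δ / φlo) := by ring
    simp only [p, h10, mass_sub_left]
    rw [← hδ] at h3
    linarith

open Filter Topology in
variable (G d μ φlo φhi T) in
/-- The estimate of the time derivative of a Galerkin flow. -/
theorem exists_sq_deriv_le (hφ : 0 < φlo) (hT : 0 < T) :
    ∃ C, 0 < C ∧ ∀ D : GalerkinFlow G d μ φlo φhi T, ∀ tstar, 0 < tstar → tstar < T →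
      ∀ t ∈ Icc tstar T,
        D.sq (D.c' t) ≤ C * (1 + tstar⁻¹) * D.data + C * D.N T := by
  obtain ⟨C₁, hC₁, h₁⟩ := exists_time_mass_le G d μ φlo φhi T hφ hT
  obtain ⟨C₂, hC₂, h₂⟩ := exists_mass_sub_le G d μ φlo φhi T hφ hT
  refine ⟨φlo⁻¹ * (1 + C₂) * (1 + C₁), by positivity, fun D ts hts htsT t ht => ?_⟩
  obtain ⟨t₀, ht₀, hm₀⟩ := h₁ D ts hts htsT
  have hd1 := D.one_le_data hT.le
  have hNT := D.N_nonneg (t := T) ⟨hT.le, le_rfl⟩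
  have hts' : 0 < ts⁻¹ := inv_pos.2 hts
  have key : D.mass (D.c' t) (D.c' t) ≤ (1 + C₂) * (C₁ * ts⁻¹ * D.data + (D.data + D.N T)) := by
    have hX : 0 ≤ C₁ * ts⁻¹ * D.data := by positivity
    rcases (ht₀.2.trans ht.1).eq_or_lt with rfl | hlt
    · nlinarith
    have hlim : D.mass (D.c' t) (D.c' t) ≤ C₂ * (D.mass (D.c' t₀) (D.c' t₀) +
        (D.data + D.N T)) := by
      have hmc : Continuous fun e : Fin D.n → ℝ => D.mass e e :=
        D.mass_param.2.comp (continuous_id.prodMk continuous_id)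
      -- Backward quotients at t, so that t = T is allowed, and forward quotients at t₀, which is
      -- strictly before T.
      have hs1 : Tendsto (fun s => slope D.c t (t - s)) (𝓝[>] 0) (𝓝 (D.c' t)) := by
        refine (hasDerivWithinAt_iff_tendsto_slope.1
          (D.hasDerivWithinAt_c ⟨hts.trans_le ht.1, ht.2⟩)).comp
          (tendsto_nhdsWithin_iff.2 ⟨?_, ?_⟩)
        · have : ContinuousAt (fun s : ℝ => t - s) 0 := by fun_prop
          simpa [ContinuousAt] using this.tendsto.mono_left nhdsWithin_le_nhds
        · filter_upwards [Ioo_mem_nhdsGT (hts.trans_le ht.1)] with s hs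
          exact ⟨⟨by linarith [hs.2], by linarith [hs.1, ht.2]⟩, by
            have := hs.1
            simp only [mem_singleton_iff]
            intro h0
            linarith⟩
      have hs0 : Tendsto (fun s => slope D.c t₀ (t₀ + s)) (𝓝[>] 0) (𝓝 (D.c' t₀)) := by
        refine (hasDerivAt_iff_tendsto_slope.1
          (D.hasDerivAt_c ⟨ht₀.1, ht₀.2.trans_lt htsT⟩)).comp
          (tendsto_nhdsWithin_iff.2 ⟨?_, ?_⟩)
        · have : ContinuousAt (fun s : ℝ => t₀ + s) 0 := by fun_prop
          simpa [ContinuousAt] using this.tendsto.mono_left nhdsWithin_le_nhds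
        · filter_upwards [self_mem_nhdsWithin] with s hs
          simp only [mem_compl_iff, mem_singleton_iff]
          intro h0
          have : (0 : ℝ) < s := hs
          linarith
      refine le_of_tendsto_of_tendsto ((hmc.tendsto _).comp hs1)
        ((((hmc.tendsto _).comp hs0).add_const (D.data + D.N T)).const_mul C₂) ?_
      filter_upwards [Ioo_mem_nhdsGT (sub_pos.2 hlt)] with s hs
      have hsp : 0 < s := hs.1
      have h := h₂ D t₀ t s ht₀.1 hsp (by linarith [hs.2]) ht.2
      have e1 : D.c t - D.c (t - s) = s • slope D.c t (t - s) := by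
        have := sub_smul_slope D.c t (t - s)
        rw [vsub_eq_sub] at this
        rw [← neg_sub, ← this, ← neg_smul]; congr 1; ring
      have e2 : D.c (t₀ + s) - D.c t₀ = s • slope D.c t₀ (t₀ + s) := by
        have := sub_smul_slope D.c t₀ (t₀ + s)
        rw [vsub_eq_sub] at this
        rw [← this]; congr 1; ring
      rw [e1, e2, mass_smul_self, mass_smul_self, ← mul_add, mul_left_comm] at h
      simpa only [Function.comp_def] using le_of_mul_le_mul_left h (by positivity)
    refine hlim.trans ?_
    have : C₂ * (D.mass (D.c' t₀) (D.c' t₀) + (D.data + D.N T)) ≤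
      C₂ * (C₁ * ts⁻¹ * D.data + (D.data + D.N T)) := by gcongr
    nlinarith
  have h3 := D.lo_mul_sq_le (D.c' t)
  have h4 : D.sq (D.c' t) ≤ φlo⁻¹ * ((1 + C₂) * (C₁ * ts⁻¹ * D.data + (D.data + D.N T))) := by
    rw [← div_eq_inv_mul, le_div_iff₀ hφ]; linarith
  refine h4.trans ?_
  have h5 : C₁ * ts⁻¹ * D.data + (D.data + D.N T) ≤
      (1 + C₁) * ((1 + ts⁻¹) * D.data + D.N T) := by
    have : 0 ≤ ts⁻¹ * D.data := by positivity
    nlinarith [mul_nonneg hC₁.le hNT]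
  calc _ ≤ φlo⁻¹ * ((1 + C₂) * ((1 + C₁) * ((1 + ts⁻¹) * D.data + D.N T))) := by gcongr
    _ = _ := by ring

end GalerkinFlow

/-! ### Barycentric coordinates on simplices. -/

section Simplices

variable {d : ℕ}

/-- The vertex sets of nondegenerate `d`-simplices. -/
structure IsCell (s : Finset (EuclideanSpace ℝ (Fin d))) : Prop where
  indep : AffineIndependent ℝ ((↑) : s → EuclideanSpace ℝ (Fin d))
  card_eq : s.card = d + 1

/-- The vertices as an affine basis. -/
def IsCell.basis {s : Finset (EuclideanSpace ℝ (Fin d))} (hs : IsCell s) :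
    AffineBasis s ℝ (EuclideanSpace ℝ (Fin d)) where
  toFun := (↑)
  ind' := hs.indep
  tot' := hs.indep.affineSpan_eq_top_iff_card_eq_finrank_add_one.2 (by simp [hs.card_eq])

open Classical in
/-- The barycentric coordinate of the vertex `v` with respect to `s`. -/
def bary (s : Finset (EuclideanSpace ℝ (Fin d))) (v : EuclideanSpace ℝ (Fin d)) :
    EuclideanSpace ℝ (Fin d) →ᵃ[ℝ] ℝ :=
  -- The value 0 for a vertex outside s is a working convention: with it the coordinates of two
  -- cells agree at their common points.
  if h : IsCell s ∧ v ∈ s then h.1.basis.coord ⟨v, h.2⟩ else 0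

variable {s t u : Finset (EuclideanSpace ℝ (Fin d))} {v x : EuclideanSpace ℝ (Fin d)}

theorem bary_of_notMem (hv : v ∉ s) : bary s v x = 0 := by
  rw [bary, dif_neg fun h => hv h.2]; rfl

theorem continuous_bary : Continuous (bary s v) := AffineMap.continuous_of_finiteDimensional _

namespace IsCell

theorem bary_eq (hs : IsCell s) (v : s) : bary s v = hs.basis.coord v :=
  dif_pos ⟨hs, v.2⟩

theorem range_basis (hs : IsCell s) : range hs.basis = (s : Set (EuclideanSpace ℝ (Fin d))) :=
  Subtype.range_coe

theorem sum_bary (hs : IsCell s) (x) : ∑ v ∈ s, bary s v x = 1 := by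
  rw [← hs.basis.sum_coord_apply_eq_one x, ← Finset.sum_coe_sort]
  exact Finset.sum_congr rfl fun v _ => by rw [hs.bary_eq]

theorem sum_bary_smul (hs : IsCell s) (x) : ∑ v ∈ s, bary s v x • v = x := by
  conv_rhs => rw [← hs.basis.linear_combination_coord_eq_self x]
  rw [← Finset.sum_coe_sort]
  exact Finset.sum_congr rfl fun v _ => by rw [hs.bary_eq]; rfl

/-- Affine independence makes the representation of a point by vertices unique; a representation on
a face therefore gives all coordinates, those off the face being zero. -/
theorem bary_eq_ite (hs : IsCell s) (hus : u ⊆ s) {w : EuclideanSpace ℝ (Fin d) → ℝ}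
    (h1 : ∑ v ∈ u, w v = 1) (hx : ∑ v ∈ u, w v • v = x) (v) [Decidable (v ∈ u)] :
    bary s v x = if v ∈ u then w v else 0 := by
  classical
  by_cases hv : v ∈ s
  · set w' : s → ℝ := fun v => if (v : EuclideanSpace ℝ (Fin d)) ∈ u then w v else 0
    have e1 : ∑ v, w' v = 1 := by
      rw [← h1, Finset.sum_coe_sort s (fun v => if v ∈ u then w v else 0),
        ← Finset.sum_filter, Finset.filter_mem_eq_inter, Finset.inter_eq_right.2 hus]
    have e2 : Finset.univ.affineCombination ℝ hs.basis w' = x := by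
      rw [Finset.affineCombination_eq_linear_combination _ _ _ e1, ← hx]
      have : ∀ i : s, w' i • hs.basis i = (fun v => if v ∈ u then w v • v else 0)
          (i : EuclideanSpace ℝ (Fin d)) := fun i => by
        simp only [w', ite_smul, zero_smul]; rfl
      rw [Finset.sum_congr rfl fun i _ => this i, Finset.sum_coe_sort s
        (fun v => if v ∈ u then w v • v else 0), ← Finset.sum_filter,
        Finset.filter_mem_eq_inter, Finset.inter_eq_right.2 hus]
    have := hs.bary_eq ⟨v, hv⟩
    simp only at this
    rw [this, ← e2, hs.basis.coord_apply_combination_of_mem (Finset.mem_univ _) e1]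
    simp only [w']
  · rw [bary_of_notMem hv, if_neg fun h => hv (hus h)]

theorem mem_convexHull_iff (hs : IsCell s) :
    x ∈ convexHull ℝ (s : Set (EuclideanSpace ℝ (Fin d))) ↔ ∀ v ∈ s, 0 ≤ bary s v x := by
  rw [← hs.range_basis, hs.basis.convexHull_eq_nonneg_coord]
  exact ⟨fun h v hv => by rw [hs.bary_eq ⟨v, hv⟩]; exact h _,
    fun h v => by rw [← hs.bary_eq]; exact h _ v.2⟩

theorem mem_interior_iff (hs : IsCell s) :
    x ∈ interior (convexHull ℝ (s : Set (EuclideanSpace ℝ (Fin d)))) ↔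
      ∀ v ∈ s, 0 < bary s v x := by
  rw [← hs.range_basis, hs.basis.interior_convexHull]
  exact ⟨fun h v hv => by rw [hs.bary_eq ⟨v, hv⟩]; exact h _,
    fun h v => by rw [← hs.bary_eq]; exact h _ v.2⟩

theorem bary_self (hs : IsCell s) (hv : v ∈ s) : bary s v v = 1 := by
  classical
  rw [hs.bary_eq_ite (u := {v}) (w := fun _ => 1) (by simpa using hv) (by simp) (by simp)]
  simp

theorem bary_ne (hs : IsCell s) {w : EuclideanSpace ℝ (Fin d)} (hw : w ∈ s) (hvw : v ≠ w) :
    bary s v w = 0 := by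
  classical
  rw [hs.bary_eq_ite (u := {w}) (w := fun _ => 1) (by simpa using hw) (by simp) (by simp)]
  simp [hvw]

theorem mem_convexHull_subset_iff (hs : IsCell s) (hus : u ⊆ s) :
    x ∈ convexHull ℝ (u : Set (EuclideanSpace ℝ (Fin d))) ↔
      x ∈ convexHull ℝ (s : Set (EuclideanSpace ℝ (Fin d))) ∧ ∀ v ∈ s, v ∉ u → bary s v x = 0 := by
  classical
  constructor
  · intro h
    refine ⟨convexHull_mono (by exact_mod_cast hus) h, fun v _ hvu => ?_⟩
    obtain ⟨w, -, h1, h2⟩ := Finset.mem_convexHull'.1 h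
    rw [hs.bary_eq_ite hus h1 h2, if_neg hvu]
  · rintro ⟨h, h0⟩
    refine Finset.mem_convexHull'.2 ⟨fun v => bary s v x,
      fun v hv => hs.mem_convexHull_iff.1 h v (hus hv), ?_, ?_⟩
    · rw [Finset.sum_subset hus h0, hs.sum_bary]
    · rw [Finset.sum_subset hus fun v hv hvu => by
        simp only [h0 v hv hvu, zero_smul], hs.sum_bary_smul]

theorem bary_nonneg (hs : IsCell s) (hx : x ∈ convexHull ℝ (s : Set (EuclideanSpace ℝ (Fin d))))
    (v) : 0 ≤ bary s v x := by
  by_cases hv : v ∈ s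
  · exact hs.mem_convexHull_iff.1 hx v hv
  · rw [bary_of_notMem hv]

theorem bary_le_one (hs : IsCell s) (hx : x ∈ convexHull ℝ (s : Set (EuclideanSpace ℝ (Fin d))))
    (v) : bary s v x ≤ 1 := by
  by_cases hv : v ∈ s
  · rw [← hs.sum_bary x]
    exact Finset.single_le_sum (f := fun v => bary s v x) (fun v _ => hs.bary_nonneg hx v) hv
  · rw [bary_of_notMem hv]; exact zero_le_one

theorem isCompact (_ : IsCell s) :
    IsCompact (convexHull ℝ (s : Set (EuclideanSpace ℝ (Fin d)))) :=
  s.finite_toSet.isCompact_convexHull ℝ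

theorem nonempty_interior (hs : IsCell s) :
    (interior (convexHull ℝ (s : Set (EuclideanSpace ℝ (Fin d))))).Nonempty := by
  classical
  refine ⟨∑ v ∈ s, (1 / (d + 1 : ℝ)) • v, hs.mem_interior_iff.2 fun v hv => ?_⟩
  rw [hs.bary_eq_ite (u := s) (w := fun _ => 1 / (d + 1 : ℝ)) subset_rfl ?_ rfl, if_pos hv]
  · positivity
  · simp [hs.card_eq]; field_simp

end IsCell

theorem volume_frontier_convexHull (s : Set (EuclideanSpace ℝ (Fin d))) :
    volume (frontier (convexHull ℝ s)) = 0 :=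
  (convex_convexHull ℝ _).addHaar_frontier _

theorem interior_ae_eq_convexHull (s : Set (EuclideanSpace ℝ (Fin d))) :
    interior (convexHull ℝ s) =ᵐ[volume] convexHull ℝ s :=
  interior_ae_eq_of_null_frontier (volume_frontier_convexHull s)

end Simplices

/-! ### Cells of a triangulation and their overlaps. -/

namespace Triangulation

variable {d : ℕ} {Ω : Set (EuclideanSpace ℝ (Fin d))} (𝒯 : Triangulation Ω)

theorem finite_cells : {s ∈ 𝒯.complex.faces | s.card = d + 1}.Finite :=
  𝒯.finite_faces.subset fun _ h => h.1

/-- The `d`-dimensional faces. -/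
def cells : Finset (Finset (EuclideanSpace ℝ (Fin d))) := 𝒯.finite_cells.toFinset

variable {𝒯} {s t : Finset (EuclideanSpace ℝ (Fin d))} {x : EuclideanSpace ℝ (Fin d)}

theorem mem_cells : s ∈ 𝒯.cells ↔ s ∈ 𝒯.complex.faces ∧ s.card = d + 1 := by
  simp [cells]

theorem isCell (hs : s ∈ 𝒯.cells) : IsCell s :=
  ⟨𝒯.complex.indep (mem_cells.1 hs).1, (mem_cells.1 hs).2⟩

theorem mem_elements (hs : s ∈ 𝒯.cells) :
    convexHull ℝ (s : Set (EuclideanSpace ℝ (Fin d))) ∈ 𝒯.elements :=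
  ⟨s, (mem_cells.1 hs).1, (mem_cells.1 hs).2, rfl⟩

theorem forall_elements {P : Set (EuclideanSpace ℝ (Fin d)) → Prop} :
    (∀ T ∈ 𝒯.elements, P T) ↔
      ∀ s ∈ 𝒯.cells, P (convexHull ℝ (s : Set (EuclideanSpace ℝ (Fin d)))) := by
  constructor
  · exact fun h s hs => h _ (mem_elements hs)
  · rintro h _ ⟨s, hs, hc, rfl⟩
    exact h s (mem_cells.2 ⟨hs, hc⟩)

variable (𝒯)

theorem iUnion_cells :
    ⋃ s ∈ 𝒯.cells, convexHull ℝ (s : Set (EuclideanSpace ℝ (Fin d))) = closure Ω := by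
  rw [← 𝒯.space_eq]
  refine Subset.antisymm (iUnion₂_subset fun s hs =>
    𝒯.complex.convexHull_subset_space (mem_cells.1 hs).1) fun x hx => ?_
  obtain ⟨s, hs, hxs⟩ := Geometry.SimplicialComplex.mem_space_iff.1 hx
  obtain ⟨t, ht, hst, hc⟩ := 𝒯.pure_dim s hs
  exact mem_iUnion₂.2 ⟨t, mem_cells.2 ⟨ht, hc⟩, convexHull_mono (by exact_mod_cast hst) hxs⟩

variable {𝒯}

theorem exists_cell (hx : x ∈ closure Ω) :
    ∃ s ∈ 𝒯.cells, x ∈ convexHull ℝ (s : Set (EuclideanSpace ℝ (Fin d))) := by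
  rw [← 𝒯.iUnion_cells] at hx
  simpa using hx

theorem convexHull_subset_closure (hs : s ∈ 𝒯.cells) :
    convexHull ℝ (s : Set (EuclideanSpace ℝ (Fin d))) ⊆ closure Ω := by
  rw [← 𝒯.iUnion_cells]
  exact subset_biUnion_of_mem (u := fun s : Finset (EuclideanSpace ℝ (Fin d)) =>
    convexHull ℝ (s : Set (EuclideanSpace ℝ (Fin d)))) hs

theorem interior_subset (hΩr : interior (closure Ω) = Ω) (hs : s ∈ 𝒯.cells) :
    interior (convexHull ℝ (s : Set (EuclideanSpace ℝ (Fin d)))) ⊆ Ω := by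
  rw [← hΩr]
  exact interior_mono (convexHull_subset_closure hs)

theorem mem_convexHull_inter [DecidableEq (EuclideanSpace ℝ (Fin d))]
    (hs : s ∈ 𝒯.cells) (ht : t ∈ 𝒯.cells)
    (hxs : x ∈ convexHull ℝ (s : Set (EuclideanSpace ℝ (Fin d))))
    (hxt : x ∈ convexHull ℝ (t : Set (EuclideanSpace ℝ (Fin d)))) :
    x ∈ convexHull ℝ ((s ∩ t : Finset _) : Set (EuclideanSpace ℝ (Fin d))) := by
  rw [Finset.coe_inter]
  exact 𝒯.complex.inter_subset_convexHull (mem_cells.1 hs).1 (mem_cells.1 ht).1 ⟨hxs, hxt⟩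

/-- Barycentric coordinates are compatible across cells. -/
theorem bary_eq_bary (hs : s ∈ 𝒯.cells) (ht : t ∈ 𝒯.cells)
    (hxs : x ∈ convexHull ℝ (s : Set (EuclideanSpace ℝ (Fin d))))
    (hxt : x ∈ convexHull ℝ (t : Set (EuclideanSpace ℝ (Fin d)))) (v) :
    bary s v x = bary t v x := by
  classical
  obtain ⟨w, -, h1, h2⟩ := Finset.mem_convexHull'.1 (mem_convexHull_inter hs ht hxs hxt)
  rw [(isCell hs).bary_eq_ite Finset.inter_subset_left h1 h2,
    (isCell ht).bary_eq_ite Finset.inter_subset_right h1 h2]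

/-- At a common interior point every vertex of s has a positive coordinate, but the coordinates
coincide with those of t, which vanish off t. Hence s ⊆ t, with equal cardinalities. -/
theorem disjoint_interior (hs : s ∈ 𝒯.cells) (ht : t ∈ 𝒯.cells) (hst : s ≠ t) :
    Disjoint (interior (convexHull ℝ (s : Set (EuclideanSpace ℝ (Fin d)))))
      (interior (convexHull ℝ (t : Set (EuclideanSpace ℝ (Fin d))))) := by
  rw [Set.disjoint_left]
  intro x hxs hxt
  refine hst (Finset.eq_of_subset_of_card_le (fun v hv => ?_) ?_)
  · by_contra hvt
    have h1 := (isCell hs).mem_interior_iff.1 hxs v hv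
    rw [bary_eq_bary hs ht (_root_.interior_subset hxs) (_root_.interior_subset hxt),
      bary_of_notMem hvt] at h1
    exact h1.false
  · rw [(isCell hs).card_eq, (isCell ht).card_eq]

variable (𝒯)

theorem ae_eq_iUnion_interior (hΩr : interior (closure Ω) = Ω) :
    Ω =ᵐ[volume] ⋃ s ∈ 𝒯.cells, interior (convexHull ℝ (s : Set (EuclideanSpace ℝ (Fin d)))) := by
  have h1 : (⋃ s ∈ 𝒯.cells, interior (convexHull ℝ (s : Set (EuclideanSpace ℝ (Fin d))))) ⊆ Ω :=
    iUnion₂_subset fun s hs => interior_subset hΩr hs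
  have h2 : Ω \ (⋃ s ∈ 𝒯.cells, interior (convexHull ℝ (s : Set (EuclideanSpace ℝ (Fin d))))) ⊆
      ⋃ s ∈ 𝒯.cells, frontier (convexHull ℝ (s : Set (EuclideanSpace ℝ (Fin d)))) := by
    rintro x ⟨hx, hx'⟩
    obtain ⟨s, hs, hxs⟩ := 𝒯.exists_cell (subset_closure hx)
    refine mem_iUnion₂.2 ⟨s, hs, subset_closure hxs, fun hi => hx' (mem_iUnion₂.2 ⟨s, hs, hi⟩)⟩
  refine Filter.EventuallyLE.antisymm ?_ h1.eventuallyLE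
  rw [ae_le_set]
  refine measure_mono_null h2 ?_
  exact (measure_biUnion_null_iff 𝒯.cells.countable_toSet).2 fun s _ =>
    volume_frontier_convexHull _

/-- The Lebesgue measure on `Ω` is the sum of the Lebesgue measures on the cells. -/
theorem restrict_eq_sum (hΩr : interior (closure Ω) = Ω) :
    volume.restrict Ω =
      ∑ s ∈ 𝒯.cells, volume.restrict (convexHull ℝ (s : Set (EuclideanSpace ℝ (Fin d)))) := by
  rw [Measure.restrict_congr_set (𝒯.ae_eq_iUnion_interior hΩr), Measure.restrict_biUnion_finset
    (fun s hs t ht hst => disjoint_interior hs ht hst) (fun _ => isOpen_interior.measurableSet),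
    Measure.sum_fintype, Finset.sum_coe_sort 𝒯.cells (fun s => volume.restrict
      (interior (convexHull ℝ (s : Set (EuclideanSpace ℝ (Fin d))))))]
  exact Finset.sum_congr rfl fun s _ =>
    Measure.restrict_congr_set (interior_ae_eq_convexHull _)

theorem lintegral_eq_sum (hΩr : interior (closure Ω) = Ω)
    (f : EuclideanSpace ℝ (Fin d) → ℝ≥0∞) :
    ∫⁻ x in Ω, f x =
      ∑ s ∈ 𝒯.cells, ∫⁻ x in convexHull ℝ (s : Set (EuclideanSpace ℝ (Fin d))), f x := by
  rw [𝒯.restrict_eq_sum hΩr, lintegral_finsetSum_measure]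

theorem ae_mem_interior (hΩr : interior (closure Ω) = Ω) :
    ∀ᵐ x ∂volume.restrict Ω,
      ∃ s ∈ 𝒯.cells, x ∈ interior (convexHull ℝ (s : Set (EuclideanSpace ℝ (Fin d)))) := by
  rw [Measure.restrict_congr_set (𝒯.ae_eq_iUnion_interior hΩr)]
  filter_upwards [ae_restrict_mem (.biUnion 𝒯.cells.countable_toSet
    fun _ _ => isOpen_interior.measurableSet)] with x hx
  simpa using hx

theorem cells_nonempty (hΩ : Ω.Nonempty) : 𝒯.cells.Nonempty := by
  obtain ⟨x, hx⟩ := hΩ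
  obtain ⟨s, hs, -⟩ := 𝒯.exists_cell (subset_closure hx)
  exact ⟨s, hs⟩

/-- The boundary of `Ω` is covered by the facets of the cells. -/
theorem frontier_subset (hΩo : IsOpen Ω) (hΩr : interior (closure Ω) = Ω)
    [DecidableEq (EuclideanSpace ℝ (Fin d))] :
    frontier Ω ⊆ ⋃ s ∈ 𝒯.cells, ⋃ v ∈ s,
      convexHull ℝ ((s.erase v : Finset _) : Set (EuclideanSpace ℝ (Fin d))) := by
  intro x hx
  obtain ⟨s, hs, hxs⟩ := 𝒯.exists_cell (frontier_subset_closure hx)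
  have hx' : x ∉ interior (convexHull ℝ (s : Set (EuclideanSpace ℝ (Fin d)))) := fun h => by
    rw [hΩo.frontier_eq] at hx
    exact hx.2 (interior_subset hΩr hs h)
  rw [(isCell hs).mem_interior_iff] at hx'
  push Not at hx'
  obtain ⟨v, hv, hv0⟩ := hx'
  refine mem_iUnion₂.2 ⟨s, hs, mem_iUnion₂.2 ⟨v, hv, ?_⟩⟩
  refine ((isCell hs).mem_convexHull_subset_iff (s.erase_subset v)).2 ⟨hxs, fun w hw hwv => ?_⟩
  have : w = v := by simpa [hw] using hwv
  rw [this]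
  exact le_antisymm hv0 ((isCell hs).bary_nonneg hxs v)

end Triangulation


/-! ### Polynomial functions and their gradients. -/

section Polynomials

variable {d : ℕ}

/-- The polynomial function on `ℝᵈ` defined by `p`. -/
def polyEval (p : MvPolynomial (Fin d) ℝ) (x : EuclideanSpace ℝ (Fin d)) : ℝ :=
  MvPolynomial.eval (fun j => x j) p

/-- The gradient of the polynomial function defined by `p`. -/
def polyGrad (p : MvPolynomial (Fin d) ℝ) (x : EuclideanSpace ℝ (Fin d)) :
    EuclideanSpace ℝ (Fin d) :=
  WithLp.toLp 2 fun j => polyEval (MvPolynomial.pderiv j p) x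

theorem continuous_polyEval (p : MvPolynomial (Fin d) ℝ) : Continuous (polyEval p) :=
  (MvPolynomial.continuous_eval p).comp (by fun_prop)

theorem continuous_polyGrad (p : MvPolynomial (Fin d) ℝ) : Continuous (polyGrad p) :=
  (PiLp.continuous_toLp 2 _).comp (continuous_pi fun _ => continuous_polyEval _)

@[simp] theorem polyEval_add (p q : MvPolynomial (Fin d) ℝ) (x) :
    polyEval (p + q) x = polyEval p x + polyEval q x := by simp [polyEval]

@[simp] theorem polyEval_mul (p q : MvPolynomial (Fin d) ℝ) (x) :
    polyEval (p * q) x = polyEval p x * polyEval q x := by simp [polyEval]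

@[simp] theorem polyEval_smul (c : ℝ) (p : MvPolynomial (Fin d) ℝ) (x) :
    polyEval (c • p) x = c * polyEval p x := by simp [polyEval, MvPolynomial.smul_eval]

@[simp] theorem polyEval_sum {ι : Type*} (s : Finset ι) (p : ι → MvPolynomial (Fin d) ℝ) (x) :
    polyEval (∑ i ∈ s, p i) x = ∑ i ∈ s, polyEval (p i) x := by simp [polyEval]

theorem polyGrad_sum_smul {n : ℕ} (c : Fin n → ℝ) (p : Fin n → MvPolynomial (Fin d) ℝ) (x) :
    polyGrad (∑ i, c i • p i) x = ∑ i, c i • polyGrad (p i) x := by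
  ext j
  simp [polyGrad]

theorem hasFDerivAt_polyEval (p : MvPolynomial (Fin d) ℝ) (x : EuclideanSpace ℝ (Fin d)) :
    HasFDerivAt (polyEval p) (innerSL ℝ (polyGrad p x)) x := by
  induction p using MvPolynomial.induction_on with
  | C a =>
    have h1 : polyEval (MvPolynomial.C a) = fun _ : EuclideanSpace ℝ (Fin d) => a := by
      ext y; simp [polyEval]
    have h2 : polyGrad (MvPolynomial.C a) x = 0 := by ext j; simp [polyGrad, polyEval]
    rw [h1, h2, map_zero]
    exact hasFDerivAt_const a x
  | add p q hp hq =>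
    have h1 : polyEval (p + q) = polyEval p + polyEval q := by ext y; simp
    have h2 : polyGrad (p + q) x = polyGrad p x + polyGrad q x := by ext j; simp [polyGrad]
    rw [h1, h2, map_add]
    exact hp.add hq
  | mul_X p i hp =>
    have h1 : polyEval (p * MvPolynomial.X i) =
        fun y : EuclideanSpace ℝ (Fin d) => polyEval p y * y i := by
      ext y; simp [polyEval]
    rw [h1]
    have h3 : HasFDerivAt (fun y : EuclideanSpace ℝ (Fin d) => y i)
        (EuclideanSpace.proj i : EuclideanSpace ℝ (Fin d) →L[ℝ] ℝ) x :=
      (EuclideanSpace.proj i : EuclideanSpace ℝ (Fin d) →L[ℝ] ℝ).hasFDerivAt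
    refine (hp.mul h3).congr_fderiv ?_
    ext w
    simp only [_root_.add_apply, _root_.smul_apply, innerSL_apply_apply,
      polyGrad, PiLp.inner_apply, Derivation.leibniz, MvPolynomial.pderiv_X, smul_eq_mul,
      polyEval_add, polyEval_mul, PiLp.proj_apply]
    have h4 : ∀ j, polyEval ((Pi.single j 1 : Fin d → MvPolynomial (Fin d) ℝ) i) x =
        if j = i then 1 else 0 := fun j => by
      by_cases h : j = i
      · subst h; simp [polyEval]
      · simp [polyEval, h, Ne.symm h]
    have h5 : polyEval (MvPolynomial.X i) x = x i := by simp [polyEval]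
    simp only [h4, h5, RCLike.inner_apply, conj_trivial]
    have h6 : ∀ j, w j * (polyEval p x * (if j = i then 1 else 0) +
        x i * polyEval (MvPolynomial.pderiv j p) x) =
        (if j = i then w j * polyEval p x else 0) +
          x i * (w j * polyEval (MvPolynomial.pderiv j p) x) := fun j => by
      split_ifs <;> ring
    simp only [h6, Finset.sum_add_distrib, Finset.sum_ite_eq', Finset.mem_univ, if_true,
      Finset.mul_sum]
    ring

theorem gradient_polyEval (p : MvPolynomial (Fin d) ℝ) (x : EuclideanSpace ℝ (Fin d)) :
    gradient (polyEval p) x = polyGrad p x :=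
  HasGradientAt.gradient (hasGradientAt_iff_hasFDerivAt.2 (hasFDerivAt_polyEval p x))

theorem eq_zero_of_polyEval_eq_zero {p : MvPolynomial (Fin d) ℝ} {x₀ : EuclideanSpace ℝ (Fin d)}
    {U : Set (EuclideanSpace ℝ (Fin d))} (hU : U ∈ nhds x₀) (h : ∀ x ∈ U, polyEval p x = 0) :
    p = 0 := by
  have h1 : (WithLp.toLp 2 : (Fin d → ℝ) → EuclideanSpace ℝ (Fin d)) ⁻¹' U ∈
      nhds (WithLp.ofLp x₀) :=
    (PiLp.continuous_toLp 2 fun _ : Fin d => ℝ).continuousAt.preimage_mem_nhds (by simpa using hU)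
  obtain ⟨ε, hε, hb⟩ := Metric.mem_nhds_iff.1 h1
  refine MvPolynomial.funext_set (fun j => Ioo (x₀ j - ε) (x₀ j + ε))
    (fun j => Ioo_infinite (by linarith)) fun y hy => ?_
  rw [map_zero]
  refine h (WithLp.toLp 2 y) (hb ?_)
  rw [Metric.mem_ball, dist_pi_lt_iff hε]
  intro j
  have := hy j (mem_univ j)
  rw [Real.dist_eq, abs_lt]
  constructor <;> linarith [this.1, this.2]

theorem totalDegree_aeval_le {p : MvPolynomial (Fin d) ℝ} {k : ℕ} (hp : p.totalDegree ≤ k)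
    {f : Fin d → MvPolynomial (Fin d) ℝ} (hf : ∀ j, (f j).totalDegree ≤ 1) :
    (MvPolynomial.aeval f p).totalDegree ≤ k := by
  rw [MvPolynomial.aeval_def, MvPolynomial.eval₂_eq]
  refine MvPolynomial.totalDegree_finsetSum_le fun m hm => ?_
  refine (MvPolynomial.totalDegree_mul _ _).trans ?_
  have h1 : (algebraMap ℝ (MvPolynomial (Fin d) ℝ) (MvPolynomial.coeff m p)).totalDegree = 0 := by
    rw [MvPolynomial.algebraMap_eq, MvPolynomial.totalDegree_C]
  rw [h1, zero_add]
  refine (MvPolynomial.totalDegree_finsetProd _ _).trans ?_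
  refine le_trans (Finset.sum_le_sum fun j _ => (MvPolynomial.totalDegree_pow _ _).trans
    (Nat.mul_le_mul_left _ (hf j))) ?_
  simp only [mul_one]
  exact (MvPolynomial.le_totalDegree hm).trans hp

/-- Polynomials of bounded degree are invariant under dilations. -/
theorem exists_polyEval_dilation {p : MvPolynomial (Fin d) ℝ} {k : ℕ} (hp : p.totalDegree ≤ k)
    (x₀ : EuclideanSpace ℝ (Fin d)) (h : ℝ) : ∃ q : MvPolynomial (Fin d) ℝ, q.totalDegree ≤ k ∧
      ∀ z, polyEval q z = polyEval p (x₀ + h • z) := by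
  refine ⟨MvPolynomial.aeval (fun j => MvPolynomial.C (x₀ j) + MvPolynomial.C h * MvPolynomial.X j)
    p, totalDegree_aeval_le hp fun j => ?_, fun z => ?_⟩
  · refine (MvPolynomial.totalDegree_add _ _).trans (max_le (by simp) ?_)
    refine (MvPolynomial.totalDegree_mul _ _).trans ?_
    simp
  · simp only [polyEval]
    rw [MvPolynomial.aeval_def, MvPolynomial.eval_eval₂]
    have : (MvPolynomial.eval fun j => z j).comp
        (algebraMap ℝ (MvPolynomial (Fin d) ℝ)) = RingHom.id ℝ := by
      ext; simp
    rw [this, MvPolynomial.eval₂_id]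
    congr 2
    ext j; simp

theorem exists_polyEval_affine (ℓ : EuclideanSpace ℝ (Fin d) →ᵃ[ℝ] ℝ) :
    ∃ q : MvPolynomial (Fin d) ℝ, q.totalDegree ≤ 1 ∧ ∀ x, polyEval q x = ℓ x := by
  refine ⟨MvPolynomial.C (ℓ 0) + ∑ j, MvPolynomial.C (ℓ.linear (EuclideanSpace.single j 1)) *
    MvPolynomial.X j, ?_, fun x => ?_⟩
  · refine (MvPolynomial.totalDegree_add _ _).trans (max_le (by simp) ?_)
    refine MvPolynomial.totalDegree_finsetSum_le fun j _ => ?_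
    refine (MvPolynomial.totalDegree_mul _ _).trans ?_
    simp
  · have h1 : ℓ x = ℓ 0 + ℓ.linear x := by
      rw [AffineMap.decomp ℓ]; simp [add_comm]
    have h2 : ℓ.linear x = ∑ j, x j * ℓ.linear (EuclideanSpace.single j (1 : ℝ)) := by
      conv_lhs => rw [← (EuclideanSpace.basisFun (Fin d) ℝ).sum_repr x]
      simp
    rw [h1, h2]
    simp [polyEval, mul_comm]

theorem totalDegree_pderiv_le {p : MvPolynomial (Fin d) ℝ} {k : ℕ} (hp : p.totalDegree ≤ k + 1)
    (j : Fin d) : (MvPolynomial.pderiv j p).totalDegree ≤ k := by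
  rw [p.as_sum, map_sum]
  refine MvPolynomial.totalDegree_finsetSum_le fun m hm => ?_
  rw [MvPolynomial.pderiv_monomial]
  by_cases h0 : m j = 0
  · simp [h0]
  refine (MvPolynomial.totalDegree_monomial_le _ _).trans ?_
  have h1 := (MvPolynomial.le_totalDegree hm).trans hp
  have h2 : Finsupp.single j 1 ≤ m := by
    rw [Finsupp.single_le_iff]; omega
  have h3 : (m - Finsupp.single j 1).degree + (Finsupp.single j 1).degree = m.degree := by
    rw [← map_add, tsub_add_cancel_of_le h2]
  have h4 : m.degree ≤ k + 1 := h1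
  rw [Finsupp.degree_single] at h3
  change (m - Finsupp.single j 1).degree ≤ k
  omega

theorem totalDegree_pderiv_le' {p : MvPolynomial (Fin d) ℝ} {k : ℕ} (hp : p.totalDegree ≤ k)
    (j : Fin d) : (MvPolynomial.pderiv j p).totalDegree ≤ k :=
  totalDegree_pderiv_le (hp.trans (Nat.le_succ k)) j

/-- The polynomial `(k + 1) p + ∇p · (v - x)` has smaller degree than one would expect. -/
theorem totalDegree_euler_le {p : MvPolynomial (Fin d) ℝ} {k : ℕ} (hp : p.totalDegree ≤ k + 1)
    (v : Fin d → ℝ) :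
    ((k + 1 : ℝ) • p + ∑ j, (MvPolynomial.C (v j) - MvPolynomial.X j) *
      MvPolynomial.pderiv j p).totalDegree ≤ k := by
  have e : (k + 1 : ℝ) • p + ∑ j, (MvPolynomial.C (v j) - MvPolynomial.X j) *
      MvPolynomial.pderiv j p = (∑ j, MvPolynomial.C (v j) * MvPolynomial.pderiv j p) +
        ((k + 1 : ℝ) • p - ∑ j, MvPolynomial.X j * MvPolynomial.pderiv j p) := by
    simp only [sub_mul, Finset.sum_sub_distrib]; ring
  rw [e]
  refine (MvPolynomial.totalDegree_add _ _).trans (max_le ?_ ?_)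
  · refine MvPolynomial.totalDegree_finsetSum_le fun j _ => ?_
    refine (MvPolynomial.totalDegree_mul _ _).trans ?_
    rw [MvPolynomial.totalDegree_C, zero_add]
    exact totalDegree_pderiv_le hp j
  -- Euler's identity: x·∇ multiplies a monomial of degree j by j, so its coefficient becomes k + 1
  -- - j, and the top degree disappears.
  · have e2 : (k + 1 : ℝ) • p - ∑ j, MvPolynomial.X j * MvPolynomial.pderiv j p =
        ∑ m ∈ p.support, ((k + 1 : ℝ) - m.degree) • MvPolynomial.monomial m (p.coeff m) := by
      conv_lhs => rw [p.as_sum]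
      simp only [map_sum, Finset.mul_sum, Finset.smul_sum]
      rw [Finset.sum_comm, ← Finset.sum_sub_distrib]
      refine Finset.sum_congr rfl fun m _ => ?_
      simp only [MvPolynomial.X_mul_pderiv_monomial]
      rw [← Finset.sum_smul, sub_smul, ← Finsupp.degree_eq_sum, Nat.cast_smul_eq_nsmul]
    rw [e2]
    refine MvPolynomial.totalDegree_finsetSum_le fun m hm => ?_
    have h4 : m.degree ≤ k + 1 := (MvPolynomial.le_totalDegree hm).trans hp
    rcases h4.eq_or_lt with h | h
    · rw [h]; simp
    · refine (MvPolynomial.totalDegree_smul_le _ _).trans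
        ((MvPolynomial.totalDegree_monomial_le _ _).trans ?_)
      change m.degree ≤ k
      omega

end Polynomials


/-! ### Inverse inequalities for polynomials. -/

section InverseInequality

variable {d : ℕ}

theorem polyGrad_smul (c : ℝ) (p : MvPolynomial (Fin d) ℝ) (x) :
    polyGrad (c • p) x = c • polyGrad p x := by
  ext j; simp [polyGrad]

/-- The gradient of a dilated polynomial. -/
theorem polyGrad_of_dilation {p q : MvPolynomial (Fin d) ℝ} {x₀ : EuclideanSpace ℝ (Fin d)}
    {h : ℝ} (hq : ∀ z, polyEval q z = polyEval p (x₀ + h • z)) (z) :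
    polyGrad q z = h • polyGrad p (x₀ + h • z) := by
  have e : polyEval q = fun z => polyEval p (x₀ + h • z) := funext hq
  have h1 : HasFDerivAt (fun z : EuclideanSpace ℝ (Fin d) => x₀ + h • z)
      (h • ContinuousLinearMap.id ℝ (EuclideanSpace ℝ (Fin d))) z :=
    ((hasFDerivAt_id z).const_smul h).const_add x₀
  have h2 := (hasFDerivAt_polyEval p (x₀ + h • z)).comp z h1
  have h3 := hasFDerivAt_polyEval q z
  rw [e] at h3
  have h4 := h3.unique h2
  refine ext_inner_right ℝ fun w => ?_
  have h5 := congrArg (fun L => L w) h4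
  simpa [inner_smul_left, inner_smul_right] using h5

/-- Inverse inequality on the unit ball. -/
theorem exists_inverse_inequality_unit (d k : ℕ) {κ : ℝ} (hκ : 0 < κ) : ∃ C : ℝ, 0 < C ∧
    ∀ p : MvPolynomial (Fin d) ℝ, p.totalDegree ≤ k →
      ∀ y ∈ Metric.closedBall (0 : EuclideanSpace ℝ (Fin d)) 1,
      polyEval p y ^ 2 + ‖polyGrad p y‖ ^ 2 ≤
        C * ∫ x in Metric.closedBall (0 : EuclideanSpace ℝ (Fin d)) κ, polyEval p x ^ 2 := by
  set V := MvPolynomial.restrictTotalDegree (Fin d) ℝ k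
  set e := Module.finBasis ℝ V
  set n := Module.finrank ℝ V
  set P : (Fin n → ℝ) → MvPolynomial (Fin d) ℝ := fun c => ∑ i, c i • (e i : MvPolynomial (Fin d) ℝ)
  set K := Metric.closedBall (0 : EuclideanSpace ℝ (Fin d)) κ
  have hK : IsCompact K := isCompact_closedBall 0 κ
  have hKn : K ∈ nhds (0 : EuclideanSpace ℝ (Fin d)) := Metric.closedBall_mem_nhds 0 hκ
  have hPe : ∀ c x, polyEval (P c) x = ∑ i, c i * polyEval (e i : MvPolynomial (Fin d) ℝ) x :=
    fun c x => by simp [P]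
  have hPg : ∀ c x, polyGrad (P c) x = ∑ i, c i • polyGrad (e i : MvPolynomial (Fin d) ℝ) x :=
    fun c x => polyGrad_sum_smul _ _ _
  have hint : ∀ q : MvPolynomial (Fin d) ℝ, IntegrableOn (polyEval q) K := fun q =>
    (continuous_polyEval q).continuousOn.integrableOn_compact hK
  have hN : ∀ c, ∫ x in K, polyEval (P c) x ^ 2 = ∑ i, ∑ j, c i * c j *
      ∫ x in K, polyEval (e i * e j : MvPolynomial (Fin d) ℝ) x := fun c => by
    have : ∀ x, polyEval (P c) x ^ 2 = ∑ i, ∑ j, c i * c j *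
        polyEval (e i * e j : MvPolynomial (Fin d) ℝ) x := fun x => by
      rw [hPe, sq, Finset.sum_mul_sum]
      refine Finset.sum_congr rfl fun i _ => Finset.sum_congr rfl fun j _ => ?_
      rw [polyEval_mul]; ring
    simp only [this]
    rw [integral_finsetSum _ fun i _ => integrable_finsetSum _ fun j _ => (hint _).const_mul _]
    refine Finset.sum_congr rfl fun i _ => ?_
    rw [integral_finsetSum _ fun j _ => (hint _).const_mul _]
    exact Finset.sum_congr rfl fun j _ => integral_const_mul _ _
  have hNc : Continuous fun c : Fin n → ℝ => ∫ x in K, polyEval (P c) x ^ 2 := by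
    simp only [hN]
    fun_prop
  have hNpos : ∀ c : Fin n → ℝ, c ≠ 0 → 0 < ∫ x in K, polyEval (P c) x ^ 2 := by
    intro c hc
    have hcont : Continuous fun x => polyEval (P c) x ^ 2 := (continuous_polyEval _).pow 2
    refine (integral_nonneg fun x => sq_nonneg _).lt_of_ne' fun h0 => hc ?_
    have hae := (integral_eq_zero_iff_of_nonneg (fun x => sq_nonneg (polyEval (P c) x))
      (hcont.continuousOn.integrableOn_compact hK)).1 h0
    have hb : EqOn (fun x => polyEval (P c) x ^ 2) 0 (Metric.ball 0 κ) := by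
      refine Measure.eqOn_open_of_ae_eq (μ := volume) ?_ Metric.isOpen_ball hcont.continuousOn
        continuousOn_const
      exact ae_restrict_of_ae_restrict_of_subset Metric.ball_subset_closedBall hae
    have hP0 : P c = 0 := eq_zero_of_polyEval_eq_zero (Metric.ball_mem_nhds 0 hκ)
      fun x hx => by simpa using hb hx
    have h1 : ∑ i, c i • e i = 0 := by
      ext1
      simpa [P] using hP0
    have h2 := Fintype.linearIndependent_iff.1 e.linearIndependent c h1
    exact funext h2
  set F : (Fin n → ℝ) × EuclideanSpace ℝ (Fin d) → ℝ :=
    fun q => polyEval (P q.1) q.2 ^ 2 + ‖polyGrad (P q.1) q.2‖ ^ 2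
  have hF : Continuous F := by
    simp only [F, hPe, hPg]
    have h1 : ∀ i, Continuous (polyEval (e i : MvPolynomial (Fin d) ℝ)) :=
      fun i => continuous_polyEval _
    have h2 : ∀ i, Continuous (polyGrad (e i : MvPolynomial (Fin d) ℝ)) :=
      fun i => continuous_polyGrad _
    fun_prop
  obtain ⟨M, hM⟩ := ((isCompact_sphere (0 : Fin n → ℝ) 1).prod
    (isCompact_closedBall (0 : EuclideanSpace ℝ (Fin d)) 1)).exists_bound_of_continuousOn
    hF.continuousOn
  -- By homogeneity it suffices to compare the two quadratic quantities on the compact unit sphere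
  -- of coefficients, where the L²-norm over the small ball has a positive minimum.
  obtain ⟨m, hm, hmN⟩ : ∃ m : ℝ, 0 < m ∧ ∀ c ∈ Metric.sphere (0 : Fin n → ℝ) 1,
      m ≤ ∫ x in K, polyEval (P c) x ^ 2 := by
    rcases (Metric.sphere (0 : Fin n → ℝ) 1).eq_empty_or_nonempty with h | h
    · exact ⟨1, one_pos, fun c hc => by rw [h] at hc; exact hc.elim⟩
    · obtain ⟨c, hc, hmin⟩ := (isCompact_sphere (0 : Fin n → ℝ) 1).exists_isMinOn h
        hNc.continuousOn
      refine ⟨_, hNpos c ?_, fun c' hc' => hmin hc'⟩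
      rintro rfl
      simp at hc
  refine ⟨(|M| + 1) / m, by positivity, fun p hp y hy => ?_⟩
  have hpV : p ∈ V := (MvPolynomial.mem_restrictTotalDegree _ _ _).2 hp
  set c : Fin n → ℝ := fun i => e.repr ⟨p, hpV⟩ i
  have hpc : p = P c := by
    have h1 := congrArg V.subtype (e.sum_repr ⟨p, hpV⟩)
    rw [map_sum] at h1
    exact h1.symm
  rcases eq_or_ne c 0 with h0 | h0
  · have hz : p = 0 := by rw [hpc, h0]; simp [P]
    have h1 : ∀ x, polyEval (0 : MvPolynomial (Fin d) ℝ) x = 0 := fun x => by simp [polyEval]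
    have h2 : ∀ x, polyGrad (0 : MvPolynomial (Fin d) ℝ) x = 0 := fun x => by
      ext; simp [polyGrad, polyEval]
    simp [hz, h1, h2]
  · set c' : Fin n → ℝ := ‖c‖⁻¹ • c
    have hc0 : 0 < ‖c‖ := norm_pos_iff.2 h0
    have hc' : c' ∈ Metric.sphere (0 : Fin n → ℝ) 1 := by
      rw [mem_sphere_zero_iff_norm, norm_smul, norm_inv, norm_norm, inv_mul_cancel₀ hc0.ne']
    have hp' : p = ‖c‖ • P c' := by
      rw [hpc]
      simp only [P, c', Finset.smul_sum, smul_smul, Pi.smul_apply, smul_eq_mul]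
      refine Finset.sum_congr rfl fun i _ => ?_
      rw [← mul_assoc, mul_inv_cancel₀ hc0.ne', one_mul]
    have hb := (le_abs_self _).trans ((hM (c', y) ⟨hc', hy⟩).trans (le_abs_self _))
    have hlow := hmN c' hc'
    have hI : ∫ x in K, polyEval p x ^ 2 = ‖c‖ ^ 2 * ∫ x in K, polyEval (P c') x ^ 2 := by
      rw [← integral_const_mul]
      refine integral_congr_ae (Filter.Eventually.of_forall fun x => ?_)
      simp only [hp', polyEval_smul]; ring
    have hE : polyEval p y ^ 2 + ‖polyGrad p y‖ ^ 2 = ‖c‖ ^ 2 * F (c', y) := by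
      rw [hp', polyEval_smul, polyGrad_smul, norm_smul, norm_norm]
      simp only [F]; ring
    rw [hI, hE, div_mul_eq_mul_div, le_div_iff₀ hm]
    have h3 : F (c', y) * m ≤ (|M| + 1) * ∫ x in K, polyEval (P c') x ^ 2 :=
      mul_le_mul (hb.trans (by linarith)) hlow hm.le (by positivity)
    nlinarith [sq_nonneg ‖c‖]

/-- Inverse inequality: on a ball of radius `h` a polynomial and its gradient are controlled by the
`L²`-norm on a concentric ball of comparable radius. -/
theorem exists_inverse_inequality (d k : ℕ) {κ : ℝ} (hκ : 0 < κ) : ∃ C : ℝ, 0 < C ∧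
    ∀ p : MvPolynomial (Fin d) ℝ, p.totalDegree ≤ k → ∀ (x₀ : EuclideanSpace ℝ (Fin d)) (h : ℝ),
      0 < h → ∀ y ∈ Metric.closedBall x₀ h,
      h ^ d * (polyEval p y ^ 2 + h ^ 2 * ‖polyGrad p y‖ ^ 2) ≤
        C * ∫ x in Metric.closedBall x₀ (κ * h), polyEval p x ^ 2 := by
  obtain ⟨C, hC, hb⟩ := exists_inverse_inequality_unit d k hκ
  refine ⟨C, hC, fun p hp x₀ h hh y hy => ?_⟩
  obtain ⟨q, hq, hqe⟩ := exists_polyEval_dilation hp x₀ h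
  set z := h⁻¹ • (y - x₀)
  have hyz : x₀ + h • z = y := by simp [z, smul_smul, hh.ne']
  have hz : z ∈ Metric.closedBall (0 : EuclideanSpace ℝ (Fin d)) 1 := by
    rw [mem_closedBall_zero_iff, norm_smul, norm_inv, Real.norm_of_nonneg hh.le,
      inv_mul_le_iff₀ hh, mul_one]
    exact mem_closedBall_iff_norm.1 hy
  have h1 := hb q hq z hz
  rw [hqe, polyGrad_of_dilation hqe, hyz, norm_smul, mul_pow, Real.norm_of_nonneg hh.le] at h1
  have h2 : ∫ x in Metric.closedBall x₀ (κ * h), polyEval p x ^ 2 = h ^ d *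
      ∫ x in Metric.closedBall (0 : EuclideanSpace ℝ (Fin d)) κ, polyEval q x ^ 2 := by
    rw [← integral_indicator Metric.isClosed_closedBall.measurableSet,
      ← integral_indicator Metric.isClosed_closedBall.measurableSet,
      ← integral_add_left_eq_self _ x₀]
    have h3 := Measure.integral_comp_smul (volume : Measure (EuclideanSpace ℝ (Fin d)))
      (fun x => (Metric.closedBall x₀ (κ * h)).indicator (fun x => polyEval p x ^ 2) (x₀ + x)) h
    have h4 : ∀ z, (Metric.closedBall x₀ (κ * h)).indicator (fun x => polyEval p x ^ 2)
        (x₀ + h • z) = (Metric.closedBall (0 : EuclideanSpace ℝ (Fin d)) κ).indicator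
        (fun x => polyEval q x ^ 2) z := fun z => by
      have : x₀ + h • z ∈ Metric.closedBall x₀ (κ * h) ↔
          z ∈ Metric.closedBall (0 : EuclideanSpace ℝ (Fin d)) κ := by
        rw [mem_closedBall_iff_norm, mem_closedBall_zero_iff, add_sub_cancel_left, norm_smul,
          Real.norm_of_nonneg hh.le, mul_comm κ, mul_le_mul_iff_right₀ hh]
      by_cases hz : z ∈ Metric.closedBall (0 : EuclideanSpace ℝ (Fin d)) κ
      · rw [indicator_of_mem (this.2 hz), indicator_of_mem hz, hqe]
      · rw [indicator_of_notMem (mt this.1 hz), indicator_of_notMem hz]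
    simp only [h4, finrank_euclideanSpace_fin, smul_eq_mul] at h3
    rw [h3, abs_of_pos (by positivity), ← mul_assoc, mul_inv_cancel₀ (by positivity), one_mul]
  rw [h2]
  nlinarith [pow_pos hh d]

end InverseInequality


/-! ### Finite element functions and their decomposition over vertices. -/

/-- The closed simplex with vertex set `s`. -/
abbrev hull {d : ℕ} (s : Finset (EuclideanSpace ℝ (Fin d))) : Set (EuclideanSpace ℝ (Fin d)) :=
  convexHull ℝ (s : Set (EuclideanSpace ℝ (Fin d)))

theorem hull_mem {d : ℕ} {s : Finset (EuclideanSpace ℝ (Fin d))} {v : EuclideanSpace ℝ (Fin d)}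
    (hv : v ∈ s) : v ∈ hull s := subset_convexHull ℝ _ (by exact_mod_cast hv)

theorem IsCell.measurableSet_hull {d : ℕ} {s : Finset (EuclideanSpace ℝ (Fin d))} (hs : IsCell s) :
    MeasurableSet (hull s) := hs.isCompact.measurableSet

namespace Triangulation

variable {d : ℕ} {Ω : Set (EuclideanSpace ℝ (Fin d))} {𝒯 : Triangulation Ω}
  {s t : Finset (EuclideanSpace ℝ (Fin d))} {x v : EuclideanSpace ℝ (Fin d)} {k : ℕ}

theorem finite_elements : 𝒯.elements.Finite := by
  refine (𝒯.cells.finite_toSet.image fun s => hull s).subset ?_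
  rintro _ ⟨s, hs, hc, rfl⟩
  exact ⟨s, mem_cells.2 ⟨hs, hc⟩, rfl⟩

theorem diam_le_meshSize (hs : s ∈ 𝒯.cells) : Metric.diam (hull s) ≤ 𝒯.meshSize :=
  le_csSup (finite_elements.image _).bddAbove (mem_image_of_mem _ (mem_elements hs))

theorem dist_le_meshSize (hs : s ∈ 𝒯.cells) {x y : EuclideanSpace ℝ (Fin d)} (hx : x ∈ hull s)
    (hy : y ∈ hull s) : dist x y ≤ 𝒯.meshSize :=
  (Metric.dist_le_diam_of_mem (isCell hs).isCompact.isBounded hx hy).trans (diam_le_meshSize hs)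

theorem hull_subset_closedBall (hs : s ∈ 𝒯.cells) (hx : x ∈ hull s) :
    hull s ⊆ Metric.closedBall x 𝒯.meshSize :=
  fun _ hy => Metric.mem_closedBall.2 (dist_le_meshSize hs hy hx)

theorem meshSize_pos (hd : 1 ≤ d) (hΩ : Ω.Nonempty) : 0 < 𝒯.meshSize := by
  obtain ⟨s, hs⟩ := 𝒯.cells_nonempty hΩ
  have hc := (isCell hs).card_eq
  obtain ⟨v, hv, w, hw, hvw⟩ := Finset.one_lt_card.1 (show 1 < s.card by omega)
  exact (dist_pos.2 hvw).trans_le (dist_le_meshSize hs (hull_mem hv) (hull_mem hw))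

theorem exists_poly {r : EuclideanSpace ℝ (Fin d) → ℝ} (hr : r ∈ 𝒯.scalarSpace k) :
    ∃ P : Finset (EuclideanSpace ℝ (Fin d)) → MvPolynomial (Fin d) ℝ, ∀ s ∈ 𝒯.cells,
      (P s).totalDegree ≤ k ∧ ∀ x ∈ hull s, r x = polyEval (P s) x := by
  classical
  have h : ∀ s ∈ 𝒯.cells, ∃ p : MvPolynomial (Fin d) ℝ, p.totalDegree ≤ k ∧
      ∀ x ∈ hull s, r x = polyEval p x := fun s hs => hr.2 _ (mem_elements hs)
  choose! P hP using h
  exact ⟨P, hP⟩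

theorem gradient_eq_polyGrad {r : EuclideanSpace ℝ (Fin d) → ℝ} {p : MvPolynomial (Fin d) ℝ}
    (hp : ∀ x ∈ hull s, r x = polyEval p x) (hx : x ∈ interior (hull s)) :
    gradient r x = polyGrad p x := by
  have : r =ᶠ[nhds x] polyEval p := by
    filter_upwards [mem_interior_iff_mem_nhds.1 hx] with y hy using hp y hy
  rw [this.gradient_eq, gradient_polyEval]

theorem continuousOn_closure {r : EuclideanSpace ℝ (Fin d) → ℝ}
    (h : ∀ s ∈ 𝒯.cells, ContinuousOn r (hull s)) : ContinuousOn r (closure Ω) := by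
  have h1 : ContinuousOn r (⋃ s : 𝒯.cells, hull (s : Finset (EuclideanSpace ℝ (Fin d)))) :=
    (locallyFinite_of_finite _).continuousOn_iUnion (fun s => (isCell s.2).isCompact.isClosed)
      fun s => h s s.2
  rwa [iUnion_subtype, 𝒯.iUnion_cells] at h1

/-- Gluing: polynomials that agree on the intersections of cells define an element of `R_h`. -/
theorem exists_mem_scalarSpace {Q : Finset (EuclideanSpace ℝ (Fin d)) → MvPolynomial (Fin d) ℝ}
    (hQ : ∀ s ∈ 𝒯.cells, (Q s).totalDegree ≤ k)
    (h : ∀ s ∈ 𝒯.cells, ∀ t ∈ 𝒯.cells, ∀ x ∈ hull s, x ∈ hull t →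
      polyEval (Q s) x = polyEval (Q t) x) :
    ∃ r ∈ 𝒯.scalarSpace k, ∀ s ∈ 𝒯.cells, ∀ x ∈ hull s, r x = polyEval (Q s) x := by
  classical
  set r : EuclideanSpace ℝ (Fin d) → ℝ := fun x =>
    if h : ∃ s ∈ 𝒯.cells, x ∈ hull s then polyEval (Q h.choose) x else 0
  have hr : ∀ s ∈ 𝒯.cells, ∀ x ∈ hull s, r x = polyEval (Q s) x := by
    intro s hs x hx
    have h1 : ∃ s ∈ 𝒯.cells, x ∈ hull s := ⟨s, hs, hx⟩
    simp only [r, dif_pos h1]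
    exact h _ h1.choose_spec.1 s hs x h1.choose_spec.2 hx
  refine ⟨r, ⟨continuousOn_closure (𝒯 := 𝒯) fun s hs => ?_, forall_elements.2 fun s hs =>
    ⟨Q s, hQ s hs, hr s hs⟩⟩, hr⟩
  exact (continuous_polyEval _).continuousOn.congr (hr s hs)

theorem gradient_mem_vectorSpace {r : EuclideanSpace ℝ (Fin d) → ℝ} (hr : r ∈ 𝒯.scalarSpace k) :
    gradient r ∈ 𝒯.vectorSpace k := by
  obtain ⟨P, hP⟩ := exists_poly hr
  refine forall_elements.2 fun s hs => ⟨fun j => MvPolynomial.pderiv j (P s), fun j =>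
    ⟨totalDegree_pderiv_le' (hP s hs).1 j, fun x hx => ?_⟩⟩
  rw [gradient_eq_polyGrad (hP s hs).2 hx]
  rfl

theorem sub_const_mem_scalarSpace {r : EuclideanSpace ℝ (Fin d) → ℝ} (hr : r ∈ 𝒯.scalarSpace k)
    (c : ℝ) : (fun x => r x - c) ∈ 𝒯.scalarSpace k := by
  refine ⟨hr.1.sub continuousOn_const, fun T hT => ?_⟩
  obtain ⟨p, hp, h⟩ := hr.2 T hT
  refine ⟨p - MvPolynomial.C c, (MvPolynomial.totalDegree_sub _ _).trans (max_le hp (by simp)),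
    fun x hx => ?_⟩
  simp [h x hx]

theorem const_mul_mem_scalarSpace {r : EuclideanSpace ℝ (Fin d) → ℝ} (hr : r ∈ 𝒯.scalarSpace k)
    (c : ℝ) : (fun x => c * r x) ∈ 𝒯.scalarSpace k := by
  refine ⟨continuousOn_const.mul hr.1, fun T hT => ?_⟩
  obtain ⟨p, hp, h⟩ := hr.2 T hT
  refine ⟨c • p, (MvPolynomial.totalDegree_smul_le _ _).trans hp, fun x hx => ?_⟩
  simp [h x hx, MvPolynomial.smul_eval]

theorem sum_mem_scalarSpace {ι : Type*} (I : Finset ι) {r : ι → EuclideanSpace ℝ (Fin d) → ℝ}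
    (hr : ∀ i ∈ I, r i ∈ 𝒯.scalarSpace k) : (fun x => ∑ i ∈ I, r i x) ∈ 𝒯.scalarSpace k := by
  refine ⟨continuousOn_finsetSum _ fun i hi => (hr i hi).1, fun T hT => ?_⟩
  have h : ∀ i ∈ I, ∃ p : MvPolynomial (Fin d) ℝ, p.totalDegree ≤ k ∧
      ∀ x ∈ T, r i x = MvPolynomial.eval (fun j => x j) p := fun i hi => (hr i hi).2 T hT
  choose! p hp using h
  refine ⟨∑ i ∈ I, p i, MvPolynomial.totalDegree_finsetSum_le fun i hi => (hp i hi).1,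
    fun x hx => ?_⟩
  rw [map_sum]
  exact Finset.sum_congr rfl fun i hi => (hp i hi).2 x hx

/-- The directional derivatives towards a common vertex agree. -/
theorem inner_polyGrad_eq {p q : MvPolynomial (Fin d) ℝ}
    (h : ∀ y ∈ hull s ∩ hull t, polyEval p y = polyEval q y)
    (hxs : x ∈ hull s) (hxt : x ∈ hull t) (hvs : v ∈ s) (hvt : v ∈ t) :
    inner ℝ (polyGrad p x) (v - x) = inner ℝ (polyGrad q x) (v - x) := by
  have hγ : HasDerivAt (fun τ : ℝ => x + τ • (v - x)) (v - x) 0 := by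
    simpa using ((hasDerivAt_id (0 : ℝ)).smul_const (v - x)).const_add x
  have hd : ∀ p : MvPolynomial (Fin d) ℝ, HasDerivWithinAt
      (fun τ : ℝ => polyEval p (x + τ • (v - x))) (inner ℝ (polyGrad p x) (v - x)) (Icc 0 1) 0 := by
    intro p
    have h1 : HasFDerivAt (polyEval p) (innerSL ℝ (polyGrad p x)) (x + (0 : ℝ) • (v - x)) := by
      simpa using hasFDerivAt_polyEval p x
    exact (h1.comp_hasDerivAt (0 : ℝ) hγ).hasDerivWithinAt
  have hmem : ∀ (u : Finset (EuclideanSpace ℝ (Fin d))), x ∈ hull u → v ∈ u →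
      ∀ τ ∈ Icc (0 : ℝ) 1, x + τ • (v - x) ∈ hull u := fun u hx hv τ hτ =>
    (convex_convexHull ℝ _).add_smul_sub_mem hx (hull_mem hv) hτ
  refine (uniqueDiffOn_Icc one_pos 0 (by simp)).eq_deriv _ (hd p) ((hd q).congr (fun τ hτ => ?_) ?_)
  · exact h _ ⟨hmem s hxs hvs τ hτ, hmem t hxt hvt τ hτ⟩
  · simpa using h x ⟨hxs, hxt⟩

/-- The part of the polynomial `p` of degree at most `k + 1` belonging to the vertex `v`. -/
def vertexPart (k : ℕ) (p : MvPolynomial (Fin d) ℝ) (s : Finset (EuclideanSpace ℝ (Fin d)))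
    (v x : EuclideanSpace ℝ (Fin d)) : ℝ :=
  -- The weight 1/(k+1) lowers the degree of the bracket to k, so the product with a barycentric
  -- coordinate stays of degree k + 1. The derivative towards v is the same from every cell
  -- containing v, so the parts are continuous across cells; they sum to p because the
  -- coordinate-weighted vectors v - x cancel.
  bary s v x * (polyEval p x + (k + 1 : ℝ)⁻¹ * inner ℝ (polyGrad p x) (v - x))

theorem exists_polyEval_vertexPart {p : MvPolynomial (Fin d) ℝ} (hp : p.totalDegree ≤ k + 1)
    (s : Finset (EuclideanSpace ℝ (Fin d))) (v : EuclideanSpace ℝ (Fin d)) :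
    ∃ q : MvPolynomial (Fin d) ℝ, q.totalDegree ≤ k + 1 ∧
      ∀ x, polyEval q x = vertexPart k p s v x := by
  obtain ⟨a, ha, hae⟩ := exists_polyEval_affine (bary s v)
  refine ⟨a * ((k + 1 : ℝ)⁻¹ • ((k + 1 : ℝ) • p + ∑ j, (MvPolynomial.C (v j) -
    MvPolynomial.X j) * MvPolynomial.pderiv j p)), ?_, fun x => ?_⟩
  · refine (MvPolynomial.totalDegree_mul _ _).trans ?_
    have := (MvPolynomial.totalDegree_smul_le (k + 1 : ℝ)⁻¹ _).trans
      (totalDegree_euler_le hp fun j => v j)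
    omega
  · have h1 : inner ℝ (polyGrad p x) (v - x) =
        ∑ j, (v j - x j) * polyEval (MvPolynomial.pderiv j p) x := by
      simp [PiLp.inner_apply, polyGrad]
    have h2 : ∀ j, polyEval (MvPolynomial.C (v j) - MvPolynomial.X j) x = v j - x j := fun j => by
      simp [polyEval]
    rw [polyEval_mul, polyEval_smul, polyEval_add, polyEval_smul, polyEval_sum, hae, vertexPart, h1]
    simp only [polyEval_mul, h2]
    field_simp

theorem sum_vertexPart (hs : IsCell s) (p : MvPolynomial (Fin d) ℝ) (x) :
    ∑ v ∈ s, vertexPart k p s v x = polyEval p x := by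
  simp only [vertexPart, mul_add, Finset.sum_add_distrib, ← Finset.sum_mul, hs.sum_bary, one_mul]
  have h1 : ∑ v ∈ s, bary s v x * ((k + 1 : ℝ)⁻¹ * inner ℝ (polyGrad p x) (v - x)) =
      (k + 1 : ℝ)⁻¹ * inner ℝ (polyGrad p x) (∑ v ∈ s, bary s v x • (v - x)) := by
    rw [inner_sum, Finset.mul_sum]
    refine Finset.sum_congr rfl fun v _ => ?_
    rw [inner_smul_right]; ring
  have h2 : ∑ v ∈ s, bary s v x • (v - x) = 0 := by
    simp only [smul_sub, Finset.sum_sub_distrib, ← Finset.sum_smul, hs.sum_bary, hs.sum_bary_smul,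
      one_smul, sub_self]
  rw [h1, h2, inner_zero_right, mul_zero, add_zero]

theorem sq_vertexPart_le (hs : s ∈ 𝒯.cells) (hx : x ∈ hull s) (hv : v ∈ s)
    (p : MvPolynomial (Fin d) ℝ) : vertexPart k p s v x ^ 2 ≤
      2 * (polyEval p x ^ 2 + 𝒯.meshSize ^ 2 * ‖polyGrad p x‖ ^ 2) := by
  have h1 := (isCell hs).bary_nonneg hx v
  have h2 := (isCell hs).bary_le_one hx v
  have h3 : |inner ℝ (polyGrad p x) (v - x)| ≤ ‖polyGrad p x‖ * 𝒯.meshSize :=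
    (abs_real_inner_le_norm _ _).trans (mul_le_mul_of_nonneg_left (by
      rw [← dist_eq_norm]; exact dist_le_meshSize hs (hull_mem hv) hx) (norm_nonneg _))
  have h4 : |(k + 1 : ℝ)⁻¹ * inner ℝ (polyGrad p x) (v - x)| ≤ ‖polyGrad p x‖ * 𝒯.meshSize := by
    rw [abs_mul, abs_of_pos (by positivity)]
    refine (mul_le_of_le_one_left (abs_nonneg _) (inv_le_one_of_one_le₀ ?_)).trans h3
    linarith [(Nat.cast_nonneg k : (0 : ℝ) ≤ k)]
  have h5 := sq_le_sq' (neg_le_of_abs_le h4) (le_of_abs_le h4)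
  rw [vertexPart, mul_pow]
  set a := polyEval p x
  set b := (k + 1 : ℝ)⁻¹ * inner ℝ (polyGrad p x) (v - x)
  have h6 : bary s v x ^ 2 ≤ 1 := pow_le_one₀ h1 h2
  calc bary s v x ^ 2 * (a + b) ^ 2 ≤ 1 * (a + b) ^ 2 :=
        mul_le_mul_of_nonneg_right h6 (sq_nonneg _)
    _ ≤ _ := by nlinarith [sq_nonneg (a - b)]

/-- Local decomposition of a finite element function with respect to the vertices. -/
theorem exists_vertex_decomposition {w : EuclideanSpace ℝ (Fin d) → ℝ}
    {P : Finset (EuclideanSpace ℝ (Fin d)) → MvPolynomial (Fin d) ℝ}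
    (hP : ∀ s ∈ 𝒯.cells, (P s).totalDegree ≤ k + 1 ∧ ∀ x ∈ hull s, w x = polyEval (P s) x)
    (c : EuclideanSpace ℝ (Fin d) → ℝ) :
    ∃ r ∈ 𝒯.scalarSpace (k + 1), ∀ s ∈ 𝒯.cells, ∀ x ∈ hull s,
      r x = ∑ v ∈ s, c v * vertexPart k (P s) s v x := by
  classical
  have hPP : ∀ s ∈ 𝒯.cells, ∀ t ∈ 𝒯.cells, ∀ y ∈ hull s ∩ hull t,
      polyEval (P s) y = polyEval (P t) y := fun s hs t ht y hy => by
    rw [← (hP s hs).2 y hy.1, (hP t ht).2 y hy.2]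
  have key : ∀ v, ∃ r ∈ 𝒯.scalarSpace (k + 1), ∀ s ∈ 𝒯.cells, ∀ x ∈ hull s,
      r x = vertexPart k (P s) s v x := by
    intro v
    have h : ∀ s ∈ 𝒯.cells, ∃ q : MvPolynomial (Fin d) ℝ, q.totalDegree ≤ k + 1 ∧
      ∀ x, polyEval q x = vertexPart k (P s) s v x := fun s hs =>
        exists_polyEval_vertexPart (hP s hs).1 s v
    choose! Q hQ using h
    obtain ⟨r, hr, hrQ⟩ := exists_mem_scalarSpace (𝒯 := 𝒯) (Q := Q) (fun s hs => (hQ s hs).1)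
      fun s hs t ht x hxs hxt => by
        rw [(hQ s hs).2, (hQ t ht).2]
        have hb := bary_eq_bary hs ht hxs hxt v
        by_cases hvs : v ∈ s
        · by_cases hvt : v ∈ t
          · rw [vertexPart, vertexPart, hb, hPP s hs t ht x ⟨hxs, hxt⟩,
              inner_polyGrad_eq (hPP s hs t ht) hxs hxt hvs hvt]
          · rw [vertexPart, vertexPart, hb, bary_of_notMem hvt, zero_mul, zero_mul]
        · rw [vertexPart, vertexPart, ← hb, bary_of_notMem hvs, zero_mul, zero_mul]
    exact ⟨r, hr, fun s hs x hx => by rw [hrQ s hs x hx, (hQ s hs).2]⟩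
  choose r hr hrP using key
  refine ⟨fun x => ∑ v ∈ 𝒯.cells.biUnion id, c v * r v x,
    sum_mem_scalarSpace _ fun v _ => const_mul_mem_scalarSpace (hr v) _, fun s hs x hx => ?_⟩
  symm
  simp only [hrP _ s hs x hx]
  refine Finset.sum_subset (fun v hv => Finset.mem_biUnion.2 ⟨s, hs, hv⟩) fun v _ hv => ?_
  rw [vertexPart, bary_of_notMem hv, zero_mul, mul_zero]

end Triangulation


/-! ### Exponential locality of the L²-projection. -/

namespace Triangulation

variable {d : ℕ} {Ω : Set (EuclideanSpace ℝ (Fin d))} {𝒯 : Triangulation Ω}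
  {s t : Finset (EuclideanSpace ℝ (Fin d))} {x v : EuclideanSpace ℝ (Fin d)} {k : ℕ}

theorem isCompact_closure (𝒯 : Triangulation Ω) : IsCompact (closure Ω) := by
  rw [← 𝒯.iUnion_cells]
  exact 𝒯.cells.isCompact_biUnion fun s hs => (isCell hs).isCompact

theorem integral_eq_sum (𝒯 : Triangulation Ω) (hΩr : interior (closure Ω) = Ω)
    {f : EuclideanSpace ℝ (Fin d) → ℝ} (hf : ContinuousOn f (closure Ω)) :
    ∫ x in Ω, f x = ∑ s ∈ 𝒯.cells, ∫ x in hull s, f x := by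
  rw [𝒯.restrict_eq_sum hΩr, integral_finsetSum_measure fun s hs =>
    (hf.mono (convexHull_subset_closure hs)).integrableOn_compact (isCell hs).isCompact]

theorem volume_hull_le (hh : 0 ≤ 𝒯.meshSize) (hs : s ∈ 𝒯.cells) : volume.real (hull s) ≤
    𝒯.meshSize ^ d * volume.real (Metric.closedBall (0 : EuclideanSpace ℝ (Fin d)) 1) := by
  obtain ⟨x, hx⟩ := (isCell hs).nonempty_interior
  refine (measureReal_mono (hull_subset_closedBall hs (_root_.interior_subset hx))
    (isCompact_closedBall _ _).measure_ne_top).trans ?_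
  rw [Measure.addHaar_real_closedBall' _ _ hh, finrank_euclideanSpace_fin]

/-- Inverse inequality on the cells of a quasiuniform family. -/
theorem exists_cell_inverse_inequality (d k : ℕ) {κ : ℝ} (hκ : 0 < κ) : ∃ C : ℝ, 0 < C ∧
    ∀ {Ω : Set (EuclideanSpace ℝ (Fin d))} (𝒯 : Triangulation Ω), 0 < 𝒯.meshSize →
      (∀ T ∈ 𝒯.elements, ∃ x, Metric.closedBall x (κ * 𝒯.meshSize) ⊆ T) →
      ∀ s ∈ 𝒯.cells, ∀ p : MvPolynomial (Fin d) ℝ, p.totalDegree ≤ k → ∀ y ∈ hull s,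
        𝒯.meshSize ^ d * (polyEval p y ^ 2 + 𝒯.meshSize ^ 2 * ‖polyGrad p y‖ ^ 2) ≤
          C * ∫ x in hull s, polyEval p x ^ 2 := by
  obtain ⟨C, hC, hb⟩ := exists_inverse_inequality d k hκ
  refine ⟨C, hC, fun {Ω} 𝒯 hh hq s hs p hp y hy => ?_⟩
  obtain ⟨x, hx⟩ := hq _ (mem_elements hs)
  have hxs : x ∈ hull s := hx (Metric.mem_closedBall_self (by positivity))
  refine (hb p hp x _ hh y (hull_subset_closedBall hs hxs hy)).trans
    (mul_le_mul_of_nonneg_left ?_ hC.le)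
  exact setIntegral_mono_set (((continuous_polyEval p).pow 2).continuousOn.integrableOn_compact
    (isCell hs).isCompact) (Filter.Eventually.of_forall fun x => sq_nonneg _) hx.eventuallyLE

theorem exp_sub_exp_le {a c b : ℝ} (h : |c - b| ≤ a) :
    |Real.exp (-c) - Real.exp (-b)| ≤ (Real.exp a - 1) * Real.exp (-b) := by
  have e : Real.exp (-c) = Real.exp (b - c) * Real.exp (-b) := by
    rw [← Real.exp_add]; ring_nf
  have h' := abs_le.1 h
  have h1 : Real.exp (b - c) ≤ Real.exp a := Real.exp_le_exp.2 (by linarith [h'.1])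
  have h2 : Real.exp (-a) ≤ Real.exp (b - c) := Real.exp_le_exp.2 (by linarith [h'.2])
  have h3 : 2 ≤ Real.exp a + Real.exp (-a) := by
    have := Real.one_le_cosh a
    rw [Real.cosh_eq] at this; linarith
  rw [e, show Real.exp (b - c) * Real.exp (-b) - Real.exp (-b) =
    (Real.exp (b - c) - 1) * Real.exp (-b) by ring, abs_mul, abs_of_pos (Real.exp_pos (-b))]
  refine mul_le_mul_of_nonneg_right (abs_le.2 ⟨by linarith, by linarith⟩) (Real.exp_pos _).le

/-- Exponentially weighted stability of the `L²`-projection. -/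
theorem exists_weighted_projection_le (d k : ℕ) {κ : ℝ} (hκ : 0 < κ) : ∃ a C : ℝ, 0 < a ∧ 0 < C ∧
    ∀ {Ω : Set (EuclideanSpace ℝ (Fin d))} (𝒯 : Triangulation Ω), interior (closure Ω) = Ω →
      0 < 𝒯.meshSize → (∀ T ∈ 𝒯.elements, ∃ x, Metric.closedBall x (κ * 𝒯.meshSize) ⊆ T) →
      ∀ (w e : EuclideanSpace ℝ (Fin d) → ℝ), w ∈ 𝒯.scalarSpace (k + 1) →
        ContinuousOn e (closure Ω) →
        (∀ r ∈ 𝒯.scalarSpace (k + 1), ∫ x in Ω, (w x - e x) * r x = 0) →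
      ∀ (x₀ : EuclideanSpace ℝ (Fin d)) (y : Finset (EuclideanSpace ℝ (Fin d)) →
        EuclideanSpace ℝ (Fin d)), (∀ s ∈ 𝒯.cells, y s ∈ hull s) →
        𝒯.meshSize ^ d *
          ∑ s ∈ 𝒯.cells, Real.exp (-(a * dist (y s) x₀ / 𝒯.meshSize)) * ∫ x in hull s, w x ^ 2 ≤
        C * ∑ s ∈ 𝒯.cells, Real.exp (-(a * dist (y s) x₀ / 𝒯.meshSize)) *
          (∫ x in hull s, |e x|) ^ 2 := by
  obtain ⟨C, hC, hinv⟩ := exists_cell_inverse_inequality d (k + 1) hκ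
  set ω := volume.real (Metric.closedBall (0 : EuclideanSpace ℝ (Fin d)) 1)
  have hω : 0 ≤ ω := measureReal_nonneg
  -- The rate log(1 + ε) lets the exponential weight vary across a cell by at most the relative
  -- amount ε. The bound (d+1)ε ≤ 1 keeps the test function comparable with σw, and 4ωC(d+1)ε ≤ 1
  -- makes the commutator term at most half of the left side.
  set ε : ℝ := 1 / (4 * ω * C * (d + 1) + (d + 1)) with hε
  have hε0 : 0 < ε := by positivity
  have hε1 : (d + 1) * ε ≤ 1 := by
    rw [hε, mul_one_div, div_le_one (by positivity)]
    have : 0 ≤ 4 * ω * C * (d + 1) := by positivity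
    linarith
  have hε2 : 4 * ω * C * (d + 1) * ε ≤ 1 := by
    rw [hε, mul_one_div, div_le_one (by positivity)]
    have : (0 : ℝ) ≤ d + 1 := by positivity
    linarith
  have hexp : Real.exp (Real.log (1 + ε)) - 1 = ε := by
    rw [Real.exp_log (by positivity)]; ring
  refine ⟨Real.log (1 + ε), 32 * C, Real.log_pos (by linarith), by positivity,
    fun {Ω} 𝒯 hΩr hh hq w e hw he horth x₀ y hy => ?_⟩
  set h := 𝒯.meshSize
  set a := Real.log (1 + ε)
  have ha : 0 < a := Real.log_pos (by linarith)
  set σ : EuclideanSpace ℝ (Fin d) → ℝ := fun x => Real.exp (-(a * dist x x₀ / h))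
  have hσ : ∀ x, 0 < σ x := fun x => Real.exp_pos _
  have hσσ : ∀ s ∈ 𝒯.cells, ∀ v ∈ s, |σ v - σ (y s)| ≤ ε * σ (y s) := by
    intro s hs v hv
    rw [← hexp]
    refine exp_sub_exp_le ?_
    rw [← sub_div, ← mul_sub, abs_div, abs_mul, abs_of_pos ha, abs_of_pos hh, div_le_iff₀ hh]
    refine mul_le_mul_of_nonneg_left ?_ ha.le
    exact (abs_dist_sub_le _ _ _).trans (dist_le_meshSize hs (hull_mem hv) (hy s hs))
  obtain ⟨P, hP⟩ := exists_poly hw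
  -- The weighted function σw is not a finite element function. Its substitute multiplies each
  -- vertex part of w by the value of σ at that vertex.
  obtain ⟨r, hr, hrP⟩ := exists_vertex_decomposition hP σ
  set I : Finset (EuclideanSpace ℝ (Fin d)) → ℝ := fun s => ∫ x in hull s, w x ^ 2
  set J : Finset (EuclideanSpace ℝ (Fin d)) → ℝ := fun s => ∫ x in hull s, |e x|
  -- By the inverse inequality this number bounds |w| and all vertex parts on the whole cell.
  set m : Finset (EuclideanSpace ℝ (Fin d)) → ℝ := fun s => √(2 * C * I s / h ^ d)
  have hI0 : ∀ s, 0 ≤ I s := fun s => integral_nonneg fun x => sq_nonneg _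
  have hJ0 : ∀ s, 0 ≤ J s := fun s => integral_nonneg fun x => abs_nonneg _
  have hm0 : ∀ s, 0 ≤ m s := fun s => Real.sqrt_nonneg _
  have hm2 : ∀ s, h ^ d * m s ^ 2 = 2 * C * I s := fun s => by
    have := hI0 s
    rw [Real.sq_sqrt (by positivity)]; field_simp
  have hIP : ∀ s ∈ 𝒯.cells, I s = ∫ x in hull s, polyEval (P s) x ^ 2 := fun s hs =>
    setIntegral_congr_fun (isCell hs).measurableSet_hull fun x hx => by
      simp only [(hP s hs).2 x hx]
  have hpt : ∀ s ∈ 𝒯.cells, ∀ x ∈ hull s,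
      2 * (polyEval (P s) x ^ 2 + h ^ 2 * ‖polyGrad (P s) x‖ ^ 2) ≤ m s ^ 2 := by
    intro s hs x hx
    have h1 := hinv 𝒯 hh hq s hs (P s) (hP s hs).1 x hx
    rw [← hIP s hs] at h1
    have h2 := hm2 s
    have h3 : (0 : ℝ) < h ^ d := by positivity
    refine le_of_mul_le_mul_left ?_ h3
    rw [h2]; linarith
  have hvp : ∀ s ∈ 𝒯.cells, ∀ x ∈ hull s, ∀ v ∈ s, |vertexPart k (P s) s v x| ≤ m s :=
    fun s hs x hx v hv => abs_le_of_sq_le_sq ((sq_vertexPart_le hs hx hv _).trans (hpt s hs x hx))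
      (hm0 s)
  have hwm : ∀ s ∈ 𝒯.cells, ∀ x ∈ hull s, |w x| ≤ m s := fun s hs x hx => by
    refine abs_le_of_sq_le_sq (le_trans ?_ (hpt s hs x hx)) (hm0 s)
    rw [(hP s hs).2 x hx]
    have : 0 ≤ h ^ 2 * ‖polyGrad (P s) x‖ ^ 2 := by positivity
    nlinarith [sq_nonneg (polyEval (P s) x)]
  have hdiff : ∀ s ∈ 𝒯.cells, ∀ x ∈ hull s,
      |σ (y s) * w x - r x| ≤ (d + 1) * ε * σ (y s) * m s := by
    intro s hs x hx
    rw [hrP s hs x hx, (hP s hs).2 x hx, ← sum_vertexPart (k := k) (isCell hs) (P s) x,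
      Finset.mul_sum, ← Finset.sum_sub_distrib]
    refine (Finset.abs_sum_le_sum_abs _ _).trans ?_
    refine (Finset.sum_le_card_nsmul s _ (ε * σ (y s) * m s) fun v hv => ?_).trans_eq ?_
    · rw [← sub_mul, abs_mul, abs_sub_comm]
      exact mul_le_mul (hσσ s hs v hv) (hvp s hs x hx v hv) (abs_nonneg _)
        (mul_nonneg hε0.le (hσ _).le)
    · rw [(isCell hs).card_eq, nsmul_eq_mul]; push_cast; ring
  have hrm : ∀ s ∈ 𝒯.cells, ∀ x ∈ hull s, |r x| ≤ 2 * σ (y s) * m s := by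
    intro s hs x hx
    have h1 := hdiff s hs x hx
    have h2 : |σ (y s) * w x| ≤ σ (y s) * m s := by
      rw [abs_mul, abs_of_pos (hσ _)]
      exact mul_le_mul_of_nonneg_left (hwm s hs x hx) (hσ _).le
    have h3 : |r x| ≤ |σ (y s) * w x| + |σ (y s) * w x - r x| := by
      have := abs_sub_abs_le_abs_sub (r x) (σ (y s) * w x)
      rw [abs_sub_comm] at this
      linarith
    have h4 : (d + 1) * ε * (σ (y s) * m s) ≤ 1 * (σ (y s) * m s) :=
      mul_le_mul_of_nonneg_right hε1 (mul_nonneg (hσ _).le (hm0 s))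
    linarith
  have hcw : ∀ s ∈ 𝒯.cells, ContinuousOn w (hull s) := fun s hs =>
    hw.1.mono (convexHull_subset_closure hs)
  have hcr : ∀ s ∈ 𝒯.cells, ContinuousOn r (hull s) := fun s hs =>
    hr.1.mono (convexHull_subset_closure hs)
  have hce : ∀ s ∈ 𝒯.cells, ContinuousOn e (hull s) := fun s hs =>
    he.mono (convexHull_subset_closure hs)
  -- With σ frozen on the cell, σw² = (w - e)r + (σw - r)w + er. The first term sums to zero over
  -- the cells by orthogonality, the second takes half and the third a quarter of the left side; the
  -- quarter that is left explains 32 = 4·8.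
  have hcell : ∀ s ∈ 𝒯.cells,
      σ (y s) * I s ≤ (∫ x in hull s, (w x - e x) * r x) + 1 / 2 * (σ (y s) * I s) +
        (1 / 4 * (σ (y s) * I s) + 8 * C * (σ (y s) * (J s ^ 2 / h ^ d))) := by
    intro s hs
    have hK := (isCell hs).isCompact
    have i1 : IntegrableOn (fun x => (w x - e x) * r x) (hull s) :=
      (((hcw s hs).sub (hce s hs)).mul (hcr s hs)).integrableOn_compact hK
    have i2 : IntegrableOn (fun x => (σ (y s) * w x - r x) * w x) (hull s) :=
      (((continuousOn_const.mul (hcw s hs)).sub (hcr s hs)).mul (hcw s hs)).integrableOn_compact hK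
    have i3 : IntegrableOn (fun x => e x * r x) (hull s) :=
      ((hce s hs).mul (hcr s hs)).integrableOn_compact hK
    have e1 : σ (y s) * I s = (∫ x in hull s, (w x - e x) * r x) +
        (∫ x in hull s, (σ (y s) * w x - r x) * w x) + ∫ x in hull s, e x * r x := by
      have h1 := integral_add (i1.add i2) i3
      have h2 := integral_add i1 i2
      simp only [Pi.add_apply] at h1
      rw [← h2, ← h1]
      simp only [I]
      rw [← integral_const_mul]
      refine integral_congr_ae (Filter.Eventually.of_forall fun x => ?_)
      simp only; ring
    have b1 : ∫ x in hull s, (σ (y s) * w x - r x) * w x ≤ 1 / 2 * (σ (y s) * I s) := by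
      have h1 := norm_setIntegral_le_of_norm_le_const (μ := volume) (s := hull s)
        (f := fun x => (σ (y s) * w x - r x) * w x) (C := (d + 1) * ε * σ (y s) * m s * m s)
        hK.measure_lt_top fun x hx => by
          rw [norm_mul]
          have := hm0 s
          have := hσ (y s)
          exact mul_le_mul (hdiff s hs x hx) (hwm s hs x hx) (norm_nonneg _) (by positivity)
      refine (le_abs_self _).trans (h1.trans ?_)
      have h2 := volume_hull_le hh.le hs
      have h3 : (d + 1) * ε * σ (y s) * m s * m s * volume.real (hull s) ≤
          (d + 1) * ε * σ (y s) * m s * m s * (h ^ d * ω) := by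
        have := hm0 s
        have := hσ (y s)
        exact mul_le_mul_of_nonneg_left h2 (by positivity)
      refine h3.trans ?_
      have h4 : (d + 1) * ε * σ (y s) * m s * m s * (h ^ d * ω) =
          (d + 1) * ε * σ (y s) * ω * (h ^ d * m s ^ 2) := by ring
      rw [h4, hm2]
      have h5 : 4 * ω * C * (d + 1) * ε * (σ (y s) * I s) ≤ 1 * (σ (y s) * I s) :=
        mul_le_mul_of_nonneg_right hε2 (mul_nonneg (hσ _).le (hI0 s))
      linarith
    have b2 : ∫ x in hull s, e x * r x ≤
        1 / 4 * (σ (y s) * I s) + 8 * C * (σ (y s) * (J s ^ 2 / h ^ d)) := by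
      have h1 : ∫ x in hull s, e x * r x ≤ ∫ x in hull s, |e x| * (2 * σ (y s) * m s) := by
        refine setIntegral_mono_on i3 (((hce s hs).abs.mul
          continuousOn_const).integrableOn_compact hK) (isCell hs).measurableSet_hull
          fun x hx => ?_
        refine (le_abs_self _).trans ?_
        rw [abs_mul]
        exact mul_le_mul_of_nonneg_left (hrm s hs x hx) (abs_nonneg _)
      rw [integral_mul_const] at h1
      refine h1.trans ?_
      change J s * (2 * σ (y s) * m s) ≤ _
      have hhd : (0 : ℝ) < h ^ d := by positivity
      have h2 : 2 * (J s * m s) ≤ 1 / 4 * I s + 8 * C * (J s ^ 2 / h ^ d) := by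
        have h3 : 1 / 4 * I s = h ^ d * m s ^ 2 / (8 * C) := by
          rw [hm2]; field_simp; ring
        rw [h3]
        have h4 : 2 * (J s * m s) = 2 * (m s * h ^ d) * (8 * C * J s) / (8 * C * h ^ d) := by
          field_simp
        have h5 : h ^ d * m s ^ 2 / (8 * C) + 8 * C * (J s ^ 2 / h ^ d) =
            ((m s * h ^ d) ^ 2 + (8 * C * J s) ^ 2) / (8 * C * h ^ d) := by
          field_simp
        rw [h4, h5]
        refine div_le_div_of_nonneg_right ?_ (by positivity)
        nlinarith [sq_nonneg (m s * h ^ d - 8 * C * J s)]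
      have h6 := mul_le_mul_of_nonneg_left h2 (hσ (y s)).le
      linarith
    linarith
  have hsum := Finset.sum_le_sum hcell
  have h0 : ∑ s ∈ 𝒯.cells, ∫ x in hull s, (w x - e x) * r x = 0 := by
    rw [← 𝒯.integral_eq_sum (f := fun x => (w x - e x) * r x) hΩr ((hw.1.sub he).mul hr.1)]
    exact horth r hr
  simp only [Finset.sum_add_distrib, ← Finset.mul_sum, h0] at hsum
  have hfin : ∑ s ∈ 𝒯.cells, σ (y s) * (J s ^ 2 / h ^ d) =
      (∑ s ∈ 𝒯.cells, σ (y s) * J s ^ 2) / h ^ d := by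
    rw [Finset.sum_div]
    exact Finset.sum_congr rfl fun s _ => by ring
  rw [hfin] at hsum
  have hhd : (0 : ℝ) < h ^ d := by positivity
  change h ^ d * ∑ s ∈ 𝒯.cells, σ (y s) * I s ≤ 32 * C * ∑ s ∈ 𝒯.cells, σ (y s) * J s ^ 2
  have h7 : ∑ s ∈ 𝒯.cells, σ (y s) * I s ≤
      32 * C * ((∑ s ∈ 𝒯.cells, σ (y s) * J s ^ 2) / h ^ d) := by linarith
  calc _ ≤ h ^ d * (32 * C * ((∑ s ∈ 𝒯.cells, σ (y s) * J s ^ 2) / h ^ d)) :=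
        mul_le_mul_of_nonneg_left h7 hhd.le
    _ = _ := by field_simp

end Triangulation


/-! ### Pointwise control of the projected gradient. -/

/-- Jensen's inequality for powers of lower Lebesgue integrals. -/
theorem lintegral_rpow_le {X : Type*} [MeasurableSpace X] {μ : Measure X} {f : X → ℝ≥0∞}
    (hf : AEMeasurable f μ) {β : ℝ} (hβ : 1 < β) :
    (∫⁻ x, f x ∂μ) ^ β ≤ μ univ ^ (β - 1) * ∫⁻ x, f x ^ β ∂μ := by
  have hc := Real.HolderConjugate.conjExponent hβ
  have h := ENNReal.lintegral_mul_le_Lp_mul_Lq μ hc hf (aemeasurable_const (b := (1 : ℝ≥0∞)))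
  simp only [Pi.mul_apply, mul_one, ENNReal.one_rpow, lintegral_const, one_mul] at h
  have hβ0 : 0 < β := one_pos.trans hβ
  refine (ENNReal.rpow_le_rpow h hβ0.le).trans_eq ?_
  rw [ENNReal.mul_rpow_of_nonneg _ _ hβ0.le, ← ENNReal.rpow_mul, ← ENNReal.rpow_mul,
    one_div_mul_cancel hβ0.ne', ENNReal.rpow_one, mul_comm]
  congr 2
  rw [Real.conjExponent]; field_simp

theorem sum_rpow_le {ι : Type*} (I : Finset ι) (f : ι → ℝ≥0∞) {p : ℝ} (hp : 0 < p) (hp1 : p ≤ 1) :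
    (∑ i ∈ I, f i) ^ p ≤ ∑ i ∈ I, f i ^ p :=
  Finset.le_sum_of_subadditive (fun x : ℝ≥0∞ => x ^ p) (ENNReal.zero_rpow_of_pos hp).le
    (fun a b => ENNReal.rpow_add_le_add_rpow a b hp.le hp1) I f

theorem polyGrad_eq_zero {d : ℕ} {p : MvPolynomial (Fin d) ℝ} (hp : p.totalDegree ≤ 0) (x) :
    polyGrad p x = 0 := by
  rw [MvPolynomial.totalDegree_eq_zero_iff_eq_C.1 (Nat.le_zero.1 hp)]
  ext j; simp [polyGrad, polyEval]

namespace Triangulation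

variable {d : ℕ}

/-- Pointwise bound of the gradient of the `L²`-projection by a nonlocal difference quotient. -/
theorem exists_gradient_rpow_le (d k : ℕ) {κ β : ℝ} (hκ : 0 < κ) (hβ : 1 < β) (hβ2 : β < 2) :
    ∃ a C : ℝ, 0 < a ∧ 0 < C ∧
    ∀ {Ω : Set (EuclideanSpace ℝ (Fin d))} (𝒯 : Triangulation Ω), interior (closure Ω) = Ω →
      0 < 𝒯.meshSize → (∀ T ∈ 𝒯.elements, ∃ x, Metric.closedBall x (κ * 𝒯.meshSize) ⊆ T) →
      ∀ (w u : EuclideanSpace ℝ (Fin d) → ℝ), w ∈ 𝒯.scalarSpace k →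
        ContinuousOn u (closure Ω) →
        (∀ r ∈ 𝒯.scalarSpace k, ∫ x in Ω, (w x - u x) * r x = 0) →
      ∀ s ∈ 𝒯.cells, ∀ x₀ ∈ interior (hull s),
        ENNReal.ofReal (‖gradient w x₀‖ ^ β) ≤
          ENNReal.ofReal (C * 𝒯.meshSize ^ (-(β + d))) *
            ∫⁻ y in Ω, ENNReal.ofReal (Real.exp (-(a * dist y x₀ / 𝒯.meshSize)) *
              |u y - u x₀| ^ β) := by
  have hβ0 : 0 < β := one_pos.trans hβ
  rcases k with _ | k
  -- Degree zero: the function is constant on each cell and its gradient vanishes there.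
  · refine ⟨1, 1, one_pos, one_pos, fun {Ω} 𝒯 hΩr hh hq w u hw hu horth s hs x₀ hx₀ => ?_⟩
    obtain ⟨P, hP⟩ := exists_poly hw
    rw [gradient_eq_polyGrad (hP s hs).2 hx₀, polyGrad_eq_zero (hP s hs).1, norm_zero,
      Real.zero_rpow hβ0.ne']
    simp
  obtain ⟨a, C, ha, hC, hproj⟩ := exists_weighted_projection_le d k hκ
  obtain ⟨C', hC', hinv⟩ := exists_cell_inverse_inequality d (k + 1) hκ
  set ω := volume.real (Metric.closedBall (0 : EuclideanSpace ℝ (Fin d)) 1)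
  have hω : 0 ≤ ω := measureReal_nonneg
  set C₃ := C' * C * Real.exp a
  have hC₃ : 0 < C₃ := by positivity
  refine ⟨a * (β / 2), C₃ ^ (β / 2) * Real.exp (a * (β / 2)) * ω ^ (β - 1) + 1, by positivity,
    by positivity, fun {Ω} 𝒯 hΩr hh hq w u hw hu horth s₀ hs₀ x₀ hx₀ => ?_⟩
  set h := 𝒯.meshSize
  have hx₀' := _root_.interior_subset hx₀
  -- Constants lie in the space, so w - u(x₀) is the projection of u - u(x₀) and has the gradient of
  -- w. This produces differences of u.
  have hw' := sub_const_mem_scalarSpace hw (u x₀)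
  have he : ContinuousOn (fun x => u x - u x₀) (closure Ω) := hu.sub continuousOn_const
  have hne : ∀ s : Finset (EuclideanSpace ℝ (Fin d)), ∃ y, s ∈ 𝒯.cells → y ∈ hull s := fun s => by
    by_cases hs : s ∈ 𝒯.cells
    · obtain ⟨y, hy⟩ := (isCell hs).nonempty_interior
      exact ⟨y, fun _ => _root_.interior_subset hy⟩
    · exact ⟨0, fun h => (hs h).elim⟩
  choose y hy using hne
  have h1 := hproj 𝒯 hΩr hh hq _ _ hw' he (fun r hr => by
    simp only [sub_sub_sub_cancel_right]; exact horth r hr) x₀ y hy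
  set σ : Finset (EuclideanSpace ℝ (Fin d)) → ℝ := fun s => Real.exp (-(a * dist (y s) x₀ / h))
  set J : Finset (EuclideanSpace ℝ (Fin d)) → ℝ := fun s => ∫ x in hull s, |u x - u x₀|
  obtain ⟨P, hP⟩ := exists_poly hw'
  have hgrad : gradient w x₀ = polyGrad (P s₀) x₀ := by
    rw [← gradient_eq_polyGrad (hP s₀ hs₀).2 hx₀, gradient, gradient, fderiv_sub_const]
  set g := polyGrad (P s₀) x₀
  have hhd : (0 : ℝ) < h ^ d := by positivity
  have h2 : ‖g‖ ^ 2 ≤ C₃ / h ^ (2 * d + 2) * ∑ s ∈ 𝒯.cells, σ s * J s ^ 2 := by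
    have h3 := hinv 𝒯 hh hq s₀ hs₀ (P s₀) (hP s₀ hs₀).1 x₀ hx₀'
    have h4 : ∫ x in hull s₀, polyEval (P s₀) x ^ 2 = ∫ x in hull s₀, (w x - u x₀) ^ 2 :=
      setIntegral_congr_fun (isCell hs₀).measurableSet_hull fun x hx => by
        simp only [(hP s₀ hs₀).2 x hx]
    rw [h4] at h3
    have h5 : Real.exp (-a) ≤ σ s₀ := by
      refine Real.exp_le_exp.2 (neg_le_neg ?_)
      rw [div_le_iff₀ hh]
      exact mul_le_mul_of_nonneg_left (dist_le_meshSize hs₀ (hy s₀ hs₀) hx₀') ha.le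
    set I₀ := ∫ x in hull s₀, (w x - u x₀) ^ 2
    have hI₀ : 0 ≤ I₀ := integral_nonneg fun x => sq_nonneg _
    have h6 : σ s₀ * I₀ ≤ ∑ s ∈ 𝒯.cells, σ s * ∫ x in hull s, (w x - u x₀) ^ 2 :=
      Finset.single_le_sum (f := fun s => σ s * ∫ x in hull s, (w x - u x₀) ^ 2)
        (fun s _ => mul_nonneg (Real.exp_pos _).le (integral_nonneg fun x => sq_nonneg _)) hs₀
    have h7 : h ^ d * (Real.exp (-a) * I₀) ≤ C * ∑ s ∈ 𝒯.cells, σ s * J s ^ 2 :=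
      (mul_le_mul_of_nonneg_left ((mul_le_mul_of_nonneg_right h5 hI₀).trans h6) hhd.le).trans h1
    have h8 : h ^ d * (h ^ 2 * ‖g‖ ^ 2) ≤ C' * I₀ := by
      have : 0 ≤ h ^ d * polyEval (P s₀) x₀ ^ 2 := by positivity
      linarith
    rw [div_mul_eq_mul_div, le_div_iff₀ (by positivity)]
    have h9 : Real.exp a * Real.exp (-a) = 1 := by rw [← Real.exp_add]; simp
    calc ‖g‖ ^ 2 * h ^ (2 * d + 2) = h ^ d * (h ^ d * (h ^ 2 * ‖g‖ ^ 2)) := by ring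
      _ ≤ h ^ d * (C' * I₀) := mul_le_mul_of_nonneg_left h8 hhd.le
      _ = C' * Real.exp a * (h ^ d * (Real.exp (-a) * I₀)) := by
          rw [show C' * Real.exp a * (h ^ d * (Real.exp (-a) * I₀)) =
            h ^ d * (C' * I₀) * (Real.exp a * Real.exp (-a)) by ring, h9, mul_one]
      _ ≤ C' * Real.exp a * (C * ∑ s ∈ 𝒯.cells, σ s * J s ^ 2) :=
          mul_le_mul_of_nonneg_left h7 (by positivity)
      _ = _ := by simp only [C₃]; ring
  set B := C₃ / h ^ (2 * d + 2)
  have hB : 0 < B := by positivity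
  have hJ0 : ∀ s, 0 ≤ J s := fun s => integral_nonneg fun x => abs_nonneg _
  have hσ0 : ∀ s, 0 < σ s := fun s => Real.exp_pos _
  have hJE : ∀ s ∈ 𝒯.cells, ENNReal.ofReal (J s) =
      ∫⁻ x in hull s, ENNReal.ofReal |u x - u x₀| := fun s hs => by
    refine ofReal_integral_eq_lintegral_ofReal ?_ (Filter.Eventually.of_forall fun x => abs_nonneg _)
    exact ((he.mono (convexHull_subset_closure hs)).abs).integrableOn_compact (isCell hs).isCompact
  have hJβ : ∀ s ∈ 𝒯.cells, ENNReal.ofReal (J s) ^ β ≤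
      ENNReal.ofReal ((h ^ d * ω) ^ (β - 1)) *
        ∫⁻ x in hull s, ENNReal.ofReal (|u x - u x₀| ^ β) := fun s hs => by
    rw [hJE s hs]
    have hm : AEMeasurable (fun x => ENNReal.ofReal |u x - u x₀|) (volume.restrict (hull s)) :=
      ((he.mono (convexHull_subset_closure hs)).abs.aemeasurable
        (isCell hs).measurableSet_hull).ennreal_ofReal
    refine (lintegral_rpow_le hm hβ).trans ?_
    refine mul_le_mul' ?_ (lintegral_mono fun x => ?_)
    · rw [Measure.restrict_apply_univ, ← ENNReal.ofReal_rpow_of_nonneg (by positivity)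
        (by linarith)]
      refine ENNReal.rpow_le_rpow ?_ (by linarith)
      rw [← ENNReal.ofReal_toReal (isCell hs).isCompact.measure_ne_top]
      exact ENNReal.ofReal_le_ofReal (volume_hull_le hh.le hs)
    · rw [ENNReal.ofReal_rpow_of_nonneg (abs_nonneg _) hβ0.le]
  -- Since β/2 ≤ 1, the power β/2 of the sum over cells is at most the sum of the powers.
  have hpow : ENNReal.ofReal (‖g‖ ^ β) ≤
      ∑ s ∈ 𝒯.cells, ENNReal.ofReal ((B * σ s) ^ (β / 2)) * ENNReal.ofReal (J s) ^ β := by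
    have e1 : ‖g‖ ^ β = (‖g‖ ^ 2) ^ (β / 2) := by
      rw [← Real.rpow_natCast, ← Real.rpow_mul (norm_nonneg _)]; congr 1; push_cast; ring
    rw [e1, ← ENNReal.ofReal_rpow_of_nonneg (sq_nonneg _) (by positivity)]
    refine (ENNReal.rpow_le_rpow (ENNReal.ofReal_le_ofReal h2) (by positivity)).trans ?_
    rw [Finset.mul_sum, ENNReal.ofReal_sum_of_nonneg fun s _ => by
      have := hσ0 s; have := hJ0 s; positivity]
    refine (sum_rpow_le _ _ (by positivity) (by linarith)).trans
      (Finset.sum_le_sum fun s _ => ?_)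
    have := hσ0 s
    rw [← mul_assoc, ENNReal.ofReal_mul (by positivity), ENNReal.mul_rpow_of_nonneg _ _
      (by positivity), ENNReal.ofReal_rpow_of_nonneg (by positivity) (by positivity),
      ENNReal.ofReal_pow (hJ0 s), ← ENNReal.rpow_natCast, ← ENNReal.rpow_mul]
    refine le_of_eq ?_
    congr 2; push_cast; ring
  rw [hgrad]
  refine hpow.trans ?_
  rw [𝒯.lintegral_eq_sum hΩr, Finset.mul_sum]
  refine Finset.sum_le_sum fun s hs => ?_
  refine (mul_le_mul_right (hJβ s hs) _).trans ?_
  rw [← mul_assoc, ← ENNReal.ofReal_mul (by have := hσ0 s; positivity),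
    ← lintegral_const_mul' _ _ ENNReal.ofReal_ne_top,
    ← lintegral_const_mul' _ _ ENNReal.ofReal_ne_top]
  refine setLIntegral_mono' (isCell hs).measurableSet_hull fun x hx => ?_
  have hσs := hσ0 s
  rw [← ENNReal.ofReal_mul (by positivity), ← ENNReal.ofReal_mul (by positivity)]
  refine ENNReal.ofReal_le_ofReal ?_
  rw [← mul_assoc]
  refine mul_le_mul_of_nonneg_right ?_ (Real.rpow_nonneg (abs_nonneg _) _)
  have f1 : (B * σ s) ^ (β / 2) = C₃ ^ (β / 2) * h ^ (-((2 * d + 2) * (β / 2))) * σ s ^ (β / 2) := by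
    rw [Real.mul_rpow hB.le hσs.le, Real.div_rpow hC₃.le (by positivity), ← Real.rpow_natCast,
      ← Real.rpow_mul hh.le, Real.rpow_neg hh.le]
    push_cast; rfl
  have f2 : (h ^ d * ω) ^ (β - 1) = h ^ (d * (β - 1)) * ω ^ (β - 1) := by
    rw [Real.mul_rpow hhd.le hω, ← Real.rpow_natCast, ← Real.rpow_mul hh.le]
  -- Scaling count: weighted stability and the inverse inequality give h^{-(d+1)β}, Jensen's
  -- inequality on a cell gives h^{d(β-1)}.
  have f3 : h ^ (-((2 * d + 2) * (β / 2))) * h ^ (d * (β - 1)) = h ^ (-(β + d)) := by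
    rw [← Real.rpow_add hh]; congr 1; ring
  have f4 : σ s ^ (β / 2) ≤ Real.exp (a * (β / 2)) * Real.exp (-(a * (β / 2) * dist x x₀ / h)) := by
    rw [← Real.exp_mul, ← Real.exp_add]
    refine Real.exp_le_exp.2 ?_
    have h3 : dist x x₀ ≤ h + dist (y s) x₀ :=
      (dist_triangle x (y s) x₀).trans (add_le_add_left (dist_le_meshSize hs hx (hy s hs)) _)
    have h4 : dist x x₀ / h ≤ 1 + dist (y s) x₀ / h := by
      rw [div_le_iff₀ hh, add_mul, div_mul_cancel₀ _ hh.ne']; linarith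
    have h5 := mul_le_mul_of_nonneg_left h4 (show 0 ≤ a * (β / 2) by positivity)
    rw [mul_div_assoc, mul_div_assoc]
    linarith
  have hE := Real.exp_pos (-(a * (β / 2) * dist x x₀ / h))
  calc (B * σ s) ^ (β / 2) * (h ^ d * ω) ^ (β - 1)
      = C₃ ^ (β / 2) * ω ^ (β - 1) * h ^ (-(β + d)) * σ s ^ (β / 2) := by
        rw [f1, f2, ← f3]; ring
    _ ≤ C₃ ^ (β / 2) * ω ^ (β - 1) * h ^ (-(β + d)) *
        (Real.exp (a * (β / 2)) * Real.exp (-(a * (β / 2) * dist x x₀ / h))) :=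
        mul_le_mul_of_nonneg_left f4 (by positivity)
    _ = (C₃ ^ (β / 2) * Real.exp (a * (β / 2)) * ω ^ (β - 1)) * h ^ (-(β + d)) *
        Real.exp (-(a * (β / 2) * dist x x₀ / h)) := by ring
    _ ≤ _ := by
        refine mul_le_mul_of_nonneg_right (mul_le_mul_of_nonneg_right ?_ (by positivity)) hE.le
        linarith

end Triangulation


/-! ### Transport of differences along families of curves. -/

/-- The fundamental theorem of calculus as an inequality, without integrability assumptions. -/
theorem ofReal_abs_sub_le_lintegral {f f' : ℝ → ℝ} {a b : ℝ} (hab : a ≤ b) {S : Set ℝ}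
    (hS : S.Countable) (hc : ContinuousOn f (Icc a b))
    (hd : ∀ x ∈ Ioo a b \ S, HasDerivAt f (f' x) x) :
    ENNReal.ofReal |f b - f a| ≤ ∫⁻ x in Ioo a b, ENNReal.ofReal |f' x| := by
  by_cases htop : ∫⁻ x in Ioo a b, ENNReal.ofReal |f' x| = ∞
  · rw [htop]; exact le_top
  have hS0 : ∀ᵐ x : ℝ ∂volume.restrict (Ioo a b), x ∉ S :=
    ae_restrict_of_ae (hS.ae_notMem volume)
  have hm : AEStronglyMeasurable f' (volume.restrict (Ioo a b)) := by
    refine (measurable_deriv f).aestronglyMeasurable.congr ?_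
    filter_upwards [hS0, ae_restrict_mem measurableSet_Ioo] with x hx hx'
    exact (hd x ⟨hx', hx⟩).deriv
  have hi : IntegrableOn f' (Ioo a b) :=
    ⟨hm, by
      rw [hasFiniteIntegral_iff_norm]
      exact lt_top_iff_ne_top.2 htop⟩
  have hi' : IntervalIntegrable f' volume a b :=
    (intervalIntegrable_iff_integrableOn_Ioo_of_le hab).2 hi
  rw [← integral_eq_of_hasDerivAt_off_countable_of_le f f' hab hS hc hd hi',
    intervalIntegral.integral_of_le hab, integral_Ioc_eq_integral_Ioo]
  refine (ENNReal.ofReal_le_ofReal (abs_integral_le_integral_abs)).trans_eq ?_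
  exact ofReal_integral_eq_lintegral_ofReal hi.abs (Filter.Eventually.of_forall fun x => abs_nonneg _)

section Transport

variable {E : Type*} [NormedAddCommGroup E] [InnerProductSpace ℝ E] [FiniteDimensional ℝ E]
  [MeasurableSpace E] [BorelSpace E]

theorem measurable_gradient (u : E → ℝ) : Measurable (gradient u) :=
  (InnerProductSpace.toDual ℝ E).symm.continuous.measurable.comp (measurable_fderiv ℝ u)

/-- The difference of `u` at the endpoints of a family of curves `γ · x` is controlled by the
integral of `∇u` over the region covered by the curves. -/
theorem lintegral_sub_rpow_le {μ : Measure E} [SFinite μ] {u : E → ℝ} {A D : Set E}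
    (hA : MeasurableSet A) (hD : MeasurableSet D) {β : ℝ} (hβ : 1 < β)
    (hu : ∀ x ∈ D, DifferentiableAt ℝ u x) {τ₀ : ℝ} (h0 : 0 ≤ τ₀) (h1 : τ₀ ≤ 1)
    {γ γ' : ℝ → E → E} (hγm : Measurable fun q : ℝ × E => γ q.1 q.2)
    (hγ : ∀ x ∈ A, ∀ τ ∈ Ioo τ₀ 1, HasDerivAt (fun τ => γ τ x) (γ' τ x) τ)
    (hγD : ∀ x ∈ A, ∀ τ ∈ Ioo τ₀ 1, γ τ x ∈ D)
    (hγc : ∀ x ∈ A, ContinuousOn (fun τ => u (γ τ x)) (Icc τ₀ 1))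
    {ω : E → ℝ≥0∞} {H J : ℝ → ℝ≥0∞} (hHm : Measurable H) (hJm : Measurable J)
    (hω : ∀ x ∈ A, ω x ≠ ∞)
    (hH : ∀ x ∈ A, ∀ τ ∈ Ioo τ₀ 1, ω x * ENNReal.ofReal ‖γ' τ x‖ ^ β ≤ H τ)
    (hJ : ∀ τ ∈ Ioo τ₀ 1, ∀ f : E → ℝ≥0∞, Measurable f →
      ∫⁻ x, f (γ τ x) ∂μ ≤ J τ * ∫⁻ x, f x ∂μ) :
    ∫⁻ x in A, ω x * ENNReal.ofReal (|u (γ 1 x) - u (γ τ₀ x)| ^ β) ∂μ ≤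
      (∫⁻ τ in Ioo τ₀ 1, H τ * J τ) * ∫⁻ x in D, ENNReal.ofReal (‖gradient u x‖ ^ β) ∂μ := by
  classical
  have hβ0 : 0 < β := one_pos.trans hβ
  set g : E → ℝ≥0∞ := D.indicator fun x => ENNReal.ofReal (‖gradient u x‖ ^ β)
  have hg : Measurable g := by
    refine Measurable.indicator ?_ hD
    have := measurable_gradient u
    fun_prop
  have hgI : ∫⁻ x, g x ∂μ = ∫⁻ x in D, ENNReal.ofReal (‖gradient u x‖ ^ β) ∂μ :=
    lintegral_indicator hD _
  -- Fundamental theorem along the curve, Jensen's inequality over a parameter interval of length at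
  -- most 1, and the bound H for the weight times the β-th power of the speed.
  have key : ∀ x ∈ A, ω x * ENNReal.ofReal (|u (γ 1 x) - u (γ τ₀ x)| ^ β) ≤
      ∫⁻ τ in Ioo τ₀ 1, H τ * g (γ τ x) := by
    intro x hx
    have hd : ∀ τ ∈ Ioo τ₀ 1 \ ∅, HasDerivAt (fun τ => u (γ τ x))
        (inner ℝ (gradient u (γ τ x)) (γ' τ x)) τ := by
      intro τ hτ
      have h2 := (hu _ (hγD x hx τ hτ.1)).hasGradientAt.hasFDerivAt.comp_hasDerivAt τ
        (hγ x hx τ hτ.1)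
      simpa [Function.comp_def] using h2
    have h2 := ofReal_abs_sub_le_lintegral h1 countable_empty (hγc x hx) hd
    have hmeas : AEMeasurable (fun τ => ENNReal.ofReal |inner ℝ (gradient u (γ τ x)) (γ' τ x)|)
        (volume.restrict (Ioo τ₀ 1)) := by
      refine ((measurable_deriv fun τ => u (γ τ x)).abs.ennreal_ofReal.aemeasurable).congr ?_
      filter_upwards [ae_restrict_mem measurableSet_Ioo] with τ hτ
      rw [(hd τ ⟨hτ, id⟩).deriv]
    rw [← ENNReal.ofReal_rpow_of_nonneg (abs_nonneg _) hβ0.le]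
    have h3 := (ENNReal.rpow_le_rpow h2 hβ0.le).trans (lintegral_rpow_le hmeas hβ)
    have h4 : volume.restrict (Ioo τ₀ 1) univ ^ (β - 1) ≤ 1 := by
      rw [Measure.restrict_apply_univ, Real.volume_Ioo]
      refine ENNReal.rpow_le_one ?_ (by linarith)
      rw [← ENNReal.ofReal_one]
      exact ENNReal.ofReal_le_ofReal (by linarith)
    refine (mul_le_mul_right (h3.trans (mul_le_of_le_one_left' h4)) _).trans ?_
    rw [← lintegral_const_mul' _ _ (hω x hx)]
    refine setLIntegral_mono' measurableSet_Ioo fun τ hτ => ?_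
    have h5 : g (γ τ x) = ENNReal.ofReal ‖gradient u (γ τ x)‖ ^ β := by
      simp only [g]
      rw [indicator_of_mem (hγD x hx τ hτ), ENNReal.ofReal_rpow_of_nonneg (norm_nonneg _) hβ0.le]
    rw [h5]
    refine le_trans ?_ (mul_le_mul_left (hH x hx τ hτ) _)
    rw [mul_assoc, ← ENNReal.mul_rpow_of_nonneg _ _ hβ0.le, ← ENNReal.ofReal_mul (norm_nonneg _),
      mul_comm ‖γ' τ x‖]
    gcongr
    exact abs_real_inner_le_norm _ _
  have hmeas2 : Measurable (Function.uncurry fun x τ => H τ * g (γ τ x)) :=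
    (hHm.comp measurable_snd).mul (hg.comp (hγm.comp measurable_swap))
  -- Tonelli's theorem, then for fixed τ the change of variables x ↦ γ τ x, whose inverse Jacobian
  -- is bounded by J. The constant is the integral of H·J.
  calc ∫⁻ x in A, ω x * ENNReal.ofReal (|u (γ 1 x) - u (γ τ₀ x)| ^ β) ∂μ
      ≤ ∫⁻ x in A, (∫⁻ τ in Ioo τ₀ 1, H τ * g (γ τ x)) ∂μ := setLIntegral_mono' hA key
    _ ≤ ∫⁻ x, (∫⁻ τ in Ioo τ₀ 1, H τ * g (γ τ x)) ∂μ := setLIntegral_le_lintegral _ _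
    _ = ∫⁻ τ in Ioo τ₀ 1, ∫⁻ x, H τ * g (γ τ x) ∂μ :=
        lintegral_lintegral_swap hmeas2.aemeasurable
    _ ≤ ∫⁻ τ in Ioo τ₀ 1, H τ * J τ * ∫⁻ x, g x ∂μ := by
        refine setLIntegral_mono' measurableSet_Ioo fun τ hτ => ?_
        have hgτ : Measurable fun x => g (γ τ x) := hg.comp (hγm.comp measurable_prodMk_left)
        rw [lintegral_const_mul _ hgτ, mul_assoc]
        exact mul_le_mul_right (hJ τ hτ g hg) _
    _ = _ := by
        have hHJ : Measurable fun τ => H τ * J τ := hHm.mul hJm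
        rw [← hgI, lintegral_mul_const _ hHJ]

/-- Change of variables for affine maps that move points in a fixed direction. -/
theorem lintegral_comp_add_smul {μ : Measure E} [μ.IsAddHaarMeasure] (ℓ : E →ᵃ[ℝ] ℝ) (q : E)
    (hq : 1 + ℓ.linear q ≠ 0) (f : E → ℝ≥0∞) :
    ∫⁻ x, f (x + ℓ x • q) ∂μ = ENNReal.ofReal |(1 + ℓ.linear q)⁻¹| * ∫⁻ x, f x ∂μ := by
  have hdet : LinearMap.det (LinearMap.transvection ℓ.linear q) = 1 + ℓ.linear q :=
    LinearMap.transvection.det _ _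
  have h1 := Measure.map_linearMap_addHaar_eq_smul_addHaar μ (by rw [hdet]; exact hq)
  have e : ∀ x, x + ℓ x • q = ℓ 0 • q + LinearMap.transvection ℓ.linear q x := fun x => by
    rw [LinearMap.transvection.apply, AffineMap.decomp ℓ]
    simp only [Pi.add_apply, map_zero, zero_add, add_smul]
    abel
  simp only [e]
  have hm : MeasurableEmbedding (LinearMap.transvection ℓ.linear q) :=
    ((LinearEquiv.ofIsUnitDet (v := Module.finBasis ℝ E) (v' := Module.finBasis ℝ E)
      (f := LinearMap.transvection ℓ.linear q) (by
        rw [LinearMap.det_toMatrix, hdet]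
        exact hq.isUnit)).toContinuousLinearEquiv).toHomeomorph.measurableEmbedding
  have h2 := hm.lintegral_map (μ := μ) fun y => f (ℓ 0 • q + y)
  rw [← h2, h1, lintegral_smul_measure, hdet, lintegral_add_left_eq_self, smul_eq_mul]

end Transport


/-! ### The nonlocal functional on convex sets. -/

theorem one_add_pow_mul_exp_le (n : ℕ) {a t : ℝ} (ha : 0 < a) (ht : 0 ≤ t) :
    (1 + t) ^ n * Real.exp (-(a * t)) ≤ n.factorial * Real.exp a / a ^ n := by
  have h := Real.pow_div_factorial_le_exp (a * (1 + t)) (by positivity) n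
  rw [div_le_iff₀ (by positivity), mul_pow] at h
  rw [le_div_iff₀ (by positivity)]
  have e : Real.exp (a * (1 + t)) * Real.exp (-(a * t)) = Real.exp a := by
    rw [← Real.exp_add]; ring_nf
  calc (1 + t) ^ n * Real.exp (-(a * t)) * a ^ n = a ^ n * (1 + t) ^ n * Real.exp (-(a * t)) := by
        ring
    _ ≤ Real.exp (a * (1 + t)) * n.factorial * Real.exp (-(a * t)) :=
        mul_le_mul_of_nonneg_right h (Real.exp_pos _).le
    _ = _ := by rw [mul_right_comm, e, mul_comm]

theorem rpow_le_one_add_sq {β t : ℝ} (hβ : 0 ≤ β) (hβ2 : β ≤ 2) (ht : 0 ≤ t) :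
    t ^ β ≤ (1 + t) ^ 2 := by
  calc t ^ β ≤ (1 + t) ^ β := Real.rpow_le_rpow ht (by linarith) hβ
    _ ≤ (1 + t) ^ (2 : ℝ) := Real.rpow_le_rpow_of_exponent_le (by linarith) hβ2
    _ = _ := Real.rpow_two _

/-- Powers are absorbed by exponentials, with the correct scaling. -/
theorem exists_exp_mul_rpow_le {β a : ℝ} (hβ : 0 ≤ β) (hβ2 : β ≤ 2) (ha : 0 < a) :
    ∃ C : ℝ, 0 < C ∧ ∀ h t : ℝ, 0 < h → 0 ≤ t → Real.exp (-(a * t / h)) * t ^ β ≤ C * h ^ β := by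
  refine ⟨(2 : ℕ).factorial * Real.exp a / a ^ 2, by positivity, fun h t hh ht => ?_⟩
  have hth : 0 ≤ t / h := by positivity
  have h1 := one_add_pow_mul_exp_le 2 ha hth
  have h2 := rpow_le_one_add_sq hβ hβ2 hth
  have e : t ^ β = (t / h) ^ β * h ^ β := by
    rw [← Real.mul_rpow hth hh.le, div_mul_cancel₀ _ hh.ne']
  rw [e, ← mul_assoc, mul_div_assoc]
  refine mul_le_mul_of_nonneg_right ?_ (by positivity)
  rw [mul_comm]
  exact (mul_le_mul_of_nonneg_right h2 (Real.exp_pos _).le).trans h1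

theorem measurable_indicator_of_continuousOn {X : Type*} [TopologicalSpace X] [MeasurableSpace X]
    [BorelSpace X] {u : X → ℝ} {D : Set X} (hu : ContinuousOn u D) (hD : MeasurableSet D) :
    Measurable (D.indicator u) := by
  classical
  rw [← piecewise_eq_indicator]
  exact hu.measurable_piecewise continuousOn_const hD

section Convex

variable {d : ℕ}

theorem lintegral_exp_mul_rpow_lt_top (d : ℕ) {β a : ℝ} (hβ : 0 ≤ β) (hβ2 : β ≤ 2) (ha : 0 < a) :
    ∫⁻ z : EuclideanSpace ℝ (Fin d), ENNReal.ofReal (Real.exp (-(a * ‖z‖)) * ‖z‖ ^ β) < ∞ := by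
  have h1 := finite_integral_one_add_norm (μ := (volume : Measure (EuclideanSpace ℝ (Fin d))))
    (r := d + 1) (by simp)
  set C : ℝ := (d + 3).factorial * Real.exp a / a ^ (d + 3)
  have hC : 0 ≤ C := by positivity
  have h2 : ∀ z : EuclideanSpace ℝ (Fin d), Real.exp (-(a * ‖z‖)) * ‖z‖ ^ β ≤
      C * (1 + ‖z‖) ^ (-(d + 1 : ℝ)) := fun z => by
    have h3 := one_add_pow_mul_exp_le (d + 3) ha (norm_nonneg z)
    have h4 := rpow_le_one_add_sq hβ hβ2 (norm_nonneg z)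
    have h5 : 0 < 1 + ‖z‖ := by positivity
    rw [Real.rpow_neg h5.le, ← div_eq_mul_inv, le_div_iff₀ (by positivity)]
    refine le_trans ?_ h3
    have e : (1 + ‖z‖) ^ (d + 1 : ℝ) = (1 + ‖z‖) ^ (d + 1) := by
      rw [← Real.rpow_natCast]; push_cast; rfl
    rw [e]
    calc Real.exp (-(a * ‖z‖)) * ‖z‖ ^ β * (1 + ‖z‖) ^ (d + 1)
        ≤ Real.exp (-(a * ‖z‖)) * (1 + ‖z‖) ^ 2 * (1 + ‖z‖) ^ (d + 1) := by gcongr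
      _ = _ := by ring
  refine (lintegral_mono fun z => ENNReal.ofReal_le_ofReal (h2 z)).trans_lt ?_
  simp only [ENNReal.ofReal_mul hC]
  rw [lintegral_const_mul' _ _ ENNReal.ofReal_ne_top]
  exact ENNReal.mul_lt_top ENNReal.ofReal_lt_top h1

theorem lintegral_comp_smul {f : EuclideanSpace ℝ (Fin d) → ℝ≥0∞} (hf : Measurable f) {h : ℝ}
    (hh : 0 < h) : ∫⁻ z, f (h⁻¹ • z) = ENNReal.ofReal (h ^ d) * ∫⁻ z, f z := by
  have h1 := Measure.map_addHaar_smul (volume : Measure (EuclideanSpace ℝ (Fin d)))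
    (inv_ne_zero hh.ne')
  rw [← lintegral_map (f := f) (g := fun z => h⁻¹ • z) hf (measurable_const_smul _), h1,
    lintegral_smul_measure, finrank_euclideanSpace_fin, inv_pow, inv_inv, abs_of_pos (by positivity),
    smul_eq_mul]

/-- The nonlocal functional on a convex open set. -/
theorem exists_lintegral_convex_le (d : ℕ) {β a : ℝ} (hβ : 1 < β) (hβ2 : β ≤ 2) (ha : 0 < a) :
    ∃ C : ℝ, 0 < C ∧ ∀ (D : Set (EuclideanSpace ℝ (Fin d))), IsOpen D → Convex ℝ D →
      ∀ u : EuclideanSpace ℝ (Fin d) → ℝ, (∀ x ∈ D, DifferentiableAt ℝ u x) → ∀ h : ℝ, 0 < h →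
      ∫⁻ x in D, ∫⁻ y in D, ENNReal.ofReal (Real.exp (-(a * dist y x / h)) * |u y - u x| ^ β) ≤
        ENNReal.ofReal (C * h ^ (β + d)) * ∫⁻ x in D, ENNReal.ofReal (‖gradient u x‖ ^ β) := by
  classical
  have hβ0 : 0 < β := one_pos.trans hβ
  set c := ∫⁻ z : EuclideanSpace ℝ (Fin d), ENNReal.ofReal (Real.exp (-(a * ‖z‖)) * ‖z‖ ^ β)
  have hc : c ≠ ∞ := (lintegral_exp_mul_rpow_lt_top d hβ0.le hβ2 ha).ne
  refine ⟨c.toReal + 1, by positivity, fun D hDo hDc u hu h hh => ?_⟩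
  have hD := hDo.measurableSet
  have huc : ContinuousOn u D := fun x hx => (hu x hx).continuousAt.continuousWithinAt
  set v : EuclideanSpace ℝ (Fin d) → ℝ := D.indicator u
  have hvm : Measurable v := measurable_indicator_of_continuousOn huc hD
  have hvu : ∀ x ∈ D, v x = u x := fun x hx => indicator_of_mem hx u
  -- Integrand in the variables x and z = y - x, cut off to pairs with both points in D; u is
  -- extended by zero to have a globally measurable function.
  set F : EuclideanSpace ℝ (Fin d) → EuclideanSpace ℝ (Fin d) → ℝ≥0∞ := fun x z =>
    (D ∩ {x | x + z ∈ D}).indicator (fun x => ENNReal.ofReal (Real.exp (-(a * ‖z‖ / h))) *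
      ENNReal.ofReal (|v (x + z) - v x| ^ β)) x
  have hFm : Measurable (Function.uncurry F) := by
    have hS : MeasurableSet {q : EuclideanSpace ℝ (Fin d) × EuclideanSpace ℝ (Fin d) |
        q.1 ∈ D ∧ q.1 + q.2 ∈ D} :=
      (measurable_fst hD).inter ((measurable_fst.add measurable_snd) hD)
    have e : Function.uncurry F = {q : EuclideanSpace ℝ (Fin d) × EuclideanSpace ℝ (Fin d) |
        q.1 ∈ D ∧ q.1 + q.2 ∈ D}.indicator (fun q =>
          ENNReal.ofReal (Real.exp (-(a * ‖q.2‖ / h))) *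
            ENNReal.ofReal (|v (q.1 + q.2) - v q.1| ^ β)) := by
      ext q
      simp only [Function.uncurry, F, indicator, mem_inter_iff, Set.mem_ofPred_eq]
    rw [e]
    refine Measurable.indicator ?_ hS
    have h1 : Measurable fun q : EuclideanSpace ℝ (Fin d) × EuclideanSpace ℝ (Fin d) =>
      v (q.1 + q.2) := hvm.comp (measurable_fst.add measurable_snd)
    have h2 : Measurable fun q : EuclideanSpace ℝ (Fin d) × EuclideanSpace ℝ (Fin d) => v q.1 :=
      hvm.comp measurable_fst
    fun_prop
  have step1 : ∀ x ∈ D, ∫⁻ y in D,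
      ENNReal.ofReal (Real.exp (-(a * dist y x / h)) * |u y - u x| ^ β) = ∫⁻ z, F x z := by
    intro x hx
    rw [← lintegral_indicator hD, ← lintegral_add_left_eq_self _ x]
    refine lintegral_congr fun z => ?_
    by_cases hz : x + z ∈ D
    · rw [indicator_of_mem hz]
      simp only [F]
      rw [indicator_of_mem (show x ∈ D ∩ {x | x + z ∈ D} from ⟨hx, hz⟩), hvu _ hz, hvu _ hx,
        ← ENNReal.ofReal_mul (Real.exp_pos _).le, dist_eq_norm, add_sub_cancel_left]
    · rw [indicator_of_notMem hz]
      simp only [F]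
      rw [indicator_of_notMem fun h => hz h.2]
  -- For fixed z the segments from x to x + z stay in D by convexity, and translations preserve the
  -- measure, so J = 1.
  have step2 : ∀ z, ∫⁻ x, F x z ≤
      ENNReal.ofReal (Real.exp (-(a * ‖z‖ / h)) * ‖z‖ ^ β) *
        ∫⁻ x in D, ENNReal.ofReal (‖gradient u x‖ ^ β) := by
    intro z
    have hA : MeasurableSet (D ∩ {x | x + z ∈ D}) := hD.inter ((measurable_add_const z) hD)
    have hseg : ∀ x ∈ D ∩ {x | x + z ∈ D}, ∀ τ ∈ Icc (0 : ℝ) 1, x + τ • z ∈ D := fun x hx τ hτ => by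
      have := hDc.add_smul_sub_mem hx.1 hx.2 hτ
      rwa [add_sub_cancel_left] at this
    have h1 := lintegral_sub_rpow_le (μ := volume) (u := u) hA hD hβ hu le_rfl zero_le_one
      (γ := fun τ x => x + τ • z) (γ' := fun _ _ => z)
      (by fun_prop) (fun x _ τ _ => by
        simpa using ((hasDerivAt_id τ).smul_const z).const_add x)
      (fun x hx τ hτ => hseg x hx τ (Ioo_subset_Icc_self hτ))
      (fun x hx => huc.comp (by fun_prop) fun τ hτ => hseg x hx τ hτ)
      (ω := fun _ => ENNReal.ofReal (Real.exp (-(a * ‖z‖ / h))))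
      (H := fun _ => ENNReal.ofReal (Real.exp (-(a * ‖z‖ / h)) * ‖z‖ ^ β)) (J := fun _ => 1)
      measurable_const measurable_const (fun _ _ => ENNReal.ofReal_ne_top)
      (fun x _ τ _ => by
        rw [ENNReal.ofReal_mul (Real.exp_pos _).le,
          ENNReal.ofReal_rpow_of_nonneg (norm_nonneg _) hβ0.le])
      (fun τ _ f _ => by rw [one_mul, lintegral_add_right_eq_self])
    simp only [mul_one, lintegral_const, Measure.restrict_apply_univ, Real.volume_Ioo, sub_zero,
      ENNReal.ofReal_one] at h1
    refine le_trans (le_of_eq ?_) h1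
    rw [← lintegral_indicator hA]
    refine lintegral_congr fun x => ?_
    by_cases hx : x ∈ D ∩ {x | x + z ∈ D}
    · simp only [F]
      rw [indicator_of_mem hx, indicator_of_mem hx, hvu _ hx.1, hvu _ hx.2, one_smul, zero_smul,
        add_zero]
    · simp only [F]
      rw [indicator_of_notMem hx, indicator_of_notMem hx]
  have step3 : ∫⁻ z : EuclideanSpace ℝ (Fin d),
      ENNReal.ofReal (Real.exp (-(a * ‖z‖ / h)) * ‖z‖ ^ β) = ENNReal.ofReal (h ^ (β + d)) * c := by
    have h1 := lintegral_comp_smul (d := d) (f := fun z => ENNReal.ofReal (Real.exp (-(a * ‖z‖)) *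
      ‖z‖ ^ β)) (by fun_prop) hh
    have h2 : ∀ z : EuclideanSpace ℝ (Fin d),
        ENNReal.ofReal (Real.exp (-(a * ‖z‖ / h)) * ‖z‖ ^ β) = ENNReal.ofReal (h ^ β) *
          ENNReal.ofReal (Real.exp (-(a * ‖h⁻¹ • z‖)) * ‖h⁻¹ • z‖ ^ β) := fun z => by
      rw [← ENNReal.ofReal_mul (by positivity), norm_smul, norm_inv, Real.norm_of_nonneg hh.le,
        Real.mul_rpow (by positivity) (norm_nonneg _), Real.inv_rpow hh.le]
      congr 1
      have : h ^ β ≠ 0 := (Real.rpow_pos_of_pos hh β).ne'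
      field_simp
    simp only [h2]
    rw [lintegral_const_mul' _ _ ENNReal.ofReal_ne_top, h1, ← mul_assoc,
      ← ENNReal.ofReal_mul (by positivity), Real.rpow_add hh, Real.rpow_natCast]
  calc _ = ∫⁻ x in D, ∫⁻ z, F x z := setLIntegral_congr_fun hD step1
    _ ≤ ∫⁻ x, ∫⁻ z, F x z := setLIntegral_le_lintegral _ _
    _ = ∫⁻ z, ∫⁻ x, F x z := lintegral_lintegral_swap hFm.aemeasurable
    _ ≤ ∫⁻ z, ENNReal.ofReal (Real.exp (-(a * ‖z‖ / h)) * ‖z‖ ^ β) *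
        ∫⁻ x in D, ENNReal.ofReal (‖gradient u x‖ ^ β) := lintegral_mono step2
    _ = ENNReal.ofReal (h ^ (β + d)) * c * ∫⁻ x in D, ENNReal.ofReal (‖gradient u x‖ ^ β) := by
        rw [lintegral_mul_const _ (by fun_prop), step3]
    _ ≤ _ := by
        refine mul_le_mul_left ?_ _
        rw [mul_comm, ENNReal.ofReal_mul (by positivity)]
        refine mul_le_mul_left ?_ _
        rw [← ENNReal.ofReal_toReal hc]
        exact ENNReal.ofReal_le_ofReal (by rw [ENNReal.toReal_ofReal (by positivity)]; linarith)

end Convex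


/-! ### One simplex: rays to a facet, strips along faces of codimension two. -/

theorem lintegral_rpow_Ioo_lt_top {r : ℝ} (hr : -1 < r) :
    ∫⁻ τ in Ioo (0 : ℝ) 1, ENNReal.ofReal (τ ^ r) < ∞ := by
  have h := (intervalIntegrable_iff_integrableOn_Ioo_of_le (zero_le_one (α := ℝ))).1
    (intervalIntegral.intervalIntegrable_rpow' (a := 0) (b := 1) hr)
  exact h.lintegral_lt_top

variable {d : ℕ} {s : Finset (EuclideanSpace ℝ (Fin d))}

theorem bary_add_smul (v x w : EuclideanSpace ℝ (Fin d)) (c : ℝ) :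
    bary s v (x + c • w) = bary s v x + c * (bary s v).linear w := by
  have h := (bary s v).map_vadd x (c • w)
  simp only [vadd_eq_add, map_smul, smul_eq_mul] at h
  rw [add_comm x, h, add_comm]

theorem bary_linear_sub (v y z : EuclideanSpace ℝ (Fin d)) :
    (bary s v).linear (y - z) = bary s v y - bary s v z :=
  ((bary s v).linearMap_vsub y z)

namespace IsCell

theorem mem_interior_of_pos (hs : IsCell s) {x : EuclideanSpace ℝ (Fin d)}
    (h : ∀ v ∈ s, 0 < bary s v x) : x ∈ interior (hull s) := hs.mem_interior_iff.2 h

/-- A function is compared with its value at the projection onto a facet. -/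
theorem exists_lintegral_ray_le (hs : IsCell s) {p q : EuclideanSpace ℝ (Fin d)} (hp : p ∈ s)
    (hq : q ∈ hull s) (hqp : bary s p q = 0) {β a : ℝ} (hβ : 1 < β) (hβ2 : β ≤ 2) (ha : 0 < a) :
    ∃ C : ℝ, 0 < C ∧ ∀ u : EuclideanSpace ℝ (Fin d) → ℝ, ContinuousOn u (hull s) →
      (∀ x ∈ interior (hull s), DifferentiableAt ℝ u x) → ∀ h : ℝ, 0 < h →
      ∫⁻ x in interior (hull s), ENNReal.ofReal (Real.exp (-(a * bary s p x / h)) *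
          |u x - u (x + bary s p x • (q - p))| ^ β) ≤
        ENNReal.ofReal (C * h ^ β) *
          ∫⁻ x in interior (hull s), ENNReal.ofReal (‖gradient u x‖ ^ β) := by
  have hβ0 : 0 < β := one_pos.trans hβ
  obtain ⟨A, hA, hexp⟩ := exists_exp_mul_rpow_le hβ0.le hβ2 ha
  -- The speed contributes τ^β and the Jacobian τ⁻²; their product is integrable because β > 1.
  set K := ∫⁻ τ in Ioo (0 : ℝ) 1, ENNReal.ofReal (τ ^ (β - 2))
  have hK : K ≠ ∞ := (lintegral_rpow_Ioo_lt_top (by linarith)).ne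
  set R := 2 * ‖q - p‖
  have hR : 0 ≤ R := by positivity
  refine ⟨A * R ^ β * K.toReal + 1, by positivity, fun u huc hu h hh => ?_⟩
  have hlin : ∀ v, (bary s v).linear (q - p) = bary s v q - bary s v p := fun v =>
    bary_linear_sub v q p
  have hlp : (bary s p).linear (q - p) = -1 := by
    rw [hlin, hqp, hs.bary_self hp]; ring
  -- The curves slow down quadratically at the facet, the coordinate of p being τ²·b_p(x). A linear
  -- parametrization would produce the non-integrable factor τ⁻¹.
  have hmem : ∀ x ∈ interior (hull s), ∀ τ ∈ Ioc (0 : ℝ) 1,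
      x + ((1 - τ ^ 2) * bary s p x) • (q - p) ∈ interior (hull s) := by
    intro x hx τ hτ
    rw [hs.mem_interior_iff] at hx ⊢
    intro v hv
    rw [bary_add_smul]
    have h1 := hx p hp
    have h2 : 0 ≤ 1 - τ ^ 2 := by nlinarith [hτ.1, hτ.2]
    by_cases hvp : v = p
    · rw [hvp, hlp]
      have : 0 < τ ^ 2 * bary s p x := mul_pos (pow_pos hτ.1 2) h1
      linarith
    · rw [hlin, hs.bary_ne hp hvp, sub_zero]
      have := hx v hv
      have := hs.bary_nonneg hq v
      positivity
  have hmemc : ∀ x ∈ interior (hull s), ∀ τ ∈ Icc (0 : ℝ) 1,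
      x + ((1 - τ ^ 2) * bary s p x) • (q - p) ∈ hull s := by
    intro x hx τ hτ
    rw [hs.mem_convexHull_iff]
    rw [hs.mem_interior_iff] at hx
    intro v hv
    rw [bary_add_smul]
    have h1 := hx p hp
    have h2 : 0 ≤ 1 - τ ^ 2 := by nlinarith [hτ.1, hτ.2]
    by_cases hvp : v = p
    · rw [hvp, hlp]
      have : 0 ≤ τ ^ 2 * bary s p x := by positivity
      linarith
    · rw [hlin, hs.bary_ne hp hvp, sub_zero]
      have := hx v hv
      have := hs.bary_nonneg hq v
      positivity
  have hbm : Continuous (bary s p) := continuous_bary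
  have h1 := lintegral_sub_rpow_le (μ := volume) (u := u) (A := interior (hull s))
    isOpen_interior.measurableSet isOpen_interior.measurableSet hβ hu le_rfl zero_le_one
    (γ := fun τ x => x + ((1 - τ ^ 2) * bary s p x) • (q - p))
    (γ' := fun τ x => (-(2 * τ) * bary s p x) • (q - p))
    (by
      have : Continuous fun r : ℝ × EuclideanSpace ℝ (Fin d) => bary s p r.2 :=
        hbm.comp continuous_snd
      exact Continuous.measurable (by fun_prop))
    (fun x _ τ _ => by
      have h2 : HasDerivAt (fun τ : ℝ => (1 - τ ^ 2) * bary s p x) (-(2 * τ) * bary s p x) τ := by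
        have := ((hasDerivAt_pow 2 τ).const_sub 1).mul_const (bary s p x)
        simpa using this
      exact (h2.smul_const (q - p)).const_add x)
    (fun x hx τ hτ => hmem x hx τ ⟨hτ.1, hτ.2.le⟩)
    (fun x hx => huc.comp (by fun_prop) fun τ hτ => hmemc x hx τ hτ)
    (ω := fun x => ENNReal.ofReal (Real.exp (-(a * bary s p x / h))))
    (H := fun τ => ENNReal.ofReal (A * h ^ β * R ^ β * τ ^ β))
    (J := fun τ => ENNReal.ofReal (τ ^ (-2 : ℝ)))
    (by fun_prop) (by fun_prop) (fun _ _ => ENNReal.ofReal_ne_top)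
    (fun x hx τ hτ => by
      have hb : 0 ≤ bary s p x := hs.bary_nonneg (interior_subset hx) p
      have hτ0 : 0 < τ := hτ.1
      rw [ENNReal.ofReal_rpow_of_nonneg (norm_nonneg _) hβ0.le,
        ← ENNReal.ofReal_mul (Real.exp_pos _).le]
      refine ENNReal.ofReal_le_ofReal ?_
      have e : ‖(-(2 * τ) * bary s p x) • (q - p)‖ = R * τ * bary s p x := by
        rw [norm_smul, Real.norm_eq_abs, abs_mul, abs_neg, abs_of_nonneg hb,
          abs_of_nonneg (by positivity)]
        simp only [R]; ring
      rw [e, Real.mul_rpow (by positivity) hb, Real.mul_rpow hR hτ0.le]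
      have h3 := hexp h _ hh hb
      calc _ = R ^ β * τ ^ β * (Real.exp (-(a * bary s p x / h)) * bary s p x ^ β) := by ring
        _ ≤ R ^ β * τ ^ β * (A * h ^ β) := by gcongr
        _ = _ := by ring)
    (fun τ hτ f _ => by
      have hτ0 : 0 < τ := hτ.1
      have h2 := lintegral_comp_add_smul (μ := volume) (bary s p) ((1 - τ ^ 2) • (q - p))
        (by rw [map_smul, hlp, smul_eq_mul]; have : 0 < τ ^ 2 := by positivity
            linarith) f
      have e : ∀ x, x + ((1 - τ ^ 2) * bary s p x) • (q - p) =
          x + bary s p x • (1 - τ ^ 2) • (q - p) := fun x => by rw [smul_smul, mul_comm]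
      simp only [e]
      rw [h2, map_smul, hlp, smul_eq_mul]
      refine le_of_eq ?_
      congr 2
      rw [show 1 + (1 - τ ^ 2) * -1 = τ ^ 2 by ring, abs_of_pos (by positivity),
        Real.rpow_neg hτ0.le, Real.rpow_two])
  have e1 : ∀ x, ENNReal.ofReal (Real.exp (-(a * bary s p x / h)) *
      |u x - u (x + bary s p x • (q - p))| ^ β) =
      ENNReal.ofReal (Real.exp (-(a * bary s p x / h))) *
        ENNReal.ofReal (|u (x + ((1 - (1 : ℝ) ^ 2) * bary s p x) • (q - p)) -
          u (x + ((1 - (0 : ℝ) ^ 2) * bary s p x) • (q - p))| ^ β) := fun x => by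
    rw [← ENNReal.ofReal_mul (Real.exp_pos _).le]; simp
  simp only [e1]
  refine h1.trans (mul_le_mul_left ?_ _)
  have e2 : ∀ τ ∈ Ioo (0 : ℝ) 1, ENNReal.ofReal (A * h ^ β * R ^ β * τ ^ β) *
      ENNReal.ofReal (τ ^ (-2 : ℝ)) = ENNReal.ofReal (A * h ^ β * R ^ β) *
        ENNReal.ofReal (τ ^ (β - 2)) := fun τ hτ => by
    have hτ0 : 0 < τ := hτ.1
    rw [← ENNReal.ofReal_mul (by positivity), ← ENNReal.ofReal_mul (by positivity), sub_eq_add_neg,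
      Real.rpow_add hτ0, mul_assoc]
  rw [setLIntegral_congr_fun measurableSet_Ioo e2, lintegral_const_mul' _ _ ENNReal.ofReal_ne_top]
  change _ * K ≤ _
  rw [← ENNReal.ofReal_toReal hK, ← ENNReal.ofReal_mul (by positivity)]
  refine ENNReal.ofReal_le_ofReal ?_
  rw [ENNReal.toReal_ofReal ENNReal.toReal_nonneg]
  have : 0 ≤ h ^ β := by positivity
  nlinarith

/-- Smallness of a function on a thin neighbourhood of a face of codimension two. -/
theorem exists_lintegral_strip_le (hs : IsCell s) {v₁ v₂ w : EuclideanSpace ℝ (Fin d)}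
    (h₁ : v₁ ∈ s) (h₂ : v₂ ∈ s) (hw : w ∈ s) (h₁₂ : v₁ ≠ v₂) (h₁w : v₁ ≠ w) (h₂w : v₂ ≠ w)
    {β θ : ℝ} (hβ : 1 < β) (hβ2 : β < 2) (hθ : 0 < θ) :
    ∃ C : ℝ, 0 < C ∧ ∀ u : EuclideanSpace ℝ (Fin d) → ℝ,
      (∀ x ∈ interior (hull s), DifferentiableAt ℝ u x) → ∀ h : ℝ, 0 < h →
      ∫⁻ x in interior (hull s) ∩ {x | θ ≤ bary s w x ∧ bary s v₁ x + bary s v₂ x ≤ h},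
          ENNReal.ofReal (|u x| ^ β) ≤
        ENNReal.ofReal (C * h ^ β) * ((∫⁻ x in interior (hull s), ENNReal.ofReal (|u x| ^ β)) +
          ∫⁻ x in interior (hull s), ENNReal.ofReal (‖gradient u x‖ ^ β)) := by
  have hβ0 : 0 < β := one_pos.trans hβ
  -- Chosen so that the speed factor τ^{-(q+1)β} and the Jacobian factor τ^{2q} cancel. The 2 is the
  -- codimension of the face, and q > 0 needs β < 2.
  set q := β / (2 - β) with hq
  have hq0 : 0 < q := div_pos hβ0 (by linarith)
  have hq1 : 2 * q - (q + 1) * β = 0 := by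
    rw [hq]; have : 2 - β ≠ 0 := by linarith
    field_simp; ring
  set R := q * (‖v₁ - w‖ + ‖v₂ - w‖)
  have hR : 0 ≤ R := by positivity
  refine ⟨2 ^ β * (R ^ β + (2 / θ) ^ β), by positivity, fun u hu h hh => ?_⟩
  set D := interior (hull s)
  have hDo : IsOpen D := isOpen_interior
  have hD := hDo.measurableSet
  have huc : ContinuousOn u D := fun x hx => (hu x hx).continuousAt.continuousWithinAt
  set A := D ∩ {x | θ ≤ bary s w x ∧ bary s v₁ x + bary s v₂ x ≤ h}
  have hbm : ∀ v, Continuous (bary s v) := fun v => continuous_bary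
  have hAm : MeasurableSet A := hD.inter ((measurableSet_le measurable_const
    (hbm w).measurable).inter (measurableSet_le ((hbm v₁).add (hbm v₂)).measurable
      measurable_const))
  have h2β : (1 : ℝ) ≤ 2 ^ β := Real.one_le_rpow one_le_two hβ0.le
  -- For h ≥ θ/2 the factor (2h/θ)^β is at least 1 and the estimate is trivial.
  rcases le_or_gt (θ / 2) h with hcase | hcase
  · refine (lintegral_mono_set inter_subset_left).trans ?_
    refine le_trans (le_add_of_nonneg_right zero_le) (le_mul_of_one_le_left zero_le ?_)
    rw [← ENNReal.ofReal_one]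
    refine ENNReal.ofReal_le_ofReal ?_
    have h1 : 1 ≤ (2 / θ) ^ β * h ^ β := by
      rw [← Real.mul_rpow (by positivity) hh.le]
      refine Real.one_le_rpow ?_ hβ0.le
      rw [div_mul_eq_mul_div, le_div_iff₀ hθ]; linarith
    have h3 : 0 ≤ R ^ β * h ^ β := by positivity
    nlinarith
  -- A dilation that keeps the strip inside the cell: it lowers the coordinate of w by at most M h =
  -- θ/2, and that coordinate starts at θ or more.
  set M := θ / (2 * h)
  have hM : 1 < M := by rw [lt_div_iff₀ (by positivity)]; linarith
  have hMh : M * h = θ / 2 := by simp only [M]; field_simp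
  set τ₀ := M ^ (-(1 / q))
  have hM0 : 0 < M := one_pos.trans hM
  have hτ₀ : 0 < τ₀ := Real.rpow_pos_of_pos hM0 _
  have hτ₁ : τ₀ ≤ 1 := Real.rpow_le_one_of_one_le_of_nonpos hM.le (by
    have : 0 < 1 / q := by positivity
    linarith)
  have hτM : τ₀ ^ (-q) = M := by
    rw [← Real.rpow_mul hM0.le, show -(1 / q) * -q = 1 by field_simp, Real.rpow_one]
  -- Moving by (m - 1)W multiplies the coordinates of v₁ and v₂ by m and takes the difference from
  -- w. The Jacobian is m².
  set W : EuclideanSpace ℝ (Fin d) → EuclideanSpace ℝ (Fin d) := fun x =>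
    bary s v₁ x • (v₁ - w) + bary s v₂ x • (v₂ - w)
  have hlin1 : ∀ v, (bary s v).linear (v₁ - w) = bary s v v₁ - bary s v w := fun v =>
    bary_linear_sub v v₁ w
  have hlin2 : ∀ v, (bary s v).linear (v₂ - w) = bary s v v₂ - bary s v w := fun v =>
    bary_linear_sub v v₂ w
  have hstretch : ∀ x ∈ A, ∀ m, 1 ≤ m → m ≤ M → x + (m - 1) • W x ∈ D := by
    intro x hx m hm1 hmM
    have hxp := hs.mem_interior_iff.1 hx.1
    refine hs.mem_interior_of_pos fun v hv => ?_
    have e : bary s v (x + (m - 1) • W x) = bary s v x + (m - 1) *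
        (bary s v₁ x * (bary s v v₁ - bary s v w) + bary s v₂ x * (bary s v v₂ - bary s v w)) := by
      rw [bary_add_smul, map_add, map_smul, map_smul, hlin1, hlin2, smul_eq_mul, smul_eq_mul]
    rw [e]
    have p1 := hxp v₁ h₁
    have p2 := hxp v₂ h₂
    have pv := hxp v hv
    by_cases hvw : v = w
    · rw [hvw, hs.bary_self hw, hs.bary_ne h₁ h₁w.symm, hs.bary_ne h₂ h₂w.symm]
      have h3 : θ ≤ bary s w x := hx.2.1
      have h4 : bary s v₁ x + bary s v₂ x ≤ h := hx.2.2
      have h5 : (m - 1) * (bary s v₁ x + bary s v₂ x) ≤ M * h :=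
        mul_le_mul (by linarith) h4 (by linarith) hM0.le
      rw [hMh] at h5
      linarith
    · rw [hs.bary_ne hw hvw, sub_zero, sub_zero]
      have := hs.bary_nonneg (hull_mem h₁) v
      have := hs.bary_nonneg (hull_mem h₂) v
      have : 0 ≤ m - 1 := by linarith
      positivity
  have hchange : ∀ m : ℝ, 0 < m → ∀ f : EuclideanSpace ℝ (Fin d) → ℝ≥0∞,
      ∫⁻ x, f (x + (m - 1) • W x) = ENNReal.ofReal (m ^ (-2 : ℝ)) * ∫⁻ x, f x := by
    intro m hm f
    have d1 : 1 + (bary s v₁).linear ((m - 1) • (v₁ - w)) = m := by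
      rw [map_smul, hlin1, hs.bary_self h₁, hs.bary_ne hw h₁w, smul_eq_mul]; ring
    have d2 : 1 + (bary s v₂).linear ((m - 1) • (v₂ - w)) = m := by
      rw [map_smul, hlin2, hs.bary_self h₂, hs.bary_ne hw h₂w, smul_eq_mul]; ring
    have c1 := lintegral_comp_add_smul (μ := volume) (bary s v₁) ((m - 1) • (v₁ - w))
      (by rw [d1]; exact hm.ne') f
    have c2 := lintegral_comp_add_smul (μ := volume) (bary s v₂) ((m - 1) • (v₂ - w))
      (by rw [d2]; exact hm.ne') fun x => f (x + bary s v₁ x • (m - 1) • (v₁ - w))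
    have e : ∀ x, x + (m - 1) • W x = x + bary s v₂ x • (m - 1) • (v₂ - w) +
        bary s v₁ (x + bary s v₂ x • (m - 1) • (v₂ - w)) • (m - 1) • (v₁ - w) := fun x => by
      rw [bary_add_smul v₁ x, map_smul, hlin2, hs.bary_ne h₂ h₁₂, hs.bary_ne hw h₁w]
      simp only [W, sub_self, smul_zero, mul_zero, add_zero, smul_add, smul_smul]
      rw [mul_comm (m - 1), mul_comm (m - 1)]
      abel
    simp only [e]
    rw [c2, c1, d1, d2, ← mul_assoc, ← ENNReal.ofReal_mul (abs_nonneg _)]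
    congr 2
    rw [abs_of_pos (by positivity), Real.rpow_neg hm.le, Real.rpow_two]
    field_simp
  have hτm : ∀ τ ∈ Icc τ₀ 1, 1 ≤ τ ^ (-q) ∧ τ ^ (-q) ≤ M := fun τ hτ => by
    have h0 : 0 < τ := hτ₀.trans_le hτ.1
    refine ⟨Real.one_le_rpow_of_pos_of_le_one_of_nonpos h0 hτ.2 (by linarith), ?_⟩
    rw [← hτM]
    exact Real.rpow_le_rpow_of_nonpos hτ₀ hτ.1 (by linarith)
  have hWc : Continuous W := by
    have := hbm v₁; have := hbm v₂; fun_prop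
  have hmain := lintegral_sub_rpow_le (μ := volume) (u := u) hAm hD hβ hu hτ₀.le hτ₁
    (γ := fun τ x => x + (τ ^ (-q) - 1) • W x)
    (γ' := fun τ x => (-q * τ ^ (-q - 1)) • W x)
    (by
      have h3 : Measurable fun r : ℝ × EuclideanSpace ℝ (Fin d) => W r.2 :=
        hWc.measurable.comp measurable_snd
      fun_prop)
    (fun x _ τ hτ => by
      have h3 := (Real.hasDerivAt_rpow_const (x := τ) (p := -q)
        (Or.inl (hτ₀.trans hτ.1).ne')).sub_const 1
      exact (h3.smul_const (W x)).const_add x)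
    (fun x hx τ hτ => hstretch x hx _ (hτm τ (Ioo_subset_Icc_self hτ)).1
      (hτm τ (Ioo_subset_Icc_self hτ)).2)
    (fun x hx => by
      refine huc.comp ?_ fun τ hτ => hstretch x hx _ (hτm τ hτ).1 (hτm τ hτ).2
      have h3 : ContinuousOn (fun τ : ℝ => τ ^ (-q)) (Icc τ₀ 1) :=
        continuousOn_id.rpow_const fun τ hτ => Or.inl (hτ₀.trans_le hτ.1).ne'
      fun_prop)
    (ω := fun _ => 1)
    (H := fun τ => ENNReal.ofReal (R ^ β * h ^ β * τ ^ (-((q + 1) * β))))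
    (J := fun τ => ENNReal.ofReal (τ ^ (2 * q)))
    (by fun_prop) (by fun_prop) (fun _ _ => ENNReal.one_ne_top)
    (fun x hx τ hτ => by
      have h0 : 0 < τ := hτ₀.trans hτ.1
      have p1 := hs.bary_nonneg (interior_subset hx.1) v₁
      have p2 := hs.bary_nonneg (interior_subset hx.1) v₂
      have h4 : bary s v₁ x + bary s v₂ x ≤ h := hx.2.2
      rw [one_mul, ENNReal.ofReal_rpow_of_nonneg (norm_nonneg _) hβ0.le]
      refine ENNReal.ofReal_le_ofReal ?_
      have hWn : ‖W x‖ ≤ h * (‖v₁ - w‖ + ‖v₂ - w‖) := by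
        refine (norm_add_le _ _).trans ?_
        rw [norm_smul, norm_smul, Real.norm_of_nonneg p1, Real.norm_of_nonneg p2]
        nlinarith [norm_nonneg (v₁ - w), norm_nonneg (v₂ - w)]
      have hn : ‖(-q * τ ^ (-q - 1)) • W x‖ ≤ R * h * τ ^ (-q - 1) := by
        rw [norm_smul, Real.norm_eq_abs, abs_mul, abs_neg, abs_of_pos hq0, abs_of_pos
          (Real.rpow_pos_of_pos h0 _)]
        have h5 : 0 ≤ q * τ ^ (-q - 1) := by positivity
        calc q * τ ^ (-q - 1) * ‖W x‖ ≤ q * τ ^ (-q - 1) * (h * (‖v₁ - w‖ + ‖v₂ - w‖)) := by gcongr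
          _ = _ := by simp only [R]; ring
      refine (Real.rpow_le_rpow (norm_nonneg _) hn hβ0.le).trans_eq ?_
      rw [Real.mul_rpow (by positivity) (by positivity), Real.mul_rpow hR hh.le,
        ← Real.rpow_mul h0.le]
      congr 2; ring)
    (fun τ hτ f _ => by
      have h0 : 0 < τ := hτ₀.trans hτ.1
      rw [hchange _ (Real.rpow_pos_of_pos h0 _) f, ← Real.rpow_mul h0.le]
      refine le_of_eq ?_
      congr 3; ring)
  have hHJ : ∫⁻ τ in Ioo τ₀ 1, ENNReal.ofReal (R ^ β * h ^ β * τ ^ (-((q + 1) * β))) *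
      ENNReal.ofReal (τ ^ (2 * q)) ≤ ENNReal.ofReal (R ^ β * h ^ β) := by
    have h3 : ∀ τ ∈ Ioo τ₀ 1, ENNReal.ofReal (R ^ β * h ^ β * τ ^ (-((q + 1) * β))) *
        ENNReal.ofReal (τ ^ (2 * q)) = ENNReal.ofReal (R ^ β * h ^ β) := fun τ hτ => by
      have h0 : 0 < τ := hτ₀.trans hτ.1
      rw [← ENNReal.ofReal_mul (by positivity), mul_assoc, ← Real.rpow_add h0,
        show -((q + 1) * β) + 2 * q = 0 by linarith, Real.rpow_zero, mul_one]
    rw [setLIntegral_congr_fun measurableSet_Ioo h3, lintegral_const, Measure.restrict_apply_univ,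
      Real.volume_Ioo]
    refine mul_le_of_le_one_right' ?_
    rw [← ENNReal.ofReal_one]
    exact ENNReal.ofReal_le_ofReal (by linarith)
  simp only [one_mul, Real.one_rpow, sub_self, zero_smul, add_zero, hτM] at hmain
  replace hmain := hmain.trans (mul_le_mul_left hHJ _)
  set v : EuclideanSpace ℝ (Fin d) → ℝ := D.indicator u
  have hvm : Measurable v := measurable_indicator_of_continuousOn huc hD
  have hvu : ∀ x ∈ D, v x = u x := fun x hx => indicator_of_mem hx u
  have hvf : Measurable fun x => ENNReal.ofReal (|v x| ^ β) := by fun_prop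
  -- The gain in h at the far end: the dilation spreads the strip with inverse Jacobian M⁻² ≤ M^{-β}
  -- = (2h/θ)^β.
  have hend : ∫⁻ x in A, ENNReal.ofReal (|v (x + (M - 1) • W x)| ^ β) ≤
      ENNReal.ofReal ((2 / θ) ^ β * h ^ β) * ∫⁻ x in D, ENNReal.ofReal (|u x| ^ β) := by
    refine (setLIntegral_le_lintegral _ _).trans ?_
    rw [hchange M hM0 fun x => ENNReal.ofReal (|v x| ^ β)]
    refine mul_le_mul' (ENNReal.ofReal_le_ofReal ?_) ?_
    · rw [← Real.mul_rpow (by positivity) hh.le]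
      have h3 : 2 / θ * h = M⁻¹ := by simp only [M]; field_simp
      rw [h3, ← Real.rpow_neg_eq_inv_rpow]
      exact Real.rpow_le_rpow_of_exponent_le hM.le (by linarith)
    · rw [← lintegral_indicator hD]
      refine lintegral_mono fun x => ?_
      by_cases hx : x ∈ D
      · rw [indicator_of_mem hx, hvu x hx]
      · simp only [v]
        rw [indicator_of_notMem hx, indicator_of_notMem hx]
        simp [Real.zero_rpow hβ0.ne']
  have hpt : ∀ x ∈ A, ENNReal.ofReal (|u x| ^ β) ≤ ENNReal.ofReal (2 ^ β) *
      (ENNReal.ofReal (|v (x + (M - 1) • W x)| ^ β) +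
        ENNReal.ofReal (|u x - u (x + (M - 1) • W x)| ^ β)) := by
    intro x hx
    rw [hvu _ (hstretch x hx M hM.le le_rfl), ← ENNReal.ofReal_add (by positivity) (by positivity),
      ← ENNReal.ofReal_mul (by positivity)]
    refine ENNReal.ofReal_le_ofReal ?_
    set y := u (x + (M - 1) • W x)
    have h3 : |u x| ≤ |y| + |u x - y| := by
      have := abs_add_le y (u x - y)
      rwa [add_sub_cancel] at this
    have h4 := Real.rpow_le_rpow (abs_nonneg _) h3 hβ0.le
    refine h4.trans ?_
    have h5 : |y| + |u x - y| ≤ 2 * max |y| |u x - y| := by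
      linarith [le_max_left |y| |u x - y|, le_max_right |y| |u x - y|]
    refine (Real.rpow_le_rpow (by positivity) h5 hβ0.le).trans ?_
    rw [Real.mul_rpow zero_le_two (le_max_of_le_left (abs_nonneg _))]
    gcongr
    rcases max_choice |y| |u x - y| with h6 | h6 <;> rw [h6]
    · exact le_add_of_nonneg_right (by positivity)
    · exact le_add_of_nonneg_left (by positivity)
  refine (setLIntegral_mono' hAm hpt).trans ?_
  have hvg : Measurable fun x => ENNReal.ofReal (|v (x + (M - 1) • W x)| ^ β) :=
    hvf.comp (by exact Continuous.measurable (by fun_prop))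
  rw [lintegral_const_mul' _ _ ENNReal.ofReal_ne_top, lintegral_add_left hvg]
  refine (mul_le_mul_right (add_le_add hend hmain) _).trans ?_
  rw [mul_add, mul_add, ← mul_assoc, ← mul_assoc, ← ENNReal.ofReal_mul (by positivity),
    ← ENNReal.ofReal_mul (by positivity)]
  have hRh : 0 ≤ R ^ β * h ^ β := by positivity
  have hθh : 0 ≤ (2 / θ) ^ β * h ^ β := by positivity
  refine add_le_add (mul_le_mul_left (ENNReal.ofReal_le_ofReal ?_) _)
    (mul_le_mul_left (ENNReal.ofReal_le_ofReal ?_) _)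
  · rw [mul_assoc (2 ^ β)]
    refine mul_le_mul_of_nonneg_left ?_ (by positivity)
    linarith
  · rw [mul_assoc (2 ^ β)]
    refine mul_le_mul_of_nonneg_left ?_ (by positivity)
    linarith

end IsCell


/-! ### Separation of simplices and exponential weights near faces. -/

variable {d : ℕ} {s t : Finset (EuclideanSpace ℝ (Fin d))}

theorem lintegral_biUnion_finset_le {X ι : Type*} [MeasurableSpace X] {μ : Measure X} (I : Finset ι)
    (A : ι → Set X) (f : X → ℝ≥0∞) :
    ∫⁻ x in ⋃ i ∈ I, A i, f x ∂μ ≤ ∑ i ∈ I, ∫⁻ x in A i, f x ∂μ := by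
  classical
  induction I using Finset.induction with
  | empty => simp
  | insert i I hi ih =>
    rw [Finset.set_biUnion_insert, Finset.sum_insert hi]
    exact (lintegral_union_le _ _ _).trans (add_le_add_right ih _)

theorem exists_lintegral_exp_le (d : ℕ) {b : ℝ} (hb : 0 < b) : ∃ C : ℝ, 0 < C ∧
    ∀ (x : EuclideanSpace ℝ (Fin d)) (h : ℝ), 0 < h →
      ∫⁻ y, ENNReal.ofReal (Real.exp (-(b * dist y x / h))) ≤ ENNReal.ofReal (C * h ^ d) := by
  set c := ∫⁻ z : EuclideanSpace ℝ (Fin d), ENNReal.ofReal (Real.exp (-(b * ‖z‖)))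
  have hc : c ≠ ∞ := by
    have := (lintegral_exp_mul_rpow_lt_top d le_rfl zero_le_two hb).ne
    simpa only [Real.rpow_zero, mul_one] using this
  refine ⟨c.toReal + 1, by positivity, fun x h hh => ?_⟩
  have h1 := lintegral_comp_smul (d := d) (f := fun z => ENNReal.ofReal (Real.exp (-(b * ‖z‖))))
    (by fun_prop) hh
  rw [← lintegral_add_left_eq_self _ x]
  have e : ∀ z : EuclideanSpace ℝ (Fin d), Real.exp (-(b * dist (x + z) x / h)) =
      Real.exp (-(b * ‖h⁻¹ • z‖)) := fun z => by
    rw [dist_eq_norm, add_sub_cancel_left, norm_smul, norm_inv, Real.norm_of_nonneg hh.le]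
    congr 2; ring
  simp only [e]
  rw [h1]
  change _ * c ≤ _
  rw [← ENNReal.ofReal_toReal hc, ← ENNReal.ofReal_mul (by positivity),
    ENNReal.toReal_ofReal ENNReal.toReal_nonneg]
  refine ENNReal.ofReal_le_ofReal ?_
  have : 0 < h ^ d := by positivity
  nlinarith

namespace IsCell

/-- Two simplices that meet in a common face separate linearly away from it. -/
theorem exists_bary_le_dist (hs : IsCell s) (ht : IsCell t)
    (hst : ∀ x ∈ hull s, x ∈ hull t → ∀ v ∈ s, v ∉ t → bary s v x = 0) :
    ∃ c : ℝ, 0 < c ∧ ∀ x ∈ hull s, ∀ y ∈ hull t, ∀ v ∈ s, v ∉ t →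
      c * bary s v x ≤ dist x y := by
  classical
  rcases (s \ t).eq_empty_or_nonempty with hempty | hne
  · refine ⟨1, one_pos, fun x _ y _ v hv hvt => ?_⟩
    have : v ∈ s \ t := Finset.mem_sdiff.2 ⟨hv, hvt⟩
    rw [hempty] at this
    simp at this
  set F := s ∩ t
  rcases F.eq_empty_or_nonempty with hF | hF
  -- Without common vertices the simplices are disjoint and compact. A positive distance suffices,
  -- since the coordinates are at most 1.
  · have hdisj : Disjoint (hull s) (hull t) := by
      refine Set.disjoint_left.2 fun x hxs hxt => ?_
      have h1 : ∑ v ∈ s, bary s v x = 0 := Finset.sum_eq_zero fun v hv => by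
        refine hst x hxs hxt v hv fun hvt => ?_
        have : v ∈ F := Finset.mem_inter.2 ⟨hv, hvt⟩
        rw [hF] at this
        simp at this
      rw [hs.sum_bary] at h1
      exact one_ne_zero h1
    obtain ⟨r, hr, hrd⟩ := hdisj.exists_cthickenings hs.isCompact ht.isCompact.isClosed
    refine ⟨r, hr, fun x hx y hy v _ _ => ?_⟩
    by_contra! hlt
    have h1 : dist x y < r := hlt.trans_le (mul_le_of_le_one_right hr.le (hs.bary_le_one hx v))
    refine Set.disjoint_left.1 hrd (Metric.self_subset_cthickening _ hx) ?_
    exact Metric.mem_cthickening_of_dist_le x y r _ hy h1.le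
  -- A closed convex cone with apex c₀, the barycentre of the common face, and containing t. It is
  -- to be separated from the face of s opposite to the common one.
  set K : Set (EuclideanSpace ℝ (Fin d)) := {x | ∀ w ∈ t, w ∉ s → 0 ≤ bary t w x}
  set c₀ : EuclideanSpace ℝ (Fin d) := ∑ v ∈ F, (1 / F.card : ℝ) • v
  have hcard : 0 < (F.card : ℝ) := by exact_mod_cast hF.card_pos
  have hsum1 : ∑ v ∈ F, (1 / F.card : ℝ) = 1 := by
    rw [Finset.sum_const, nsmul_eq_mul]; field_simp
  have hct : ∀ w, bary t w c₀ = if w ∈ F then 1 / (F.card : ℝ) else 0 := fun w =>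
    ht.bary_eq_ite Finset.inter_subset_right hsum1 rfl w
  have hcs : ∀ w, bary s w c₀ = if w ∈ F then 1 / (F.card : ℝ) else 0 := fun w =>
    hs.bary_eq_ite Finset.inter_subset_left hsum1 rfl w
  have hKc : c₀ ∈ K := fun w hw hws => by
    rw [hct, if_neg fun h => hws (Finset.mem_inter.1 h).1]
  have hlin : ∀ w, bary t w = fun x => bary t w x := fun w => rfl
  have hcomb : ∀ (u : Finset (EuclideanSpace ℝ (Fin d))) (w x y : EuclideanSpace ℝ (Fin d)) (τ : ℝ),
      bary u w (x + τ • (y - x)) = bary u w x + τ * (bary u w y - bary u w x) := fun u w x y τ => by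
    rw [bary_add_smul, bary_linear_sub]
  have hKconv : Convex ℝ K := by
    intro x hx y hy α β hα hβ hαβ w hw hws
    have e : α • x + β • y = x + β • (y - x) := by
      rw [← eq_sub_iff_add_eq] at hαβ
      rw [hαβ, sub_smul, one_smul, smul_sub]; abel
    rw [e, hcomb]
    have h1 := hx w hw hws
    have h2 := hy w hw hws
    have h3 : α = 1 - β := by linarith
    nlinarith
  have hKclosed : IsClosed K := by
    have : K = ⋂ w ∈ t, ⋂ (_ : w ∉ s), {x | 0 ≤ bary t w x} := by
      ext x; simp [K]
    rw [this]
    exact isClosed_biInter fun w _ => isClosed_iInter fun _ =>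
      isClosed_le continuous_const continuous_bary
  -- A point z of the opposite face lying in K would, by a small step from c₀ towards z, give a
  -- common point of s and t with a nonzero coordinate at some vertex of s outside t.
  have hdisj : Disjoint (hull (s \ t)) K := by
    refine Set.disjoint_left.2 fun z hz hzK => ?_
    have hzs := (hs.mem_convexHull_subset_iff (u := s \ t) Finset.sdiff_subset).1 hz
    have hev : ∀ᶠ ε : ℝ in nhdsWithin 0 (Ioi 0), ε < 1 ∧ ∀ w ∈ F,
        0 ≤ bary t w (c₀ + ε • (z - c₀)) := by
      refine (((gt_mem_nhds zero_lt_one).filter_mono nhdsWithin_le_nhds)).and ?_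
      rw [Filter.eventually_all_finset]
      intro w hw
      have hcont : Continuous fun ε : ℝ => bary t w (c₀ + ε • (z - c₀)) :=
        continuous_bary.comp (by fun_prop)
      have h0 : 0 < bary t w (c₀ + (0 : ℝ) • (z - c₀)) := by
        rw [zero_smul, add_zero, hct, if_pos hw]; exact one_div_pos.2 hcard
      exact ((hcont.continuousAt.eventually_const_lt h0).filter_mono nhdsWithin_le_nhds).mono
        fun _ h => h.le
    obtain ⟨ε, ⟨hε1, hεF⟩, hε0⟩ := (hev.and self_mem_nhdsWithin).exists
    have hε0 : 0 < ε := hε0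
    set x := c₀ + ε • (z - c₀)
    have hxs : x ∈ hull s := by
      rw [hs.mem_convexHull_iff]
      intro v hv
      simp only [x]
      rw [hcomb, hcs]
      have := hs.bary_nonneg hzs.1 v
      have h3 : 0 ≤ if v ∈ F then 1 / (F.card : ℝ) else 0 := by
        split_ifs
        exacts [(one_div_pos.2 hcard).le, le_rfl]
      nlinarith
    have hxt : x ∈ hull t := by
      rw [ht.mem_convexHull_iff]
      intro w hw
      by_cases hwF : w ∈ F
      · exact hεF w hwF
      · simp only [x]
        have hws : w ∉ s := fun h => hwF (Finset.mem_inter.2 ⟨h, hw⟩)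
        rw [hcomb, hct, if_neg hwF, zero_add, sub_zero]
        exact mul_nonneg hε0.le (hzK w hw hws)
    have h0 := hst x hxs hxt
    have h1 : ∑ v ∈ s, bary s v z = 0 := by
      refine Finset.sum_eq_zero fun v hv => ?_
      by_cases hvt : v ∈ t
      · exact hzs.2 v hv fun h => (Finset.mem_sdiff.1 h).2 hvt
      · have h2 := h0 v hv hvt
        simp only [x] at h2
        rw [hcomb, hcs, if_neg fun h => hvt (Finset.mem_inter.1 h).2, zero_add, sub_zero] at h2
        exact (mul_eq_zero.1 h2).resolve_left hε0.ne'
    rw [hs.sum_bary] at h1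
    exact one_ne_zero h1
  obtain ⟨f, a, b, hfa, hab, hfb⟩ := geometric_hahn_banach_compact_closed
    (convex_convexHull ℝ _) ((s \ t).finite_toSet.isCompact_convexHull ℝ) hKconv hKclosed hdisj
  -- A linear functional bounded below on a cone attains its minimum at the apex.
  have hcone : ∀ y ∈ K, f c₀ ≤ f y := by
    intro y hy
    by_contra! hlt
    obtain ⟨n, hn⟩ := exists_nat_gt ((f c₀ - b) / (f c₀ - f y))
    rw [div_lt_iff₀ (by linarith)] at hn
    have hmem : c₀ + (n : ℝ) • (y - c₀) ∈ K := fun w hw hws => by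
      rw [hcomb, hct, if_neg fun h => hws (Finset.mem_inter.1 h).1, zero_add, sub_zero]
      exact mul_nonneg (Nat.cast_nonneg n) (hy w hw hws)
    have h1 := hfb _ hmem
    rw [map_add, map_smul, map_sub, smul_eq_mul] at h1
    linarith
  have hFle : ∀ g ∈ F, f g ≤ f c₀ := by
    intro g hg
    have hmem : c₀ + (-1 : ℝ) • (g - c₀) ∈ K := fun w hw hws => by
      have hwF : w ∉ F := fun h => hws (Finset.mem_inter.1 h).1
      rw [hcomb, hct, if_neg hwF, ht.bary_ne (Finset.mem_inter.1 hg).2 (by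
        rintro rfl; exact hwF hg)]
      norm_num
    have h1 := hcone _ hmem
    rw [map_add, map_smul, map_sub, smul_eq_mul] at h1
    linarith
  have hgap : 0 < f c₀ - a := by have := hfb c₀ hKc; linarith
  refine ⟨(f c₀ - a) / (‖f‖ + 1), by positivity, fun x hx y hy v hv hvt => ?_⟩
  have hyK : y ∈ K := fun w hw _ => ht.bary_nonneg hy w
  have hfx : f x ≤ f c₀ - (f c₀ - a) * bary s v x := by
    have e1 : f x = ∑ w ∈ s, bary s w x * f w := by
      conv_lhs => rw [← hs.sum_bary_smul x]
      rw [map_sum]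
      exact Finset.sum_congr rfl fun w _ => by rw [map_smul, smul_eq_mul]
    have e2 : f c₀ - (f c₀ - a) * bary s v x =
        ∑ w ∈ s, (bary s w x * f c₀ - if w = v then (f c₀ - a) * bary s v x else 0) := by
      rw [Finset.sum_sub_distrib, ← Finset.sum_mul, hs.sum_bary, one_mul, Finset.sum_ite_eq',
        if_pos hv]
    rw [e1, e2]
    refine Finset.sum_le_sum fun w hw => ?_
    have hb := hs.bary_nonneg hx w
    by_cases hwt : w ∈ t
    · have hwv : w ≠ v := by rintro rfl; exact hvt hwt
      rw [if_neg hwv, sub_zero]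
      exact mul_le_mul_of_nonneg_left (hFle w (Finset.mem_inter.2 ⟨hw, hwt⟩)) hb
    · have h3 : f w < a := hfa w (hull_mem (Finset.mem_sdiff.2 ⟨hw, hwt⟩))
      split_ifs with hwv
      · subst hwv; nlinarith
      · nlinarith
  have h4 := hcone y hyK
  have h5 : f y - f x ≤ ‖f‖ * dist x y := by
    rw [← map_sub, dist_comm, dist_eq_norm]
    exact (le_abs_self _).trans (f.le_opNorm _)
  rw [div_mul_eq_mul_div, div_le_iff₀ (by positivity)]
  have := dist_nonneg (x := x) (y := y)
  nlinarith

/-- Exponentially weighted version of the estimate near a face of codimension two. -/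
theorem exists_lintegral_exp_bary_le (hs : IsCell s) (hd : 2 ≤ d)
    {v₁ v₂ : EuclideanSpace ℝ (Fin d)} (h₁ : v₁ ∈ s) (h₂ : v₂ ∈ s) (h₁₂ : v₁ ≠ v₂)
    {β b : ℝ} (hβ : 1 < β) (hβ2 : β < 2) (hb : 0 < b) :
    ∃ C : ℝ, 0 < C ∧ ∀ u : EuclideanSpace ℝ (Fin d) → ℝ,
      (∀ x ∈ interior (hull s), DifferentiableAt ℝ u x) → ∀ h : ℝ, 0 < h →
      ∫⁻ x in interior (hull s), ENNReal.ofReal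
          (Real.exp (-(b * (bary s v₁ x + bary s v₂ x) / h)) * |u x| ^ β) ≤
        ENNReal.ofReal (C * h ^ β) * ((∫⁻ x in interior (hull s), ENNReal.ofReal (|u x| ^ β)) +
          ∫⁻ x in interior (hull s), ENNReal.ofReal (‖gradient u x‖ ^ β)) := by
  classical
  have hβ0 : 0 < β := one_pos.trans hβ
  set θ : ℝ := 1 / (2 * (d + 1))
  have hθ : 0 < θ := by positivity
  have hbm : ∀ v, Continuous (bary s v) := fun v => continuous_bary
  have hstrip : ∀ w ∈ s, w ≠ v₁ → w ≠ v₂ → ∃ C : ℝ, 0 < C ∧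
      ∀ u : EuclideanSpace ℝ (Fin d) → ℝ,
      (∀ x ∈ interior (hull s), DifferentiableAt ℝ u x) → ∀ h : ℝ, 0 < h →
      ∫⁻ x in interior (hull s) ∩ {x | θ ≤ bary s w x ∧ bary s v₁ x + bary s v₂ x ≤ h},
          ENNReal.ofReal (|u x| ^ β) ≤
        ENNReal.ofReal (C * h ^ β) * ((∫⁻ x in interior (hull s), ENNReal.ofReal (|u x| ^ β)) +
          ∫⁻ x in interior (hull s), ENNReal.ofReal (‖gradient u x‖ ^ β)) := fun w hw h1 h2 =>
    hs.exists_lintegral_strip_le h₁ h₂ hw h₁₂ h1.symm h2.symm hβ hβ2 hθ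
  choose! Cw hCw hstrip using hstrip
  set I := (s.erase v₁).erase v₂
  have hI : ∀ w, w ∈ I ↔ w ∈ s ∧ w ≠ v₁ ∧ w ≠ v₂ := fun w => by
    simp only [I, Finset.mem_erase]; tauto
  set C₁ := ∑ w ∈ I, Cw w with hC₁
  have hC₁0 : 0 ≤ C₁ := Finset.sum_nonneg fun w hw =>
    (hCw w ((hI w).1 hw).1 ((hI w).1 hw).2.1 ((hI w).1 hw).2.2).le
  have hstrip2 : ∀ u : EuclideanSpace ℝ (Fin d) → ℝ,
      (∀ x ∈ interior (hull s), DifferentiableAt ℝ u x) → ∀ h : ℝ, 0 < h →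
      ∫⁻ x in interior (hull s) ∩ {x | bary s v₁ x + bary s v₂ x ≤ h},
          ENNReal.ofReal (|u x| ^ β) ≤
        ENNReal.ofReal ((C₁ + 2 ^ β) * h ^ β) *
          ((∫⁻ x in interior (hull s), ENNReal.ofReal (|u x| ^ β)) +
          ∫⁻ x in interior (hull s), ENNReal.ofReal (‖gradient u x‖ ^ β)) := by
    intro u hu h hh
    have hhβ : 0 ≤ h ^ β := by positivity
    rcases lt_or_ge (1 / 2) h with hcase | hcase
    · refine (lintegral_mono_set inter_subset_left).trans ?_
      refine le_trans (le_add_of_nonneg_right zero_le) (le_mul_of_one_le_left zero_le ?_)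
      rw [← ENNReal.ofReal_one]
      refine ENNReal.ofReal_le_ofReal ?_
      have h1 : 1 ≤ 2 ^ β * h ^ β := by
        rw [← Real.mul_rpow zero_le_two hh.le]
        exact Real.one_le_rpow (by linarith) hβ0.le
      nlinarith
    -- When the coordinates of v₁ and v₂ sum to at most 1/2, the remaining d - 1 ones sum to at
    -- least 1/2, so one of them is at least θ. Finitely many strips therefore cover the set.
    · have hsub : interior (hull s) ∩ {x | bary s v₁ x + bary s v₂ x ≤ h} ⊆ ⋃ w ∈ I,
          interior (hull s) ∩ {x | θ ≤ bary s w x ∧ bary s v₁ x + bary s v₂ x ≤ h} := by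
        rintro x ⟨hx, hxh⟩
        have hxh : bary s v₁ x + bary s v₂ x ≤ h := hxh
        by_contra hcon
        simp only [mem_iUnion, not_exists] at hcon
        have hlt : ∀ w ∈ I, bary s w x < θ := fun w hw => by
          by_contra! hle
          exact hcon w hw ⟨hx, hle, hxh⟩
        have h1 := hs.sum_bary x
        rw [← Finset.add_sum_erase s _ h₁, ← Finset.add_sum_erase (s.erase v₁) _
          (Finset.mem_erase.2 ⟨h₁₂.symm, h₂⟩)] at h1
        have hcardI : (I.card : ℝ) + 2 = d + 1 := by
          have h2 : I.card = d - 1 := by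
            rw [Finset.card_erase_of_mem (Finset.mem_erase.2 ⟨h₁₂.symm, h₂⟩),
              Finset.card_erase_of_mem h₁, hs.card_eq]; omega
          rw [h2]; push_cast [show 1 ≤ d by omega]; ring
        have h3 : ∑ w ∈ I, bary s w x ≤ I.card • θ :=
          Finset.sum_le_card_nsmul _ _ _ fun w hw => (hlt w hw).le
        rw [nsmul_eq_mul] at h3
        have h4 : (I.card : ℝ) * θ < 1 / 2 := by
          have : (d + 1 : ℝ) * θ = 1 / 2 := by simp only [θ]; field_simp
          nlinarith
        change bary s v₁ x + (bary s v₂ x + ∑ w ∈ I, bary s w x) = 1 at h1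
        linarith
      refine (lintegral_mono_set hsub).trans ((lintegral_biUnion_finset_le I _ _).trans ?_)
      have h1 : ∀ w ∈ I, ∫⁻ x in interior (hull s) ∩
          {x | θ ≤ bary s w x ∧ bary s v₁ x + bary s v₂ x ≤ h}, ENNReal.ofReal (|u x| ^ β) ≤
          ENNReal.ofReal (Cw w * h ^ β) *
          ((∫⁻ x in interior (hull s), ENNReal.ofReal (|u x| ^ β)) +
          ∫⁻ x in interior (hull s), ENNReal.ofReal (‖gradient u x‖ ^ β)) := fun w hw =>
        hstrip w ((hI w).1 hw).1 ((hI w).1 hw).2.1 ((hI w).1 hw).2.2 u hu h hh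
      refine (Finset.sum_le_sum h1).trans ?_
      rw [← Finset.sum_mul, ← ENNReal.ofReal_sum_of_nonneg fun w hw =>
        mul_nonneg (hCw w ((hI w).1 hw).1 ((hI w).1 hw).2.1 ((hI w).1 hw).2.2).le hhβ,
        ← Finset.sum_mul]
      refine mul_le_mul_left (ENNReal.ofReal_le_ofReal (mul_le_mul_of_nonneg_right ?_ hhβ)) _
      exact le_add_of_nonneg_right (by positivity)
  set B : ℝ := (4 : ℕ).factorial * Real.exp b / b ^ 4
  have hB : 0 < B := by positivity
  have hsummable : Summable fun j : ℕ => B / (j + 1 : ℝ) ^ 2 := by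
    have h1 := (summable_nat_add_iff 1).2 (Real.summable_one_div_nat_pow.2 one_lt_two)
    refine (h1.mul_left B).congr fun j => ?_
    push_cast; ring
  have hexpj : ∀ j : ℕ, Real.exp (-(b * j)) * (j + 1 : ℝ) ^ β ≤ B / (j + 1 : ℝ) ^ 2 := fun j => by
    have h1 := one_add_pow_mul_exp_le 4 hb (Nat.cast_nonneg j)
    have h2 := rpow_le_one_add_sq hβ0.le hβ2.le (show (0 : ℝ) ≤ j + 1 by positivity)
    have h3 : (j + 1 : ℝ) ^ β ≤ (j + 1 : ℝ) ^ 2 := by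
      rw [← Real.rpow_two]
      exact Real.rpow_le_rpow_of_exponent_le (by linarith [(Nat.cast_nonneg j : (0 : ℝ) ≤ j)]) hβ2.le
    rw [le_div_iff₀ (by positivity)]
    calc Real.exp (-(b * j)) * (j + 1 : ℝ) ^ β * (j + 1 : ℝ) ^ 2
        ≤ Real.exp (-(b * j)) * (j + 1 : ℝ) ^ 2 * (j + 1 : ℝ) ^ 2 := by gcongr
      _ = (1 + j : ℝ) ^ 4 * Real.exp (-(b * j)) := by ring
      _ ≤ B := h1
  set S := ∑' j : ℕ, B / (j + 1 : ℝ) ^ 2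
  have hS : 0 ≤ S := tsum_nonneg fun j => by positivity
  refine ⟨(C₁ + 2 ^ β) * S + 1, by positivity, fun u hu h hh => ?_⟩
  set D := interior (hull s)
  have hD : MeasurableSet D := isOpen_interior.measurableSet
  have huc : ContinuousOn u D := fun x hx => (hu x hx).continuousAt.continuousWithinAt
  set v := D.indicator u
  have hvm : Measurable v := measurable_indicator_of_continuousOn huc hD
  set σ : EuclideanSpace ℝ (Fin d) → ℝ := fun x => bary s v₁ x + bary s v₂ x
  have hσm : Continuous σ := (hbm v₁).add (hbm v₂)
  have hSm : ∀ r : ℝ, MeasurableSet {x | σ x ≤ r} := fun r =>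
    measurableSet_le hσm.measurable measurable_const
  -- Slicing by the integer part j of σ/h: the decay of exp(-bj) beats the growth (j+1)^β of the
  -- strip estimate at height (j+1)h.
  have hpt : ∀ x ∈ D, ENNReal.ofReal (Real.exp (-(b * σ x / h)) * |u x| ^ β) ≤
      ∑' j : ℕ, ENNReal.ofReal (Real.exp (-(b * j))) *
        ({x | σ x ≤ (j + 1) * h}.indicator (fun x => ENNReal.ofReal (|v x| ^ β)) x) := by
    intro x hx
    have hσ0 : 0 ≤ σ x := add_nonneg (hs.bary_nonneg (interior_subset hx) v₁)
      (hs.bary_nonneg (interior_subset hx) v₂)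
    have hσh : 0 ≤ σ x / h := by positivity
    set j := ⌊σ x / h⌋₊
    refine le_trans ?_ (ENNReal.le_tsum j)
    have h1 : σ x ≤ (j + 1) * h := by
      rw [← div_le_iff₀ hh]; exact (Nat.lt_floor_add_one _).le
    rw [indicator_of_mem (show x ∈ {x | σ x ≤ (j + 1) * h} from h1),
      ← ENNReal.ofReal_mul (Real.exp_pos _).le, show v x = u x from indicator_of_mem hx u]
    refine ENNReal.ofReal_le_ofReal (mul_le_mul_of_nonneg_right (Real.exp_le_exp.2 ?_)
      (by positivity))
    have h2 : (j : ℝ) ≤ σ x / h := Nat.floor_le hσh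
    rw [mul_div_assoc]
    nlinarith
  have hvf : Measurable fun x => ENNReal.ofReal (|v x| ^ β) := by fun_prop
  refine (setLIntegral_mono' hD hpt).trans ?_
  rw [lintegral_tsum fun j => ((hvf.indicator (hSm _)).const_mul _).aemeasurable]
  set Q := (∫⁻ x in D, ENNReal.ofReal (|u x| ^ β)) + ∫⁻ x in D, ENNReal.ofReal (‖gradient u x‖ ^ β)
  have hterm : ∀ j : ℕ, ∫⁻ x in D, ENNReal.ofReal (Real.exp (-(b * j))) *
        ({x | σ x ≤ (j + 1) * h}.indicator (fun x => ENNReal.ofReal (|v x| ^ β)) x) ≤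
      ENNReal.ofReal (B / (j + 1 : ℝ) ^ 2) * (ENNReal.ofReal ((C₁ + 2 ^ β) * h ^ β) * Q) := by
    intro j
    rw [lintegral_const_mul' _ _ ENNReal.ofReal_ne_top, lintegral_indicator (hSm _),
      Measure.restrict_restrict (hSm _), inter_comm]
    have h1 := hstrip2 u hu ((j + 1) * h) (by positivity)
    have h2 : ∫⁻ x in D ∩ {x | σ x ≤ (j + 1) * h}, ENNReal.ofReal (|v x| ^ β) =
        ∫⁻ x in D ∩ {x | σ x ≤ (j + 1) * h}, ENNReal.ofReal (|u x| ^ β) :=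
      setLIntegral_congr_fun (hD.inter (hSm _)) fun x hx => by
        simp only [v]; rw [indicator_of_mem hx.1]
    rw [h2]
    refine (mul_le_mul_right h1 _).trans ?_
    rw [← mul_assoc, ← mul_assoc, ← ENNReal.ofReal_mul (Real.exp_pos _).le,
      ← ENNReal.ofReal_mul (by positivity)]
    refine mul_le_mul_left (ENNReal.ofReal_le_ofReal ?_) _
    rw [Real.mul_rpow (by positivity) hh.le]
    have h3 := mul_le_mul_of_nonneg_right (hexpj j) (show 0 ≤ (C₁ + 2 ^ β) * h ^ β by positivity)
    linarith
  refine (ENNReal.tsum_le_tsum hterm).trans ?_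
  rw [ENNReal.tsum_mul_right, ← ENNReal.ofReal_tsum_of_nonneg (fun j => by positivity) hsummable,
    ← mul_assoc, ← ENNReal.ofReal_mul hS]
  refine mul_le_mul_left (ENNReal.ofReal_le_ofReal ?_) _
  have : 0 ≤ h ^ β := by positivity
  nlinarith

end IsCell


/-! ### The nonlocal functional for a pair of cells. -/

variable {d : ℕ} {s t : Finset (EuclideanSpace ℝ (Fin d))}

/-- The nonlocal functional whose kernel decays exponentially at scale `h`. -/
def nonlocalForm (a β h : ℝ) (u : EuclideanSpace ℝ (Fin d) → ℝ)
    (A B : Set (EuclideanSpace ℝ (Fin d))) : ℝ≥0∞ :=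
  ∫⁻ x in A, ∫⁻ y in B, ENNReal.ofReal (Real.exp (-(a * dist y x / h)) * |u y - u x| ^ β)

/-- The `β`-th power of the norm of `W^{1,β}(A)`. -/
def sobolevMass (β : ℝ) (u : EuclideanSpace ℝ (Fin d) → ℝ) (A : Set (EuclideanSpace ℝ (Fin d))) :
    ℝ≥0∞ :=
  (∫⁻ x in A, ENNReal.ofReal (|u x| ^ β)) + ∫⁻ x in A, ENNReal.ofReal (‖gradient u x‖ ^ β)

theorem aemeasurable_ofReal_of_continuousOn {D : Set (EuclideanSpace ℝ (Fin d))}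
    (hD : MeasurableSet D) {f : EuclideanSpace ℝ (Fin d) → ℝ} (hf : ContinuousOn f D) :
    AEMeasurable (fun x => ENNReal.ofReal (f x)) (volume.restrict D) :=
  (hf.aemeasurable hD).ennreal_ofReal

/-- Half of the decay is kept for the integration over the second variable, the other half is traded
for decay in the lower bound L of the distance. -/
theorem exp_neg_le_mul {a c h L D : ℝ} (ha : 0 < a) (hh : 0 < h) (hL : c * L ≤ D) :
    Real.exp (-(a * D / h)) ≤
      Real.exp (-(a * c / 2 * L / h)) * Real.exp (-(a / 2 * D / h)) := by
  rw [← Real.exp_add]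
  refine Real.exp_le_exp.2 ?_
  have h1 : a / 2 / h * (c * L) ≤ a / 2 / h * D := mul_le_mul_of_nonneg_left hL (by positivity)
  have e1 : a * D / h = a / 2 / h * D + a / 2 * D / h := by ring
  have e2 : a * c / 2 * L / h = a / 2 / h * (c * L) := by ring
  linarith

/-- Integration of the kernel in one variable, with a gain from the distance. -/
theorem exists_lintegral_kernel_le (d : ℕ) {a c : ℝ} (ha : 0 < a) : ∃ C : ℝ, 0 < C ∧
    ∀ (x : EuclideanSpace ℝ (Fin d)) (B : Set (EuclideanSpace ℝ (Fin d))) (h L F : ℝ), 0 < h →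
      0 ≤ F → MeasurableSet B → (∀ y ∈ B, c * L ≤ dist y x) →
      ∫⁻ y in B, ENNReal.ofReal (Real.exp (-(a * dist y x / h)) * F) ≤
        ENNReal.ofReal (C * h ^ d) * ENNReal.ofReal (Real.exp (-(a * c / 2 * L / h)) * F) := by
  obtain ⟨C, hC, hb⟩ := exists_lintegral_exp_le d (half_pos ha)
  refine ⟨C, hC, fun x B h L F hh hF hB hL => ?_⟩
  have h1 : ∀ y ∈ B, ENNReal.ofReal (Real.exp (-(a * dist y x / h)) * F) ≤
      ENNReal.ofReal (Real.exp (-(a / 2 * dist y x / h))) *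
        ENNReal.ofReal (Real.exp (-(a * c / 2 * L / h)) * F) := fun y hy => by
    rw [← ENNReal.ofReal_mul (Real.exp_pos _).le]
    refine ENNReal.ofReal_le_ofReal ?_
    have := mul_le_mul_of_nonneg_right (exp_neg_le_mul ha hh (hL y hy)) hF
    linarith
  refine (setLIntegral_mono' hB h1).trans ?_
  rw [lintegral_mul_const' _ _ ENNReal.ofReal_ne_top]
  exact mul_le_mul_left ((setLIntegral_le_lintegral _ _).trans (hb x h hh)) _

theorem add_rpow_le_two {β : ℝ} (hβ : 0 ≤ β) {x y : ℝ} (hx : 0 ≤ x) (hy : 0 ≤ y) :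
    (x + y) ^ β ≤ 2 ^ β * (x ^ β + y ^ β) := by
  have h5 : x + y ≤ 2 * max x y := by linarith [le_max_left x y, le_max_right x y]
  refine (Real.rpow_le_rpow (by positivity) h5 hβ).trans ?_
  rw [Real.mul_rpow zero_le_two (le_max_of_le_left hx)]
  gcongr
  rcases max_choice x y with h6 | h6 <;> rw [h6]
  · exact le_add_of_nonneg_right (by positivity)
  · exact le_add_of_nonneg_left (by positivity)

theorem abs_sub_rpow_le {β : ℝ} (hβ : 0 ≤ β) (x y : ℝ) :
    |x - y| ^ β ≤ 2 ^ β * (|x| ^ β + |y| ^ β) :=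
  (Real.rpow_le_rpow (abs_nonneg _) (abs_sub _ _) hβ).trans
    (add_rpow_le_two hβ (abs_nonneg _) (abs_nonneg _))

namespace IsCell

theorem exists_nonlocalForm_self_le (_ : IsCell s) {β a : ℝ} (hβ : 1 < β) (hβ2 : β < 2)
    (ha : 0 < a) : ∃ C : ℝ, 0 < C ∧ ∀ u : EuclideanSpace ℝ (Fin d) → ℝ,
      (∀ x ∈ interior (hull s), DifferentiableAt ℝ u x) → ∀ h : ℝ, 0 < h →
      nonlocalForm a β h u (interior (hull s)) (interior (hull s)) ≤
        ENNReal.ofReal (C * h ^ (β + d)) * sobolevMass β u (interior (hull s)) := by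
  obtain ⟨C, hC, hb⟩ := exists_lintegral_convex_le d hβ hβ2.le ha
  refine ⟨C, hC, fun u hu h hh => (hb _ isOpen_interior (convex_convexHull ℝ _).interior u hu h
    hh).trans (mul_le_mul_right le_add_self _)⟩

/-- If each simplex has two vertices outside the other, the distance of x and y dominates two
barycentric coordinates on either side. Then |u(y) - u(x)| may simply be split into |u(y)| and
|u(x)|: the exponential weight confines each to a neighbourhood of a face of codimension two, where
it is small of order h^β. -/
theorem exists_nonlocalForm_far_le (hs : IsCell s) (ht : IsCell t) (hd : 2 ≤ d)
    (hst : ∀ x ∈ hull s, x ∈ hull t → ∀ v, bary s v x = bary t v x)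
    {v₁ v₂ w₁ w₂ : EuclideanSpace ℝ (Fin d)} (hv₁ : v₁ ∈ s) (hv₂ : v₂ ∈ s) (hv₁t : v₁ ∉ t)
    (hv₂t : v₂ ∉ t) (hv : v₁ ≠ v₂) (hw₁ : w₁ ∈ t) (hw₂ : w₂ ∈ t) (hw₁s : w₁ ∉ s) (hw₂s : w₂ ∉ s)
    (hw : w₁ ≠ w₂) {β a : ℝ} (hβ : 1 < β) (hβ2 : β < 2) (ha : 0 < a) :
    ∃ C : ℝ, 0 < C ∧ ∀ u : EuclideanSpace ℝ (Fin d) → ℝ,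
      (∀ x ∈ interior (hull s), DifferentiableAt ℝ u x) →
      (∀ x ∈ interior (hull t), DifferentiableAt ℝ u x) → ∀ h : ℝ, 0 < h →
      nonlocalForm a β h u (interior (hull s)) (interior (hull t)) ≤
        ENNReal.ofReal (C * h ^ (β + d)) *
          (sobolevMass β u (interior (hull s)) + sobolevMass β u (interior (hull t))) := by
  have hβ0 : 0 < β := one_pos.trans hβ
  obtain ⟨c, hc, hcs⟩ := hs.exists_bary_le_dist ht fun x hxs hxt v _ hvt => by
    rw [hst x hxs hxt, bary_of_notMem hvt]
  obtain ⟨c', hc', hct⟩ := ht.exists_bary_le_dist hs fun x hxt hxs v _ hvs => by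
    rw [← hst x hxs hxt, bary_of_notMem hvs]
  obtain ⟨K₁, hK₁, hker₁⟩ := exists_lintegral_kernel_le d (c := c / 2) ha
  obtain ⟨K₂, hK₂, hker₂⟩ := exists_lintegral_kernel_le d (c := c' / 2) ha
  obtain ⟨C₁, hC₁, h₁⟩ := hs.exists_lintegral_exp_bary_le hd hv₁ hv₂ hv hβ hβ2
    (b := a * (c / 2) / 2) (by positivity)
  obtain ⟨C₂, hC₂, h₂⟩ := ht.exists_lintegral_exp_bary_le hd hw₁ hw₂ hw hβ hβ2
    (b := a * (c' / 2) / 2) (by positivity)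
  refine ⟨2 ^ β * (K₁ * C₁ + K₂ * C₂), by positivity, fun u hus hut h hh => ?_⟩
  set D := interior (hull s)
  set D' := interior (hull t)
  have hD : MeasurableSet D := isOpen_interior.measurableSet
  have hD' : MeasurableSet D' := isOpen_interior.measurableSet
  have hutc : ContinuousOn u D' := fun x hx => (hut x hx).continuousAt.continuousWithinAt
  set v := D'.indicator u
  have hvm : Measurable v := measurable_indicator_of_continuousOn hutc hD'
  have hvu : ∀ y ∈ D', v y = u y := fun y hy => indicator_of_mem hy u
  have hm1 : ∀ x, Measurable fun y : EuclideanSpace ℝ (Fin d) =>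
      ENNReal.ofReal (Real.exp (-(a * dist y x / h)) * |u x| ^ β) := fun x => by fun_prop
  have hm2 : Measurable fun q : EuclideanSpace ℝ (Fin d) × EuclideanSpace ℝ (Fin d) =>
      ENNReal.ofReal (Real.exp (-(a * dist q.1 q.2 / h)) * |v q.2| ^ β) := by
    have : Measurable fun q : EuclideanSpace ℝ (Fin d) × EuclideanSpace ℝ (Fin d) => v q.2 :=
      hvm.comp measurable_snd
    fun_prop
  have hx : ∀ x ∈ D, ∫⁻ y in D', ENNReal.ofReal (Real.exp (-(a * dist y x / h)) * |u y - u x| ^ β) ≤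
      ENNReal.ofReal (2 ^ β) * (ENNReal.ofReal (K₁ * h ^ d) * ENNReal.ofReal
        (Real.exp (-(a * (c / 2) / 2 * (bary s v₁ x + bary s v₂ x) / h)) * |u x| ^ β) +
        ∫⁻ y in D', ENNReal.ofReal (Real.exp (-(a * dist x y / h)) * |v y| ^ β)) := by
    intro x hx
    have hpt : ∀ y ∈ D', ENNReal.ofReal (Real.exp (-(a * dist y x / h)) * |u y - u x| ^ β) ≤
        ENNReal.ofReal (2 ^ β) * (ENNReal.ofReal (Real.exp (-(a * dist y x / h)) * |u x| ^ β) +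
          ENNReal.ofReal (Real.exp (-(a * dist x y / h)) * |v y| ^ β)) := fun y hy => by
      rw [hvu y hy, ← ENNReal.ofReal_add (by positivity) (by positivity),
        ← ENNReal.ofReal_mul (by positivity), dist_comm x y]
      refine ENNReal.ofReal_le_ofReal ?_
      have := mul_le_mul_of_nonneg_left (abs_sub_rpow_le hβ0.le (u y) (u x))
        (Real.exp_pos (-(a * dist y x / h))).le
      linarith
    refine (setLIntegral_mono' hD' hpt).trans ?_
    rw [lintegral_const_mul' _ _ ENNReal.ofReal_ne_top, lintegral_add_left (hm1 x)]
    refine mul_le_mul_right (add_le_add_left ?_ _) _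
    refine hker₁ x D' h (bary s v₁ x + bary s v₂ x) (|u x| ^ β) hh (by positivity) hD' fun y hy => ?_
    have b1 := hcs x (interior_subset hx) y (interior_subset hy) v₁ hv₁ hv₁t
    have b2 := hcs x (interior_subset hx) y (interior_subset hy) v₂ hv₂ hv₂t
    rw [dist_comm]
    linarith
  have husc : ContinuousOn u D := fun x hx => (hus x hx).continuousAt.continuousWithinAt
  have hg1 : AEMeasurable (fun x => ENNReal.ofReal (K₁ * h ^ d) * ENNReal.ofReal
      (Real.exp (-(a * (c / 2) / 2 * (bary s v₁ x + bary s v₂ x) / h)) * |u x| ^ β))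
      (volume.restrict D) := by
    refine AEMeasurable.const_mul (aemeasurable_ofReal_of_continuousOn hD ?_) _
    have e1 : Continuous (bary s v₁) := continuous_bary
    have e2 : Continuous (bary s v₂) := continuous_bary
    have e3 : ContinuousOn (fun x => |u x| ^ β) D :=
      husc.abs.rpow_const fun x _ => Or.inr hβ0.le
    exact ContinuousOn.mul (Continuous.continuousOn (by fun_prop)) e3
  have hswap : ∫⁻ x in D, ∫⁻ y in D', ENNReal.ofReal (Real.exp (-(a * dist x y / h)) * |v y| ^ β) ≤
      ENNReal.ofReal (K₂ * h ^ d) * (ENNReal.ofReal (C₂ * h ^ β) * sobolevMass β u D') := by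
    rw [lintegral_lintegral_swap hm2.aemeasurable]
    refine le_trans ?_ (mul_le_mul_right (h₂ u hut h hh) _)
    rw [← lintegral_const_mul' _ _ ENNReal.ofReal_ne_top]
    refine setLIntegral_mono' hD' fun y hy => ?_
    rw [hvu y hy]
    refine hker₂ y D h (bary t w₁ y + bary t w₂ y) (|u y| ^ β) hh (by positivity) hD fun x hx => ?_
    have b1 := hct y (interior_subset hy) x (interior_subset hx) w₁ hw₁ hw₁s
    have b2 := hct y (interior_subset hy) x (interior_subset hx) w₂ hw₂ hw₂s
    rw [dist_comm]
    linarith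
  refine (setLIntegral_mono' hD hx).trans ?_
  rw [lintegral_const_mul' _ _ ENNReal.ofReal_ne_top, lintegral_add_left' hg1,
    lintegral_const_mul' _ _ ENNReal.ofReal_ne_top]
  refine (mul_le_mul_right (add_le_add (mul_le_mul_right (h₁ u hus h hh) _) hswap) _).trans ?_
  have hhβ : h ^ (β + d) = h ^ β * h ^ d := by rw [Real.rpow_add hh, Real.rpow_natCast]
  have e1 : ENNReal.ofReal (K₁ * h ^ d) * (ENNReal.ofReal (C₁ * h ^ β) * sobolevMass β u D) ≤
      ENNReal.ofReal ((K₁ * C₁ + K₂ * C₂) * h ^ (β + d)) * sobolevMass β u D := by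
    rw [← mul_assoc, ← ENNReal.ofReal_mul (by positivity)]
    refine mul_le_mul_left (ENNReal.ofReal_le_ofReal ?_) _
    rw [hhβ]
    have : 0 ≤ K₂ * C₂ * (h ^ β * h ^ d) := by positivity
    nlinarith
  have e2 : ENNReal.ofReal (K₂ * h ^ d) * (ENNReal.ofReal (C₂ * h ^ β) * sobolevMass β u D') ≤
      ENNReal.ofReal ((K₁ * C₁ + K₂ * C₂) * h ^ (β + d)) * sobolevMass β u D' := by
    rw [← mul_assoc, ← ENNReal.ofReal_mul (by positivity)]
    refine mul_le_mul_left (ENNReal.ofReal_le_ofReal ?_) _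
    rw [hhβ]
    have : 0 ≤ K₁ * C₁ * (h ^ β * h ^ d) := by positivity
    nlinarith
  refine (mul_le_mul_right (add_le_add e1 e2) _).trans_eq ?_
  rw [← mul_add, ← mul_assoc, ← ENNReal.ofReal_mul (by positivity), mul_assoc]

/-- The case of two cells sharing a facet. -/
theorem exists_nonlocalForm_adjacent_le [DecidableEq (EuclideanSpace ℝ (Fin d))]
    {F : Finset (EuclideanSpace ℝ (Fin d))}
    {p p' : EuclideanSpace ℝ (Fin d)} (hs : IsCell (insert p F)) (ht : IsCell (insert p' F))
    (hst : ∀ x ∈ hull (insert p F), x ∈ hull (insert p' F) →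
      ∀ v, bary (insert p F) v x = bary (insert p' F) v x)
    (hp : p ∉ F) (hp' : p' ∉ F) (hpp : p ≠ p') (hF : F.Nonempty)
    {β a : ℝ} (hβ : 1 < β) (hβ2 : β < 2) (ha : 0 < a) :
    ∃ C : ℝ, 0 < C ∧ ∀ u : EuclideanSpace ℝ (Fin d) → ℝ, ContinuousOn u (hull (insert p F)) →
      ContinuousOn u (hull (insert p' F)) →
      (∀ x ∈ interior (hull (insert p F)), DifferentiableAt ℝ u x) →
      (∀ x ∈ interior (hull (insert p' F)), DifferentiableAt ℝ u x) → ∀ h : ℝ, 0 < h →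
      nonlocalForm a β h u (interior (hull (insert p F))) (interior (hull (insert p' F))) ≤
        ENNReal.ofReal (C * h ^ (β + d)) *
          (sobolevMass β u (interior (hull (insert p F))) +
            sobolevMass β u (interior (hull (insert p' F)))) := by
  have hβ0 : 0 < β := one_pos.trans hβ
  set s := insert p F with hsF
  set t := insert p' F with htF
  have hps : p ∈ s := Finset.mem_insert_self _ _
  have hpt : p ∉ t := fun h => (Finset.mem_insert.1 h).elim hpp hp
  have hp't : p' ∈ t := Finset.mem_insert_self _ _
  have hFs : F ⊆ s := Finset.subset_insert _ _
  have hFt : F ⊆ t := Finset.subset_insert _ _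
  obtain ⟨q, hq⟩ := hF
  have hqs : q ∈ s := hFs hq
  have hqt : q ∈ t := hFt hq
  have hqp : p ≠ q := by rintro rfl; exact hp hq
  have hqp' : p' ≠ q := by rintro rfl; exact hp' hq
  -- The affine map that fixes the vertices of the common facet and sends p to p'.
  set T : EuclideanSpace ℝ (Fin d) → EuclideanSpace ℝ (Fin d) := fun x =>
    x + bary s p x • (p' - p)
  have hne : ∀ w ∈ F, w ≠ p' := fun w hw h => hp' (h ▸ hw)
  have hTt : ∀ x v, v ∈ t → bary t v (T x) = if v = p' then bary s p x else bary s v x := by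
    intro x v hv
    have e1 : ∑ v ∈ t, (if v = p' then bary s p x else bary s v x) = 1 := by
      rw [← hs.sum_bary x, htF, Finset.sum_insert hp', hsF, Finset.sum_insert hp, if_pos rfl]
      congr 1
      exact Finset.sum_congr rfl fun w hw => if_neg (hne w hw)
    have e2 : ∑ v ∈ t, (if v = p' then bary s p x else bary s v x) • v = T x := by
      have h1 := hs.sum_bary_smul x
      have h2 : T x = x + bary s p x • (p' - p) := rfl
      have h3 : ∑ v ∈ F, (if v = p' then bary s p x else bary s v x) • v =
          ∑ v ∈ F, bary s v x • v := Finset.sum_congr rfl fun w hw => by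
        rw [if_neg (hne w hw)]
      rw [hsF, Finset.sum_insert hp] at h1
      rw [h2, htF, Finset.sum_insert hp', if_pos rfl, h3, eq_sub_of_add_eq' h1, smul_sub]
      abel
    rw [ht.bary_eq_ite subset_rfl e1 e2, if_pos hv]
  have hTp : ∀ x, bary t p' (T x) = bary s p x := fun x => by rw [hTt x p' hp't, if_pos rfl]
  have hTD : ∀ x ∈ interior (hull s), T x ∈ interior (hull t) := by
    intro x hx
    rw [hs.mem_interior_iff] at hx
    refine ht.mem_interior_of_pos fun v hv => ?_
    rw [hTt x v hv]
    split_ifs with h1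
    · exact hx p hps
    · exact hx v (hFs ((Finset.mem_insert.1 hv).resolve_left h1))
  -- If the determinant vanished, p' would be an affine combination of the common facet, against the
  -- independence of the vertices of t.
  have hdet : 1 + (bary s p).linear (p' - p) ≠ 0 := by
    rw [bary_linear_sub, hs.bary_self hps, add_sub_cancel]
    intro h0
    have e1 : ∑ v ∈ F, bary s v p' = 1 := by
      have := hs.sum_bary p'
      rwa [hsF, Finset.sum_insert hp, ← hsF, h0, zero_add] at this
    have e2 : ∑ v ∈ F, bary s v p' • v = p' := by
      have := hs.sum_bary_smul p'
      rwa [hsF, Finset.sum_insert hp, ← hsF, h0, zero_smul, zero_add] at this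
    have h1 := ht.bary_eq_ite hFt e1 e2 p'
    rw [ht.bary_self hp't, if_neg hp'] at h1
    exact one_ne_zero h1
  set J : ℝ := |(1 + (bary s p).linear (p' - p))⁻¹|
  have hJ : 0 ≤ J := abs_nonneg _
  have hTI : ∀ f : EuclideanSpace ℝ (Fin d) → ℝ≥0∞, ∫⁻ x in interior (hull s), f (T x) ≤
      ENNReal.ofReal J * ∫⁻ z in interior (hull t), f z := by
    intro f
    rw [← lintegral_indicator isOpen_interior.measurableSet,
      ← lintegral_indicator isOpen_interior.measurableSet]
    have h1 := lintegral_comp_add_smul (μ := volume) (bary s p) (p' - p) hdet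
      ((interior (hull t)).indicator f)
    rw [← h1]
    refine lintegral_mono fun x => ?_
    by_cases hx : x ∈ interior (hull s)
    · rw [indicator_of_mem hx]
      refine le_of_eq ?_
      exact (indicator_of_mem (hTD x hx) f).symm
    · rw [indicator_of_notMem hx]; exact zero_le
  obtain ⟨c, hc, hcs⟩ := hs.exists_bary_le_dist ht fun x hxs hxt v _ hvt => by
    rw [hst x hxs hxt, bary_of_notMem hvt]
  obtain ⟨K, hK, hker⟩ := exists_lintegral_kernel_le d (c := c) ha
  obtain ⟨C₁, hC₁, h₁⟩ := hs.exists_lintegral_ray_le hps (hull_mem hqs) (hs.bary_ne hqs hqp) hβ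
    hβ2.le (a := a * c / 2) (by positivity)
  obtain ⟨C₂, hC₂, h₂⟩ := ht.exists_lintegral_ray_le hp't (hull_mem hqt) (ht.bary_ne hqt hqp') hβ
    hβ2.le (a := a * c / 2) (by positivity)
  -- For y in t, dist y (T x) ≤ R·dist y x: x is moved by b_p(x)|p' - p|, and c·b_p(x) is at most
  -- the distance of x from t.
  set R := 1 + ‖p' - p‖ / c
  have hR : 0 < R := by positivity
  obtain ⟨C₃, hC₃, h₃⟩ := exists_lintegral_convex_le d hβ hβ2.le (a := a / R) (by positivity)
  refine ⟨4 ^ β * (K * C₁ + K * (J * C₂) + J * C₃), by positivity,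
    fun u hcus hcut hus hut h hh => ?_⟩
  set D := interior (hull s)
  set D' := interior (hull t)
  have hD : MeasurableSet D := isOpen_interior.measurableSet
  have hD' : MeasurableSet D' := isOpen_interior.measurableSet
  set P : EuclideanSpace ℝ (Fin d) → EuclideanSpace ℝ (Fin d) := fun x =>
    x + bary s p x • (q - p)
  set P' : EuclideanSpace ℝ (Fin d) → EuclideanSpace ℝ (Fin d) := fun x =>
    x + bary t p' x • (q - p')
  -- x and its image T x project to the same point of the facet. Hence u(y) - u(x) splits into a
  -- difference within t, for the convex estimate, and two differences along rays to the facet, one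
  -- in each cell.
  have hPT : ∀ x, P' (T x) = P x := fun x => by
    simp only [P', P, hTp]
    simp only [T, smul_sub]; abel
  set g₁ : EuclideanSpace ℝ (Fin d) → ℝ≥0∞ := fun x =>
    ENNReal.ofReal (Real.exp (-(a * c / 2 * bary s p x / h)) * |u x - u (P x)| ^ β)
  set g₂ : EuclideanSpace ℝ (Fin d) → ℝ≥0∞ := fun x =>
    ENNReal.ofReal (Real.exp (-(a * c / 2 * bary t p' x / h)) * |u x - u (P' x)| ^ β)
  set g₃ : EuclideanSpace ℝ (Fin d) → ℝ≥0∞ := fun x =>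
    ∫⁻ y in D', ENNReal.ofReal (Real.exp (-(a / R * dist y x / h)) * |u y - u x| ^ β)
  have hx : ∀ x ∈ D, ∫⁻ y in D', ENNReal.ofReal (Real.exp (-(a * dist y x / h)) * |u y - u x| ^ β) ≤
      ENNReal.ofReal (4 ^ β) * (ENNReal.ofReal (K * h ^ d) * g₁ x +
        (ENNReal.ofReal (K * h ^ d) * g₂ (T x) + g₃ (T x))) := by
    intro x hx
    have hdist : ∀ y ∈ D', c * bary s p x ≤ dist y x := fun y hy => by
      rw [dist_comm]
      exact hcs x (interior_subset hx) y (interior_subset hy) p hps hpt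
    have hpt' : ∀ y ∈ D', ENNReal.ofReal (Real.exp (-(a * dist y x / h)) * |u y - u x| ^ β) ≤
        ENNReal.ofReal (4 ^ β) *
          (ENNReal.ofReal (Real.exp (-(a * dist y x / h)) * |u x - u (P x)| ^ β) +
          (ENNReal.ofReal (Real.exp (-(a * dist y x / h)) * |u (T x) - u (P' (T x))| ^ β) +
          ENNReal.ofReal (Real.exp (-(a / R * dist y (T x) / h)) * |u y - u (T x)| ^ β))) := by
      intro y hy
      rw [← ENNReal.ofReal_add (by positivity) (by positivity),
        ← ENNReal.ofReal_add (by positivity) (by positivity), ← ENNReal.ofReal_mul (by positivity)]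
      refine ENNReal.ofReal_le_ofReal ?_
      rw [hPT]
      set A := |u x - u (P x)|
      set B := |u (T x) - u (P x)|
      set E := |u y - u (T x)|
      have hA : 0 ≤ A := abs_nonneg _
      have hB : 0 ≤ B := abs_nonneg _
      have hE : 0 ≤ E := abs_nonneg _
      have f1 : |u y - u x| ≤ A + (B + E) := by
        have e : u y - u x = (u y - u (T x)) + (u (T x) - u (P x)) - (u x - u (P x)) := by ring
        rw [e]
        refine (abs_sub _ _).trans ?_
        have := abs_add_le (u y - u (T x)) (u (T x) - u (P x))
        simp only [A, B, E]
        linarith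
      have f2 : |u y - u x| ^ β ≤ 4 ^ β * (A ^ β + (B ^ β + E ^ β)) := by
        refine (Real.rpow_le_rpow (abs_nonneg _) f1 hβ0.le).trans ?_
        refine (add_rpow_le_two hβ0.le hA (by positivity)).trans ?_
        have f3 := add_rpow_le_two hβ0.le hB hE
        have f4 : (4 : ℝ) ^ β = 2 ^ β * 2 ^ β := by
          rw [← Real.mul_rpow zero_le_two zero_le_two]; norm_num
        have f5 : (1 : ℝ) ≤ 2 ^ β := Real.one_le_rpow one_le_two hβ0.le
        have f6 : 0 ≤ A ^ β := by positivity
        rw [f4, mul_assoc]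
        refine mul_le_mul_of_nonneg_left ?_ (by positivity)
        nlinarith
      have f7 : Real.exp (-(a * dist y x / h)) ≤ Real.exp (-(a / R * dist y (T x) / h)) := by
        refine Real.exp_le_exp.2 (neg_le_neg (div_le_div_of_nonneg_right ?_ hh.le))
        rw [div_mul_eq_mul_div, div_le_iff₀ hR, mul_assoc]
        refine mul_le_mul_of_nonneg_left ?_ ha.le
        have f8 : dist x (T x) = bary s p x * ‖p' - p‖ := by
          rw [dist_comm, dist_eq_norm]
          simp only [T]
          rw [add_sub_cancel_left, norm_smul,
            Real.norm_of_nonneg (hs.bary_nonneg (interior_subset hx) p)]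
        have f9 := dist_triangle y x (T x)
        rw [f8] at f9
        have f10 : bary s p x * ‖p' - p‖ ≤ dist y x / c * ‖p' - p‖ := by
          refine mul_le_mul_of_nonneg_right ?_ (norm_nonneg _)
          rw [le_div_iff₀ hc, mul_comm]; exact hdist y hy
        calc dist y (T x) ≤ dist y x + dist y x / c * ‖p' - p‖ := by linarith
          _ = dist y x * R := by simp only [R]; ring
      calc Real.exp (-(a * dist y x / h)) * |u y - u x| ^ β
          ≤ Real.exp (-(a * dist y x / h)) * (4 ^ β * (A ^ β + (B ^ β + E ^ β))) := by gcongr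
        _ = 4 ^ β * (Real.exp (-(a * dist y x / h)) * A ^ β +
            (Real.exp (-(a * dist y x / h)) * B ^ β + Real.exp (-(a * dist y x / h)) * E ^ β)) := by
            ring
        _ ≤ _ := by gcongr
    refine (setLIntegral_mono' hD' hpt').trans ?_
    rw [lintegral_const_mul' _ _ ENNReal.ofReal_ne_top, lintegral_add_left (by fun_prop),
      lintegral_add_left (by fun_prop)]
    refine mul_le_mul_right (add_le_add ?_ (add_le_add_left ?_ _)) _
    · exact hker x D' h (bary s p x) _ hh (by positivity) hD' hdist
    · simp only [g₂]
      rw [hTp]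
      exact hker x D' h (bary s p x) _ hh (by positivity) hD' hdist
  have hbc : Continuous (bary s p) := continuous_bary
  have hbc' : Continuous (bary t p') := continuous_bary
  have hPc : Continuous P := by fun_prop
  have hPc' : Continuous P' := by fun_prop
  have hTc : Continuous T := by fun_prop
  have hPm : ∀ x ∈ D, P x ∈ hull s := by
    intro x hx
    rw [hs.mem_interior_iff] at hx
    rw [hs.mem_convexHull_iff]
    intro v hv
    simp only [P]
    rw [bary_add_smul, bary_linear_sub]
    by_cases hvp : v = p
    · rw [hvp, hs.bary_self hps, hs.bary_ne hqs hqp]; linarith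
    · rw [hs.bary_ne hps hvp, sub_zero]
      have := hx v hv; have := hx p hps; have := hs.bary_nonneg (hull_mem hqs) v
      positivity
  have hm1 : AEMeasurable (fun x => ENNReal.ofReal (K * h ^ d) * g₁ x) (volume.restrict D) := by
    refine AEMeasurable.const_mul (aemeasurable_ofReal_of_continuousOn hD ?_) _
    refine ContinuousOn.mul (Continuous.continuousOn (by fun_prop)) (ContinuousOn.rpow_const ?_
      fun x _ => Or.inr hβ0.le)
    exact ((hcus.mono interior_subset).sub (hcus.comp hPc.continuousOn hPm)).abs
  have hm2 : AEMeasurable (fun x => ENNReal.ofReal (K * h ^ d) * g₂ (T x)) (volume.restrict D) := by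
    refine AEMeasurable.const_mul (aemeasurable_ofReal_of_continuousOn hD ?_) _
    refine ContinuousOn.mul (Continuous.continuousOn (by fun_prop)) (ContinuousOn.rpow_const ?_
      fun x _ => Or.inr hβ0.le)
    simp only [hPT]
    exact (((hcut.mono interior_subset).comp hTc.continuousOn hTD).sub
      (hcus.comp hPc.continuousOn hPm)).abs
  refine (setLIntegral_mono' hD hx).trans ?_
  rw [lintegral_const_mul' _ _ ENNReal.ofReal_ne_top, lintegral_add_left' hm1,
    lintegral_add_left' hm2, lintegral_const_mul' _ _ ENNReal.ofReal_ne_top,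
    lintegral_const_mul' _ _ ENNReal.ofReal_ne_top]
  set Q := sobolevMass β u D + sobolevMass β u D'
  have q1 : ∫⁻ x in D, g₁ x ≤ ENNReal.ofReal (C₁ * h ^ β) * Q :=
    (h₁ u hcus hus h hh).trans (mul_le_mul_right (le_add_self.trans le_self_add) _)
  have q2 : ∫⁻ x in D, g₂ (T x) ≤ ENNReal.ofReal J * (ENNReal.ofReal (C₂ * h ^ β) * Q) :=
    (hTI g₂).trans (mul_le_mul_right ((h₂ u hcut hut h hh).trans
      (mul_le_mul_right (le_add_self.trans le_add_self) _)) _)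
  have q3 : ∫⁻ x in D, g₃ (T x) ≤ ENNReal.ofReal J * (ENNReal.ofReal (C₃ * h ^ (β + d)) * Q) :=
    (hTI g₃).trans (mul_le_mul_right ((h₃ D' isOpen_interior (convex_convexHull ℝ _).interior u hut h
      hh).trans (mul_le_mul_right (le_add_self.trans le_add_self) _)) _)
  refine (mul_le_mul_right (add_le_add (mul_le_mul_right q1 _)
    (add_le_add (mul_le_mul_right q2 _) q3)) _).trans_eq ?_
  have hhβ : h ^ (β + d) = h ^ β * h ^ d := by rw [Real.rpow_add hh, Real.rpow_natCast]
  simp only [← mul_assoc]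
  rw [← ENNReal.ofReal_mul (by positivity), ← ENNReal.ofReal_mul (by positivity),
    ← ENNReal.ofReal_mul (by positivity), ← ENNReal.ofReal_mul (by positivity), ← add_mul, ← add_mul,
    ← ENNReal.ofReal_add (by positivity) (by positivity),
    ← ENNReal.ofReal_add (by positivity) (by positivity), ← mul_assoc,
    ← ENNReal.ofReal_mul (by positivity)]
  congr 2
  rw [hhβ]; ring

end IsCell


/-! ### The nonlocal functional on Ω and stability of the projection in W^{1,β}. -/

namespace Triangulation

variable {d : ℕ} {Ω : Set (EuclideanSpace ℝ (Fin d))} {𝒯 : Triangulation Ω}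
  {s t : Finset (EuclideanSpace ℝ (Fin d))}

theorem sobolevMass_mono {β : ℝ} {u : EuclideanSpace ℝ (Fin d) → ℝ}
    {A B : Set (EuclideanSpace ℝ (Fin d))} (h : A ⊆ B) : sobolevMass β u A ≤ sobolevMass β u B :=
  add_le_add (lintegral_mono_set h) (lintegral_mono_set h)

/-- The cases are counted by the vertices of s outside t: none means the same cell, one a common
facet, two or more an intersection of codimension at least two, possibly empty. -/
theorem exists_nonlocalForm_cells_le (hd : 2 ≤ d) (hΩr : interior (closure Ω) = Ω)
    (hs : s ∈ 𝒯.cells) (ht : t ∈ 𝒯.cells) {β a : ℝ} (hβ : 1 < β) (hβ2 : β < 2) (ha : 0 < a) :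
    ∃ C : ℝ, 0 < C ∧ ∀ u : EuclideanSpace ℝ (Fin d) → ℝ, ContinuousOn u (closure Ω) →
      (∀ x ∈ Ω, DifferentiableAt ℝ u x) → ∀ h : ℝ, 0 < h →
      nonlocalForm a β h u (interior (hull s)) (interior (hull t)) ≤
        ENNReal.ofReal (C * h ^ (β + d)) * sobolevMass β u Ω := by
  classical
  have hsub : ∀ s ∈ 𝒯.cells, interior (hull s) ⊆ Ω := fun s hs => interior_subset hΩr hs
  have hcl : ∀ s ∈ 𝒯.cells, hull s ⊆ closure Ω := fun s hs => convexHull_subset_closure hs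
  have hcs := isCell hs
  have hct := isCell ht
  have hst : ∀ x ∈ hull s, x ∈ hull t → ∀ v, bary s v x = bary t v x := fun x hxs hxt v =>
    bary_eq_bary hs ht hxs hxt v
  suffices h : ∃ C : ℝ, 0 < C ∧ ∀ u : EuclideanSpace ℝ (Fin d) → ℝ, ContinuousOn u (closure Ω) →
      (∀ x ∈ Ω, DifferentiableAt ℝ u x) → ∀ h : ℝ, 0 < h →
      nonlocalForm a β h u (interior (hull s)) (interior (hull t)) ≤
        ENNReal.ofReal (C * h ^ (β + d)) *
          (sobolevMass β u (interior (hull s)) + sobolevMass β u (interior (hull t))) by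
    obtain ⟨C, hC, h⟩ := h
    refine ⟨2 * C, by positivity, fun u hu hu' r hr => (h u hu hu' r hr).trans ?_⟩
    refine (mul_le_mul_right (add_le_add (sobolevMass_mono (hsub s hs))
      (sobolevMass_mono (hsub t ht))) _).trans_eq ?_
    rw [← two_mul, ← mul_assoc, mul_assoc 2, ENNReal.ofReal_mul zero_le_two, mul_comm _ 2]
    congr 2
    simp
  have hcards : (t \ s).card = (s \ t).card :=
    Finset.card_sdiff_comm (by rw [hcs.card_eq, hct.card_eq])
  rcases Nat.lt_or_ge (s \ t).card 2 with hlt | hge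
  · rcases Nat.eq_zero_or_pos (s \ t).card with h0 | h1
    · have e : s = t := Finset.eq_of_subset_of_card_le (Finset.sdiff_eq_empty_iff_subset.1
        (Finset.card_eq_zero.1 h0)) (by rw [hcs.card_eq, hct.card_eq])
      subst e
      obtain ⟨C, hC, h⟩ := hcs.exists_nonlocalForm_self_le hβ hβ2 ha
      exact ⟨C, hC, fun u _ hu' r hr => (h u (fun x hx => hu' x (hsub s hs hx)) r hr).trans
        (mul_le_mul_right le_self_add _)⟩
    · have hs1 : (s \ t).card = 1 := by omega
      obtain ⟨p, hp⟩ := Finset.card_eq_one.1 hs1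
      obtain ⟨p', hp'⟩ := Finset.card_eq_one.1 (hcards.trans hs1)
      have es : insert p (s ∩ t) = s := by
        have := Finset.sdiff_union_inter s t
        rwa [hp, Finset.singleton_union] at this
      have et : insert p' (s ∩ t) = t := by
        have := Finset.sdiff_union_inter t s
        rwa [hp', Finset.singleton_union, Finset.inter_comm] at this
      have hpm : p ∈ s \ t := by rw [hp]; exact Finset.mem_singleton_self p
      have hpm' : p' ∈ t \ s := by rw [hp']; exact Finset.mem_singleton_self p'
      rw [Finset.mem_sdiff] at hpm hpm'
      have hF : (s ∩ t).Nonempty := by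
        rw [← Finset.card_pos]
        have := Finset.card_sdiff_add_card_inter s t
        have := hcs.card_eq
        omega
      obtain ⟨C, hC, h⟩ := IsCell.exists_nonlocalForm_adjacent_le (F := s ∩ t) (p := p) (p' := p')
        (by rw [es]; exact hcs) (by rw [et]; exact hct) (by rw [es, et]; exact hst)
        (fun h => hpm.2 (Finset.mem_inter.1 h).2) (fun h => hpm'.2 (Finset.mem_inter.1 h).1)
        (by rintro rfl; exact hpm.2 hpm'.1) hF hβ hβ2 ha
      rw [es, et] at h
      exact ⟨C, hC, fun u hu hu' r hr => h u (hu.mono (hcl s hs)) (hu.mono (hcl t ht))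
        (fun x hx => hu' x (hsub s hs hx)) (fun x hx => hu' x (hsub t ht hx)) r hr⟩
  · obtain ⟨v₁, hv₁, v₂, hv₂, hv⟩ := Finset.one_lt_card.1 hge
    obtain ⟨w₁, hw₁, w₂, hw₂, hw⟩ := Finset.one_lt_card.1 (hge.trans_eq hcards.symm)
    rw [Finset.mem_sdiff] at hv₁ hv₂ hw₁ hw₂
    obtain ⟨C, hC, h⟩ := hcs.exists_nonlocalForm_far_le hct hd hst hv₁.1 hv₂.1 hv₁.2 hv₂.2 hv
      hw₁.1 hw₂.1 hw₁.2 hw₂.2 hw hβ hβ2 ha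
    exact ⟨C, hC, fun u _ hu' r hr => h u (fun x hx => hu' x (hsub s hs hx))
      (fun x hx => hu' x (hsub t ht hx)) r hr⟩

theorem lintegral_eq_sum_interior (𝒯 : Triangulation Ω) (hΩr : interior (closure Ω) = Ω)
    (f : EuclideanSpace ℝ (Fin d) → ℝ≥0∞) :
    ∫⁻ x in Ω, f x = ∑ s ∈ 𝒯.cells, ∫⁻ x in interior (hull s), f x := by
  rw [𝒯.lintegral_eq_sum hΩr]
  exact Finset.sum_congr rfl fun s _ => (setLIntegral_congr (interior_ae_eq_convexHull _)).symm

/-- The nonlocal functional is controlled by the Sobolev norm, on a triangulated domain. -/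
theorem exists_nonlocalForm_le (𝒯 : Triangulation Ω) (hd : 2 ≤ d) (hΩo : IsOpen Ω)
    (hΩr : interior (closure Ω) = Ω) {β a : ℝ} (hβ : 1 < β) (hβ2 : β < 2) (ha : 0 < a) :
    ∃ C : ℝ, 0 < C ∧ ∀ u : EuclideanSpace ℝ (Fin d) → ℝ, ContinuousOn u (closure Ω) →
      (∀ x ∈ Ω, DifferentiableAt ℝ u x) → ∀ h : ℝ, 0 < h →
      nonlocalForm a β h u Ω Ω ≤ ENNReal.ofReal (C * h ^ (β + d)) * sobolevMass β u Ω := by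
  have key : ∀ s t : Finset (EuclideanSpace ℝ (Fin d)), s ∈ 𝒯.cells → t ∈ 𝒯.cells →
      ∃ C : ℝ, 0 < C ∧ ∀ u : EuclideanSpace ℝ (Fin d) → ℝ, ContinuousOn u (closure Ω) →
      (∀ x ∈ Ω, DifferentiableAt ℝ u x) → ∀ h : ℝ, 0 < h →
      nonlocalForm a β h u (interior (hull s)) (interior (hull t)) ≤
        ENNReal.ofReal (C * h ^ (β + d)) * sobolevMass β u Ω := fun s t hs ht =>
    exists_nonlocalForm_cells_le hd hΩr hs ht hβ hβ2 ha
  choose! C hC hb using key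
  have hS : 0 ≤ ∑ s ∈ 𝒯.cells, ∑ t ∈ 𝒯.cells, C s t :=
    Finset.sum_nonneg fun s hs => Finset.sum_nonneg fun t ht => (hC s t hs ht).le
  refine ⟨∑ s ∈ 𝒯.cells, ∑ t ∈ 𝒯.cells, C s t + 1, by positivity, fun u hu hu' h hh => ?_⟩
  have hcl : MeasurableSet (closure Ω) := isClosed_closure.measurableSet
  set v := (closure Ω).indicator u
  have hvm : Measurable v := measurable_indicator_of_continuousOn hu hcl
  have hvu : ∀ x ∈ Ω, v x = u x := fun x hx => indicator_of_mem (subset_closure hx) u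
  have hm : Measurable fun q : EuclideanSpace ℝ (Fin d) × EuclideanSpace ℝ (Fin d) =>
      ENNReal.ofReal (Real.exp (-(a * dist q.2 q.1 / h)) * |v q.2 - v q.1| ^ β) := by
    have h1 : Measurable fun q : EuclideanSpace ℝ (Fin d) × EuclideanSpace ℝ (Fin d) => v q.2 :=
      hvm.comp measurable_snd
    have h2 : Measurable fun q : EuclideanSpace ℝ (Fin d) × EuclideanSpace ℝ (Fin d) => v q.1 :=
      hvm.comp measurable_fst
    fun_prop
  have hcongr : ∀ A B : Set (EuclideanSpace ℝ (Fin d)), MeasurableSet A → MeasurableSet B →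
      A ⊆ Ω → B ⊆ Ω → nonlocalForm a β h u A B = nonlocalForm a β h v A B := by
    intro A B hA hB hAΩ hBΩ
    refine setLIntegral_congr_fun hA fun x hx => setLIntegral_congr_fun hB fun y hy => ?_
    rw [hvu x (hAΩ hx), hvu y (hBΩ hy)]
  rw [hcongr Ω Ω hΩo.measurableSet hΩo.measurableSet subset_rfl subset_rfl]
  have e1 : nonlocalForm a β h v Ω Ω = ∑ s ∈ 𝒯.cells, ∑ t ∈ 𝒯.cells,
      nonlocalForm a β h u (interior (hull s)) (interior (hull t)) := by
    simp only [nonlocalForm]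
    rw [𝒯.lintegral_eq_sum_interior hΩr]
    refine Finset.sum_congr rfl fun s hs => ?_
    simp only [𝒯.lintegral_eq_sum_interior hΩr]
    rw [lintegral_finsetSum _ fun t _ => hm.lintegral_prod_right']
    refine Finset.sum_congr rfl fun t ht => ?_
    exact (hcongr _ _ isOpen_interior.measurableSet isOpen_interior.measurableSet
      (interior_subset hΩr hs) (interior_subset hΩr ht)).symm
  rw [e1]
  refine (Finset.sum_le_sum fun s hs => Finset.sum_le_sum fun t ht =>
    hb s t hs ht u hu hu' h hh).trans ?_
  have hhβ : 0 ≤ h ^ (β + d) := by positivity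
  simp only [← Finset.sum_mul]
  refine mul_le_mul_left ?_ _
  have e2 : ∀ s ∈ 𝒯.cells, ∑ t ∈ 𝒯.cells, ENNReal.ofReal (C s t * h ^ (β + d)) =
      ENNReal.ofReal (∑ t ∈ 𝒯.cells, C s t * h ^ (β + d)) := fun s hs =>
    (ENNReal.ofReal_sum_of_nonneg fun t ht => mul_nonneg (hC s t hs ht).le hhβ).symm
  rw [Finset.sum_congr rfl e2, ← ENNReal.ofReal_sum_of_nonneg fun s hs =>
    Finset.sum_nonneg fun t ht => mul_nonneg (hC s t hs ht).le hhβ]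
  refine ENNReal.ofReal_le_ofReal ?_
  simp only [← Finset.sum_mul]
  exact mul_le_mul_of_nonneg_right (by linarith) hhβ

/-- Stability of the `L²`-projection in `W^{1,β}`, uniformly in a quasiuniform family. -/
theorem exists_gradient_projection_le (𝒯₀ : Triangulation Ω) (hd : 2 ≤ d) (hΩo : IsOpen Ω)
    (hΩr : interior (closure Ω) = Ω) (k : ℕ) {κ β : ℝ} (hκ : 0 < κ) (hβ : 1 < β) (hβ2 : β < 2) :
    ∃ C : ℝ, 0 < C ∧ ∀ 𝒯 : Triangulation Ω, 0 < 𝒯.meshSize →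
      (∀ T ∈ 𝒯.elements, ∃ x, Metric.closedBall x (κ * 𝒯.meshSize) ⊆ T) →
      ∀ (w u : EuclideanSpace ℝ (Fin d) → ℝ), w ∈ 𝒯.scalarSpace k →
        ContinuousOn u (closure Ω) → (∀ x ∈ Ω, DifferentiableAt ℝ u x) →
        (∀ r ∈ 𝒯.scalarSpace k, ∫ x in Ω, (w x - u x) * r x = 0) →
        ∫⁻ x in Ω, ENNReal.ofReal (‖gradient w x‖ ^ β) ≤
          ENNReal.ofReal C * sobolevMass β u Ω := by
  obtain ⟨a, C₁, ha, hC₁, h₁⟩ := exists_gradient_rpow_le d k hκ hβ hβ2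
  -- Here Ω is cut along the fixed triangulation `𝒯₀`, and the estimate holds for every h > 0. The
  -- varying mesh enters through h alone, whose powers cancel below.
  obtain ⟨C₂, hC₂, h₂⟩ := 𝒯₀.exists_nonlocalForm_le hd hΩo hΩr hβ hβ2 ha
  refine ⟨C₁ * C₂, by positivity, fun 𝒯 hh hq w u hw hu hu' horth => ?_⟩
  set h := 𝒯.meshSize
  have hpt : ∀ᵐ x ∂volume.restrict Ω, ENNReal.ofReal (‖gradient w x‖ ^ β) ≤
      ENNReal.ofReal (C₁ * h ^ (-(β + d))) *
        ∫⁻ y in Ω, ENNReal.ofReal (Real.exp (-(a * dist y x / h)) * |u y - u x| ^ β) := by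
    filter_upwards [𝒯.ae_mem_interior hΩr] with x hx
    obtain ⟨s, hs, hxs⟩ := hx
    exact h₁ 𝒯 hΩr hh hq w u hw hu horth s hs x hxs
  refine (lintegral_mono_ae hpt).trans ?_
  rw [lintegral_const_mul' _ _ ENNReal.ofReal_ne_top]
  refine (mul_le_mul_right (h₂ u hu hu' h hh) _).trans_eq ?_
  rw [← mul_assoc, ← ENNReal.ofReal_mul (by positivity)]
  congr 2
  have hne : h ^ (β + d) ≠ 0 := (Real.rpow_pos_of_pos hh _).ne'
  rw [Real.rpow_neg hh.le]
  field_simp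

end Triangulation


/-! ### Trace inequality on the boundary. -/

section Cone

variable {E : Type*} [NormedAddCommGroup E] [InnerProductSpace ℝ E] [FiniteDimensional ℝ E]
  [MeasurableSpace E] [BorelSpace E]

/-- Integration over the part of a cone over a hyperplane that lies away from the apex. -/
theorem exists_lintegral_cone_le (W : Submodule ℝ E) (e : E) (he : e ∉ W)
    (hW : Module.finrank ℝ W + 1 = Module.finrank ℝ E) :
    ∃ c : ℝ≥0∞, c ≠ ∞ ∧ ∀ g : E → ℝ≥0∞, Measurable g →
      ∫⁻ τ in Ioo (1 / 2 : ℝ) 1, ∫⁻ w : W, g (τ • (w : E) + (1 - τ) • e) ≤ c * ∫⁻ x, g x := by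
  set L₀ : W × ℝ →ₗ[ℝ] E := W.subtype.coprod (LinearMap.toSpanSingleton ℝ E e) with hL₀
  have hL₀a : ∀ q, L₀ q = (q.1 : E) + q.2 • e := fun q => by simp [hL₀]
  have hinj : Function.Injective L₀ := by
    rw [← LinearMap.ker_eq_bot, LinearMap.ker_eq_bot']
    rintro ⟨w, a⟩ h
    rw [hL₀a] at h
    have ha : a = 0 := by
      by_contra ha
      refine he ?_
      have : e = -(a⁻¹ • (w : E)) := by
        rw [eq_neg_iff_add_eq_zero]
        have h' := congrArg (a⁻¹ • ·) h
        simp only [smul_add, smul_smul, inv_mul_cancel₀ ha, one_smul, smul_zero] at h'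
        rw [add_comm]; exact h'
      rw [this]
      exact W.neg_mem (W.smul_mem _ w.2)
    subst ha
    simpa using h
  set L : (W × ℝ) ≃L[ℝ] E := (LinearMap.linearEquivOfInjective L₀ hinj
    (by simp [hW])).toContinuousLinearEquiv with hL
  have hLa : ∀ q, L q = (q.1 : E) + q.2 • e := fun q => hL₀a q
  set ν : Measure E := ((volume : Measure W).prod (volume : Measure ℝ)).map L
  -- The image of the product measure under a linear isomorphism is a Haar measure, hence a multiple
  -- of the volume.
  have hν : ν.IsAddHaarMeasure := L.isAddHaarMeasure_map _
  obtain ⟨c, hνv⟩ : ∃ c : NNReal, ν = c • (volume : Measure E) :=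
    ⟨_, Measure.isAddLeftInvariant_eq_smul ν volume⟩
  set n := Module.finrank ℝ W
  refine ⟨ENNReal.ofReal (2 ^ n) * (c : ℝ≥0∞),
    ENNReal.mul_ne_top ENNReal.ofReal_ne_top ENNReal.coe_ne_top, fun g hg => ?_⟩
  have hslice : ∀ τ ∈ Ioo (1 / 2 : ℝ) 1, ∫⁻ w : W, g (τ • (w : E) + (1 - τ) • e) ≤
      ENNReal.ofReal (2 ^ n) * ∫⁻ w : W, g ((w : E) + (1 - τ) • e) := by
    intro τ hτ
    have hτ0 : 0 < τ := by linarith [hτ.1]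
    have h1 : ∫⁻ w : W, g (τ • (w : E) + (1 - τ) • e) =
        ∫⁻ w : W, g ((w : E) + (1 - τ) • e) ∂(Measure.map (τ • ·) volume) := by
      rw [lintegral_map (by fun_prop) (by fun_prop)]
      rfl
    rw [h1, Measure.map_addHaar_smul _ hτ0.ne', lintegral_smul_measure, smul_eq_mul]
    refine mul_le_mul_left (ENNReal.ofReal_le_ofReal ?_) _
    rw [abs_of_pos (by positivity), ← inv_pow]
    refine pow_le_pow_left₀ (by positivity) ?_ _
    rw [inv_le_comm₀ hτ0 two_pos]
    linarith [hτ.1]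
  calc ∫⁻ τ in Ioo (1 / 2 : ℝ) 1, ∫⁻ w : W, g (τ • (w : E) + (1 - τ) • e)
      ≤ ∫⁻ τ in Ioo (1 / 2 : ℝ) 1,
        ENNReal.ofReal (2 ^ n) * ∫⁻ w : W, g ((w : E) + (1 - τ) • e) :=
        setLIntegral_mono' measurableSet_Ioo hslice
    _ ≤ ∫⁻ τ : ℝ, ENNReal.ofReal (2 ^ n) * ∫⁻ w : W, g ((w : E) + (1 - τ) • e) :=
        setLIntegral_le_lintegral _ _
    _ = ENNReal.ofReal (2 ^ n) * ∫⁻ τ : ℝ, ∫⁻ w : W, g ((w : E) + (1 - τ) • e) :=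
        lintegral_const_mul' _ _ ENNReal.ofReal_ne_top
    _ = ENNReal.ofReal (2 ^ n) * ∫⁻ τ : ℝ, ∫⁻ w : W, g ((w : E) + τ • e) := by
        rw [lintegral_sub_left_eq_self (fun τ : ℝ => ∫⁻ w : W, g ((w : E) + τ • e)) 1]
    _ = ENNReal.ofReal (2 ^ n) * ∫⁻ x, g x ∂ν := by
        rw [lintegral_map hg L.continuous.measurable, lintegral_prod_symm'
          (fun q => g (L q)) (hg.comp L.continuous.measurable)]
        rfl
    _ = _ := by
        rw [hνv, lintegral_smul_measure, mul_assoc]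
        rfl

end Cone


namespace IsCell

variable {d : ℕ} {s : Finset (EuclideanSpace ℝ (Fin d))} {p y₀ : EuclideanSpace ℝ (Fin d)}

theorem finrank_ker_bary (hs : IsCell s) (hp : p ∈ s) (hy : y₀ ∈ s) (hpy : p ≠ y₀) :
    p - y₀ ∉ LinearMap.ker (bary s p).linear ∧
      Module.finrank ℝ (LinearMap.ker (bary s p).linear) + 1 = d := by
  have h1 : (bary s p).linear (p - y₀) = 1 := by
    rw [bary_linear_sub, hs.bary_self hp, hs.bary_ne hy hpy, sub_zero]
  refine ⟨fun h => ?_, ?_⟩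
  · rw [LinearMap.mem_ker, h1] at h
    exact one_ne_zero h
  · have h0 : (bary s p).linear ≠ 0 := fun h => by
      rw [h] at h1
      exact zero_ne_one h1
    have := Module.Dual.finrank_ker_add_one_of_ne_zero h0
    rwa [finrank_euclideanSpace_fin] at this

variable [DecidableEq (EuclideanSpace ℝ (Fin d))]

theorem mem_facet_iff (hs : IsCell s) (hp : p ∈ s) {x : EuclideanSpace ℝ (Fin d)} :
    x ∈ hull (s.erase p) ↔ x ∈ hull s ∧ bary s p x = 0 := by
  rw [hs.mem_convexHull_subset_iff (Finset.erase_subset p s)]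
  refine and_congr_right fun _ => ⟨fun h => h p hp (Finset.notMem_erase p s), fun h v hv hv' => ?_⟩
  have : v = p := by
    by_contra hvp
    exact hv' (Finset.mem_erase.2 ⟨hvp, hv⟩)
  rwa [this]

/-- Surface integrals over a facet, in coordinates. -/
theorem lintegral_facet (hs : IsCell s) (hp : p ∈ s) (hy : y₀ ∈ s) (hpy : p ≠ y₀)
    (f : EuclideanSpace ℝ (Fin d) → ℝ≥0∞) :
    ∫⁻ y in hull (s.erase p), f y ∂(Measure.euclideanHausdorffMeasure (d - 1)) =
      ∫⁻ w in (fun w : LinearMap.ker (bary s p).linear => y₀ + (w : EuclideanSpace ℝ (Fin d))) ⁻¹'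
        hull (s.erase p), f (y₀ + w) := by
  set W := LinearMap.ker (bary s p).linear with hW
  set j : W → EuclideanSpace ℝ (Fin d) := fun w => y₀ + w with hj
  have hrank : Module.finrank ℝ W = d - 1 := by
    have h : Module.finrank ℝ W + 1 = d := (hs.finrank_ker_bary hp hy hpy).2
    omega
  have hiso : Isometry j := Isometry.of_dist_eq fun a b => by
    simp only [hj, dist_add_left]
    rfl
  have hemb : MeasurableEmbedding j := hiso.isClosedEmbedding.measurableEmbedding
  have hsub : hull (s.erase p) ⊆ range j := by
    intro y hy'
    rw [hs.mem_facet_iff hp] at hy'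
    refine ⟨⟨y - y₀, ?_⟩, by simp [hj]⟩
    rw [hW, LinearMap.mem_ker, bary_linear_sub, hy'.2, hs.bary_ne hy hpy, sub_zero]
  have hmap := hiso.map_euclideanHausdorffMeasure (d := d - 1)
  rw [show (Measure.euclideanHausdorffMeasure (d - 1) : Measure W) = volume by
    rw [← hrank]; exact InnerProductSpace.euclideanHausdorffMeasure_eq_volume] at hmap
  rw [← Measure.restrict_restrict_of_subset hsub, ← hmap, hemb.restrict_map, hemb.lintegral_map]

theorem facet_measure_lt_top (hs : IsCell s) (hp : p ∈ s) (hy : y₀ ∈ s) (hpy : p ≠ y₀) :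
    Measure.euclideanHausdorffMeasure (d - 1) (hull (s.erase p)) < ∞ := by
  have h := hs.lintegral_facet hp hy hpy 1
  simp only [Pi.one_apply, lintegral_const, one_mul, Measure.restrict_apply_univ] at h
  rw [h]
  have hc : Bornology.IsBounded (hull (s.erase p)) :=
    ((s.erase p).finite_toSet.isCompact_convexHull ℝ).isBounded
  obtain ⟨R, hR⟩ := hc.subset_closedBall y₀
  refine (measure_mono (fun w hw => ?_ : _ ⊆ Metric.closedBall
    (0 : LinearMap.ker (bary s p).linear) R)).trans_lt
    (isCompact_closedBall _ _).measure_lt_top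
  have := hR hw
  simpa [dist_eq_norm] using this

/-- The cone over a facet, away from the apex. -/
theorem exists_lintegral_facet_le (hs : IsCell s) (hp : p ∈ s) (hy : y₀ ∈ s) (hpy : p ≠ y₀) :
    ∃ c : ℝ≥0∞, c ≠ ∞ ∧ ∀ g : EuclideanSpace ℝ (Fin d) → ℝ≥0∞, Measurable g →
      ∫⁻ τ in Ioo (1 / 2 : ℝ) 1, ∫⁻ y in hull (s.erase p), g (p + τ • (y - p))
        ∂(Measure.euclideanHausdorffMeasure (d - 1)) ≤ c * ∫⁻ x, g x := by
  obtain ⟨h1, h2⟩ := hs.finrank_ker_bary hp hy hpy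
  obtain ⟨c, hc, h⟩ := exists_lintegral_cone_le _ _ h1 (by rw [h2, finrank_euclideanSpace_fin])
  refine ⟨c, hc, fun g hg => ?_⟩
  have h3 := h (fun x => g (y₀ + x)) (by fun_prop)
  rw [lintegral_add_left_eq_self g y₀] at h3
  refine le_trans (lintegral_mono fun τ => ?_) h3
  rw [hs.lintegral_facet hp hy hpy]
  refine (setLIntegral_le_lintegral _ _).trans_eq (lintegral_congr fun w => congrArg g ?_)
  module

end IsCell

namespace Triangulation

variable {d : ℕ} {Ω : Set (EuclideanSpace ℝ (Fin d))} (𝒯 : Triangulation Ω)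

/-- The size of the piecewise gradient; on overlaps of the closed cells, the sum. -/
def gradSize (P : Finset (EuclideanSpace ℝ (Fin d)) → MvPolynomial (Fin d) ℝ)
    (x : EuclideanSpace ℝ (Fin d)) : ℝ≥0∞ :=
  ∑ s ∈ 𝒯.cells, (hull s).indicator (fun x => ENNReal.ofReal ‖polyGrad (P s) x‖) x

theorem measurable_gradSize (P : Finset (EuclideanSpace ℝ (Fin d)) → MvPolynomial (Fin d) ℝ) :
    Measurable (𝒯.gradSize P) := by
  refine Finset.measurable_fun_sum _ fun s hs => ?_
  exact ((continuous_polyGrad (P s)).norm.measurable.ennreal_ofReal).indicator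
    (isCell hs).measurableSet_hull

theorem lintegral_gradSize (hΩr : interior (closure Ω) = Ω)
    {P : Finset (EuclideanSpace ℝ (Fin d)) → MvPolynomial (Fin d) ℝ}
    {r : EuclideanSpace ℝ (Fin d) → ℝ}
    (hP : ∀ s ∈ 𝒯.cells, ∀ x ∈ hull s, r x = polyEval (P s) x) :
    ∫⁻ x, 𝒯.gradSize P x = ∫⁻ x in Ω, ENNReal.ofReal ‖gradient r x‖ := by
  simp only [gradSize]
  rw [lintegral_finsetSum' _ fun s hs =>
    (((continuous_polyGrad (P s)).norm.measurable.ennreal_ofReal).indicator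
      (isCell hs).measurableSet_hull).aemeasurable, 𝒯.lintegral_eq_sum_interior hΩr]
  refine Finset.sum_congr rfl fun s hs => ?_
  rw [lintegral_indicator (isCell hs).measurableSet_hull,
    ← setLIntegral_congr (interior_ae_eq_convexHull _)]
  exact setLIntegral_congr_fun isOpen_interior.measurableSet fun x hx => by
    rw [gradient_eq_polyGrad (hP s hs) hx]

theorem le_gradSize {P : Finset (EuclideanSpace ℝ (Fin d)) → MvPolynomial (Fin d) ℝ}
    {s : Finset (EuclideanSpace ℝ (Fin d))} (hs : s ∈ 𝒯.cells) {x : EuclideanSpace ℝ (Fin d)}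
    (hx : x ∈ hull s) : ENNReal.ofReal ‖polyGrad (P s) x‖ ≤ 𝒯.gradSize P x := by
  have := Finset.single_le_sum (f := fun s => (hull s).indicator
    (fun x => ENNReal.ofReal ‖polyGrad (P s) x‖) x) (fun _ _ => zero_le) hs
  rwa [indicator_of_mem hx] at this

/-- The increments of a continuous piecewise polynomial function along a segment. -/
theorem ofReal_abs_sub_le_gradSize
    {P : Finset (EuclideanSpace ℝ (Fin d)) → MvPolynomial (Fin d) ℝ}
    {r : EuclideanSpace ℝ (Fin d) → ℝ} (hr : ContinuousOn r (closure Ω))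
    (hP : ∀ s ∈ 𝒯.cells, ∀ x ∈ hull s, r x = polyEval (P s) x)
    (p q : EuclideanSpace ℝ (Fin d)) {a b : ℝ} (hab : a ≤ b)
    (hsub : ∀ τ ∈ Icc a b, p + τ • q ∈ closure Ω) :
    ENNReal.ofReal |r (p + b • q) - r (p + a • q)| ≤
      ENNReal.ofReal ‖q‖ * ∫⁻ τ in Ioo a b, 𝒯.gradSize P (p + τ • q) := by
  -- The segment meets each cell in a compact interval. Away from the finitely many endpoints the
  -- function agrees near τ with a single polynomial.
  set J : Finset (EuclideanSpace ℝ (Fin d)) → Set ℝ := fun s =>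
    (fun τ : ℝ => p + τ • q) ⁻¹' hull s ∩ Icc a b with hJ
  have hγ : Continuous fun τ : ℝ => p + τ • q := by fun_prop
  have hJI : ∀ s ∈ 𝒯.cells, (J s).Nonempty → J s = Icc (sInf (J s)) (sSup (J s)) := by
    intro s hs hne
    refine eq_Icc_of_connected_compact ⟨hne, ?_⟩ ?_
    · have h1 : Convex ℝ ((fun τ : ℝ => p + τ • q) ⁻¹' hull s) :=
        (convex_convexHull ℝ _).affine_preimage
          (AffineMap.const ℝ ℝ p + (LinearMap.toSpanSingleton ℝ _ q).toAffineMap)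
      exact (h1.inter (convex_Icc a b)).isPreconnected
    · exact isCompact_Icc.inter_left ((isCell hs).isCompact.isClosed.preimage hγ)
  set S : Set ℝ := ⋃ s ∈ 𝒯.cells, {sInf (J s), sSup (J s)} with hS
  have hSc : S.Countable := (Finset.finite_toSet 𝒯.cells).countable.biUnion fun s _ =>
    (Set.toFinite _).countable
  have hkey : ∀ τ ∈ Ioo a b \ S, ∃ s ∈ 𝒯.cells, p + τ • q ∈ hull s ∧
      HasDerivAt (fun τ : ℝ => r (p + τ • q)) (inner ℝ (polyGrad (P s) (p + τ • q)) q) τ := by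
    rintro τ ⟨hτ, hτS⟩
    obtain ⟨s, hs, hτs⟩ := 𝒯.exists_cell (hsub τ (Ioo_subset_Icc_self hτ))
    have hτJ : τ ∈ J s := ⟨hτs, Ioo_subset_Icc_self hτ⟩
    have e := hJI s hs ⟨τ, hτJ⟩
    have hτS' : τ ≠ sInf (J s) ∧ τ ≠ sSup (J s) := by
      refine ⟨fun h => hτS ?_, fun h => hτS ?_⟩
      · exact mem_biUnion hs (Or.inl h)
      · exact mem_biUnion hs (Or.inr h)
    have hτe := hτJ
    rw [e] at hτe
    have hnhds : J s ∈ nhds τ := by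
      rw [e]
      exact Icc_mem_nhds (lt_of_le_of_ne hτe.1 hτS'.1.symm) (lt_of_le_of_ne hτe.2 hτS'.2)
    refine ⟨s, hs, hτs, ?_⟩
    have h1 : HasDerivAt (fun τ : ℝ => p + τ • q) q τ := by
      simpa using ((hasDerivAt_id τ).smul_const q).const_add p
    have h2 := (hasFDerivAt_polyEval (P s) (p + τ • q)).comp_hasDerivAt τ h1
    refine HasDerivAt.congr_of_eventuallyEq (f := fun τ : ℝ => polyEval (P s) (p + τ • q)) ?_ ?_
    · exact h2
    · filter_upwards [hnhds] with σ hσ using hP s hs _ hσ.1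
  have hc : ContinuousOn (fun τ : ℝ => r (p + τ • q)) (Icc a b) :=
    hr.comp hγ.continuousOn hsub
  refine (ofReal_abs_sub_le_lintegral hab hSc hc (f' := deriv fun τ : ℝ => r (p + τ • q))
    fun τ hτ => ?_).trans ?_
  · obtain ⟨s, _, _, h⟩ := hkey τ hτ
    exact h.differentiableAt.hasDerivAt
  rw [← lintegral_const_mul' _ _ ENNReal.ofReal_ne_top]
  refine lintegral_mono_ae ?_
  have hS0 : ∀ᵐ τ : ℝ ∂volume.restrict (Ioo a b), τ ∉ S :=
    ae_restrict_of_ae (measure_eq_zero_iff_ae_notMem.1 (hSc.measure_zero _))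
  filter_upwards [hS0, ae_restrict_mem measurableSet_Ioo] with τ h1 h2
  obtain ⟨s, hs, hτs, h⟩ := hkey τ ⟨h2, h1⟩
  rw [h.deriv]
  refine le_trans (ENNReal.ofReal_le_ofReal (abs_real_inner_le_norm _ _)) ?_
  rw [ENNReal.ofReal_mul (norm_nonneg _), mul_comm]
  exact mul_le_mul_right (𝒯.le_gradSize hs hτs) _

end Triangulation


namespace Triangulation

variable {d : ℕ} {Ω : Set (EuclideanSpace ℝ (Fin d))}

theorem closure_ae_eq (𝒯₀ : Triangulation Ω) (hΩr : interior (closure Ω) = Ω) :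
    closure Ω =ᵐ[volume] Ω := by
  refine Filter.EventuallyLE.antisymm ?_ subset_closure.eventuallyLE
  rw [ae_le_set]
  have h : closure Ω \ Ω ⊆ ⋃ s ∈ 𝒯₀.cells, frontier (hull s) := by
    rintro x ⟨hx, hx'⟩
    obtain ⟨s, hs, hxs⟩ := 𝒯₀.exists_cell hx
    exact mem_biUnion hs ⟨subset_closure hxs, fun h => hx' (interior_subset hΩr hs h)⟩
  exact measure_mono_null h ((measure_biUnion_null_iff
    (Finset.finite_toSet 𝒯₀.cells).countable).2 fun s _ => volume_frontier_convexHull _)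

/-- The facet belongs to the fixed triangulation, r to an arbitrary one. The value at a boundary
point y is compared with the values on the segment towards the opposite vertex p, averaged over τ in
(1/2, 1); the resulting double integral is a volume integral over the cone away from its apex, where
the change of variables is harmless. -/
theorem exists_facet_trace_le [DecidableEq (EuclideanSpace ℝ (Fin d))] (𝒯₀ : Triangulation Ω)
    (hd : 2 ≤ d) (hΩr : interior (closure Ω) = Ω)
    {s : Finset (EuclideanSpace ℝ (Fin d))} (hs : s ∈ 𝒯₀.cells) {p : EuclideanSpace ℝ (Fin d)}
    (hp : p ∈ s) (k : ℕ) :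
    Measure.euclideanHausdorffMeasure (d - 1) (hull (s.erase p)) < ∞ ∧
      ∃ c : ℝ≥0∞, c ≠ ∞ ∧ ∀ (𝒯 : Triangulation Ω), ∀ r ∈ 𝒯.scalarSpace k,
        ∫⁻ y in hull (s.erase p), ENNReal.ofReal |r y|
          ∂(Measure.euclideanHausdorffMeasure (d - 1)) ≤
        c * ((∫⁻ x in Ω, ENNReal.ofReal |r x|) + ∫⁻ x in Ω, ENNReal.ofReal ‖gradient r x‖) := by
  have hcs := isCell hs
  obtain ⟨y₀, hy, hpy⟩ := Finset.exists_mem_ne (show 1 < s.card by rw [hcs.card_eq]; omega) p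
  have hfin := hcs.facet_measure_lt_top hp hy hpy.symm
  obtain ⟨c, hc, hcone⟩ := hcs.exists_lintegral_facet_le hp hy hpy.symm
  set μ : Measure (EuclideanSpace ℝ (Fin d)) :=
    (Measure.euclideanHausdorffMeasure (d - 1)).restrict (hull (s.erase p)) with hμ
  have : IsFiniteMeasure μ := ⟨by rwa [hμ, Measure.restrict_apply_univ]⟩
  set D := ENNReal.ofReal (Metric.diam (hull s)) with hD
  refine ⟨hfin, 2 * c * (1 + D), ENNReal.mul_ne_top (ENNReal.mul_ne_top (by simp) hc)
    (by simp [hD]), fun 𝒯 r hr => ?_⟩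
  obtain ⟨P, hP⟩ := exists_poly hr
  have hP' : ∀ s ∈ 𝒯.cells, ∀ x ∈ hull s, r x = polyEval (P s) x := fun s hs => (hP s hs).2
  have hcl : MeasurableSet (closure Ω) := isClosed_closure.measurableSet
  set v := (closure Ω).indicator r with hv
  have hvm : Measurable v := measurable_indicator_of_continuousOn hr.1 hcl
  set A : EuclideanSpace ℝ (Fin d) → ℝ≥0∞ := fun x => ENNReal.ofReal |v x|
  have hAm : Measurable A := by fun_prop
  have hGm := 𝒯.measurable_gradSize P
  have hm : ∀ g : EuclideanSpace ℝ (Fin d) → ℝ≥0∞, Measurable g →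
      Measurable (Function.uncurry fun (y : EuclideanSpace ℝ (Fin d)) (τ : ℝ) =>
        g (p + τ • (y - p))) := fun g hg => hg.comp (by fun_prop)
  have hmem : ∀ y ∈ hull (s.erase p), ∀ τ ∈ Icc (1 / 2 : ℝ) 1, p + τ • (y - p) ∈ hull s := by
    intro y hy' τ hτ
    have h1 := ((hcs.mem_facet_iff hp).1 hy').1
    exact (convex_convexHull ℝ _).add_smul_sub_mem (hull_mem hp) h1 ⟨by linarith [hτ.1], hτ.2⟩
  have hpoint : ∀ y ∈ hull (s.erase p), ∀ τ ∈ Ioo (1 / 2 : ℝ) 1,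
      ENNReal.ofReal |r y| ≤ A (p + τ • (y - p)) +
        D * ∫⁻ σ in Ioo (1 / 2 : ℝ) 1, 𝒯.gradSize P (p + σ • (y - p)) := by
    intro y hy' τ hτ
    have hin : ∀ σ ∈ Icc τ 1, p + σ • (y - p) ∈ closure Ω := fun σ hσ =>
      convexHull_subset_closure hs (hmem y hy' σ ⟨hτ.1.le.trans hσ.1, hσ.2⟩)
    have h1 := 𝒯.ofReal_abs_sub_le_gradSize hr.1 hP' p (y - p) hτ.2.le hin
    rw [one_smul, add_sub_cancel] at h1
    have h2 : v (p + τ • (y - p)) = r (p + τ • (y - p)) :=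
      indicator_of_mem (hin τ (left_mem_Icc.2 hτ.2.le)) r
    have h3 : ENNReal.ofReal |r y| ≤ A (p + τ • (y - p)) +
        ENNReal.ofReal |r y - r (p + τ • (y - p))| := by
      rw [← ENNReal.ofReal_add (abs_nonneg _) (abs_nonneg _), h2]
      refine ENNReal.ofReal_le_ofReal ?_
      have := abs_add_le (r (p + τ • (y - p))) (r y - r (p + τ • (y - p)))
      rwa [add_sub_cancel] at this
    refine h3.trans (add_le_add_right (h1.trans (mul_le_mul' (ENNReal.ofReal_le_ofReal ?_)
      (lintegral_mono_set (Ioo_subset_Ioo_left hτ.1.le)))) _)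
    rw [← dist_eq_norm]
    exact Metric.dist_le_diam_of_mem hcs.isCompact.isBounded
      ((hcs.mem_facet_iff hp).1 hy').1 (hull_mem hp)
  have hhalf : volume (Ioo (1 / 2 : ℝ) 1) = 2⁻¹ := by
    rw [Real.volume_Ioo, show (1 - 1 / 2 : ℝ) = 2⁻¹ by norm_num, ENNReal.ofReal_inv_of_pos two_pos]
    simp
  have hswap : ∀ g : EuclideanSpace ℝ (Fin d) → ℝ≥0∞, Measurable g →
      ∫⁻ y, ∫⁻ τ in Ioo (1 / 2 : ℝ) 1, g (p + τ • (y - p)) ∂volume ∂μ ≤ c * ∫⁻ x, g x := by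
    intro g hg
    rw [lintegral_lintegral_swap (hm g hg).aemeasurable]
    exact hcone g hg
  have hI : ∀ y ∈ hull (s.erase p), 2⁻¹ * ENNReal.ofReal |r y| ≤
      (∫⁻ τ in Ioo (1 / 2 : ℝ) 1, A (p + τ • (y - p))) +
        2⁻¹ * (D * ∫⁻ σ in Ioo (1 / 2 : ℝ) 1, 𝒯.gradSize P (p + σ • (y - p))) := by
    intro y hy'
    have h := setLIntegral_mono' (μ := volume) measurableSet_Ioo (hpoint y hy')
    rw [setLIntegral_const, hhalf, lintegral_add_right _ measurable_const,
      setLIntegral_const, hhalf] at h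
    rw [mul_comm, mul_comm 2⁻¹]
    exact h
  have hFm : MeasurableSet (hull (s.erase p)) :=
    ((s.erase p).finite_toSet.isCompact_convexHull ℝ).measurableSet
  have hAτ : Measurable fun y => ∫⁻ τ in Ioo (1 / 2 : ℝ) 1, A (p + τ • (y - p)) :=
    (hm A hAm).lintegral_prod_right'
  have h1 := setLIntegral_mono' (μ := Measure.euclideanHausdorffMeasure (d - 1)) hFm hI
  rw [lintegral_const_mul' _ _ (by simp), lintegral_add_left hAτ,
    lintegral_const_mul' _ _ (by simp), lintegral_const_mul' _ _ ENNReal.ofReal_ne_top] at h1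
  have hA : ∫⁻ x, A x = ∫⁻ x in Ω, ENNReal.ofReal |r x| := by
    rw [← setLIntegral_congr (𝒯₀.closure_ae_eq hΩr), ← lintegral_indicator hcl]
    refine lintegral_congr fun x => ?_
    by_cases hx : x ∈ closure Ω
    · simp only [A, hv, indicator_of_mem hx]
    · simp [A, hv, indicator_of_notMem hx]
  have hG := 𝒯.lintegral_gradSize hΩr hP'
  have h2 := hswap A hAm
  have h3 := hswap _ hGm
  rw [hA] at h2
  rw [hG] at h3
  set a := ∫⁻ x in Ω, ENNReal.ofReal |r x|
  set b := ∫⁻ x in Ω, ENNReal.ofReal ‖gradient r x‖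
  set R := ∫⁻ y, ENNReal.ofReal |r y| ∂μ
  have h4 : 2⁻¹ * R ≤ c * a + 2⁻¹ * (D * (c * b)) :=
    h1.trans (add_le_add h2 (mul_le_mul_right (mul_le_mul_right h3 _) _))
  have e2 : (2 : ℝ≥0∞) * 2⁻¹ = 1 := ENNReal.mul_inv_cancel (by simp) (by simp)
  calc R = 2 * (2⁻¹ * R) := by rw [← mul_assoc, e2, one_mul]
    _ ≤ 2 * (c * a + 2⁻¹ * (D * (c * b))) := mul_le_mul_right h4 _
    _ = 2 * c * a + D * c * b := by
        rw [mul_add, ← mul_assoc 2 2⁻¹, e2]; ring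
    _ ≤ 2 * c * a + D * c * b + (2 * c * b + 2 * c * D * a + D * c * b) := le_self_add
    _ = 2 * c * (1 + D) * (a + b) := by ring

/-- A trace inequality, uniform over all triangulations of the domain. -/
theorem exists_trace_le (𝒯₀ : Triangulation Ω) (hd : 2 ≤ d) (hΩo : IsOpen Ω)
    (hΩr : interior (closure Ω) = Ω) (k : ℕ) :
    IsFiniteMeasure (surfaceMeasure Ω) ∧
      ∃ c : ℝ≥0∞, c ≠ ∞ ∧ ∀ (𝒯 : Triangulation Ω), ∀ r ∈ 𝒯.scalarSpace k,
        ∫⁻ y, ENNReal.ofReal |r y| ∂(surfaceMeasure Ω) ≤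
        c * ((∫⁻ x in Ω, ENNReal.ofReal |r x|) + ∫⁻ x in Ω, ENNReal.ofReal ‖gradient r x‖) := by
  classical
  have key := fun s hs p hp => 𝒯₀.exists_facet_trace_le hd hΩr (s := s) (p := p) hs hp k
  have hsub := 𝒯₀.frontier_subset hΩo hΩr
  constructor
  · refine ⟨?_⟩
    rw [surfaceMeasure, Measure.restrict_apply_univ]
    refine (measure_mono hsub).trans_lt ?_
    refine (measure_biUnion_lt_top 𝒯₀.cells.finite_toSet fun s hs => ?_)
    exact measure_biUnion_lt_top s.finite_toSet fun p hp => (key s hs p hp).1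
  · have key' := fun s hs p hp => (key s hs p hp).2
    choose! c hc hb using key'
    refine ⟨∑ s ∈ 𝒯₀.cells, ∑ p ∈ s, c s p, ?_, fun 𝒯 r hr => ?_⟩
    · exact ENNReal.sum_ne_top.2 fun s hs => ENNReal.sum_ne_top.2 fun p hp => hc s hs p hp
    rw [surfaceMeasure]
    refine (lintegral_mono_set hsub).trans ((lintegral_biUnion_finset_le _ _ _).trans ?_)
    rw [Finset.sum_mul]
    refine Finset.sum_le_sum fun s hs => (lintegral_biUnion_finset_le _ _ _).trans ?_
    rw [Finset.sum_mul]
    exact Finset.sum_le_sum fun p hp => hb s hs p hp 𝒯 r hr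

end Triangulation


/-! ### Nodal bases. -/

/-- Elements of a finite-dimensional space of functions are determined by their values at finitely
many points, linearly. -/
theorem Submodule.exists_nodal_basis {X : Type*} (V : Submodule ℝ (X → ℝ)) [FiniteDimensional ℝ V] :
    ∃ (n : ℕ) (x : Fin n → X) (b : Fin n → V), ∀ r ∈ V, r = ∑ j, r (x j) • (b j : X → ℝ) := by
  classical
  let R : (S : Finset X) → V →ₗ[ℝ] (S → ℝ) := fun S =>
    (LinearMap.pi fun x : S => LinearMap.proj (x : X)) ∘ₗ V.subtype
  have hR : ∀ (S : Finset X) (v : V) (x : S), R S v x = (v : X → ℝ) x := fun S v x => rfl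
  -- Take a finite set of points whose evaluation map has the smallest kernel. An element of that
  -- kernel nonzero at some further point would allow a smaller one.
  obtain ⟨S, hS⟩ : ∃ S : Finset X, ∀ S' : Finset X,
      Module.finrank ℝ (LinearMap.ker (R S)) ≤ Module.finrank ℝ (LinearMap.ker (R S')) :=
    ⟨Function.argmin fun S => Module.finrank ℝ (LinearMap.ker (R S)),
      fun S' => Function.argmin_le (fun S => Module.finrank ℝ (LinearMap.ker (R S))) S'⟩
  have hker : LinearMap.ker (R S) = ⊥ := by
    rw [LinearMap.ker_eq_bot']
    intro v hv
    ext x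
    have hle : LinearMap.ker (R (insert x S)) ≤ LinearMap.ker (R S) := by
      intro w hw
      rw [LinearMap.mem_ker] at hw ⊢
      ext y
      have := congrFun hw ⟨y, Finset.mem_insert_of_mem y.2⟩
      exact this
    have heq := Submodule.eq_of_le_of_finrank_le hle (hS _)
    have hv' : v ∈ LinearMap.ker (R (insert x S)) := by rw [heq]; exact hv
    exact congrFun (LinearMap.mem_ker.1 hv') ⟨x, Finset.mem_insert_self x S⟩
  obtain ⟨g, hg⟩ := (R S).exists_leftInverse_of_injective hker
  refine ⟨S.card, fun j => S.equivFin.symm j, fun j => g (Pi.single (S.equivFin.symm j) 1),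
    fun r hr => ?_⟩
  have h1 : g (R S ⟨r, hr⟩) = ⟨r, hr⟩ := LinearMap.congr_fun hg ⟨r, hr⟩
  have h2 : R S ⟨r, hr⟩ = ∑ x : S, r x • Pi.single x (1 : ℝ) := by
    ext y
    simp [hR, Finset.sum_apply, Pi.single_apply]
  rw [h2, map_sum] at h1
  have h3 := congrArg (V.subtype) h1
  rw [map_sum] at h3
  rw [← S.equivFin.symm.sum_comp] at h3
  simp only [map_smul, Submodule.subtype_apply] at h3
  exact h3.symm

namespace Triangulation

variable {d : ℕ} {Ω : Set (EuclideanSpace ℝ (Fin d))} (𝒯 : Triangulation Ω) (k : ℕ)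

/-- The restrictions of the elements of `R_h` to the closure of the domain. -/
def restrictedSpace : Submodule ℝ (closure Ω → ℝ) where
  carrier := {v | ∃ r ∈ 𝒯.scalarSpace k, ∀ y : closure Ω, v y = r y}
  zero_mem' := ⟨fun _ => 0, ⟨continuousOn_const, fun _ _ => ⟨0, by simp⟩⟩, fun _ => rfl⟩
  add_mem' := by
    rintro v w ⟨r, hr, hv⟩ ⟨q, hq, hw⟩
    refine ⟨fun x => ∑ i : Bool, (if i then r else q) x,
      sum_mem_scalarSpace _ fun i _ => by cases i <;> simpa, fun y => ?_⟩
    simp [hv y, hw y]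
  smul_mem' := by
    rintro c v ⟨r, hr, hv⟩
    exact ⟨fun x => c * r x, const_mul_mem_scalarSpace hr c, fun y => by simp [hv y]⟩

/-- Choosing for each point a cell that contains it exhibits the space inside the image of the
cellwise polynomials of degree at most k. -/
instance finiteDimensional_restrictedSpace : FiniteDimensional ℝ (𝒯.restrictedSpace k) := by
  choose c hc hxc using fun x : closure Ω => 𝒯.exists_cell x.2
  set Λ : (𝒯.cells → MvPolynomial.restrictTotalDegree (Fin d) ℝ k) →ₗ[ℝ] (closure Ω → ℝ) :=
    { toFun := fun P x => polyEval (P ⟨c x, hc x⟩ : MvPolynomial (Fin d) ℝ) x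
      map_add' := fun P Q => by ext x; simp
      map_smul' := fun a P => by ext x; simp }
  refine Submodule.finiteDimensional_of_le (S₂ := LinearMap.range Λ) ?_
  rintro v ⟨r, hr, hv⟩
  obtain ⟨P, hP⟩ := exists_poly hr
  refine ⟨fun s => ⟨P s, (MvPolynomial.mem_restrictTotalDegree _ _ _).2 (hP s s.2).1⟩, ?_⟩
  ext x
  rw [hv x]
  exact ((hP _ (hc x)).2 x (hxc x)).symm

/-- The coefficients are values at fixed points, so pointwise continuity and differentiability in
time pass directly to them. -/
theorem exists_nodal_basis : ∃ (n : ℕ) (x : Fin n → EuclideanSpace ℝ (Fin d))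
    (b : Fin n → EuclideanSpace ℝ (Fin d) → ℝ), (∀ j, x j ∈ closure Ω) ∧
      (∀ j, b j ∈ 𝒯.scalarSpace k) ∧
      ∀ r ∈ 𝒯.scalarSpace k, ∀ y ∈ closure Ω, r y = ∑ j, r (x j) * b j y := by
  obtain ⟨n, x, b, h⟩ := (𝒯.restrictedSpace k).exists_nodal_basis
  choose q hq hbq using fun j => (b j).2
  refine ⟨n, fun j => x j, q, fun j => (x j).2, hq, fun r hr y hy => ?_⟩
  have h1 := congrFun (h (fun y => r y) ⟨r, hr, fun _ => rfl⟩) ⟨y, hy⟩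
  simpa only [Finset.sum_apply, Pi.smul_apply, smul_eq_mul, hbq] using h1

variable {𝒯 k}

theorem differentiableAt_of_mem_interior {r : EuclideanSpace ℝ (Fin d) → ℝ}
    (hr : r ∈ 𝒯.scalarSpace k) {s : Finset (EuclideanSpace ℝ (Fin d))} (hs : s ∈ 𝒯.cells)
    {x : EuclideanSpace ℝ (Fin d)} (hx : x ∈ interior (hull s)) : DifferentiableAt ℝ r x := by
  obtain ⟨P, hP⟩ := exists_poly hr
  refine (hasFDerivAt_polyEval (P s) x).differentiableAt.congr_of_eventuallyEq ?_
  filter_upwards [mem_interior_iff_mem_nhds.1 hx] with y hy using (hP s hs).2 y hy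

theorem ae_gradient_sum (hΩr : interior (closure Ω) = Ω) {n : ℕ}
    {b : Fin n → EuclideanSpace ℝ (Fin d) → ℝ} (hb : ∀ j, b j ∈ 𝒯.scalarSpace k) :
    ∀ᵐ x ∂volume.restrict Ω, ∀ e : Fin n → ℝ,
      gradient (fun y => ∑ j, e j * b j y) x = ∑ j, e j • gradient (b j) x := by
  filter_upwards [𝒯.ae_mem_interior hΩr] with x hx e
  obtain ⟨s, hs, hxs⟩ := hx
  have hd := fun j => differentiableAt_of_mem_interior (hb j) hs hxs
  simp only [gradient]
  rw [fderiv_fun_sum fun j _ => (hd j).const_mul _, map_sum]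
  refine Finset.sum_congr rfl fun j _ => ?_
  rw [fderiv_const_mul (hd j), map_smulₛₗ]
  rfl

theorem exists_gradient_bound (hΩr : interior (closure Ω) = Ω)
    {r : EuclideanSpace ℝ (Fin d) → ℝ} (hr : r ∈ 𝒯.scalarSpace k) :
    ∃ M, ∀ᵐ x ∂volume.restrict Ω, ‖gradient r x‖ ≤ M := by
  obtain ⟨P, hP⟩ := exists_poly hr
  have h : ∀ s ∈ 𝒯.cells, ∃ M, ∀ x ∈ hull s, ‖polyGrad (P s) x‖ ≤ M := fun s hs =>
    (isCell hs).isCompact.exists_bound_of_continuousOn (continuous_polyGrad _).continuousOn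
  choose! M hM using h
  refine ⟨∑ s ∈ 𝒯.cells, |M s|, ?_⟩
  filter_upwards [𝒯.ae_mem_interior hΩr] with x hx
  obtain ⟨s, hs, hxs⟩ := hx
  rw [gradient_eq_polyGrad (hP s hs).2 hxs]
  exact ((hM s hs x (_root_.interior_subset hxs)).trans (le_abs_self _)).trans
    (Finset.single_le_sum (f := fun s => |M s|) (fun _ _ => abs_nonneg _) hs)

theorem exists_bound {r : EuclideanSpace ℝ (Fin d) → ℝ} (hr : r ∈ 𝒯.scalarSpace k) :
    ∃ M, ∀ x ∈ closure Ω, ‖r x‖ ≤ M :=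
  𝒯.isCompact_closure.exists_bound_of_continuousOn hr.1

theorem gradient_congr (hΩo : IsOpen Ω) {r q : EuclideanSpace ℝ (Fin d) → ℝ}
    (h : ∀ y ∈ closure Ω, r y = q y) {x : EuclideanSpace ℝ (Fin d)} (hx : x ∈ Ω) :
    gradient r x = gradient q x :=
  Filter.EventuallyEq.gradient_eq <| by
    filter_upwards [hΩo.mem_nhds hx] with y hy using h y (subset_closure hy)

end Triangulation


/-! ### Dual pairings and regularity in time. -/

section Pairings

variable {X : Type*} [MeasurableSpace X] {μ : Measure X}

theorem integrable_mul_of_Lp_two (f : Lp ℝ 2 μ) {r : X → ℝ} (hr : MemLp r 2 μ) :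
    Integrable (fun x => f x * r x) μ := (Lp.memLp f).integrable_mul hr

theorem abs_integral_mul_le_of_Lp_two (f : Lp ℝ 2 μ) {r : X → ℝ} (hr : MemLp r 2 μ) :
    |∫ x, f x * r x ∂μ| ≤ ‖f‖ * √(∫ x, r x ^ 2 ∂μ) := by
  have h1 : inner ℝ (hr.toLp r) f = ∫ x, f x * r x ∂μ := by
    rw [L2.inner_def]
    refine integral_congr_ae ?_
    filter_upwards [hr.coeFn_toLp] with x hx
    rw [hx]
    simp
  have h2 : ‖hr.toLp r‖ ^ 2 = ∫ x, r x ^ 2 ∂μ := by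
    rw [← real_inner_self_eq_norm_sq, L2.inner_def]
    refine integral_congr_ae ?_
    filter_upwards [hr.coeFn_toLp] with x hx
    rw [hx]
    simp [sq]
  rw [← h1, ← h2, Real.sqrt_sq (norm_nonneg _), mul_comm]
  exact abs_real_inner_le_norm _ _

theorem Lp_top_ae_le (g : Lp ℝ ∞ μ) : ∀ᵐ x ∂μ, ‖g x‖ ≤ ‖g‖ := by
  have h := ae_le_eLpNormEssSup (f := g) (μ := μ)
  filter_upwards [h] with x hx
  rw [Lp.norm_def, eLpNorm_exponent_top, ← toReal_enorm]
  refine ENNReal.toReal_mono ?_ hx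
  have := Lp.eLpNorm_ne_top g
  rwa [eLpNorm_exponent_top] at this

theorem integrable_mul_of_Lp_top (g : Lp ℝ ∞ μ) {r : X → ℝ} (hr : Integrable r μ) :
    Integrable (fun x => g x * r x) μ :=
  hr.bdd_mul (Lp.aestronglyMeasurable g) (Lp_top_ae_le g)

theorem abs_integral_mul_le_of_Lp_top (g : Lp ℝ ∞ μ) {r : X → ℝ} (hr : Integrable r μ) :
    |∫ x, g x * r x ∂μ| ≤ ‖g‖ * ∫ x, |r x| ∂μ := by
  rw [← integral_const_mul, ← Real.norm_eq_abs]
  refine norm_integral_le_of_norm_le (hr.abs.const_mul _) ?_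
  filter_upwards [Lp_top_ae_le g] with x hx
  rw [norm_mul]
  exact mul_le_mul_of_nonneg_right hx (norm_nonneg _)

end Pairings

theorem sq_integral_le {g : ℝ → ℝ} {s t : ℝ} (hst : s ≤ t)
    (h1 : IntervalIntegrable g volume s t)
    (h2 : IntervalIntegrable (fun x => g x ^ 2) volume s t) :
    (∫ x in s..t, g x) ^ 2 ≤ (t - s) * ∫ x in s..t, g x ^ 2 := by
  rcases hst.eq_or_lt with rfl | hlt
  · simp
  set I := ∫ x in s..t, g x
  set Q := ∫ x in s..t, g x ^ 2
  have h3 : ∀ c : ℝ, 0 ≤ Q - 2 * c * I + c ^ 2 * (t - s) := by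
    intro c
    have h4 : ∫ x in s..t, (g x - c) ^ 2 = Q - 2 * c * I + c ^ 2 * (t - s) := by
      have e : ∀ x, (g x - c) ^ 2 = g x ^ 2 - 2 * c * g x + c ^ 2 := fun x => by ring
      simp only [e]
      rw [intervalIntegral.integral_add (h2.sub (h1.const_mul _)) (by simp),
        intervalIntegral.integral_sub h2 (h1.const_mul _), intervalIntegral.integral_const_mul,
        intervalIntegral.integral_const, smul_eq_mul]
      ring
    rw [← h4]
    exact intervalIntegral.integral_nonneg hst fun x _ => sq_nonneg _
  have hpos : 0 < t - s := sub_pos.2 hlt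
  have h5 := h3 (I / (t - s))
  have e : Q - 2 * (I / (t - s)) * I + (I / (t - s)) ^ 2 * (t - s) = Q - I ^ 2 / (t - s) := by
    field_simp
    ring
  rw [e, sub_nonneg, div_le_iff₀ hpos] at h5
  linarith

/-- For a continuous function the essential supremum over the open interval bounds every value,
endpoints included; the flow needs the bound on the boundary flux at each time. -/
theorem ContinuousOn.norm_le_eLpNorm_top {X : Type*} [NormedAddCommGroup X] {T : ℝ} (hT : 0 < T)
    {u : ℝ → X} (hu : ContinuousOn u (Icc 0 T)) {t : ℝ} (ht : t ∈ Icc 0 T) :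
    ‖u t‖ ≤ (eLpNorm u ∞ (volume.restrict (Ioo 0 T))).toReal := by
  obtain ⟨M, hM⟩ := isCompact_Icc.exists_bound_of_continuousOn hu
  have hfin : eLpNorm u ∞ (volume.restrict (Ioo 0 T)) ≠ ∞ := by
    rw [eLpNorm_exponent_top]
    refine (eLpNormEssSup_lt_top_of_ae_bound (C := M) ?_).ne
    filter_upwards [ae_restrict_mem measurableSet_Ioo] with x hx using hM x (Ioo_subset_Icc_self hx)
  set K := (eLpNorm u ∞ (volume.restrict (Ioo 0 T))).toReal with hK
  have hae : ∀ᵐ x ∂volume.restrict (Ioo 0 T), ‖u x‖ ≤ K := by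
    filter_upwards [ae_le_eLpNormEssSup (f := u) (μ := volume.restrict (Ioo 0 T))] with x hx
    rw [hK, ← toReal_enorm]
    rw [eLpNorm_exponent_top] at hfin ⊢
    exact ENNReal.toReal_mono hfin hx
  by_contra! hlt
  have h1 : ∀ᶠ x in nhdsWithin t (Icc 0 T), K < ‖u x‖ :=
    (hu t ht).norm.eventually_const_lt hlt
  obtain ⟨V, hVo, htV, hV⟩ := mem_nhdsWithin.1 h1
  have hne : (V ∩ Ioo 0 T).Nonempty := by
    have : t ∈ closure (Ioo 0 T) := by rwa [closure_Ioo hT.ne]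
    exact mem_closure_iff.1 this V hVo htV
  have hpos := (hVo.inter isOpen_Ioo).measure_pos volume hne
  rw [ae_restrict_iff' measurableSet_Ioo] at hae
  refine hpos.ne' (measure_mono_null (fun x hx => ?_) hae)
  intro h
  exact absurd (h hx.2) (not_le.2 (hV ⟨hx.1, Ioo_subset_Icc_self hx.2⟩))

namespace HasSobolevTimeDeriv

variable {X : Type*} [NormedAddCommGroup X] [NormedSpace ℝ X] {p : ℝ≥0∞} {T : ℝ} {u ut : ℝ → X}

theorem integrableOn (h : HasSobolevTimeDeriv p T u ut) (hp : 1 ≤ p) :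
    IntegrableOn ut (Icc 0 T) := by
  rw [integrableOn_Icc_iff_integrableOn_Ioo]
  exact h.1.integrable hp

theorem intervalIntegrable (h : HasSobolevTimeDeriv p T u ut) (hp : 1 ≤ p) {s t : ℝ}
    (hs : s ∈ Icc 0 T) (ht : t ∈ Icc 0 T) : IntervalIntegrable ut volume s t :=
  (h.integrableOn hp).mono_set (uIcc_subset_Icc hs ht) |>.intervalIntegrable

theorem sub_eq (h : HasSobolevTimeDeriv p T u ut) (hp : 1 ≤ p) (hT : 0 ≤ T) {s t : ℝ}
    (hs : s ∈ Icc 0 T) (ht : t ∈ Icc 0 T) : u t - u s = ∫ x in s..t, ut x := by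
  have h0 : (0 : ℝ) ∈ Icc 0 T := ⟨le_rfl, hT⟩
  rw [h.2 t ht, h.2 s hs, add_sub_add_left_eq_sub, intervalIntegral.integral_interval_sub_left
    (h.intervalIntegrable hp h0 ht) (h.intervalIntegrable hp h0 hs)]

theorem continuousOn (h : HasSobolevTimeDeriv p T u ut) (hp : 1 ≤ p) (hT : 0 ≤ T) :
    ContinuousOn u (Icc 0 T) := by
  have h1 := intervalIntegral.continuousOn_primitive_interval (a := 0) (b := T) (f := ut)
    (μ := volume) (by rw [uIcc_of_le hT]; exact h.integrableOn hp)
  rw [uIcc_of_le hT] at h1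
  exact (continuousOn_const.add h1).congr h.2

theorem norm_sub_le_of_top (h : HasSobolevTimeDeriv ∞ T u ut) {s t : ℝ} (hT : 0 ≤ T)
    (hs : s ∈ Icc 0 T) (ht : t ∈ Icc 0 T) (hst : s ≤ t) :
    ‖u t - u s‖ ≤ (eLpNorm ut ∞ (volume.restrict (Ioo 0 T))).toReal * (t - s) := by
  rw [h.sub_eq le_top hT hs ht]
  have hfin := h.1.2.ne
  have h1 : ∀ᵐ x ∂volume.restrict (Ioo 0 T),
      ‖ut x‖ ≤ (eLpNorm ut ∞ (volume.restrict (Ioo 0 T))).toReal := by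
    filter_upwards [ae_le_eLpNormEssSup (f := ut) (μ := volume.restrict (Ioo 0 T))] with x hx
    rw [← toReal_enorm]
    rw [eLpNorm_exponent_top] at hfin ⊢
    exact ENNReal.toReal_mono hfin hx
  generalize (eLpNorm ut ∞ (volume.restrict (Ioo 0 T))).toReal = K at h1 ⊢
  rw [restrict_Ioo_eq_restrict_Ioc, ae_restrict_iff' measurableSet_Ioc] at h1
  have h2 := intervalIntegral.norm_integral_le_of_norm_le_const_ae (a := s) (b := t) (f := ut)
    (C := K) (by
      filter_upwards [h1] with x hx hx'
      rw [uIoc_of_le hst] at hx'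
      exact hx ⟨hs.1.trans_lt hx'.1, hx'.2.trans ht.2⟩)
  rwa [abs_of_nonneg (sub_nonneg.2 hst)] at h2

theorem intervalIntegrable_sq (h : HasSobolevTimeDeriv 2 T u ut) {s t : ℝ}
    (hs : s ∈ Icc 0 T) (ht : t ∈ Icc 0 T) :
    IntervalIntegrable (fun x => ‖ut x‖ ^ 2) volume s t := by
  have h1 : IntegrableOn (fun x => ‖ut x‖ ^ 2) (Icc 0 T) := by
    rw [integrableOn_Icc_iff_integrableOn_Ioo]
    exact h.1.integrable_norm_pow (by simp)
  exact (h1.mono_set (uIcc_subset_Icc hs ht)).intervalIntegrable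

theorem norm_sub_le_of_two (h : HasSobolevTimeDeriv 2 T u ut) {s t : ℝ} (hT : 0 ≤ T)
    (hs : s ∈ Icc 0 T) (ht : t ∈ Icc 0 T) (hst : s ≤ t) :
    ‖u t - u s‖ ≤
      √((t - s) * ((∫ x in (0 : ℝ)..t, ‖ut x‖ ^ 2) - ∫ x in (0 : ℝ)..s, ‖ut x‖ ^ 2)) := by
  have h0 : (0 : ℝ) ∈ Icc 0 T := ⟨le_rfl, hT⟩
  rw [h.sub_eq (by norm_num) hT hs ht, intervalIntegral.integral_interval_sub_left
    (h.intervalIntegrable_sq h0 ht) (h.intervalIntegrable_sq h0 hs)]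
  refine Real.le_sqrt_of_sq_le ?_
  have h1 := h.intervalIntegrable (by norm_num) hs ht
  exact (pow_le_pow_left₀ (norm_nonneg _) (intervalIntegral.norm_integral_le_integral_norm hst)
    2).trans (sq_integral_le hst h1.norm (h.intervalIntegrable_sq hs ht))

end HasSobolevTimeDeriv


/-! ### From the semidiscrete problem to the abstract flow. -/

theorem sum_mul_integral_mul {X : Type*} [MeasurableSpace X] {μ : Measure X} {n : ℕ} {f : X → ℝ}
    {b : Fin n → X → ℝ} (h : ∀ j, Integrable (fun x => f x * b j x) μ) (e : Fin n → ℝ) :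
    ∑ j, e j * ∫ x, f x * b j x ∂μ = ∫ x, f x * ∑ j, e j * b j x ∂μ := by
  simp only [← integral_const_mul]
  rw [← integral_finsetSum _ fun j _ => (h j).const_mul (e j)]
  refine integral_congr_ae (.of_forall fun x => ?_)
  simp only [Finset.mul_sum]
  exact Finset.sum_congr rfl fun j _ => by ring

theorem Lp_integral_mul_sub {X : Type*} [MeasurableSpace X] {μ : Measure X} {p : ℝ≥0∞}
    (f g : Lp ℝ p μ) {r : X → ℝ} (hf : Integrable (fun x => f x * r x) μ)
    (hg : Integrable (fun x => g x * r x) μ) :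
    (∫ x, f x * r x ∂μ) - ∫ x, g x * r x ∂μ = ∫ x, (f - g : Lp ℝ p μ) x * r x ∂μ := by
  rw [← integral_sub hf hg]
  refine integral_congr_ae ?_
  filter_upwards [Lp.coeFn_sub f g] with x hx
  rw [hx, Pi.sub_apply, sub_mul]

namespace Triangulation

variable {d : ℕ} {Ω : Set (EuclideanSpace ℝ (Fin d))} {𝒯 : Triangulation Ω} {k : ℕ}

theorem volume_lt_top (𝒯 : Triangulation Ω) : volume Ω < ∞ :=
  (measure_mono subset_closure).trans_lt 𝒯.isCompact_closure.measure_lt_top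

theorem memLp_of_continuousOn (hΩo : IsOpen Ω) (𝒯 : Triangulation Ω)
    {r : EuclideanSpace ℝ (Fin d) → ℝ} (hr : ContinuousOn r (closure Ω)) {p : ℝ≥0∞} :
    MemLp r p (volume.restrict Ω) := by
  have : IsFiniteMeasure (volume.restrict Ω) := ⟨by
    rw [Measure.restrict_apply_univ]; exact 𝒯.volume_lt_top⟩
  obtain ⟨M, hM⟩ := 𝒯.isCompact_closure.exists_bound_of_continuousOn hr
  refine MemLp.of_bound ((hr.mono subset_closure).aestronglyMeasurable hΩo.measurableSet) M ?_
  filter_upwards [ae_restrict_mem hΩo.measurableSet] with x hx using hM x (subset_closure hx)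

theorem memLp_gradient (hΩr : interior (closure Ω) = Ω)
    {r : EuclideanSpace ℝ (Fin d) → ℝ} (hr : r ∈ 𝒯.scalarSpace k) {p : ℝ≥0∞} :
    MemLp (gradient r) p (volume.restrict Ω) := by
  have : IsFiniteMeasure (volume.restrict Ω) := ⟨by
    rw [Measure.restrict_apply_univ]; exact 𝒯.volume_lt_top⟩
  obtain ⟨M, hM⟩ := exists_gradient_bound hΩr hr
  exact MemLp.of_bound (measurable_gradient r).aestronglyMeasurable M hM

theorem integrable_surfaceMeasure [IsFiniteMeasure (surfaceMeasure Ω)] (𝒯 : Triangulation Ω)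
    {r : EuclideanSpace ℝ (Fin d) → ℝ} (hr : ContinuousOn r (closure Ω)) :
    Integrable r (surfaceMeasure Ω) := by
  obtain ⟨M, hM⟩ := 𝒯.isCompact_closure.exists_bound_of_continuousOn hr
  have hm : MeasurableSet (frontier Ω) := isClosed_frontier.measurableSet
  refine Integrable.of_bound (C := M)
    ((hr.mono frontier_subset_closure).aestronglyMeasurable hm) ?_
  filter_upwards [ae_restrict_mem hm] with x hx using hM x (frontier_subset_closure hx)

/-- The trace inequality, in terms of Bochner integrals. -/
theorem exists_integral_trace_le (𝒯₀ : Triangulation Ω) (hd : 2 ≤ d) (hΩo : IsOpen Ω)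
    (hΩr : interior (closure Ω) = Ω) (k : ℕ) :
    IsFiniteMeasure (surfaceMeasure Ω) ∧ ∃ C : ℝ, 0 < C ∧ ∀ (𝒯 : Triangulation Ω),
      ∀ r ∈ 𝒯.scalarSpace k, ∫ y, |r y| ∂(surfaceMeasure Ω) ≤
        C * ((∫ x in Ω, |r x|) + ∫ x in Ω, ‖gradient r x‖) := by
  obtain ⟨hfin, c, hc, h⟩ := 𝒯₀.exists_trace_le hd hΩo hΩr k
  refine ⟨hfin, c.toReal + 1, by positivity, fun 𝒯 r hr => ?_⟩
  have h1 := h 𝒯 r hr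
  have i1 : Integrable r (volume.restrict Ω) :=
    memLp_one_iff_integrable.1 (𝒯.memLp_of_continuousOn hΩo hr.1)
  have i2 : Integrable (gradient r) (volume.restrict Ω) :=
    memLp_one_iff_integrable.1 (memLp_gradient hΩr hr)
  have i3 := 𝒯.integrable_surfaceMeasure hr.1
  have n1 : 0 ≤ ∫ x in Ω, |r x| := integral_nonneg fun _ => abs_nonneg _
  have n2 : 0 ≤ ∫ x in Ω, ‖gradient r x‖ := integral_nonneg fun _ => norm_nonneg _
  rw [← ofReal_integral_eq_lintegral_ofReal i3.abs (.of_forall fun _ => abs_nonneg _),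
    ← ofReal_integral_eq_lintegral_ofReal i1.abs (.of_forall fun _ => abs_nonneg _),
    ← ofReal_integral_eq_lintegral_ofReal i2.norm (.of_forall fun _ => norm_nonneg _),
    ← ENNReal.ofReal_add n1 n2, ← ENNReal.ofReal_toReal hc,
    ← ENNReal.ofReal_mul ENNReal.toReal_nonneg,
    ENNReal.ofReal_le_ofReal_iff (by positivity)] at h1
  refine h1.trans (mul_le_mul_of_nonneg_right (by linarith) (by positivity))

/-- The initial values of the semidiscrete solutions are controlled by the initial data. -/
theorem exists_projection_le (𝒯₀ : Triangulation Ω) (hd : 2 ≤ d) (hΩo : IsOpen Ω)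
    (hΩr : interior (closure Ω) = Ω) (k : ℕ) {κ β : ℝ} (hκ : 0 < κ) (hβ : 1 < β) (hβ2 : β < 2) :
    ∃ C : ℝ, 0 < C ∧ ∀ 𝒯 : Triangulation Ω, 0 < 𝒯.meshSize →
      (∀ T ∈ 𝒯.elements, ∃ x, Metric.closedBall x (κ * 𝒯.meshSize) ⊆ T) →
      ∀ (w u : EuclideanSpace ℝ (Fin d) → ℝ), w ∈ 𝒯.scalarSpace k →
        ContinuousOn u (closure Ω) → ContDiffOn ℝ 1 u Ω →
        MemLp (gradient u) 2 (volume.restrict Ω) →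
        (∀ r ∈ 𝒯.scalarSpace k, ∫ x in Ω, (w x - u x) * r x = 0) →
        (∫ x in Ω, w x ^ 2) ≤ (∫ x in Ω, u x ^ 2) ∧
        ∫ x in Ω, ‖gradient w x‖ ^ β ≤
          C * (1 + (∫ x in Ω, u x ^ 2) + ∫ x in Ω, ‖gradient u x‖ ^ β) := by
  have hμ : IsFiniteMeasure (volume.restrict Ω) := ⟨by
    rw [Measure.restrict_apply_univ]; exact 𝒯₀.volume_lt_top⟩
  obtain ⟨C, hC, h⟩ := 𝒯₀.exists_gradient_projection_le hd hΩo hΩr k hκ hβ hβ2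
  refine ⟨C * (1 + volume.real Ω), by positivity,
    fun 𝒯 hh hq w u hw hu hu1 hu2 horth => ⟨?_, ?_⟩⟩
  · have mw := 𝒯.memLp_of_continuousOn hΩo hw.1 (p := 2)
    have mu := 𝒯.memLp_of_continuousOn hΩo hu (p := 2)
    have h1 := horth w hw
    -- Orthogonality tested with w itself: (w - u)w = (w² - u² + (w - u)²)/2.
    have e : ∀ x, (w x - u x) * w x =
        2⁻¹ * w x ^ 2 - 2⁻¹ * u x ^ 2 + 2⁻¹ * (w x - u x) ^ 2 := fun x => by ring
    simp only [e] at h1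
    have i1 := mw.integrable_sq.const_mul 2⁻¹
    have i2 := mu.integrable_sq.const_mul 2⁻¹
    have i3 := (mw.sub mu).integrable_sq.const_mul 2⁻¹
    simp only [Pi.sub_apply] at i3
    have i12 : Integrable (fun x => 2⁻¹ * w x ^ 2 - 2⁻¹ * u x ^ 2) (volume.restrict Ω) := i1.sub i2
    rw [integral_add i12 i3, integral_sub i1 i2, integral_const_mul, integral_const_mul,
      integral_const_mul] at h1
    have h2 : 0 ≤ ∫ x in Ω, (w x - u x) ^ 2 := integral_nonneg fun _ => sq_nonneg _
    linarith
  · have h1 := h 𝒯 hh hq w u hw hu (fun x hx =>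
      (hu1.differentiableOn one_ne_zero).differentiableAt (hΩo.mem_nhds hx)) horth
    have hβ0 : 0 ≤ β := by linarith
    have hβe : ENNReal.ofReal β ≠ 0 := by simpa using by linarith
    have hint : ∀ {v : EuclideanSpace ℝ (Fin d) → EuclideanSpace ℝ (Fin d)},
        MemLp v 2 (volume.restrict Ω) → Integrable (fun x => ‖v x‖ ^ β) (volume.restrict Ω) := by
      intro v hv
      have h2 : MemLp v (ENNReal.ofReal β) (volume.restrict Ω) := hv.mono_exponent (by
        rw [← ENNReal.ofReal_ofNat 2]
        exact ENNReal.ofReal_le_ofReal hβ2.le)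
      have h3 := h2.integrable_norm_rpow hβe ENNReal.ofReal_ne_top
      rwa [ENNReal.toReal_ofReal hβ0] at h3
    have i1 := hint (memLp_gradient hΩr hw)
    have i2 := hint hu2
    have mu := 𝒯.memLp_of_continuousOn hΩo hu (p := 2)
    have hle : ∀ x, |u x| ^ β ≤ 1 + u x ^ 2 := fun x => by
      have := ForchheimerPolynomial.rpow_le_one_add_rpow (abs_nonneg (u x)) hβ0 hβ2.le
      rwa [show (2 : ℝ) = ((2 : ℕ) : ℝ) by norm_num, Real.rpow_natCast, sq_abs] at this
    have i3 : Integrable (fun x => 1 + u x ^ 2) (volume.restrict Ω) :=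
      (integrable_const _).add mu.integrable_sq
    have hsm : sobolevMass β u Ω ≤ ENNReal.ofReal
        ((∫ x in Ω, (1 + u x ^ 2)) + ∫ x in Ω, ‖gradient u x‖ ^ β) := by
      rw [ENNReal.ofReal_add (integral_nonneg fun _ => by positivity)
        (integral_nonneg fun _ => by positivity),
        ofReal_integral_eq_lintegral_ofReal i3 (.of_forall fun _ => by positivity),
        ofReal_integral_eq_lintegral_ofReal i2 (.of_forall fun _ => by positivity)]
      exact add_le_add_left (lintegral_mono fun x => ENNReal.ofReal_le_ofReal (hle x)) _
    have n1 : 0 ≤ ∫ x in Ω, u x ^ 2 := integral_nonneg fun _ => by positivity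
    have n2 : 0 ≤ ∫ x in Ω, ‖gradient u x‖ ^ β := integral_nonneg fun _ => by positivity
    rw [integral_add (integrable_const _) mu.integrable_sq, integral_const, smul_eq_mul, mul_one,
      measureReal_restrict_apply_univ] at hsm
    have hV : 0 ≤ volume.real Ω := measureReal_nonneg
    have h2 := h1.trans (mul_le_mul_right hsm _)
    rw [← ENNReal.ofReal_mul hC.le,
      ← ofReal_integral_eq_lintegral_ofReal i1 (.of_forall fun _ => by positivity),
      ENNReal.ofReal_le_ofReal_iff (by positivity)] at h2
    refine h2.trans ?_
    rw [mul_assoc]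
    refine mul_le_mul_of_nonneg_left ?_ hC.le
    nlinarith [mul_nonneg hV n1, mul_nonneg hV n2]

end Triangulation

/-- Gradients of functions in R_h lie in M_h, so the momentum equation may be tested with ∇r, which
eliminates m_h. -/
theorem IsSemidiscreteSolution.weak_form {d : ℕ} {Ω : Set (EuclideanSpace ℝ (Fin d))}
    {G : ForchheimerPolynomial} {𝒯 : Triangulation Ω} {k : ℕ} {T : ℝ}
    {φ : EuclideanSpace ℝ (Fin d) → ℝ} {f : ℝ → Lp ℝ 2 (volume.restrict Ω)}
    {ψ : ℝ → Lp ℝ ∞ (surfaceMeasure Ω)} {ρ0 : EuclideanSpace ℝ (Fin d) → ℝ}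
    {m : ℝ → EuclideanSpace ℝ (Fin d) → EuclideanSpace ℝ (Fin d)}
    {ρ ρt : ℝ → EuclideanSpace ℝ (Fin d) → ℝ}
    (h : IsSemidiscreteSolution G 𝒯 k T φ f ψ ρ0 m ρ ρt) {t : ℝ} (ht : t ∈ Ioc 0 T)
    {r : EuclideanSpace ℝ (Fin d) → ℝ} (hr : r ∈ 𝒯.scalarSpace k) :
    (∫ x in Ω, φ x * ρt t x * r x) +
      (∫ x in Ω, inner ℝ (G.flux (gradient (ρ t) x)) (gradient r x)) =
        (∫ x in Ω, f t x * r x) - ∫ x, ψ t x * r x ∂(surfaceMeasure Ω) := by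
  have h1 := h.momentum_eq t ht _ (Triangulation.gradient_mem_vectorSpace hr)
  have h2 := h.continuity_eq t ht r hr
  simp only [ForchheimerPolynomial.flux]
  linarith


/-- A solution of the semidiscrete problem, written in a nodal basis, is a Galerkin flow. -/
theorem IsSemidiscreteSolution.exists_galerkinFlow {d : ℕ} {Ω : Set (EuclideanSpace ℝ (Fin d))}
    {G : ForchheimerPolynomial} {𝒯 : Triangulation Ω} {k : ℕ} {T φlo φhi Ctr : ℝ}
    {φ : EuclideanSpace ℝ (Fin d) → ℝ} {f ft : ℝ → Lp ℝ 2 (volume.restrict Ω)}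
    {ψ ψt : ℝ → Lp ℝ ∞ (surfaceMeasure Ω)} {ρ0 : EuclideanSpace ℝ (Fin d) → ℝ}
    {m : ℝ → EuclideanSpace ℝ (Fin d) → EuclideanSpace ℝ (Fin d)}
    {ρ ρt : ℝ → EuclideanSpace ℝ (Fin d) → ℝ} [IsFiniteMeasure (surfaceMeasure Ω)]
    (h : IsSemidiscreteSolution G 𝒯 k T φ f ψ ρ0 m ρ ρt) (hT : 0 < T)
    (hΩo : IsOpen Ω) (hΩr : interior (closure Ω) = Ω) (hφ1 : ContDiffOn ℝ 1 φ Ω)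
    (hφ : ∀ x ∈ Ω, φlo < φ x ∧ φ x < φhi) (hf : HasSobolevTimeDeriv 2 T f ft)
    (hψ : HasSobolevTimeDeriv ∞ T ψ ψt) (hCtr : 0 ≤ Ctr)
    (htr : ∀ r ∈ 𝒯.scalarSpace k, ∫ y, |r y| ∂(surfaceMeasure Ω) ≤
      Ctr * ((∫ x in Ω, |r x|) + ∫ x in Ω, ‖gradient r x‖)) :
    ∃ D : GalerkinFlow G d (volume.restrict Ω) φlo φhi T,
      (∀ t ∈ Ioc 0 T, D.sq (D.c' t) = ∫ x in Ω, ρt t x ^ 2) ∧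
      D.N T = (∫ t in (0 : ℝ)..T, ‖ft t‖ ^ 2) ∧
      D.data = 1 + (∫ x in Ω, ρ 0 x ^ 2) + (∫ x in Ω, ‖gradient (ρ 0) x‖ ^ G.β) +
        (Ctr * (eLpNorm ψ ∞ (volume.restrict (Ioo 0 T))).toReal) ^ G.lam +
        (Ctr * (eLpNorm ψt ∞ (volume.restrict (Ioo 0 T))).toReal) ^ G.lam +
        ∫ t in (0 : ℝ)..T, ‖f t‖ ^ 2 := by
  obtain ⟨n, x, b, hx, hb, hrep⟩ := 𝒯.exists_nodal_basis k
  have h0T : (0 : ℝ) ∈ Icc 0 T := ⟨le_rfl, hT.le⟩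
  have hgs := Triangulation.ae_gradient_sum hΩr hb
  have hmem : ∀ e : Fin n → ℝ, (fun y => ∑ j, e j * b j y) ∈ 𝒯.scalarSpace k := fun e =>
    Triangulation.sum_mem_scalarSpace _ fun j _ =>
      Triangulation.const_mul_mem_scalarSpace (hb j) (e j)
  have hρ : ∀ t ∈ Icc 0 T, ∀ y ∈ closure Ω, ρ t y = ∑ j, ρ t (x j) * b j y := fun t ht y hy =>
    hrep _ (h.ρ_mem t ht) y hy
  -- That the time derivative lies in the discrete space is derived, not assumed: it is the unique
  -- derivative of the nodal representation.
  have hρt : ∀ t ∈ Ioc 0 T, ∀ y ∈ closure Ω, ρt t y = ∑ j, ρt t (x j) * b j y := by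
    intro t ht y hy
    have h1 := h.hasDeriv t ht y hy
    have h2 : HasDerivWithinAt (fun s => ∑ j, ρ s (x j) * b j y) (∑ j, ρt t (x j) * b j y)
        (Icc 0 T) t :=
      HasDerivWithinAt.fun_sum fun j _ => (h.hasDeriv t ht (x j) (hx j)).mul_const _
    have h3 := h2.congr (fun s hs => hρ s hs y hy) (hρ t (Ioc_subset_Icc_self ht) y hy)
    exact (uniqueDiffOn_Icc hT t (Ioc_subset_Icc_self ht)).eq_deriv _ h1 h3
  have hgrad : ∀ t ∈ Icc 0 T, ∀ᵐ y ∂volume.restrict Ω,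
      gradient (ρ t) y = ∑ j, ρ t (x j) • gradient (b j) y := by
    intro t ht
    filter_upwards [hgs, ae_restrict_mem hΩo.measurableSet] with y h1 h2
    rw [← h1 fun j => ρ t (x j)]
    exact Triangulation.gradient_congr hΩo (hρ t ht) h2
  choose M₀ hM₀ using fun j => Triangulation.exists_bound (hb j)
  choose M₁ hM₁ using fun j => Triangulation.exists_gradient_bound hΩr (hb j)
  set M := ∑ j, (|M₀ j| + |M₁ j|)
  have hM : ∀ j, |M₀ j| + |M₁ j| ≤ M := fun j =>
    Finset.single_le_sum (f := fun j => |M₀ j| + |M₁ j|) (fun _ _ => by positivity)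
      (Finset.mem_univ j)
  have m2 : ∀ {r}, r ∈ 𝒯.scalarSpace k → MemLp r 2 (volume.restrict Ω) := fun hr =>
    𝒯.memLp_of_continuousOn hΩo hr.1
  have mσ : ∀ {r}, r ∈ 𝒯.scalarSpace k → Integrable r (surfaceMeasure Ω) := fun hr =>
    𝒯.integrable_surfaceMeasure hr.1
  have hLf : ∀ (g : Lp ℝ 2 (volume.restrict Ω)) (e : Fin n → ℝ),
      |∑ j, e j * ∫ y in Ω, g y * b j y| ≤ ‖g‖ * √(∫ y in Ω, (∑ j, e j * b j y) ^ 2) := by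
    intro g e
    rw [sum_mul_integral_mul fun j => integrable_mul_of_Lp_two g (m2 (hb j))]
    exact abs_integral_mul_le_of_Lp_two g (m2 (hmem e))
  have hLψ : ∀ (g : Lp ℝ ∞ (surfaceMeasure Ω)) (e : Fin n → ℝ),
      |∑ j, e j * ∫ y, g y * b j y ∂(surfaceMeasure Ω)| ≤
        ‖g‖ * (Ctr * ((∫ y in Ω, |∑ j, e j * b j y|) +
          ∫ y in Ω, ‖∑ j, e j • gradient (b j) y‖)) := by
    intro g e
    rw [sum_mul_integral_mul fun j => integrable_mul_of_Lp_top g (mσ (hb j))]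
    refine (abs_integral_mul_le_of_Lp_top g (mσ (hmem e))).trans
      (mul_le_mul_of_nonneg_left ((htr _ (hmem e)).trans_eq ?_) (norm_nonneg _))
    congr 2
    refine integral_congr_ae ?_
    filter_upwards [hgs] with y hy
    rw [hy e]
  have hn0 : ∀ e : Fin n → ℝ, 0 ≤ (∫ y in Ω, |∑ j, e j * b j y|) +
      ∫ y in Ω, ‖∑ j, e j • gradient (b j) y‖ := fun e =>
    add_nonneg (integral_nonneg fun _ => abs_nonneg _) (integral_nonneg fun _ => norm_nonneg _)
  have hψc := hψ.continuousOn le_top hT.le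
  have hfc := hf.continuousOn (by norm_num) hT.le
  refine ⟨{ n := n
            b := b
            B := fun j => gradient (b j)
            φ := φ
            c := fun t j => ρ t (x j)
            c' := fun t j => ρt t (x j)
            Lf := fun t j => ∫ y in Ω, f t y * b j y
            Lψ := fun t j => ∫ y, ψ t y * b j y ∂(surfaceMeasure Ω)
            Nf := fun t => ‖f t‖
            N := fun t => ∫ s in (0 : ℝ)..t, ‖ft s‖ ^ 2
            Ps := Ctr * (eLpNorm ψ ∞ (volume.restrict (Ioo 0 T))).toReal
            Pt := Ctr * (eLpNorm ψt ∞ (volume.restrict (Ioo 0 T))).toReal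
            M := M
            aesm_b := fun j => (m2 (hb j)).1
            aesm_B := fun j => (measurable_gradient (b j)).aestronglyMeasurable
            aesm_φ := hφ1.continuousOn.aestronglyMeasurable hΩo.measurableSet
            bound_b := fun j => ?_
            bound_B := fun j => ?_
            le_φ := ?_
            φ_le := ?_
            continuousOn_c := fun j => h.continuousOn _ (hx j)
            hasDeriv_c := fun t ht j => h.hasDeriv t ht _ (hx j)
            eqn := fun t ht e => ?_
            continuousOn_Nf := hfc.norm
            Lf_le := fun t _ e => hLf (f t) e
            continuousOn_N := ?_
            N_mono := fun s hs t ht hst => ?_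
            N_zero := by simp
            Lf_sub_le := fun s hs t ht hst e => ?_
            Ps_nonneg := by positivity
            Pt_nonneg := by positivity
            Lψ_le := fun t ht e => ?_
            Lψ_sub_le := fun s hs t ht hst e => ?_ }, fun t ht => ?_, rfl, ?_⟩
  · filter_upwards [ae_restrict_mem hΩo.measurableSet] with y hy
    linarith [hM₀ j y (subset_closure hy), hM j, le_abs_self (M₀ j), abs_nonneg (M₁ j)]
  · filter_upwards [hM₁ j] with y hy
    linarith [hM j, le_abs_self (M₁ j), abs_nonneg (M₀ j)]
  · filter_upwards [ae_restrict_mem hΩo.measurableSet] with y hy using (hφ y hy).1.le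
  · filter_upwards [ae_restrict_mem hΩo.measurableSet] with y hy using (hφ y hy).2.le
  · have hw := h.weak_form ht (hmem e)
    rw [sum_mul_integral_mul fun j => integrable_mul_of_Lp_two (f t) (m2 (hb j)),
      sum_mul_integral_mul fun j => integrable_mul_of_Lp_top (ψ t) (mσ (hb j)), ← hw]
    congr 1
    · refine setIntegral_congr_fun hΩo.measurableSet fun y hy => ?_
      simp only [hρt t ht y (subset_closure hy)]
    · refine integral_congr_ae ?_
      filter_upwards [hgs, hgrad t (Ioc_subset_Icc_self ht)] with y h1 h2
      rw [h1, h2]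
  · have h1 := intervalIntegral.continuousOn_primitive_interval (a := 0) (b := T)
      (f := fun s => ‖ft s‖ ^ 2) (μ := volume) (by
        rw [uIcc_of_le hT.le, integrableOn_Icc_iff_integrableOn_Ioo]
        exact hf.1.integrable_norm_pow (by simp))
    rwa [uIcc_of_le hT.le] at h1
  · rw [← sub_nonneg, intervalIntegral.integral_interval_sub_left
      (hf.intervalIntegrable_sq h0T ht) (hf.intervalIntegrable_sq h0T hs)]
    exact intervalIntegral.integral_nonneg hst fun _ _ => sq_nonneg _
  · simp only [fun j => Lp_integral_mul_sub (f t) (f s)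
      (integrable_mul_of_Lp_two (f t) (m2 (hb j))) (integrable_mul_of_Lp_two (f s) (m2 (hb j)))]
    exact (hLf _ e).trans (mul_le_mul_of_nonneg_right (hf.norm_sub_le_of_two hT.le hs ht hst)
      (Real.sqrt_nonneg _))
  · refine (hLψ _ e).trans ?_
    rw [← mul_assoc, mul_comm ‖ψ t‖]
    exact mul_le_mul_of_nonneg_right (mul_le_mul_of_nonneg_left
      (hψc.norm_le_eLpNorm_top hT ht) hCtr) (hn0 e)
  · simp only [fun j => Lp_integral_mul_sub (ψ t) (ψ s)
      (integrable_mul_of_Lp_top (ψ t) (mσ (hb j))) (integrable_mul_of_Lp_top (ψ s) (mσ (hb j)))]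
    refine (hLψ _ e).trans ?_
    rw [← mul_assoc, mul_comm ‖ψ t - ψ s‖, mul_assoc Ctr _ (t - s)]
    exact mul_le_mul_of_nonneg_right (mul_le_mul_of_nonneg_left
      (hψ.norm_sub_le_of_top hT.le hs ht hst) hCtr) (hn0 e)
  · refine setIntegral_congr_fun hΩo.measurableSet fun y hy => ?_
    simp only [hρt t ht y (subset_closure hy)]
    rfl
  · have e1 : ∫ y in Ω, ρ 0 y ^ 2 = ∫ y in Ω, (∑ j, ρ 0 (x j) * b j y) ^ 2 :=
      setIntegral_congr_fun hΩo.measurableSet fun y hy => by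
        simp only [hρ 0 h0T y (subset_closure hy)]
    have e2 : ∫ y in Ω, ‖gradient (ρ 0) y‖ ^ G.β =
        ∫ y in Ω, ‖∑ j, ρ 0 (x j) • gradient (b j) y‖ ^ G.β := by
      refine integral_congr_ae ?_
      filter_upwards [hgrad 0 h0T] with y hy
      rw [hy]
    rw [e1, e2]
    rfl


/-! ### Comparison of the data and conclusion. -/

/-- Needed for the comparison that follows: the integral of a non-integrable weight would be zero by
convention. -/
theorem intervalIntegrable_weight {X Y : Type*} [NormedAddCommGroup X] [NormedAddCommGroup Y]
    {T q : ℝ} (hT : 0 ≤ T) (hq : 0 ≤ q) {v : ℝ → X} {w : ℝ → Y}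
    (hv : MemLp v ∞ (volume.restrict (Ioo 0 T))) (hw : MemLp w 2 (volume.restrict (Ioo 0 T))) :
    IntervalIntegrable (fun τ => (1 + ‖v τ‖) ^ q * (1 + ‖w τ‖) ^ 2) volume 0 T := by
  rw [intervalIntegrable_iff_integrableOn_Ioo_of_le hT]
  have hm : MemLp ((fun _ : ℝ => (1 : ℝ)) + fun τ => ‖w τ‖) 2 (volume.restrict (Ioo 0 T)) :=
    MemLp.add (memLp_const 1) hw.norm
  have hsm : AEStronglyMeasurable (fun τ => (1 + ‖v τ‖) ^ q) (volume.restrict (Ioo 0 T)) :=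
    ((hv.1.norm.aemeasurable.const_add 1).pow_const q).aestronglyMeasurable
  have hbd : ∀ᵐ τ ∂volume.restrict (Ioo 0 T), ‖(1 + ‖v τ‖) ^ q‖ ≤
      (1 + (eLpNorm v ∞ (volume.restrict (Ioo 0 T))).toReal) ^ q := by
    have hfin := hv.2.ne
    filter_upwards [ae_le_eLpNormEssSup (f := v) (μ := volume.restrict (Ioo 0 T))] with τ hτ
    have h1 : ‖v τ‖ ≤ (eLpNorm v ∞ (volume.restrict (Ioo 0 T))).toReal := by
      rw [← toReal_enorm]
      rw [eLpNorm_exponent_top] at hfin ⊢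
      exact ENNReal.toReal_mono hfin hτ
    rw [Real.norm_of_nonneg (by positivity)]
    exact Real.rpow_le_rpow (by positivity) (by linarith) hq
  exact hm.integrable_sq.bdd_mul hsm hbd

theorem integral_sq_le_integral_weight {X Y : Type*} [NormedAddCommGroup X] [NormedAddCommGroup Y]
    {T q : ℝ} (hT : 0 ≤ T) (hq : 0 ≤ q) {v : ℝ → X} {w : ℝ → Y}
    (hv : MemLp v ∞ (volume.restrict (Ioo 0 T))) (hw : MemLp w 2 (volume.restrict (Ioo 0 T))) :
    ∫ τ in (0 : ℝ)..T, ‖w τ‖ ^ 2 ≤ ∫ τ in (0 : ℝ)..T, (1 + ‖v τ‖) ^ q * (1 + ‖w τ‖) ^ 2 := by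
  have hi : IntervalIntegrable (fun τ => ‖w τ‖ ^ 2) volume 0 T := by
    rw [intervalIntegrable_iff_integrableOn_Ioo_of_le hT]
    exact hw.integrable_norm_pow (by simp)
  refine intervalIntegral.integral_mono_on hT hi (intervalIntegrable_weight hT hq hv hw)
    fun τ _ => ?_
  have h1 : ‖w τ‖ ^ 2 ≤ (1 + ‖w τ‖) ^ 2 := pow_le_pow_left₀ (norm_nonneg _) (by linarith) 2
  exact h1.trans (le_mul_of_one_le_left (sq_nonneg _)
    (Real.one_le_rpow (by linarith [norm_nonneg (v τ)]) hq))

end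

theorem theorem4p2 {d : ℕ} (hd : 2 ≤ d)
    -- the domain
    (Ω : Set (EuclideanSpace ℝ (Fin d))) (hΩo : IsOpen Ω) (hΩc : IsConnected Ω)
    (hΩb : Bornology.IsBounded Ω) (hΩr : interior (closure Ω) = Ω)
    -- the Forchheimer polynomial, the bounds of the porosity, the final time
    (G : ForchheimerPolynomial) (φlo φhi : ℝ) (hφlo : 0 < φlo) (T : ℝ) (hT : 0 < T)
    -- the mixed finite element spaces
    (k : ℕ) {ι : Type*} (𝒯 : ι → Triangulation Ω) (h𝒯 : Triangulation.IsQuasiuniform 𝒯) :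
    ∃ C : ℝ, 0 < C ∧
      ∀ (i : ι)
        (φ : EuclideanSpace ℝ (Fin d) → ℝ), ContDiffOn ℝ 1 φ Ω →
        (∀ x ∈ Ω, φlo < φ x ∧ φ x < φhi) →
      ∀ (f ft : ℝ → Lp ℝ 2 (volume.restrict Ω)), HasSobolevTimeDeriv 2 T f ft →
      ∀ (ψ ψt : ℝ → Lp ℝ ∞ (surfaceMeasure Ω)), HasSobolevTimeDeriv ∞ T ψ ψt →
      ∀ (ρ0 : EuclideanSpace ℝ (Fin d) → ℝ), ContinuousOn ρ0 (closure Ω) →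
        ContDiffOn ℝ 1 ρ0 Ω → MemLp (gradient ρ0) 2 (volume.restrict Ω) →
      ∀ (m : ℝ → EuclideanSpace ℝ (Fin d) → EuclideanSpace ℝ (Fin d))
        (ρ ρt : ℝ → EuclideanSpace ℝ (Fin d) → ℝ),
        IsSemidiscreteSolution G (𝒯 i) k T φ f ψ ρ0 m ρ ρt →
      ∀ tstar : ℝ, 0 < tstar → tstar < T → ∀ t ∈ Icc tstar T,
        ∫ x in Ω, ρt t x ^ 2 ≤
          C * (1 + tstar⁻¹) * dataB G T f ψ ψt ρ0 +
            C * ∫ τ in (0 : ℝ)..T, (1 + ‖ψt τ‖) ^ (2 * G.lam) * (1 + ‖ft τ‖) ^ 2 := by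
  -- Any one member of a nonempty family serves as the fixed triangulation of Ω that yields the
  -- geometric constants.
  rcases isEmpty_or_nonempty ι with hι | ⟨⟨i₀⟩⟩
  · exact ⟨1, one_pos, fun i => (hι.false i).elim⟩
  obtain ⟨κ, hκ, hquasi⟩ := h𝒯
  have hfin : IsFiniteMeasure (volume.restrict Ω) := ⟨by
    rw [Measure.restrict_apply_univ]; exact (𝒯 i₀).volume_lt_top⟩
  obtain ⟨hσ, Ctr, hCtr, htr⟩ := (𝒯 i₀).exists_integral_trace_le hd hΩo hΩr k
  obtain ⟨C₁, hC₁, hproj⟩ :=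
    (𝒯 i₀).exists_projection_le hd hΩo hΩr k hκ G.one_lt_β G.β_lt_two
  obtain ⟨C₂, hC₂, hflow⟩ :=
    GalerkinFlow.exists_sq_deriv_le G d (volume.restrict Ω) φlo φhi T hφlo hT
  -- Converts the data of the flow into ℬ: C₁ comes from the stability of the projection, and Ctr^λ
  -- because the trace constant multiplies ψ and ψ_t inside the power λ.
  set L := 1 + C₁ + Ctr ^ G.lam with hL
  have hLpos : 0 < L := by positivity
  refine ⟨C₂ * (1 + L), by positivity, ?_⟩
  intro i φ hφ1 hφ f ft hf ψ ψt hψ ρ0 hρ0 hρ1 hρ2 m ρ ρt hsol ts hts htsT t ht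
  have htT : t ∈ Ioc 0 T := ⟨hts.trans_le ht.1, ht.2⟩
  have h0T : (0 : ℝ) ∈ Icc 0 T := ⟨le_rfl, hT.le⟩
  obtain ⟨D, hD1, hD2, hD3⟩ := hsol.exists_galerkinFlow hT hΩo hΩr hφ1 hφ hf hψ hCtr.le
    (htr (𝒯 i))
  have hmain := hflow D ts hts htsT t ht
  rw [hD1 t htT, hD2, hD3] at hmain
  obtain ⟨hp1, hp2⟩ := hproj (𝒯 i) ((𝒯 i).meshSize_pos (by omega) hΩc.nonempty) (hquasi i)
    (ρ 0) ρ0 (hsol.ρ_mem 0 h0T) hρ0 hρ1 hρ2 hsol.initial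
  set R₀ := ∫ x in Ω, ρ0 x ^ 2
  set R₁ := ∫ x in Ω, ‖gradient ρ0 x‖ ^ G.β
  set S := (eLpNorm ψ ∞ (volume.restrict (Ioo 0 T))).toReal with hS
  set S' := (eLpNorm ψt ∞ (volume.restrict (Ioo 0 T))).toReal with hS'
  set F := ∫ t in (0 : ℝ)..T, ‖f t‖ ^ 2 with hF
  have nR₀ : 0 ≤ R₀ := integral_nonneg fun _ => sq_nonneg _
  have nR₁ : 0 ≤ R₁ := integral_nonneg fun _ => Real.rpow_nonneg (norm_nonneg _) _
  have nS : 0 ≤ S ^ G.lam := Real.rpow_nonneg ENNReal.toReal_nonneg _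
  have nS' : 0 ≤ S' ^ G.lam := Real.rpow_nonneg ENNReal.toReal_nonneg _
  have nF : 0 ≤ F := intervalIntegral.integral_nonneg hT.le fun _ _ => sq_nonneg _
  have nCtr : 0 ≤ Ctr ^ G.lam := by positivity
  have hB : 1 + R₀ + R₁ + S ^ G.lam + S' ^ G.lam + F ≤ dataB G T f ψ ψt ρ0 := by
    have hprod : 0 ≤ (eLpNorm (ψ 0) 2 (surfaceMeasure Ω)).toReal *
        (eLpNorm ρ0 2 (surfaceMeasure Ω)).toReal := by positivity
    rw [dataB, dataA]
    linarith
  have hdata : 1 + (∫ x in Ω, ρ 0 x ^ 2) + (∫ x in Ω, ‖gradient (ρ 0) x‖ ^ G.β) +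
      (Ctr * S) ^ G.lam + (Ctr * S') ^ G.lam + F ≤ L * dataB G T f ψ ψt ρ0 := by
    refine le_trans ?_ (mul_le_mul_of_nonneg_left hB hLpos.le)
    rw [Real.mul_rpow hCtr.le ENNReal.toReal_nonneg, Real.mul_rpow hCtr.le ENNReal.toReal_nonneg,
      hL]
    have h3 := mul_nonneg hC₁.le nR₁
    have h4 := mul_nonneg hC₁.le nS
    have h5 := mul_nonneg hC₁.le nS'
    have h6 := mul_nonneg hC₁.le nF
    have h7 := mul_nonneg nCtr nR₀
    have h8 := mul_nonneg nCtr nR₁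
    have h9 := mul_nonneg nCtr nF
    linarith
  have hN : (∫ τ in (0 : ℝ)..T, ‖ft τ‖ ^ 2) ≤
      ∫ τ in (0 : ℝ)..T, (1 + ‖ψt τ‖) ^ (2 * G.lam) * (1 + ‖ft τ‖) ^ 2 :=
    integral_sq_le_integral_weight hT.le (by linarith [G.lam_pos]) hψ.1 hf.1
  set I := ∫ τ in (0 : ℝ)..T, (1 + ‖ψt τ‖) ^ (2 * G.lam) * (1 + ‖ft τ‖) ^ 2
  have nI : 0 ≤ I := intervalIntegral.integral_nonneg hT.le fun τ _ =>
    by positivity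
  have nB : 0 ≤ dataB G T f ψ ψt ρ0 := le_trans (by positivity) hB
  have hts' : 0 < ts⁻¹ := inv_pos.2 hts
  calc ∫ x in Ω, ρt t x ^ 2 ≤ C₂ * (1 + ts⁻¹) * (L * dataB G T f ψ ψt ρ0) + C₂ * I :=
        hmain.trans (add_le_add (mul_le_mul_of_nonneg_left hdata (by positivity))
          (mul_le_mul_of_nonneg_left hN hC₂.le))
    _ ≤ C₂ * (1 + L) * (1 + ts⁻¹) * dataB G T f ψ ψt ρ0 + C₂ * (1 + L) * I := by
        have h1 : 0 ≤ C₂ * (1 + ts⁻¹) * dataB G T f ψ ψt ρ0 := by positivity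
        have h2 : 0 ≤ C₂ * L * I := by positivity
        linarith
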